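/- Let $n\ge 1$, $0<\alpha<1$, and let $R_\alpha=|D|^{-\alpha}\partial_1$ be the modified Riesz transform on $\mathbb R^n$, i.e. the Fourier multiplier with symbol $i\xi_1|\xi|^{-\alpha}$. Let $B^s_{p,r}$ be the nonhomogeneous Besov spaces, with norm $\big\|\,(2^{qs}\|\Delta_q f\|_{L^p})_{q\ge -1}\big\|_{\ell^r}$, where $\Delta_q$ are the Littlewood–Paley operators of a fixed smooth dyadic partition of unity $(\chi,\varphi)$, and let $H^s=B^s_{2,2}$ (with equivalent norms) be the Sobolev spaces. Let $u$ be a smooth divergence-free vector field on $\mathbb R^n$ and $\theta$ a smooth real function on $\mathbb R^n$. Write $[R_\alpha,u]\theta=R_\alpha(u\theta)-u\,R_\alpha\theta$ and $[R_\alpha,u\cdot\nabla]\theta=R_\alpha(u\cdot\nabla\theta)-u\cdot\nabla R_\alpha\theta$; both are understood as distributions. Then the following holds. (1) For every $s\in(0,\alpha)$ there is a constant $C$ depending only on $n,s,\alpha$ and $(\chi,\varphi)$ such that, if $u,\theta,\nabla u\in L^2$ and $\theta\in B^{s-\alpha}_{\infty,2}$, then $[R_\alpha,u]\theta\in H^s$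 and $$\|[R_\alpha,u]\theta\|_{H^s}\le C\big(\|\nabla u\|_{L^2}\|\theta\|_{B^{s-\alpha}_{\infty,2}}+\|u\|_{L^2}\|\theta\|_{L^2}\big).$$ Moreover, if $n=2$ and $u=\Delta^{-1}\nabla^{\perp}\omega$, $\nabla^\perp=(-\partial_2,\partial_1)$, is given by the Biot–Savart law with $\omega=\Gamma+R_\alpha\theta$, where $u,\Gamma\in L^2$ and $\theta\in L^2\cap L^\infty\cap H^{s+1-2\alpha}$, then $[R_\alpha,u]\theta\in H^s$ and, again with $C$ depending only on $s,\alpha$ and $(\chi,\varphi)$, $$\|[R_\alpha,u]\theta\|_{H^s}\le C\big(\|\Gamma\|_{L^2}\|\theta\|_{B^{s-\alpha}_{\infty,2}}+\|\theta\|_{L^\infty}\|\theta\|_{H^{s+1-2\alpha}}+\|u\|_{L^2}\|\theta\|_{L^2}\big).$$ (2) For every $s\in(-1,\alpha)$ there is a constant $C$ depending only on $n,s,\alpha$ and $(\chi,\varphi)$ such that for all $p\in[2,\infty)$ and $r\in[1,\infty]$: if $\nabla u\in L^p$, $\theta\in L^p\cap B^{s+1-\alpha}_{\infty,r}$, and $R_\alpha(u\cdot\nabla\theta)$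 is defined in the sense that $\int_{\mathbb R^n}|u\cdot\nabla\theta|\,(1+|x|)^{-(n+1-\alpha)}\,dx<\infty$, then $[R_\alpha,u\cdot\nabla]\theta\in B^s_{p,r}$ and $$\|[R_\alpha,u\cdot\nabla]\theta\|_{B^s_{p,r}}\le C\,\|\nabla u\|_{L^p}\big(\|\theta\|_{B^{s+1-\alpha}_{\infty,r}}+\|\theta\|_{L^p}\big).$$ -/

import Mathlib

open MeasureTheory FourierTransform SchwartzMap TemperedDistribution
open scoped ENNReal NNReal ContDiff

noncomputable section

/-- The Euclidean space `ℝⁿ`. -/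
abbrev Space (n : ℕ) := EuclideanSpace ℝ (Fin n)

/-! ### Littlewood-Paley decomposition, Besov and Sobolev norms -/

/-- A dyadic partition of unity: smooth nonnegative radial functions `χ`, `φ`, supported in the ball
of radius `4/3` and in the shell `3/4 ≤ |ξ| ≤ 8/3`, with
`χ(ξ) + ∑_{q ≥ 0} φ(2^{-q} ξ) = 1` for all `ξ` and `∑_{q ∈ ℤ} φ(2^{-q} ξ) = 1` for `ξ ≠ 0`. -/
structure DyadicPartition (n : ℕ) where
  χ : Space n → ℝ
  φ : Space n → ℝ
  χ_smooth : ContDiff ℝ ∞ χ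
  φ_smooth : ContDiff ℝ ∞ φ
  χ_nonneg : ∀ ξ, 0 ≤ χ ξ
  φ_nonneg : ∀ ξ, 0 ≤ φ ξ
  χ_radial : ∀ ξ η, ‖ξ‖ = ‖η‖ → χ ξ = χ η
  φ_radial : ∀ ξ η, ‖ξ‖ = ‖η‖ → φ ξ = φ η
  χ_support : ∀ ξ, χ ξ ≠ 0 → ‖ξ‖ ≤ 4 / 3
  φ_support : ∀ ξ, φ ξ ≠ 0 → 3 / 4 ≤ ‖ξ‖ ∧ ‖ξ‖ ≤ 8 / 3
  sum_inhomogeneous : ∀ ξ, HasSum (fun q : ℕ => φ (((2 : ℝ) ^ q)⁻¹ • ξ)) (1 - χ ξ)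
  sum_homogeneous : ∀ ξ, ξ ≠ 0 → HasSum (fun q : ℤ => φ (((2 : ℝ) ^ q)⁻¹ • ξ)) 1

/-- The symbol of the block `Δ_{k-1}`, `k = 0, 1, 2, …`, as a function of Mathlib's frequency
variable, which is the usual one divided by `2π`. -/
def DyadicPartition.symbol {n : ℕ} (P : DyadicPartition n) : ℕ → Space n → ℂ
  | 0 => fun ξ => (P.χ ((2 * Real.pi) • ξ) : ℂ)
  | q + 1 => fun ξ => (P.φ (((2 : ℝ) ^ q)⁻¹ • (2 * Real.pi) • ξ) : ℂ)

/-- The nonhomogeneous Littlewood-Paley operator `Δ_{k-1}`, `k = 0, 1, 2, …`. -/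
def DyadicPartition.block {n : ℕ} (P : DyadicPartition n) (k : ℕ) (G : 𝓢'(Space n, ℂ)) :
    𝓢'(Space n, ℂ) :=
  fourierMultiplierCLM ℂ (P.symbol k) G

/-- The `L^p` norm of a tempered distribution: that of the `L^p` function representing it, and `∞`
if there is none. -/
def distLpNorm {n : ℕ} (p : ℝ≥0∞) (G : 𝓢'(Space n, ℂ)) : ℝ≥0∞ :=
  ⨅ (f : Space n → ℂ) (_ : MemLp f p volume ∧ ∀ ψ : 𝓢(Space n, ℂ), G ψ = ∫ x, ψ x * f x),
    eLpNorm f p volume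

/-- The norm of the nonhomogeneous Besov space `B^s_{p,r}`: the `ℓ^r` norm over `q = k - 1 ≥ -1` of
`2^{qs} ‖Δ_q G‖_{L^p}`. -/
def besovNorm {n : ℕ} (P : DyadicPartition n) (s : ℝ) (p r : ℝ≥0∞) (G : 𝓢'(Space n, ℂ)) : ℝ≥0∞ :=
  eLpNorm (fun k : ℕ =>
    ENNReal.ofReal ((2 : ℝ) ^ (((k : ℝ) - 1) * s)) * distLpNorm p (P.block k G)) r Measure.count

/-- The norm of the Sobolev space `H^s`, the `L²` norm of the Bessel potential of order `s`. -/
def sobolevNorm {n : ℕ} (s : ℝ) (G : 𝓢'(Space n, ℂ)) : ℝ≥0∞ :=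
  distLpNorm 2 (besselPotential (Space n) ℂ s G)

/-- A real function in `L^p` as a tempered distribution. -/
def lpDist {n : ℕ} {p : ℝ≥0∞} [Fact (1 ≤ p)] {f : Space n → ℝ} (hf : MemLp f p volume) :
    𝓢'(Space n, ℂ) :=
  Lp.toTemperedDistribution ((hf.ofReal (K := ℂ)).toLp)

/-! ### Distributions, as functionals on compactly supported smooth functions -/

/-- The product `a T` of a distribution with a smooth function, `⟨a T, ψ⟩ = ⟨T, a ψ⟩`. -/
def mulDist {n : ℕ} (a : Space n → ℝ) (T : (Space n → ℂ) → ℂ) : (Space n → ℂ) → ℂ :=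
  fun ψ => T (fun x => (a x : ℂ) * ψ x)

/-- The distributional derivative, `⟨∂_i T, ψ⟩ = -⟨T, ∂_i ψ⟩`. -/
def partialDist {n : ℕ} (i : Fin n) (T : (Space n → ℂ) → ℂ) : (Space n → ℂ) → ℂ :=
  fun ψ => -T (fun x => fderiv ℝ ψ x (EuclideanSpace.single i 1))

/-- The tempered distribution `G` extends the distribution `T`. By density of the compactly
supported functions there is at most one such `G`. -/
def Extends {n : ℕ} (G : 𝓢'(Space n, ℂ)) (T : (Space n → ℂ) → ℂ) : Prop :=
  ∀ ψ : 𝓢(Space n, ℂ), HasCompactSupport (ψ : Space n → ℂ) → G ψ = T ψ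

/-! ### The modified Riesz transform and its commutators -/

/-- The symbol of `R_α = |D|^{-α} ∂₁` in Mathlib's frequency variable. -/
def rieszSymbol {n : ℕ} [NeZero n] (α : ℝ) (ξ : Space n) : ℂ :=
  (((2 * Real.pi * ‖ξ‖) ^ (-α) : ℝ) : ℂ) * (2 * Real.pi * Complex.I * (ξ 0 : ℂ))

/-- The distribution `R_α f = 𝓕⁻¹(m 𝓕 f)`, `m` the symbol above, with the Fourier transforms moved
to the test function: `⟨R_α f, ψ⟩ = ∫ f 𝓕(m 𝓕⁻¹ ψ)`. -/
def riesz {n : ℕ} [NeZero n] (α : ℝ) (f : Space n → ℝ) : (Space n → ℂ) → ℂ :=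
  fun ψ => ∫ x, (f x : ℂ) * 𝓕 (fun ξ => rieszSymbol α ξ * 𝓕⁻ ψ ξ) x

/-- The functions on which `R_α` is defined: `f ∈ L¹((1 + |x|)^{-(n+1-α)} dx)`. For `ψ` smooth with
compact support `𝓕(m 𝓕⁻¹ ψ)` is `O((1 + |x|)^{-(n+1-α)})`, which is optimal in general. -/
def RieszDomain {n : ℕ} (α : ℝ) (f : Space n → ℝ) : Prop :=
  Integrable (fun x => (1 + ‖x‖) ^ (-((n : ℝ) + 1 - α)) * f x) volume

/-- The `i`-th component of `[R_α, u] θ = R_α(u θ) - u R_α θ`. -/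
def commMul {n : ℕ} [NeZero n] (α : ℝ) (u : Space n → Space n) (θ : Space n → ℝ) (i : Fin n) :
    (Space n → ℂ) → ℂ :=
  riesz α (fun x => u x i * θ x) - mulDist (fun x => u x i) (riesz α θ)

/-- `u · ∇θ` for a differentiable function `θ`. -/
def advect {n : ℕ} (u : Space n → Space n) (θ : Space n → ℝ) : Space n → ℝ :=
  fun x => ∑ i, u x i * fderiv ℝ θ x (EuclideanSpace.single i 1)

/-- `[R_α, u · ∇] θ = R_α(u · ∇θ) - u · ∇ R_α θ`. -/
def commAdvect {n : ℕ} [NeZero n] (α : ℝ) (u : Space n → Space n) (θ : Space n → ℝ) :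
    (Space n → ℂ) → ℂ :=
  riesz α (advect u θ) - ∑ i, mulDist (fun x => u x i) (partialDist i (riesz α θ))

/-- `div u = 0`. -/
def DivergenceFree {n : ℕ} (u : Space n → Space n) : Prop :=
  ∀ x, ∑ i, fderiv ℝ u x (EuclideanSpace.single i 1) i = 0

/-! ### The Biot-Savart law -/

/-- The Fourier transform of a real square integrable function. -/
def fourierL2 {n : ℕ} {f : Space n → ℝ} (hf : MemLp f 2 volume) : Space n → ℂ :=
  (𝓕 ((hf.ofReal (K := ℂ)).toLp) : Lp ℂ 2 (volume : Measure (Space n)))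

/-- The square integrable planar field `u = (u₁, u₂)` is `Δ⁻¹ ∇^⊥ ω`, `∇^⊥ = (-∂₂, ∂₁)`, for the
tempered distribution `ω` whose Fourier transform is the function `ωhat`. -/
def IsBiotSavart {u : Space 2 → Space 2} (hu : ∀ i, MemLp (fun x => u x i) 2 volume)
    (ωhat : Space 2 → ℂ) : Prop :=
  (∀ᵐ ξ : Space 2, fourierL2 (hu 0) ξ =
    (-((2 * Real.pi * ‖ξ‖) ^ 2 : ℝ) : ℂ)⁻¹ * (-(2 * Real.pi * Complex.I * (ξ 1 : ℂ))) * ωhat ξ) ∧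
  (∀ᵐ ξ : Space 2, fourierL2 (hu 1) ξ =
    (-((2 * Real.pi * ‖ξ‖) ^ 2 : ℝ) : ℂ)⁻¹ * (2 * Real.pi * Complex.I * (ξ 0 : ℂ)) * ωhat ξ)

end

/-!
Estimates for the commutators of the modified Riesz transform `R_α`, whose symbol is homogeneous
of degree `d = 1 - α ∈ (0, 1)`, with the multiplication by `u` and with `u · ∇`.

All operators are Fourier multipliers localized by the dyadic partition, written `op σ f` as
convolutions with the kernel `𝓕⁻¹ σ`. The symbol `σ_k h` of a homogeneous function `h` of degree
`d` at frequency `2^k` has a Schwartz kernel with `∫ |y|^m |K(y)| dy ≲ 2^{k(d - m)}`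
(`Shell.bounds`, collected in `Bds`); the low frequency part of `h` is a series of dilated shells,
and its kernel decays only like `|x|^{-(n+d)}` (`symb_low`). For this reason functions are
measured against the weights `wt M`, with the classes `Decays`, `WInt` and `Symb`, and identities
between operators hold on `WInt`.

Commutators with multiplications use `[σ(D), u] f (x) = ∫ K(y) (u(x - y) - u(x)) f(x - y) dy`, so
that `‖[σ(D), u] f‖_r ≤ ‖|y| K‖₁ ‖∇u‖_p ‖f‖_q` by Minkowski's inequality (`eLpNorm_com_le`).

*The commutator `[R_α, u] θ`.* The block `Δ_j [R_α, u] Δ_q θ` gains `2^{-α max(j, q)}`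
(`exists_block_estimate`): for `q ≤ j + 2` it is a difference of two commutators of `u` with
multipliers at frequency `2^j`; for `q ≥ j + 3` the symbols of `Δ_j` and `Δ_q` have disjoint
supports, and the commutator is taken with a multiplier at frequency `2^q`. Multiplied by `2^{js}`
with `0 < s < α` this is a geometric kernel in `|j - q|` acting on the sequence of the
`2^{q(s - α)} ‖Δ_q θ‖`, and such kernels are bounded on `ℓ^r` (`eLpNorm_geo_le`). Only the
lowest block of `u Δ_q θ`, `q ≤ 2`, has no gain; it is bounded by `‖u‖_2 ‖θ‖_2`. The estimates
are made for the pairing of the commutator with a test function; `exists_sobolev_extension` turns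
a bound on the pairing into an element of `H^s` by duality.

*The Biot-Savart velocity.* Here `u` is split into its lowest frequencies, the part generated by
`Γ`, whose gradient is bounded in `L²` by `Γ`, and the part `κ(D) θ` generated by `R_α θ`, with
`κ` of degree `-α` (`op_symbol_ae_eq`). The first two are treated as above. In the third the
velocity is frequency localized as well, and the two ranges in which its frequency is much lower
than that of the transported function, or not, are estimated by `‖θ‖_∞` and the `L²` norms of the
blocks of `θ` (`exists_low_velocity_estimate`, `exists_high_velocity_estimate`).

*The commutator `[R_α, u · ∇] θ`.* As `div u = 0`, it is
`∑ i, ([∂_i R_α, u_i] θ - [∂_i, u_i] R_α θ)`. For an output frequency `2^j ≳ 2^q` the divergence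
allows to subtract the further terms `θ ∂_i R_α u_i` and `R_α θ ∂_i u_i`, which sum up to zero.
There remain the second order commutators `com₂`, whose kernels act on products of two
differences, and which gain `|y|²` (`eLpNorm_com₂_le`). This gives `2^{min(j, q) - α max(j, q)}`
for each block (`exists_ablk_estimate`), which is summable for `-1 < s < α`. Since `s` may be
negative, the sum of the blocks is built as a tempered distribution directly, as `F₀ + |D|² F₁`
with `F₀` and `F₁` in `L^p` (`exists_synthesis`). That it is the commutator follows by testing:
all derivatives are moved to the test function (`commAdvect_eq`, an integration by parts for
functions `u` of moderate growth, `exists_growth_decomposition`), and the frequencies of `θ` and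
of the product are truncated (`tendsto_truncated_advection`, `tendsto_sum_ablk`).
-/

noncomputable section

open Filter Topology

namespace RieszCommutator

variable {n : ℕ}

/-! ### Polynomial weights, decaying kernels and convolution -/

/-- The weight `(1 + |x|)^{-M}`. -/
def wt (M : ℝ) (x : Space n) : ℝ := (1 + ‖x‖) ^ (-M)

/-- Continuous functions of size `O((1 + |x|)^{-M})`. -/
structure Decays (M : ℝ) (K : Space n → ℂ) : Prop where
  cont : Continuous K
  bound : ∃ C, ∀ x, ‖K x‖ ≤ C * wt M x

/-- Functions integrable against the weight `(1 + |x|)^{-M}`, the natural partners of `Decays M`. -/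
structure WInt (M : ℝ) (f : Space n → ℂ) : Prop where
  meas : AEStronglyMeasurable f volume
  integ : Integrable (fun x => wt M x * ‖f x‖) volume

/-- The convolution `K * f`. -/
def cv (K f : Space n → ℂ) (x : Space n) : ℂ := ∫ y, K (x - y) * f y

lemma wt_pos (M : ℝ) (x : Space n) : 0 < wt M x := by unfold wt; positivity

lemma wt_continuous (M : ℝ) : Continuous (wt (n := n) M) := by
  unfold wt
  exact (continuous_const.add continuous_norm).rpow_const
    (fun x => Or.inl (add_pos_of_pos_of_nonneg one_pos (norm_nonneg x)).ne')

lemma wt_neg (M : ℝ) (x : Space n) : wt M (-x) = wt M x := by simp [wt]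

lemma wt_sub_comm (M : ℝ) (x y : Space n) : wt M (x - y) = wt M (y - x) := by
  rw [← wt_neg, neg_sub]

lemma wt_le_one {M : ℝ} (hM : 0 ≤ M) (x : Space n) : wt M x ≤ 1 := by
  unfold wt
  exact Real.rpow_le_one_of_one_le_of_nonpos (by linarith [norm_nonneg x]) (by linarith)

lemma wt_anti {M N : ℝ} (h : N ≤ M) (x : Space n) : wt M x ≤ wt N x := by
  unfold wt
  exact Real.rpow_le_rpow_of_exponent_le (by linarith [norm_nonneg x]) (by linarith)

lemma wt_add (M N : ℝ) (x : Space n) : wt (M + N) x = wt M x * wt N x := by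
  unfold wt
  rw [neg_add, Real.rpow_add (by positivity)]

/-- Peetre's inequality. -/
lemma wt_peetre {M : ℝ} (hM : 0 ≤ M) (x y : Space n) :
    wt M (x - y) ≤ (1 + ‖x‖) ^ M * wt M y := by
  unfold wt
  rw [Real.rpow_neg (by positivity), Real.rpow_neg (by positivity), ← div_eq_mul_inv,
    le_div_iff₀ (by positivity), inv_mul_le_iff₀ (by positivity), ← Real.mul_rpow (by positivity)
      (by positivity)]
  apply Real.rpow_le_rpow (by positivity) _ hM
  have h := norm_sub_le x (x - y)
  rw [sub_sub_cancel] at h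
  nlinarith [norm_nonneg x, norm_nonneg (x - y)]

/-- The inequality behind `wt M * wt M ≲ wt M`: one of two points adding up to `y` is at least half
as long as `y`. -/
lemma wt_mul_le {M : ℝ} (hM : 0 ≤ M) (x y : Space n) :
    wt M (x - y) * wt M x ≤ 2 ^ M * wt M y * (wt M x + wt M (x - y)) := by
  have key : ∀ z : Space n, ‖y‖ ≤ 2 * ‖z‖ → wt M z ≤ 2 ^ M * wt M y := by
    intro z hz
    unfold wt
    rw [Real.rpow_neg (by positivity), Real.rpow_neg (by positivity), ← div_eq_mul_inv,
      le_div_iff₀ (by positivity), inv_mul_le_iff₀ (by positivity),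
      ← Real.mul_rpow (by positivity) (by positivity)]
    exact Real.rpow_le_rpow (by positivity) (by linarith) hM
  have h := norm_sub_le x (x - y)
  rw [sub_sub_cancel] at h
  have h1 := wt_pos M x
  have h2 := wt_pos M (x - y)
  have h3 : (0 : ℝ) ≤ 2 ^ M * wt M y := mul_nonneg (by positivity) (wt_pos M y).le
  rcases le_total ‖x‖ ‖x - y‖ with h' | h'
  · nlinarith [key (x - y) (by linarith)]
  · nlinarith [key x (by linarith)]

lemma wt_integrable {M : ℝ} (hM : n < M) : Integrable (wt (n := n) M) := by
  unfold wt
  exact integrable_one_add_norm (by simpa using hM)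

lemma Decays.bound' {M : ℝ} {K : Space n → ℂ} (hK : Decays M K) :
    ∃ C, 0 ≤ C ∧ ∀ x, ‖K x‖ ≤ C * wt M x := by
  obtain ⟨C, hC⟩ := hK.bound
  refine ⟨max C 0, le_max_right _ _, fun x => (hC x).trans ?_⟩
  exact mul_le_mul_of_nonneg_right (le_max_left _ _) (wt_pos M x).le

lemma Decays.mono {M N : ℝ} (h : N ≤ M) {K : Space n → ℂ} (hK : Decays M K) : Decays N K := by
  obtain ⟨C, h0, hC⟩ := hK.bound'
  exact ⟨hK.cont, C, fun x => (hC x).trans (mul_le_mul_of_nonneg_left (wt_anti h x) h0)⟩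

lemma Decays.integrable {M : ℝ} (hM : n < M) {K : Space n → ℂ} (hK : Decays M K) :
    Integrable K := by
  obtain ⟨C, hC⟩ := hK.bound
  exact ((wt_integrable hM).const_mul C).mono' hK.cont.aestronglyMeasurable
    (Eventually.of_forall hC)

lemma Decays.add {M : ℝ} {K H : Space n → ℂ} (hK : Decays M K) (hH : Decays M H) :
    Decays M (fun x => K x + H x) := by
  obtain ⟨C, hC⟩ := hK.bound
  obtain ⟨D, hD⟩ := hH.bound
  refine ⟨hK.cont.add hH.cont, C + D, fun x => (norm_add_le _ _).trans ?_⟩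
  rw [add_mul]
  exact add_le_add (hC x) (hD x)

lemma Decays.const_mul {M : ℝ} {K : Space n → ℂ} (hK : Decays M K) (c : ℂ) :
    Decays M (fun x => c * K x) := by
  obtain ⟨C, hC⟩ := hK.bound
  refine ⟨continuous_const.mul hK.cont, ‖c‖ * C, fun x => ?_⟩
  rw [norm_mul, mul_assoc]
  exact mul_le_mul_of_nonneg_left (hC x) (norm_nonneg _)

lemma Decays.comp_neg {M : ℝ} {K : Space n → ℂ} (hK : Decays M K) :
    Decays M (fun x => K (-x)) := by
  obtain ⟨C, hC⟩ := hK.bound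
  exact ⟨hK.cont.comp continuous_neg, C, fun x => by simpa [wt_neg] using hC (-x)⟩

lemma Decays.comp_sub_left {M : ℝ} (hM : 0 ≤ M) {K : Space n → ℂ} (hK : Decays M K) (x : Space n) :
    Decays M (fun y => K (x - y)) := by
  obtain ⟨C, h0, hC⟩ := hK.bound'
  refine ⟨hK.cont.comp (continuous_const.sub continuous_id), C * (1 + ‖x‖) ^ M,
    fun y => (hC _).trans ?_⟩
  rw [mul_assoc]
  exact mul_le_mul_of_nonneg_left (wt_peetre hM x y) h0

lemma Decays.norm_le {M : ℝ} (hM : 0 ≤ M) {K : Space n → ℂ} (hK : Decays M K) :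
    ∃ C, ∀ x, ‖K x‖ ≤ C := by
  obtain ⟨C, h0, hC⟩ := hK.bound'
  exact ⟨C, fun x => (hC x).trans (mul_le_of_le_one_right h0 (wt_le_one hM x))⟩

lemma WInt.mono {M N : ℝ} (h : N ≤ M) {f : Space n → ℂ} (hf : WInt N f) : WInt M f := by
  refine ⟨hf.meas, hf.integ.mono' ((wt_continuous M).aestronglyMeasurable.mul hf.meas.norm)
    (Eventually.of_forall fun x => ?_)⟩
  have := (wt_pos M x).le
  rw [Real.norm_of_nonneg (by positivity)]
  exact mul_le_mul_of_nonneg_right (wt_anti h x) (norm_nonneg _)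

lemma WInt.add {M : ℝ} {f g : Space n → ℂ} (hf : WInt M f) (hg : WInt M g) :
    WInt M (fun x => f x + g x) := by
  refine ⟨hf.meas.add hg.meas, (hf.integ.add hg.integ).mono'
    ((wt_continuous M).aestronglyMeasurable.mul (hf.meas.add hg.meas).norm)
    (Eventually.of_forall fun x => ?_)⟩
  have := (wt_pos M x).le
  rw [Real.norm_of_nonneg (by positivity), Pi.add_apply, ← mul_add]
  exact mul_le_mul_of_nonneg_left (norm_add_le _ _) this

lemma WInt.const_mul {M : ℝ} {f : Space n → ℂ} (hf : WInt M f) (c : ℂ) :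
    WInt M (fun x => c * f x) := by
  refine ⟨hf.meas.const_mul c, (hf.integ.const_mul ‖c‖).congr (Eventually.of_forall fun x => ?_)⟩
  simp only [norm_mul]; ring

lemma WInt.sub {M : ℝ} {f g : Space n → ℂ} (hf : WInt M f) (hg : WInt M g) :
    WInt M (fun x => f x - g x) := by
  have := hf.add (hg.const_mul (-1))
  simpa [sub_eq_add_neg] using this

/-- Decaying functions pair with weighted integrable ones. -/
lemma Decays.integrable_mul {M : ℝ} {g f : Space n → ℂ} (hg : Decays M g) (hf : WInt M f) :
    Integrable (fun x => g x * f x) := by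
  obtain ⟨C, hC⟩ := hg.bound
  refine (hf.integ.const_mul C).mono' (hg.cont.aestronglyMeasurable.mul hf.meas)
    (Eventually.of_forall fun x => ?_)
  rw [norm_mul, ← mul_assoc]
  exact mul_le_mul_of_nonneg_right (hC x) (norm_nonneg _)

lemma Decays.integrable_cv {M : ℝ} (hM : 0 ≤ M) {K f : Space n → ℂ} (hK : Decays M K)
    (hf : WInt M f) (x : Space n) : Integrable (fun y => K (x - y) * f y) :=
  (hK.comp_sub_left hM x).integrable_mul hf

/-- Absolute convergence of `∬ g(x) K(x-y) f(y)`. -/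
lemma integrable_triple {M : ℝ} (hn : n < M) {K g f : Space n → ℂ} (hK : Decays M K)
    (hg : Decays M g) (hf : WInt M f) :
    Integrable (fun p : Space n × Space n => g p.1 * (K (p.1 - p.2) * f p.2))
      (volume.prod volume) := by
  have hM : 0 ≤ M := (Nat.cast_nonneg n).trans hn.le
  obtain ⟨C, hC0, hC⟩ := hK.bound'
  obtain ⟨D, hD0, hD⟩ := hg.bound'
  have i1 : Integrable (fun p : Space n × Space n => wt M p.1 * (wt M p.2 * ‖f p.2‖))
      (volume.prod volume) := (wt_integrable hn).mul_prod hf.integ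
  have i2 : Integrable (fun p : Space n × Space n => (wt M p.2 * ‖f p.2‖) * wt M (p.1 - p.2))
      (volume.prod volume) :=
    Integrable.convolution_integrand (ContinuousLinearMap.mul ℝ ℝ) hf.integ (wt_integrable hn)
  refine ((i1.add i2).const_mul (C * D * 2 ^ M)).mono' ?_ (Eventually.of_forall fun p => ?_)
  · refine (hg.cont.comp continuous_fst).aestronglyMeasurable.mul
      ((hK.cont.comp (continuous_fst.sub continuous_snd)).aestronglyMeasurable.mul ?_)
    exact hf.meas.comp_snd
  · have h := wt_mul_le hM p.1 p.2
    have a1 := hC (p.1 - p.2)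
    have a2 := hD p.1
    have p1 := (wt_pos M p.1).le
    have p2 := (wt_pos M (p.1 - p.2)).le
    calc ‖g p.1 * (K (p.1 - p.2) * f p.2)‖
        = ‖g p.1‖ * ‖K (p.1 - p.2)‖ * ‖f p.2‖ := by simp [mul_assoc]
      _ ≤ (D * wt M p.1) * (C * wt M (p.1 - p.2)) * ‖f p.2‖ := by gcongr
      _ = (C * D) * (wt M (p.1 - p.2) * wt M p.1) * ‖f p.2‖ := by ring
      _ ≤ (C * D) * (2 ^ M * wt M p.2 * (wt M p.1 + wt M (p.1 - p.2))) * ‖f p.2‖ := by gcongr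
      _ = _ := by simp only [Pi.add_apply]; ring

/-- Transposition of a convolution. -/
lemma integral_mul_cv {M : ℝ} (hn : n < M) {K g f : Space n → ℂ} (hK : Decays M K)
    (hg : Decays M g) (hf : WInt M f) :
    ∫ x, g x * cv K f x = ∫ y, cv (fun z => K (-z)) g y * f y := by
  have h := integral_integral_swap (f := fun x y => g x * (K (x - y) * f y))
    (integrable_triple hn hK hg hf)
  simp only [integral_const_mul] at h
  rw [show (fun x => g x * cv K f x) = fun x => g x * ∫ y, K (x - y) * f y from rfl, h]
  congr 1
  ext y
  rw [cv, ← integral_mul_const]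
  congr 1
  ext x
  simp only [neg_sub]
  ring

/-- The convolution of a decaying kernel and a weighted integrable function is again weighted
integrable. -/
lemma WInt.cv {M : ℝ} (hn : n < M) {K f : Space n → ℂ} (hK : Decays M K) (hf : WInt M f) :
    WInt M (cv K f) := by
  have hg : Decays M (fun x : Space n => ((wt M x : ℝ) : ℂ)) :=
    ⟨Complex.continuous_ofReal.comp (wt_continuous M), 1, fun x => by
      simp [abs_of_pos (wt_pos M x)]⟩
  have hi := (integrable_triple hn hK hg hf).integral_prod_left
  have hi' : Integrable (fun x => ((wt M x : ℝ) : ℂ) * RieszCommutator.cv K f x) := by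
    refine hi.congr (Eventually.of_forall fun x => ?_)
    simp only [integral_const_mul]
    rfl
  refine ⟨?_, hi'.norm.congr (Eventually.of_forall fun x => by
    simp [abs_of_pos (wt_pos M x)])⟩
  have hc : Continuous (fun x : Space n => (((wt M x)⁻¹ : ℝ) : ℂ)) :=
    Complex.continuous_ofReal.comp ((wt_continuous M).inv₀ fun x => (wt_pos M x).ne')
  refine (hc.aestronglyMeasurable.mul hi'.aestronglyMeasurable).congr
    (Eventually.of_forall fun x => ?_)
  have := (wt_pos M x).ne'
  simp only [Pi.mul_apply]
  rw [← mul_assoc, ← Complex.ofReal_mul, inv_mul_cancel₀ this, Complex.ofReal_one, one_mul]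

lemma Decays.cv {M : ℝ} (hn : n < M) {K H : Space n → ℂ} (hK : Decays M K) (hH : Decays M H) :
    Decays M (RieszCommutator.cv K H) := by
  have hM : 0 ≤ M := (Nat.cast_nonneg n).trans hn.le
  obtain ⟨C, hC0, hC⟩ := hK.bound'
  obtain ⟨D, hD0, hD⟩ := hH.bound'
  obtain ⟨B, hB⟩ := hK.norm_le hM
  refine ⟨?_, C * D * 2 ^ M * ((∫ x, wt (n := n) M x) + ∫ x, wt (n := n) M x), fun y => ?_⟩
  · refine continuous_of_dominated (bound := fun y => B * ‖H y‖) (fun x => ?_)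
      (fun x => Eventually.of_forall fun y => ?_) ((hH.integrable hn).norm.const_mul B)
      (Eventually.of_forall fun y => ?_)
    · exact ((hK.cont.comp (continuous_const.sub continuous_id)).mul hH.cont).aestronglyMeasurable
    · rw [norm_mul]; exact mul_le_mul_of_nonneg_right (hB _) (norm_nonneg _)
    · exact (hK.cont.comp (continuous_id.sub continuous_const)).mul continuous_const
  · have hw := wt_integrable (n := n) hn
    have hws : Integrable (fun x : Space n => wt M (x - y)) := hw.comp_sub_right y
    have e1 : ∫ x, wt M x = ∫ x : Space n, wt M (x - y) :=
      (integral_sub_right_eq_self (fun x : Space n => wt M x) y).symm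
    calc ‖RieszCommutator.cv K H y‖
        ≤ ∫ x, (C * D * 2 ^ M * wt M y) * (wt M x + wt M (x - y)) := by
          refine norm_integral_le_of_norm_le ((hw.add hws).const_mul _)
            (Eventually.of_forall fun x => ?_)
          have h := wt_mul_le hM x y
          have p1 := (wt_pos M x).le
          have p2 := (wt_pos M (y - x)).le
          calc ‖K (y - x) * H x‖ = ‖K (y - x)‖ * ‖H x‖ := norm_mul _ _
            _ ≤ (C * wt M (y - x)) * (D * wt M x) := by
                gcongr
                · exact hC _
                · exact hD _
            _ = (C * D) * (wt M (x - y) * wt M x) := by rw [wt_sub_comm]; ring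
            _ ≤ (C * D) * (2 ^ M * wt M y * (wt M x + wt M (x - y))) := by gcongr
            _ = _ := by ring
      _ = _ := by
          rw [integral_const_mul, integral_add hw hws, ← e1]; ring

/-- Associativity of convolution. -/
lemma cv_cv {M : ℝ} (hn : n < M) {K H f : Space n → ℂ} (hK : Decays M K) (hH : Decays M H)
    (hf : WInt M f) (x : Space n) : cv K (cv H f) x = cv (cv K H) f x := by
  have hM : 0 ≤ M := (Nat.cast_nonneg n).trans hn.le
  have h := integral_mul_cv hn hH (hK.comp_sub_left hM x) hf
  rw [cv, h, cv]
  congr 1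
  ext z
  congr 1
  simp only [cv, neg_sub]
  rw [← integral_sub_right_eq_self (fun w => K (x - z - w) * H w) z]
  congr 1
  ext y
  rw [mul_comm, show x - z - (y - z) = x - y by abel]

lemma cv_sub {M : ℝ} (hM : 0 ≤ M) {K f g : Space n → ℂ} (hK : Decays M K) (hf : WInt M f)
    (hg : WInt M g) (x : Space n) : cv K (fun y => f y - g y) x = cv K f x - cv K g x := by
  simp only [cv, mul_sub]
  exact integral_sub (hK.integrable_cv hM hf x) (hK.integrable_cv hM hg x)

lemma cv_sum {M : ℝ} (hM : 0 ≤ M) {ι : Type*} (s : Finset ι) {K : Space n → ℂ}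
    {f : ι → Space n → ℂ} (hK : Decays M K) (hf : ∀ i ∈ s, WInt M (f i)) (x : Space n) :
    cv K (fun y => ∑ i ∈ s, f i y) x = ∑ i ∈ s, cv K (f i) x := by
  simp only [cv, Finset.mul_sum]
  exact integral_finsetSum _ fun i hi => hK.integrable_cv hM (hf i hi) x

lemma Decays.memLp {M : ℝ} (hn : n < M) {K : Space n → ℂ} (hK : Decays M K) {q : ℝ≥0∞}
    (hq : 1 ≤ q) : MemLp K q volume := by
  have hM : 0 ≤ M := (Nat.cast_nonneg n).trans hn.le
  obtain ⟨C, hC0, hC⟩ := hK.bound'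
  obtain ⟨B, hB⟩ := hK.norm_le hM
  rcases eq_or_ne q ⊤ with rfl | hq'
  · exact memLp_top_of_bound hK.cont.aestronglyMeasurable B (Eventually.of_forall hB)
  have hw : MemLp (fun x : Space n => wt M x) q volume := by
    have h1 : (1 : ℝ) ≤ q.toReal := by
      simpa using (ENNReal.toReal_le_toReal (by simp) hq').2 hq
    rw [← integrable_norm_rpow_iff (wt_continuous M).aestronglyMeasurable
      (zero_lt_one.trans_le hq).ne' hq']
    refine (wt_integrable hn).mono' (((wt_continuous M).norm.rpow_const
      fun x => Or.inr (by linarith)).aestronglyMeasurable) (Eventually.of_forall fun x => ?_)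
    have h0 := (wt_pos M x).le
    rw [Real.norm_of_nonneg (by positivity), Real.norm_of_nonneg h0]
    simpa using Real.rpow_le_rpow_of_exponent_ge (wt_pos M x) (wt_le_one hM x) h1
  refine (hw.const_mul C).of_le hK.cont.aestronglyMeasurable (Eventually.of_forall fun x => ?_)
  exact (hC x).trans (le_abs_self _)

lemma exists_holderConjugate {p : ℝ≥0∞} (hp : 1 ≤ p) : ∃ q, 1 ≤ q ∧ ENNReal.HolderConjugate p
    q := by
  refine ⟨ENNReal.conjExponent p, ?_, ENNReal.HolderConjugate.conjExponent hp⟩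
  have := ENNReal.HolderConjugate.conjExponent hp
  exact ENNReal.HolderConjugate.one_le _ p

/-- Functions in `L^p` are weighted integrable. -/
lemma WInt.of_memLp {M : ℝ} (hn : n < M) {p : ℝ≥0∞} (hp : 1 ≤ p) {f : Space n → ℂ}
    (hf : MemLp f p volume) : WInt M f := by
  refine ⟨hf.1, ?_⟩
  obtain ⟨q, hq, hpq⟩ := exists_holderConjugate hp
  have hg : Decays M (fun x : Space n => ((wt M x : ℝ) : ℂ)) :=
    ⟨Complex.continuous_ofReal.comp (wt_continuous M), 1, fun x => by
      simp [abs_of_pos (wt_pos M x)]⟩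
  have := (hf.integrable_mul (hg.memLp hn hq)).norm
  refine this.congr (Eventually.of_forall fun x => ?_)
  simp [abs_of_pos (wt_pos M x), mul_comm]

/-! ### Fourier multipliers with decaying kernels -/

/-- Symbols whose kernel `𝓕⁻¹ σ` decays like `(1 + |x|)^{-M}`. -/
structure Symb (M : ℝ) (σ : Space n → ℂ) : Prop where
  cont : Continuous σ
  integ : Integrable σ
  decay : Decays M (𝓕⁻ σ)

/-- The Fourier multiplier `σ(D)`, as convolution with `𝓕⁻¹ σ`. -/
def op (σ f : Space n → ℂ) : Space n → ℂ := cv (𝓕⁻ σ) f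

lemma Symb.mono {M N : ℝ} (h : N ≤ M) {σ : Space n → ℂ} (hσ : Symb M σ) : Symb N σ :=
  ⟨hσ.cont, hσ.integ, hσ.decay.mono h⟩

lemma Symb.fourier_ker {M : ℝ} (hn : n < M) {σ : Space n → ℂ} (hσ : Symb M σ) :
    𝓕 (𝓕⁻ σ) = σ :=
  hσ.cont.fourier_fourierInv_eq hσ.integ <| by
    have h := (hσ.decay.integrable hn).comp_neg
    refine h.congr (Eventually.of_forall fun x => ?_)
    simp [Real.fourierInv_eq_fourier_neg]

lemma fourierInv_fun_add {σ τ : Space n → ℂ} (hσ : Integrable σ) (hτ : Integrable τ) :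
    𝓕⁻ (fun ξ => σ ξ + τ ξ) = fun x => 𝓕⁻ σ x + 𝓕⁻ τ x := by
  ext x
  simp only [Real.fourierInv_eq, smul_add]
  exact integral_add ((Real.fourierIntegral_convergent_iff (-x)).2 hσ |>.congr (by simp))
    ((Real.fourierIntegral_convergent_iff (-x)).2 hτ |>.congr (by simp))

lemma fourierInv_const_mul (σ : Space n → ℂ) (c : ℂ) :
    𝓕⁻ (fun ξ => c * σ ξ) = fun x => c * 𝓕⁻ σ x := by
  ext x
  simp only [Real.fourierInv_eq]
  rw [← integral_const_mul]
  congr 1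
  ext v
  simp only [Circle.smul_def, smul_eq_mul]
  ring

lemma fourierInv_comp_neg (σ : Space n → ℂ) :
    𝓕⁻ (fun ξ => σ (-ξ)) = fun x => 𝓕⁻ σ (-x) := by
  ext x
  simp only [Real.fourierInv_eq]
  rw [← integral_neg_eq_self]
  simp

lemma fourierInv_comp_smul (σ : Space n → ℂ) {l : ℝ} (hl : 0 < l) :
    𝓕⁻ (fun ξ => σ (l⁻¹ • ξ)) = fun x => ((l ^ n : ℝ) : ℂ) * 𝓕⁻ σ (l • x) := by
  ext x
  simp only [Real.fourierInv_eq]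
  have h := Measure.integral_comp_inv_smul_of_nonneg (volume : Measure (Space n))
    (fun ξ => Real.fourierChar (inner ℝ ξ (l • x)) • σ ξ) hl.le
  simp only [finrank_euclideanSpace, Fintype.card_fin] at h
  rw [Complex.real_smul] at h
  rw [← h]
  congr 1
  ext ξ
  rw [inner_smul_left, inner_smul_right]
  simp [hl.ne']

lemma Symb.add {M : ℝ} {σ τ : Space n → ℂ} (hσ : Symb M σ) (hτ : Symb M τ) :
    Symb M (fun ξ => σ ξ + τ ξ) :=
  ⟨hσ.cont.add hτ.cont, hσ.integ.add hτ.integ, by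
    rw [fourierInv_fun_add hσ.integ hτ.integ]; exact hσ.decay.add hτ.decay⟩

lemma Symb.comp_neg {M : ℝ} {σ : Space n → ℂ} (hσ : Symb M σ) : Symb M (fun ξ => σ (-ξ)) :=
  ⟨hσ.cont.comp continuous_neg, hσ.integ.comp_neg, by
    rw [fourierInv_comp_neg]; exact hσ.decay.comp_neg⟩

lemma Symb.zero (M : ℝ) : Symb M (fun _ : Space n => (0 : ℂ)) := by
  refine ⟨continuous_const, by simp, ?_⟩
  have : (𝓕⁻ (fun _ : Space n => (0 : ℂ)) : Space n → ℂ) = fun _ => 0 := by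
    ext x; simp [Real.fourierInv_eq]
  rw [this]
  exact ⟨continuous_const, 0, by simp⟩

lemma Symb.sum {M : ℝ} {ι : Type*} (s : Finset ι) {σ : ι → Space n → ℂ}
    (hσ : ∀ i ∈ s, Symb M (σ i)) : Symb M (fun ξ => ∑ i ∈ s, σ i ξ) := by
  classical
  induction s using Finset.induction_on with
  | empty => simpa using Symb.zero M
  | insert a s ha ih =>
    simp only [Finset.sum_insert ha]
    exact (hσ a (by simp)).add (ih fun i hi => hσ i (by simp [hi]))

lemma schwartz_decays (M : ℝ) (f : 𝓢(Space n, ℂ)) : Decays M f := by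
  obtain ⟨k, hk⟩ := exists_nat_ge M
  obtain ⟨B, hB⟩ : ∃ B, ∀ x, (1 + ‖x‖) ^ k * ‖f x‖ ≤ B :=
    ⟨_, fun x => by
      simpa using SchwartzMap.one_add_le_sup_seminorm_apply (𝕜 := ℝ) (m := (k, 0)) (k := k)
        (n := 0) le_rfl le_rfl f x⟩
  have hB0 : 0 ≤ B := (by positivity : (0 : ℝ) ≤ _).trans (hB 0)
  refine ⟨f.continuous, B, fun x => ?_⟩
  have hp : (0 : ℝ) < (1 + ‖x‖) ^ k := by positivity
  calc ‖f x‖ = ((1 + ‖x‖) ^ k * ‖f x‖) * ((1 + ‖x‖) ^ k)⁻¹ := by field_simp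
    _ ≤ B * ((1 + ‖x‖) ^ k)⁻¹ := by gcongr; exact hB x
    _ ≤ _ := by
      refine mul_le_mul_of_nonneg_left ?_ hB0
      unfold wt
      rw [← Real.rpow_natCast, ← Real.rpow_neg (by positivity)]
      exact Real.rpow_le_rpow_of_exponent_le (by linarith [norm_nonneg x]) (by linarith)

lemma Symb.of_schwartz (M : ℝ) (f : 𝓢(Space n, ℂ)) : Symb M f :=
  ⟨f.continuous, f.integrable, by rw [← SchwartzMap.fourierInv_coe]; exact schwartz_decays M _⟩

lemma Symb.of_smooth (M : ℝ) {σ : Space n → ℂ} (h : ContDiff ℝ ∞ σ) (hc : HasCompactSupport σ) :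
    Symb M σ :=
  Symb.of_schwartz M (hc.toSchwartzMap h)

lemma Symb.mul_ker {M : ℝ} (hn : n < M) {σ τ : Space n → ℂ} (hσ : Symb M σ) (hτ : Symb M τ) :
    𝓕⁻ (fun ξ => σ ξ * τ ξ) = cv (𝓕⁻ σ) (𝓕⁻ τ) := by
  have hd := hσ.decay.cv hn hτ.decay
  have hf : 𝓕 (cv (𝓕⁻ σ) (𝓕⁻ τ)) = fun ξ => σ ξ * τ ξ := by
    have e : cv (𝓕⁻ σ) (𝓕⁻ τ) =
        MeasureTheory.convolution (𝓕⁻ τ) (𝓕⁻ σ) (ContinuousLinearMap.mul ℂ ℂ) volume := by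
      ext x
      simp only [cv, MeasureTheory.convolution, ContinuousLinearMap.mul_apply', mul_comm]
    ext ξ
    rw [e, Real.fourier_mul_convolution_eq (hτ.decay.integrable hn) (hσ.decay.integrable hn),
      hσ.fourier_ker hn, hτ.fourier_ker hn, mul_comm]
  obtain ⟨C, hC⟩ := hσ.decay.norm_le ((Nat.cast_nonneg n).trans hn.le)
  have hi : Integrable (fun ξ => σ ξ * τ ξ) := by
    have hb : ∀ ξ, ‖σ ξ‖ ≤ ∫ x, ‖𝓕⁻ σ x‖ := fun ξ => by
      conv_lhs => rw [← hσ.fourier_ker hn]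
      exact VectorFourier.norm_fourierIntegral_le_integral_norm _ _ _ _ _
    exact hτ.integ.bdd_mul hσ.cont.aestronglyMeasurable (Eventually.of_forall hb)
  rw [← hf] at hi
  rw [← hd.cont.fourierInv_fourier_eq (hd.integrable hn) hi, hf]

lemma Symb.bounded {M : ℝ} (hn : n < M) {σ : Space n → ℂ} (hσ : Symb M σ) :
    ∃ C, ∀ ξ, ‖σ ξ‖ ≤ C :=
  ⟨∫ x, ‖𝓕⁻ σ x‖, fun ξ => by
    conv_lhs => rw [← hσ.fourier_ker hn]
    exact VectorFourier.norm_fourierIntegral_le_integral_norm _ _ _ _ _⟩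

lemma Symb.mul {M : ℝ} (hn : n < M) {σ τ : Space n → ℂ} (hσ : Symb M σ) (hτ : Symb M τ) :
    Symb M (fun ξ => σ ξ * τ ξ) := by
  obtain ⟨C, hC⟩ := hσ.bounded hn
  refine ⟨hσ.cont.mul hτ.cont, hτ.integ.bdd_mul hσ.cont.aestronglyMeasurable
    (Eventually.of_forall hC), ?_⟩
  rw [hσ.mul_ker hn hτ]
  exact hσ.decay.cv hn hτ.decay

lemma op_op {M : ℝ} (hn : n < M) {σ τ f : Space n → ℂ} (hσ : Symb M σ) (hτ : Symb M τ)
    (hf : WInt M f) : op σ (op τ f) = op (fun ξ => σ ξ * τ ξ) f := by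
  ext x
  simp only [op, hσ.mul_ker hn hτ]
  exact cv_cv hn hσ.decay hτ.decay hf x

lemma WInt.op {M : ℝ} (hn : n < M) {σ f : Space n → ℂ} (hσ : Symb M σ) (hf : WInt M f) :
    WInt M (op σ f) := hf.cv hn hσ.decay

lemma Decays.op {M : ℝ} (hn : n < M) {σ f : Space n → ℂ} (hσ : Symb M σ) (hf : Decays M f) :
    Decays M (RieszCommutator.op σ f) := hσ.decay.cv hn hf

lemma integral_mul_op {M : ℝ} (hn : n < M) {σ g f : Space n → ℂ} (hσ : Symb M σ)
    (hg : Decays M g) (hf : WInt M f) :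
    ∫ x, g x * op σ f x = ∫ x, op (fun ξ => σ (-ξ)) g x * f x := by
  simp only [op, fourierInv_comp_neg]
  exact integral_mul_cv hn hσ.decay hg hf

lemma op_zero (f : Space n → ℂ) : op (fun _ => 0) f = fun _ => 0 := by
  ext x
  simp [op, cv, Real.fourierInv_eq]

lemma op_symb_add {M : ℝ} (hM : 0 ≤ M) {σ τ f : Space n → ℂ} (hσ : Symb M σ) (hτ : Symb M τ)
    (hf : WInt M f) : op (fun ξ => σ ξ + τ ξ) f = fun x => op σ f x + op τ f x := by
  ext x
  simp only [op, cv, fourierInv_fun_add hσ.integ hτ.integ, add_mul]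
  exact integral_add (hσ.decay.integrable_cv hM hf x) (hτ.decay.integrable_cv hM hf x)

lemma op_symb_sum {M : ℝ} (hM : 0 ≤ M) {ι : Type*} (s : Finset ι) {σ : ι → Space n → ℂ}
    {f : Space n → ℂ} (hσ : ∀ i ∈ s, Symb M (σ i)) (hf : WInt M f) :
    op (fun ξ => ∑ i ∈ s, σ i ξ) f = fun x => ∑ i ∈ s, op (σ i) f x := by
  classical
  induction s using Finset.induction_on with
  | empty => simpa using op_zero f
  | insert a s ha ih =>
    simp only [Finset.sum_insert ha]
    rw [op_symb_add hM (hσ a (by simp)) (Symb.sum s fun i hi => hσ i (by simp [hi])) hf,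
      ih fun i hi => hσ i (by simp [hi])]

/-- On a Schwartz function, `σ(D)` is inverse Fourier transform of `σ 𝓕 ψ`. -/
lemma op_schwartz {M : ℝ} (hn : n < M) {σ : Space n → ℂ} (hσ : Symb M σ) (ψ : 𝓢(Space n, ℂ)) :
    op σ ψ = 𝓕⁻ (fun ξ => σ ξ * 𝓕 (ψ : Space n → ℂ) ξ) := by
  have h := hσ.mul_ker hn (Symb.of_schwartz M (𝓕 ψ))
  rw [SchwartzMap.fourier_coe] at h
  rw [h, op]
  congr 1
  rw [← SchwartzMap.fourier_coe, ← SchwartzMap.fourierInv_coe, fourierInv_fourier_eq]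

/-! ### Minkowski's integral inequality -/

section Minkowski

variable {α β : Type*} [MeasurableSpace α] [MeasurableSpace β] {μ : Measure α} {ν : Measure β}
  [SFinite μ] [SFinite ν]

lemma ae_ae_eq_zero_of_lintegral {H : α → β → ℝ≥0∞}
    (hH : AEMeasurable (Function.uncurry H) (μ.prod ν)) (h : ∀ y, ∫⁻ x, H x y ∂μ = 0) :
    ∀ᵐ x ∂μ, ∀ᵐ y ∂ν, H x y = 0 := by
  have e : ∫⁻ x, ∫⁻ y, Function.uncurry H (x, y) ∂ν ∂μ = 0 := by
    have := lintegral_lintegral_swap hH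
    simp only [Function.uncurry_apply_pair]
    rw [this]; simp [h]
  rw [lintegral_eq_zero_iff' hH.lintegral_prod_right'] at e
  filter_upwards [e, hH.aestronglyMeasurable.prodMk_left] with x hx hm
  simpa [Filter.EventuallyEq] using (lintegral_eq_zero_iff' hm.aemeasurable).1 hx

/-- Jensen's inequality for the power `q` and a measure of finite mass. -/
lemma lintegral_rpow_le_mass {β : Type*} [MeasurableSpace β] {ν : Measure β} {f : β → ℝ≥0∞}
    (hf : AEMeasurable f ν) {q : ℝ} (hq : 1 ≤ q) :
    (∫⁻ y, f y ∂ν) ^ q ≤ ν Set.univ ^ (q - 1) * ∫⁻ y, f y ^ q ∂ν := by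
  have h := eLpNorm'_le_eLpNorm'_mul_rpow_measure_univ zero_lt_one hq hf.aestronglyMeasurable
  have hq0 : 0 < q := by linarith
  simp only [eLpNorm'_eq_lintegral_enorm, enorm_eq_self, ENNReal.rpow_one, div_one] at h
  calc (∫⁻ y, f y ∂ν) ^ q ≤ ((∫⁻ y, f y ^ q ∂ν) ^ (1 / q) * ν Set.univ ^ (1 - 1 / q)) ^ q := by
        gcongr
    _ = _ := by
        rw [ENNReal.mul_rpow_of_nonneg _ _ hq0.le, ← ENNReal.rpow_mul, ← ENNReal.rpow_mul,
          one_div_mul_cancel hq0.ne', ENNReal.rpow_one, sub_mul, one_div_mul_cancel hq0.ne',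
          one_mul, mul_comm]

/-- **Minkowski's integral inequality**, with a majorant `c` of the inner norms. -/
lemma lintegral_rpow_lintegral_le {G : α → β → ℝ≥0∞}
    (hG : AEMeasurable (Function.uncurry G) (μ.prod ν)) {c : β → ℝ≥0∞} (hc : Measurable c)
    {q : ℝ} (hq : 1 ≤ q) (h : ∀ y, ∫⁻ x, G x y ^ q ∂μ ≤ c y ^ q) :
    ∫⁻ x, (∫⁻ y, G x y ∂ν) ^ q ∂μ ≤ (∫⁻ y, c y ∂ν) ^ q := by
  have hq0 : 0 < q := by linarith
  rcases eq_or_ne (∫⁻ y, c y ∂ν) ⊤ with hV | hV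
  · simp [hV, hq0]
  set V := ∫⁻ y, c y ∂ν with hVdef
  have hctop : ∀ᵐ y ∂ν, c y < ⊤ := ae_lt_top hc hV
  have hsnd : Measurable (fun p : α × β => c p.2) := hc.comp measurable_snd
  -- where the majorant vanishes, so does `G`
  have h0 : ∀ᵐ x ∂μ, ∀ᵐ y ∂ν, c y = 0 → G x y = 0 := by
    have hm : AEMeasurable (Function.uncurry fun x y => {y | c y = 0}.indicator (G x) y)
        (μ.prod ν) := by
      have e : (Function.uncurry fun x y => {y | c y = 0}.indicator (G x) y)
          = {p : α × β | c p.2 = 0}.indicator (Function.uncurry G) := by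
        ext ⟨x, y⟩; simp [Set.indicator]
      rw [e]
      exact hG.indicator (hsnd (measurableSet_singleton 0))
    have := ae_ae_eq_zero_of_lintegral (μ := μ) (ν := ν) hm ?_
    · filter_upwards [this] with x hx
      filter_upwards [hx] with y hy hcy
      simpa [Set.indicator, hcy] using hy
    · intro y
      by_cases hy : c y = 0
      · have h1 := h y
        rw [hy, ENNReal.zero_rpow_of_pos hq0, nonpos_iff_eq_zero] at h1
        obtain ⟨g, hgm, hle, hge⟩ := exists_measurable_le_lintegral_eq μ (fun x => G x y)
        have e : ∫⁻ x, {y | c y = 0}.indicator (G x) y ∂μ = ∫⁻ x, G x y ∂μ := by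
          simp [Set.indicator, hy]
        rw [e, hge]
        have h2 : ∫⁻ x, g x ^ q ∂μ = 0 := le_antisymm
          ((lintegral_mono fun x => ENNReal.rpow_le_rpow (hle x) hq0.le).trans h1.le) zero_le
        rw [lintegral_eq_zero_iff (hgm.pow_const q)] at h2
        rw [lintegral_eq_zero_iff hgm]
        filter_upwards [h2] with x hx
        simpa [hq0, hq0.not_gt] using hx
      · simp [Set.indicator, hy]
  have hJ : ∀ᵐ x ∂μ, (∫⁻ y, G x y ∂ν) ^ q
      ≤ V ^ (q - 1) * ∫⁻ y, c y * ((c y)⁻¹ * G x y) ^ q ∂ν := by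
    filter_upwards [h0, hG.aestronglyMeasurable.prodMk_left] with x hx hm
    have hm' : AEMeasurable (fun y => G x y) ν := hm.aemeasurable
    have hm2 : AEMeasurable (fun y => (c y)⁻¹ * G x y) ν := hc.inv.aemeasurable.mul hm'
    have e1 : ∫⁻ y, G x y ∂ν = ∫⁻ y, (c y)⁻¹ * G x y ∂(ν.withDensity c) := by
      rw [lintegral_withDensity_eq_lintegral_mul₀ hc.aemeasurable hm2]
      refine lintegral_congr_ae ?_
      filter_upwards [hx, hctop] with y hy hty
      by_cases h0 : c y = 0
      · simp [hy h0]
      · simp only [Pi.mul_apply]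
        rw [← mul_assoc, ENNReal.mul_inv_cancel h0 hty.ne, one_mul]
    have hρ : (ν.withDensity c) Set.univ = V := by simp [hVdef]
    have hsf : SFinite (ν.withDensity c) := inferInstance
    have := lintegral_rpow_le_mass (ν := ν.withDensity c)
      (hm2.mono_ac (withDensity_absolutelyContinuous ν c)) hq
    rw [hρ, lintegral_withDensity_eq_lintegral_mul₀ hc.aemeasurable (hm2.pow_const q)] at this
    rw [e1]
    exact this
  have hint : AEMeasurable (Function.uncurry fun x y => c y * ((c y)⁻¹ * G x y) ^ q)
      (μ.prod ν) := by
    exact hsnd.aemeasurable.mul ((hsnd.inv.aemeasurable.mul hG).pow_const q)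
  calc ∫⁻ x, (∫⁻ y, G x y ∂ν) ^ q ∂μ
      ≤ ∫⁻ x, V ^ (q - 1) * ∫⁻ y, c y * ((c y)⁻¹ * G x y) ^ q ∂ν ∂μ := lintegral_mono_ae hJ
    _ = V ^ (q - 1) * ∫⁻ y, ∫⁻ x, c y * ((c y)⁻¹ * G x y) ^ q ∂μ ∂ν := by
        rw [← lintegral_lintegral_swap hint]
        exact lintegral_const_mul'' _ hint.lintegral_prod_right'
    _ ≤ V ^ (q - 1) * ∫⁻ y, c y ∂ν := by
        gcongr with y
        calc ∫⁻ x, c y * ((c y)⁻¹ * G x y) ^ q ∂μ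
            = ∫⁻ x, (c y * ((c y)⁻¹) ^ q) * G x y ^ q ∂μ := by
              congr 1; ext x
              rw [ENNReal.mul_rpow_of_nonneg _ _ hq0.le, mul_assoc]
          _ ≤ c y := by
              by_cases h0 : c y = 0
              · simp [h0]
              by_cases ht : c y = ⊤
              · simp [ht]
              rw [lintegral_const_mul' _ _ (ENNReal.mul_ne_top ht
                (ENNReal.rpow_ne_top_of_nonneg hq0.le (by simpa using h0)))]
              calc c y * (c y)⁻¹ ^ q * ∫⁻ x, G x y ^ q ∂μ
                  ≤ c y * (c y)⁻¹ ^ q * c y ^ q := by gcongr; exact h y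
                _ = c y := by
                  rw [mul_assoc, ← ENNReal.mul_rpow_of_nonneg _ _ hq0.le,
                    ENNReal.inv_mul_cancel h0 ht, ENNReal.one_rpow, mul_one]
    _ = V ^ q := by
        rw [← hVdef]
        nth_rewrite 2 [← ENNReal.rpow_one V]
        rw [← ENNReal.rpow_add_of_nonneg _ _ (by linarith) zero_le_one, sub_add_cancel]

/-- **Minkowski's integral inequality** for the `L^p` norms, `1 ≤ p ≤ ∞`, in the form needed for
integral operators. -/
lemma eLpNorm_lintegral_le {G : α → β → ℝ≥0∞}
    (hG : AEMeasurable (Function.uncurry G) (μ.prod ν)) {c : β → ℝ≥0∞} (hc : Measurable c)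
    {p : ℝ≥0∞} (hp : 1 ≤ p) (h : ∀ y, eLpNorm (fun x => G x y) p μ ≤ c y) :
    eLpNorm (fun x => ∫⁻ y, G x y ∂ν) p μ ≤ ∫⁻ y, c y ∂ν := by
  have hp0 : p ≠ 0 := (zero_lt_one.trans_le hp).ne'
  rcases eq_or_ne p ⊤ with rfl | hp'
  · have hm : AEMeasurable (Function.uncurry fun x y => G x y - c y) (μ.prod ν) :=
      hG.sub (hc.comp measurable_snd).aemeasurable
    have := ae_ae_eq_zero_of_lintegral (μ := μ) (ν := ν) hm fun y => by
      refine (lintegral_congr_ae ?_).trans lintegral_zero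
      have hy := h y
      rw [eLpNorm_exponent_top] at hy
      filter_upwards [ae_le_eLpNormEssSup (f := fun x => G x y) (μ := μ)] with x hx
      exact tsub_eq_zero_of_le (hx.trans hy)
    rw [eLpNorm_exponent_top]
    refine essSup_le_of_ae_le _ ?_
    filter_upwards [this] with x hx
    refine lintegral_mono_ae ?_
    filter_upwards [hx] with y hy
    exact tsub_eq_zero_iff_le.1 hy
  · have h1 : 1 ≤ p.toReal := by
      simpa using (ENNReal.toReal_le_toReal (by simp) hp').2 hp
    have h0 : 0 < p.toReal := by linarith
    rw [eLpNorm_eq_lintegral_rpow_enorm_toReal hp0 hp', one_div, ENNReal.rpow_inv_le_iff h0]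
    simp only [enorm_eq_self]
    refine lintegral_rpow_lintegral_le hG hc h1 fun y => ?_
    have hy := h y
    rwa [eLpNorm_eq_lintegral_rpow_enorm_toReal hp0 hp', one_div,
      ENNReal.rpow_inv_le_iff h0] at hy

end Minkowski

/-! ### Convolution and commutator estimates in `L^p` -/

/-- The `L¹` norm of the kernel of `σ(D)`. -/
def N1 (σ : Space n → ℂ) : ℝ≥0∞ := ∫⁻ y, ‖𝓕⁻ σ y‖ₑ

/-- The first moment `∫ |y| |K(y)| dy` of the kernel `K` of `σ(D)`. -/
def N2 (σ : Space n → ℂ) : ℝ≥0∞ := ∫⁻ y, ‖𝓕⁻ σ y‖ₑ * ‖y‖ₑ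

/-- `u` is Lipschitz as a function with values in `L^p`: `‖u(· - h) - u‖_p ≤ A |h|`. -/
def LipLp (p A : ℝ≥0∞) (u : Space n → ℂ) : Prop :=
  ∀ h : Space n, eLpNorm (fun x => u (x - h) - u x) p volume ≤ ‖h‖ₑ * A

/-- The commutator `[σ(D), u] f`. -/
def com (σ u f : Space n → ℂ) (x : Space n) : ℂ :=
  op σ (fun y => u y * f y) x - u x * op σ f x

lemma aestronglyMeasurable_sub_prod {f : Space n → ℂ} (hf : AEStronglyMeasurable f volume) :
    AEStronglyMeasurable (fun p : Space n × Space n => f (p.1 - p.2)) (volume.prod volume) :=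
  hf.comp_quasiMeasurePreserving (quasiMeasurePreserving_sub volume volume)

/-- Young's inequality `‖K * f‖_p ≤ ‖K‖₁ ‖f‖_p`, together with a version for general families in
place of the translates of `f`. -/
lemma eLpNorm_kernel_le {p A : ℝ≥0∞} (hp : 1 ≤ p) {K : Space n → ℂ} (hK : Continuous K)
    {D : Space n → Space n → ℂ}
    (hD : AEStronglyMeasurable (Function.uncurry D) (volume.prod volume)) {w : Space n → ℝ≥0∞}
    (hw : Measurable w) (h : ∀ y, eLpNorm (fun x => D x y) p volume ≤ w y * A)
    {F : Space n → ℂ} (hF : ∀ x, F x = ∫ y, K y * D x y) :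
    eLpNorm F p volume ≤ (∫⁻ y, ‖K y‖ₑ * w y) * A := by
  have hK' : Measurable fun y => ‖K y‖ₑ := hK.enorm.measurable
  have key : eLpNorm (fun x => ∫⁻ y, ‖K y‖ₑ * ‖D x y‖ₑ) p volume
      ≤ ∫⁻ y, (‖K y‖ₑ * w y) * A := by
    refine eLpNorm_lintegral_le (G := fun x y => ‖K y‖ₑ * ‖D x y‖ₑ) ?_
      ((hK'.mul hw).mul_const A) hp fun y => ?_
    · exact (hK'.comp measurable_snd).aemeasurable.mul hD.enorm
    · have e : eLpNorm (fun x => ‖K y‖ₑ * ‖D x y‖ₑ) p volume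
          ≤ ‖K y‖ₑ * eLpNorm (fun x => D x y) p volume := by
        have h1 : eLpNorm (fun x => ‖K y‖ₑ * ‖D x y‖ₑ) p volume
            = eLpNorm (fun x => K y • D x y) p volume := by
          apply eLpNorm_congr_enorm_ae
          exact Eventually.of_forall fun x => by simp [enorm_mul]
        rw [h1]
        exact (eLpNorm_const_smul (K y) (fun x => D x y) p volume).le
      refine e.trans ?_
      simp only [Pi.mul_apply]
      rw [mul_assoc]
      gcongr
      exact h y
  calc eLpNorm F p volume ≤ eLpNorm (fun x => ∫⁻ y, ‖K y‖ₑ * ‖D x y‖ₑ) p volume := by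
        refine eLpNorm_mono_enorm fun x => ?_
        rw [hF x, enorm_eq_self]
        refine (enorm_integral_le_lintegral_enorm _).trans (lintegral_mono fun y => ?_)
        rw [enorm_mul]
    _ ≤ _ := key
    _ = _ := lintegral_mul_const _ (hK'.mul hw)

lemma op_eq (σ f : Space n → ℂ) (x : Space n) : op σ f x = ∫ y, 𝓕⁻ σ y * f (x - y) := by
  rw [op, cv, ← integral_sub_left_eq_self _ volume x]
  simp

lemma eLpNorm_op_le {M : ℝ} {p : ℝ≥0∞} (hp : 1 ≤ p) {σ f : Space n → ℂ} (hσ : Symb M σ)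
    (hf : AEStronglyMeasurable f volume) :
    eLpNorm (op σ f) p volume ≤ N1 σ * eLpNorm f p volume := by
  have := eLpNorm_kernel_le (A := eLpNorm f p volume) (w := fun _ => 1) hp hσ.decay.cont
    (D := fun x y => f (x - y)) (aestronglyMeasurable_sub_prod hf) measurable_const
    (fun y => by
      rw [one_mul]
      exact (eLpNorm_comp_measurePreserving hf (measurePreserving_sub_right volume y)).le)
    (op_eq σ f)
  simpa [N1] using this

lemma com_eq {M : ℝ} (hM : 0 ≤ M) {σ u f : Space n → ℂ} (hσ : Symb M σ) (hf : WInt M f)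
    (huf : WInt M fun y => u y * f y) (x : Space n) :
    com σ u f x = ∫ y, 𝓕⁻ σ y * ((u (x - y) - u x) * f (x - y)) := by
  have e : com σ u f x = ∫ y, 𝓕⁻ σ (x - y) * ((u y - u x) * f y) := by
    rw [com, op, op, cv, cv, ← integral_const_mul, ← integral_sub
      (hσ.decay.integrable_cv hM huf x) ((hσ.decay.integrable_cv hM hf x).const_mul _)]
    congr 1; ext y; ring
  rw [e, ← integral_sub_left_eq_self _ volume x]
  simp

/-- The basic commutator estimate: one derivative falls on `u` and one power of `|y|` on the
kernel. -/
lemma eLpNorm_com_le {M : ℝ} (hM : 0 ≤ M) {p q r A : ℝ≥0∞} [ENNReal.HolderTriple p q r]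
    (hr : 1 ≤ r) {σ u f : Space n → ℂ} (hσ : Symb M σ) (hf : WInt M f)
    (huf : WInt M fun y => u y * f y) (hu : AEStronglyMeasurable u volume) (hA : LipLp p A u) :
    eLpNorm (com σ u f) r volume ≤ N2 σ * A * eLpNorm f q volume := by
  have := eLpNorm_kernel_le (A := A * eLpNorm f q volume) (w := fun y => ‖y‖ₑ) hr hσ.decay.cont
    (D := fun x y => (u (x - y) - u x) * f (x - y)) (by
      exact ((aestronglyMeasurable_sub_prod hu).sub hu.comp_fst).mul
        (aestronglyMeasurable_sub_prod hf.meas)) continuous_enorm.measurable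
    (fun y => by
      have hs : AEStronglyMeasurable (fun x => f (x - y)) volume :=
        hf.meas.comp_measurePreserving (measurePreserving_sub_right volume y)
      have hs' : AEStronglyMeasurable (fun x => u (x - y) - u x) volume :=
        (hu.comp_measurePreserving (measurePreserving_sub_right volume y)).sub hu
      have h1 := eLpNorm_smul_le_mul_eLpNorm (p := p) (q := q) (r := r) hs hs'
      have h2 : eLpNorm (fun x => f (x - y)) q volume = eLpNorm f q volume :=
        eLpNorm_comp_measurePreserving hf.meas (measurePreserving_sub_right volume y)
      rw [h2] at h1
      refine h1.trans ?_
      rw [← mul_assoc]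
      gcongr
      exact hA y)
    (com_eq hM hσ hf huf)
  rw [mul_assoc]
  exact this

end RieszCommutator

namespace RieszCommutator

variable {n : ℕ}

/-! ### Powers of two -/

/-- The power `2^x` as an extended nonnegative real. -/
def pw (x : ℝ) : ℝ≥0∞ := ENNReal.ofReal (2 ^ x)

lemma pw_add (x y : ℝ) : pw (x + y) = pw x * pw y := by
  rw [pw, Real.rpow_add two_pos, ENNReal.ofReal_mul (by positivity)]; rfl

@[simp] lemma pw_zero : pw 0 = 1 := by simp [pw]

lemma pw_ne_top (x : ℝ) : pw x ≠ ⊤ := ENNReal.ofReal_ne_top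

lemma pw_pos (x : ℝ) : 0 < pw x := ENNReal.ofReal_pos.2 (by positivity)

lemma pw_mono {x y : ℝ} (h : x ≤ y) : pw x ≤ pw y :=
  ENNReal.ofReal_le_ofReal (Real.rpow_le_rpow_of_exponent_le one_le_two h)

lemma pw_neg_mul (x : ℝ) : pw (-x) * pw x = 1 := by rw [← pw_add]; simp

lemma pw_nat_mul (x : ℝ) (k : ℕ) : pw (k * x) = pw x ^ k := by
  rw [pw, mul_comm, Real.rpow_mul two_pos.le, Real.rpow_natCast, ENNReal.ofReal_pow (by positivity)]
  rfl

/-! ### Lipschitz bounds from gradients -/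

/-- A `C¹` function with gradient in `L^p` is Lipschitz as an `L^p`-valued function. -/
lemma lipLp_of_fderiv {p : ℝ≥0∞} (hp : 1 ≤ p) {u : Space n → ℂ} (hu : ContDiff ℝ 1 u) :
    LipLp p (eLpNorm (fderiv ℝ u) p volume) u := by
  intro h
  have hc : Continuous (fderiv ℝ u) := hu.continuous_fderiv one_ne_zero
  have hcG : Continuous (Function.uncurry fun (x : Space n) (t : ℝ) =>
      fderiv ℝ u (x - t • h)) :=
    hc.comp (continuous_fst.sub (continuous_snd.smul continuous_const))
  set ν : Measure ℝ := volume.restrict (Set.Ioc 0 1)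
  have hν : ν Set.univ = 1 := by simp [ν]
  have key := eLpNorm_lintegral_le (μ := (volume : Measure (Space n))) (ν := ν)
    (G := fun (x : Space n) (t : ℝ) => ‖fderiv ℝ u (x - t • h)‖ₑ * ‖h‖ₑ)
    (c := fun _ => ‖h‖ₑ * eLpNorm (fderiv ℝ u) p volume) (by
      exact (hcG.enorm.measurable.mul_const _).aemeasurable) measurable_const hp (fun t => by
      have h1 : eLpNorm (fun x => ‖fderiv ℝ u (x - t • h)‖ₑ * ‖h‖ₑ) p volume
          = eLpNorm (fun x => ‖h‖ • fderiv ℝ u (x - t • h)) p volume := by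
        apply eLpNorm_congr_enorm_ae
        exact Eventually.of_forall fun x => by simp [enorm_smul, mul_comm]
      rw [h1]
      refine (eLpNorm_const_smul (‖h‖) (fun x => fderiv ℝ u (x - t • h)) p volume).le.trans ?_
      rw [enorm_norm]
      gcongr
      exact (eLpNorm_comp_measurePreserving hc.aestronglyMeasurable
        (measurePreserving_sub_right volume (t • h))).le)
  rw [lintegral_const, hν, mul_one] at key
  refine le_trans (eLpNorm_mono_enorm fun x => ?_) key
  have hd : ∀ t : ℝ, HasDerivAt (fun t : ℝ => u (x - t • h)) (fderiv ℝ u (x - t • h) (-h)) t := by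
    intro t
    have h1 : HasDerivAt (fun t : ℝ => x - t • h) (-h) t := by
      simpa using ((hasDerivAt_id t).smul_const h).const_sub x
    exact ((hu.differentiable one_ne_zero) (x - t • h)).hasFDerivAt.comp_hasDerivAt t h1
  have hcont : Continuous fun t : ℝ => fderiv ℝ u (x - t • h) (-h) :=
    (hc.comp (continuous_const.sub (continuous_id.smul continuous_const))).clm_apply
      continuous_const
  have hi := intervalIntegral.integral_eq_sub_of_hasDerivAt (a := 0) (b := 1)
    (fun t _ => hd t) (hcont.intervalIntegrable 0 1)
  simp only [one_smul, zero_smul, sub_zero] at hi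
  rw [← hi, intervalIntegral.integral_of_le zero_le_one, enorm_eq_self]
  refine (enorm_integral_le_lintegral_enorm _).trans (lintegral_mono fun t => ?_)
  simpa using (fderiv ℝ u (x - t • h)).le_opENorm (-h)

lemma LipLp.mono {p A B : ℝ≥0∞} {u : Space n → ℂ} (h : LipLp p A u) (hAB : A ≤ B) :
    LipLp p B u := fun v => (h v).trans (by gcongr)

/-- A convolution is as smooth as its kernel. -/
lemma lipLp_op {M : ℝ} (hM : 0 ≤ M) {p B : ℝ≥0∞} (hp : 1 ≤ p) {σ f : Space n → ℂ} (hσ : Symb M σ)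
    (hB : LipLp 1 B (𝓕⁻ σ)) (hf : WInt M f) :
    LipLp p (B * eLpNorm f p volume) (op σ f) := by
  intro h
  have hcont : Continuous fun y => 𝓕⁻ σ (y - h) - 𝓕⁻ σ y :=
    (hσ.decay.cont.comp (continuous_id.sub continuous_const)).sub hσ.decay.cont
  have key := eLpNorm_kernel_le (A := eLpNorm f p volume) (w := fun _ => 1) hp hcont
    (D := fun x y => f (x - y)) (aestronglyMeasurable_sub_prod hf.meas) measurable_const
    (fun y => by
      rw [one_mul]
      exact (eLpNorm_comp_measurePreserving hf.meas (measurePreserving_sub_right volume y)).le)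
    (F := fun x => op σ f (x - h) - op σ f x) (fun x => by
      have e1 := integral_sub_left_eq_self
        (fun y => (𝓕⁻ σ (y - h) - 𝓕⁻ σ y) * f (x - y)) volume x
      rw [← e1, op, cv, cv, ← integral_sub (hσ.decay.integrable_cv hM hf _)
        (hσ.decay.integrable_cv hM hf _)]
      congr 1; ext y
      rw [sub_sub_cancel, sub_right_comm]; ring)
  refine key.trans ?_
  rw [← mul_assoc]
  gcongr
  simpa [eLpNorm_one_eq_lintegral_enorm] using hB h

/-! ### Dilations of symbols -/

lemma lintegral_comp_smul' (f : Space n → ℝ≥0∞) {l : ℝ} (hl : 0 < l) :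
    ∫⁻ x, f (l • x) = ENNReal.ofReal ((l ^ n)⁻¹) * ∫⁻ x, f x := by
  have h := lintegral_map_equiv f (Homeomorph.smulOfNeZero l hl.ne').toMeasurableEquiv
    (μ := (volume : Measure (Space n)))
  have e : Measure.map (⇑(Homeomorph.smulOfNeZero l hl.ne').toMeasurableEquiv)
      (volume : Measure (Space n)) = ENNReal.ofReal ((l ^ n)⁻¹) • volume := by
    have := Measure.map_addHaar_smul (volume : Measure (Space n)) hl.ne'
    simp only [finrank_euclideanSpace, Fintype.card_fin] at this
    rw [abs_of_pos (by positivity)] at this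
    exact this
  rw [e, lintegral_smul_measure] at h
  exact h.symm

lemma Decays.dilate {M : ℝ} (hM : 0 ≤ M) {K : Space n → ℂ} (hK : Decays M K) {l : ℝ} (hl : 0 < l)
    (c : ℂ) : Decays M (fun x => c * K (l • x)) := by
  obtain ⟨C, h0, hC⟩ := hK.bound'
  refine Decays.const_mul ⟨hK.cont.comp (continuous_const_smul l), C * (max 1 l⁻¹) ^ M,
    fun x => (hC _).trans ?_⟩ c
  rw [mul_assoc]
  refine mul_le_mul_of_nonneg_left ?_ h0
  unfold wt
  rw [Real.rpow_neg (by positivity), Real.rpow_neg (by positivity), ← div_eq_mul_inv,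
    le_div_iff₀ (by positivity), inv_mul_le_iff₀ (by positivity),
    ← Real.mul_rpow (by positivity) (by positivity)]
  refine Real.rpow_le_rpow (by positivity) ?_ hM
  rw [norm_smul, Real.norm_of_nonneg hl.le]
  have h1 : (1 : ℝ) ≤ max 1 l⁻¹ := le_max_left _ _
  have h2 : l⁻¹ ≤ max 1 l⁻¹ := le_max_right _ _
  have h3 : 1 ≤ l * max 1 l⁻¹ := by
    calc (1 : ℝ) = l * l⁻¹ := (mul_inv_cancel₀ hl.ne').symm
      _ ≤ _ := by gcongr
  nlinarith [norm_nonneg x]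

/-- The symbol `2^{kd} a(2^{-k} ξ)`. -/
def dil (d : ℝ) (a : Space n → ℂ) (k : ℕ) (ξ : Space n) : ℂ :=
  (((2 : ℝ) ^ (k * d) : ℝ) : ℂ) * a (((2 : ℝ) ^ k)⁻¹ • ξ)

lemma dil_ker (d : ℝ) (a : Space n → ℂ) (k : ℕ) :
    𝓕⁻ (dil d a k) = fun x => ((((2 : ℝ) ^ (k * d) : ℝ) : ℂ) * (((2 : ℝ) ^ k) ^ n : ℝ)) *
      𝓕⁻ a (((2 : ℝ) ^ k) • x) := by
  have h := fourierInv_comp_smul a (l := (2 : ℝ) ^ k) (by positivity)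
  unfold dil
  rw [fourierInv_const_mul, h]
  ext x
  ring

lemma Symb.dil {M : ℝ} (hM : 0 ≤ M) {a : Space n → ℂ} (ha : Symb M a) (d : ℝ) (k : ℕ) :
    Symb M (dil d a k) := by
  refine ⟨continuous_const.mul (ha.cont.comp (continuous_const_smul _)), ?_, ?_⟩
  · exact (ha.integ.comp_smul (by positivity : ((2 : ℝ) ^ k)⁻¹ ≠ 0)).const_mul _
  · rw [dil_ker]
    exact ha.decay.dilate hM (by positivity) _

lemma enorm_dil_ker (d : ℝ) (a : Space n → ℂ) (k : ℕ) (x : Space n) :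
    ‖𝓕⁻ (dil d a k) x‖ₑ
      = pw (k * d) * ENNReal.ofReal (((2 : ℝ) ^ k) ^ n) * ‖𝓕⁻ a (((2 : ℝ) ^ k) • x)‖ₑ := by
  rw [dil_ker]
  simp only [enorm_mul, pw]
  congr 2
  · rw [← ofReal_norm, Complex.norm_real, Real.norm_of_nonneg (by positivity)]
  · rw [← ofReal_norm, Complex.norm_real, Real.norm_of_nonneg (by positivity)]

lemma ofReal_mul_inv {a : ℝ} (ha : 0 < a) : ENNReal.ofReal a * ENNReal.ofReal a⁻¹ = 1 := by
  rw [← ENNReal.ofReal_mul ha.le, mul_inv_cancel₀ ha.ne', ENNReal.ofReal_one]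

lemma N1_dil (d : ℝ) (a : Space n → ℂ) (k : ℕ) : N1 (dil d a k) = pw (k * d) * N1 a := by
  have h2 : (0 : ℝ) < (2 : ℝ) ^ k := by positivity
  simp only [N1, enorm_dil_ker]
  rw [lintegral_const_mul' _ _ (ENNReal.mul_ne_top (pw_ne_top _) ENNReal.ofReal_ne_top),
    lintegral_comp_smul' (fun x => ‖𝓕⁻ a x‖ₑ) h2, mul_assoc, ← mul_assoc (ENNReal.ofReal _),
    ofReal_mul_inv (by positivity), one_mul]

lemma N2_dil (d : ℝ) (a : Space n → ℂ) (k : ℕ) :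
    N2 (dil d a k) = pw (k * (d - 1)) * N2 a := by
  have h2 : (0 : ℝ) < (2 : ℝ) ^ k := by positivity
  have e : ∀ x : Space n, ‖x‖ₑ = ENNReal.ofReal ((2 ^ k)⁻¹) * ‖((2 : ℝ) ^ k) • x‖ₑ := by
    intro x
    rw [enorm_smul, ← mul_assoc, ← ofReal_norm ((2 : ℝ) ^ k), Real.norm_of_nonneg h2.le,
      mul_comm (ENNReal.ofReal _), ofReal_mul_inv h2, one_mul]
  have e2 : pw (k * (d - 1)) = pw (k * d) * ENNReal.ofReal ((2 ^ k)⁻¹) := by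
    rw [mul_sub, mul_one, sub_eq_add_neg, pw_add]
    congr 1
    rw [pw, Real.rpow_neg two_pos.le, Real.rpow_natCast]
  simp only [N2, enorm_dil_ker]
  have : ∀ x : Space n, pw (k * d) * ENNReal.ofReal (((2 : ℝ) ^ k) ^ n) *
      ‖𝓕⁻ a (((2 : ℝ) ^ k) • x)‖ₑ * ‖x‖ₑ
      = pw (k * d) * ENNReal.ofReal (((2 : ℝ) ^ k) ^ n) * ENNReal.ofReal ((2 ^ k)⁻¹) *
        (‖𝓕⁻ a (((2 : ℝ) ^ k) • x)‖ₑ * ‖((2 : ℝ) ^ k) • x‖ₑ) := fun x => by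
    conv_lhs => rw [e x]
    ring
  simp only [this]
  rw [lintegral_const_mul' _ _ (ENNReal.mul_ne_top (ENNReal.mul_ne_top (pw_ne_top _)
    ENNReal.ofReal_ne_top) ENNReal.ofReal_ne_top),
    lintegral_comp_smul' (fun x => ‖𝓕⁻ a x‖ₑ * ‖x‖ₑ) h2, e2]
  have h3 := ofReal_mul_inv (a := ((2 : ℝ) ^ k) ^ n) (by positivity)
  calc _ = pw (k * d) * ENNReal.ofReal ((2 ^ k)⁻¹) * (ENNReal.ofReal (((2 : ℝ) ^ k) ^ n) *
        ENNReal.ofReal ((((2 : ℝ) ^ k) ^ n)⁻¹)) * ∫⁻ x, ‖𝓕⁻ a x‖ₑ * ‖x‖ₑ := by ring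
    _ = _ := by rw [h3, mul_one]

lemma lipLp_dil {B : ℝ≥0∞} (d : ℝ) {a : Space n → ℂ} (hB : LipLp 1 B (𝓕⁻ a)) (k : ℕ) :
    LipLp 1 (pw (k * (d + 1)) * B) (𝓕⁻ (dil d a k)) := by
  have h2 : (0 : ℝ) < (2 : ℝ) ^ k := by positivity
  intro v
  have h := hB (((2 : ℝ) ^ k) • v)
  rw [eLpNorm_one_eq_lintegral_enorm] at h ⊢
  have e2 : pw (k * (d + 1)) = pw (k * d) * ENNReal.ofReal (2 ^ k) := by
    rw [mul_add, mul_one, pw_add]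
    congr 1
    rw [pw, Real.rpow_natCast]
  have e : ∀ x, ‖𝓕⁻ (dil d a k) (x - v) - 𝓕⁻ (dil d a k) x‖ₑ
      = pw (k * d) * ENNReal.ofReal (((2 : ℝ) ^ k) ^ n) *
        ‖𝓕⁻ a (((2 : ℝ) ^ k) • x - ((2 : ℝ) ^ k) • v) - 𝓕⁻ a (((2 : ℝ) ^ k) • x)‖ₑ := by
    intro x
    rw [dil_ker]
    simp only [← mul_sub, enorm_mul, smul_sub, pw]
    congr 2
    · rw [← ofReal_norm, Complex.norm_real, Real.norm_of_nonneg (by positivity)]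
    · rw [← ofReal_norm, Complex.norm_real, Real.norm_of_nonneg (by positivity)]
  simp only [e]
  rw [lintegral_const_mul' _ _ (ENNReal.mul_ne_top (pw_ne_top _) ENNReal.ofReal_ne_top),
    lintegral_comp_smul' (fun x => ‖𝓕⁻ a (x - ((2 : ℝ) ^ k) • v) - 𝓕⁻ a x‖ₑ) h2, mul_assoc,
    ← mul_assoc (ENNReal.ofReal _), ofReal_mul_inv (by positivity), one_mul, e2]
  have hn : ‖((2 : ℝ) ^ k) • v‖ₑ = ENNReal.ofReal (2 ^ k) * ‖v‖ₑ := by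
    rw [enorm_smul, ← ofReal_norm ((2 : ℝ) ^ k), Real.norm_of_nonneg h2.le]
  rw [hn] at h
  calc _ ≤ pw (k * d) * (ENNReal.ofReal (2 ^ k) * ‖v‖ₑ * B) := by gcongr
    _ = _ := by ring

lemma N1_lt_top {M : ℝ} (hn : n < M) {σ : Space n → ℂ} (hσ : Symb M σ) : N1 σ < ⊤ :=
  (hσ.decay.integrable hn).2

lemma N2_lt_top {M : ℝ} (hn : n + 1 < M) {σ : Space n → ℂ} (hσ : Symb M σ) : N2 σ < ⊤ := by
  obtain ⟨C, h0, hC⟩ := hσ.decay.bound'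
  have hi : Integrable (fun y : Space n => 𝓕⁻ σ y * (‖y‖ : ℂ)) := by
    refine ((wt_integrable (n := n) (M := M - 1) (by linarith)).const_mul C).mono'
      (hσ.decay.cont.mul (Complex.continuous_ofReal.comp continuous_norm)).aestronglyMeasurable
      (Eventually.of_forall fun y => ?_)
    have e : wt (M - 1) y = wt M y * (1 + ‖y‖) := by
      rw [sub_eq_add_neg, wt_add]; simp [wt]
    rw [norm_mul, Complex.norm_real, norm_norm, e, ← mul_assoc]
    exact mul_le_mul (hC y) (by linarith) (norm_nonneg _)
      (mul_nonneg h0 (wt_pos M y).le)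
  have := hi.2
  simp only [HasFiniteIntegral, enorm_mul] at this
  refine lt_of_le_of_lt (lintegral_mono fun y => ?_) this
  gcongr
  rw [← ofReal_norm, ← ofReal_norm, Complex.norm_real, norm_norm]

/-- Smooth compactly supported symbols have integrable Lipschitz kernels. -/
lemma exists_lipLp_of_smooth {a : Space n → ℂ} (h : ContDiff ℝ ∞ a) (hc : HasCompactSupport a) :
    ∃ B : ℝ≥0∞, B ≠ ⊤ ∧ LipLp 1 B (𝓕⁻ a) := by
  set K : 𝓢(Space n, ℂ) := 𝓕⁻ (hc.toSchwartzMap h) with hK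
  have hKe : (K : Space n → ℂ) = 𝓕⁻ a := by rw [hK, SchwartzMap.fourierInv_coe]; rfl
  refine ⟨eLpNorm (fderiv ℝ K) 1 volume, ?_, ?_⟩
  · have := (SchwartzMap.fderivCLM ℝ (Space n) ℂ K).eLpNorm_lt_top 1 (volume : Measure (Space n))
    exact this.ne
  · rw [← hKe]
    exact lipLp_of_fderiv le_rfl (K.smooth 1)

/-! ### Two-sided geometric series -/

/-- The sum of the two-sided geometric series with ratio `2^{-ε}`. -/
def geo (ε : ℝ) : ℝ≥0∞ := ∑' z : ℤ, pw (-ε * |(z : ℝ)|)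

lemma geo_lt_top {ε : ℝ} (hε : 0 < ε) : geo ε < ⊤ := by
  have hs : ∑' k : ℕ, pw (-ε * k) < ⊤ := by
    have h1 : ∀ k : ℕ, pw (-ε * k) = pw (-ε) ^ k := fun k => by rw [mul_comm, pw_nat_mul]
    simp only [h1]
    rw [ENNReal.tsum_geometric]
    refine ENNReal.inv_lt_top.2 (tsub_pos_of_lt ?_)
    rw [pw, ENNReal.ofReal_lt_one]
    exact Real.rpow_lt_one_of_one_lt_of_neg one_lt_two (by linarith)
  have h := tsum_of_nat_of_neg_add_one (f := fun z : ℤ => pw (-ε * |(z : ℝ)|))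
    ENNReal.summable ENNReal.summable
  rw [geo, h]
  refine ENNReal.add_lt_top.2 ⟨by simpa using hs, lt_of_le_of_lt (ENNReal.tsum_le_tsum fun k => ?_)
      hs⟩
  refine pw_mono ?_
  have : |((-((k : ℤ) + 1) : ℤ) : ℝ)| = k + 1 := by
    push_cast
    rw [abs_of_nonpos (by linarith [(Nat.cast_nonneg k : (0 : ℝ) ≤ k)])]
    ring
  rw [this]
  nlinarith

lemma tsum_geo_le (ε : ℝ) (j : ℝ) (hj : ∃ z : ℤ, j = z) :
    ∑' q : ℕ, pw (-ε * |j - q|) ≤ geo ε := by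
  obtain ⟨z, rfl⟩ := hj
  have := ENNReal.tsum_comp_le_tsum_of_injective (f := fun q : ℕ => z - (q : ℤ))
    (fun a b h => by simpa using h) (fun z : ℤ => pw (-ε * |(z : ℝ)|))
  simpa [geo] using this

/-! ### Homogeneous functions -/

/-- Functions that are smooth away from the origin and positively homogeneous of degree `d`. -/
structure Homog (d : ℝ) (h : Space n → ℂ) : Prop where
  smooth : ContDiffOn ℝ ∞ h {0}ᶜ
  homog : ∀ l : ℝ, 0 < l → ∀ ξ, h (l • ξ) = ((l ^ d : ℝ) : ℂ) * h ξ

lemma Homog.mul {d e : ℝ} {g h : Space n → ℂ} (hg : Homog d g) (hh : Homog e h) :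
    Homog (d + e) (fun ξ => g ξ * h ξ) :=
  ⟨hg.smooth.mul hh.smooth, fun l hl ξ => by
    rw [hg.homog l hl, hh.homog l hl, Real.rpow_add hl, Complex.ofReal_mul]; ring⟩

lemma Homog.const_mul {d : ℝ} {g : Space n → ℂ} (hg : Homog d g) (c : ℂ) :
    Homog d (fun ξ => c * g ξ) :=
  ⟨contDiffOn_const.mul hg.smooth, fun l hl ξ => by rw [hg.homog l hl]; ring⟩

lemma Homog.one : Homog 0 (fun _ : Space n => (1 : ℂ)) := ⟨contDiffOn_const, by simp⟩

lemma Homog.coord (i : Fin n) : Homog 1 (fun ξ : Space n => (ξ i : ℂ)) := by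
  refine ⟨?_, fun l _ ξ => by simp⟩
  have : ContDiff ℝ ∞ (fun ξ : Space n => (ξ i : ℂ)) :=
    Complex.ofRealCLM.contDiff.comp (EuclideanSpace.proj (𝕜 := ℝ) i).contDiff
  exact this.contDiffOn

lemma Homog.norm_rpow (a : ℝ) :
    Homog a (fun ξ : Space n => (((2 * Real.pi * ‖ξ‖) ^ a : ℝ) : ℂ)) := by
  refine ⟨?_, fun l hl ξ => ?_⟩
  · refine Complex.ofRealCLM.contDiff.comp_contDiffOn ?_
    intro ξ hξ
    have h1 : ContDiffAt ℝ ∞ (fun ξ : Space n => 2 * Real.pi * ‖ξ‖) ξ :=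
      contDiffAt_const.mul (contDiffAt_norm ℝ hξ)
    exact (h1.rpow_const_of_ne (by
      have := norm_pos_iff.2 hξ
      positivity)).contDiffWithinAt
  · rw [← Complex.ofReal_mul, ← Real.mul_rpow hl.le (by positivity), norm_smul,
      Real.norm_of_nonneg hl.le]
    congr 2; ring

lemma Homog.apply_zero {d : ℝ} (hd : d ≠ 0) {h : Space n → ℂ} (hh : Homog d h) : h 0 = 0 := by
  have := hh.homog 2 two_pos 0
  rw [smul_zero] at this
  have h2 : (1 - (((2 : ℝ) ^ d : ℝ) : ℂ)) * h 0 = 0 := by rw [sub_mul, ← this]; ring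
  rcases mul_eq_zero.1 h2 with h3 | h3
  · exfalso
    have h4 : (2 : ℝ) ^ d = 1 := by
      have := (sub_eq_zero.1 h3).symm
      exact_mod_cast this
    have h5 := congrArg Real.log h4
    rw [Real.log_rpow two_pos, Real.log_one] at h5
    exact hd ((mul_eq_zero.1 h5).resolve_right (Real.log_pos one_lt_two).ne')
  · exact h3

/-- Smooth compactly supported functions vanishing near the origin. -/
structure Shell (Ψ : Space n → ℂ) : Prop where
  smooth : ContDiff ℝ ∞ Ψ
  compact : HasCompactSupport Ψ
  zero : ∃ r : ℝ, 0 < r ∧ ∀ ξ, ‖ξ‖ < r → Ψ ξ = 0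

lemma Shell.mul {Ψ : Space n → ℂ} (hΨ : Shell Ψ) {d : ℝ} {h : Space n → ℂ} (hh : Homog d h) :
    Shell (fun ξ => Ψ ξ * h ξ) := by
  refine ⟨?_, hΨ.compact.mul_right, ?_⟩
  · obtain ⟨r, hr, h0⟩ := hΨ.zero
    rw [contDiff_iff_contDiffAt]
    intro ξ
    by_cases hξ : ξ = 0
    · have : (fun ξ => Ψ ξ * h ξ) =ᶠ[𝓝 ξ] fun _ => 0 := by
        filter_upwards [Metric.ball_mem_nhds ξ hr] with η hη
        rw [hξ, mem_ball_zero_iff] at hη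
        simp [h0 η hη]
      exact contDiffAt_const.congr_of_eventuallyEq this
    · exact hΨ.smooth.contDiffAt.mul
        ((hh.smooth ξ hξ).contDiffAt (isOpen_compl_singleton.mem_nhds hξ))
  · obtain ⟨r, hr, h0⟩ := hΨ.zero
    exact ⟨r, hr, fun ξ hξ => by simp [h0 ξ hξ]⟩

/-- The dyadic dilations of a shell function times a homogeneous symbol of degree `d` have kernels
with the sizes dictated by scaling. -/
lemma Shell.kernel_bounds {Ψ : Space n → ℂ} (hΨ : Shell Ψ) {d : ℝ} {h : Space n → ℂ}
    (hh : Homog d h) : ∃ C : ℝ≥0∞, C ≠ ⊤ ∧ ∀ k : ℕ,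
      N1 (dil d (fun ξ => Ψ ξ * h ξ) k) ≤ C * pw (k * d) ∧
      N2 (dil d (fun ξ => Ψ ξ * h ξ) k) ≤ C * pw (k * (d - 1)) ∧
      LipLp 1 (C * pw (k * (d + 1))) (𝓕⁻ (dil d (fun ξ => Ψ ξ * h ξ) k)) := by
  have hs := hΨ.mul hh
  obtain ⟨B, hB, hL⟩ := exists_lipLp_of_smooth hs.smooth hs.compact
  have hS : ∀ M, Symb M (fun ξ => Ψ ξ * h ξ) := fun M => Symb.of_smooth M hs.smooth hs.compact
  set a := fun ξ => Ψ ξ * h ξ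
  have h1 : N1 a < ⊤ := N1_lt_top (M := n + 1) (by linarith) (hS _)
  have h2 : N2 a < ⊤ := N2_lt_top (M := n + 2) (by linarith) (hS _)
  refine ⟨N1 a + N2 a + B, by simp [h1.ne, h2.ne, hB], fun k => ⟨?_, ?_, ?_⟩⟩
  · rw [N1_dil, mul_comm]
    gcongr
    rw [add_assoc]; exact le_self_add
  · rw [N2_dil, mul_comm]
    gcongr
    exact le_add_right le_add_self
  · refine (lipLp_dil d hL k).mono ?_
    rw [mul_comm]
    gcongr
    exact le_add_self

lemma dil_eq {Ψ : Space n → ℂ} {d : ℝ} {h : Space n → ℂ} (hh : Homog d h) (k : ℕ) (ξ : Space n) :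
    dil d (fun ξ => Ψ ξ * h ξ) k ξ = Ψ (((2 : ℝ) ^ k)⁻¹ • ξ) * h ξ := by
  have h2 : (0 : ℝ) < 2 ^ k := by positivity
  have e : h ξ = ((((2 : ℝ) ^ k) ^ d : ℝ) : ℂ) * h (((2 : ℝ) ^ k)⁻¹ • ξ) := by
    rw [← hh.homog _ h2, smul_smul, mul_inv_cancel₀ h2.ne', one_smul]
  rw [dil, e, ← Real.rpow_natCast, ← Real.rpow_mul two_pos.le]
  ring

end RieszCommutator

/-! ### The dyadic partition -/

namespace DyadicPartition

open RieszCommutator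

variable {n : ℕ} (P : DyadicPartition n)

/-- The low frequency cutoff in Mathlib's frequency variable. -/
def low (ξ : Space n) : ℂ := (P.χ ((2 * Real.pi) • ξ) : ℂ)

/-- The shell function in Mathlib's frequency variable. -/
def shell (ξ : Space n) : ℂ := (P.φ ((2 * Real.pi) • ξ) : ℂ)

/-- A low frequency cutoff equal to one on the support of `low`. -/
def lowT (ξ : Space n) : ℂ := P.low ((2 : ℝ)⁻¹ • ξ)

/-- A shell function equal to one on the support of `shell`. -/
def shellT (ξ : Space n) : ℂ :=
  P.shell ((2 : ℝ) • ξ) + P.shell ξ + P.shell ((2 : ℝ)⁻¹ • ξ)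

/-- Symbols equal to one on the supports of those of the blocks. -/
def symT : ℕ → Space n → ℂ
  | 0 => P.lowT
  | k + 1 => fun ξ => P.shellT (((2 : ℝ) ^ k)⁻¹ • ξ)

/-- The low frequency cutoff at the scale `2^k`. -/
def cut (k : ℕ) (ξ : Space n) : ℂ := P.low (((2 : ℝ) ^ k)⁻¹ • ξ)

lemma symbol_zero : P.symbol 0 = P.low := rfl

lemma symbol_succ (k : ℕ) (ξ : Space n) :
    P.symbol (k + 1) ξ = P.shell (((2 : ℝ) ^ k)⁻¹ • ξ) := by
  rw [shell, smul_comm]; rfl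

lemma norm_two_pi_smul (ξ : Space n) : ‖(2 * Real.pi) • ξ‖ = 2 * Real.pi * ‖ξ‖ := by
  rw [norm_smul, Real.norm_of_nonneg (by positivity)]

lemma low_support {ξ : Space n} (h : P.low ξ ≠ 0) : 2 * Real.pi * ‖ξ‖ ≤ 4 / 3 := by
  rw [← norm_two_pi_smul]
  exact P.χ_support _ (by simpa [low] using h)

lemma shell_support {ξ : Space n} (h : P.shell ξ ≠ 0) :
    3 / 4 ≤ 2 * Real.pi * ‖ξ‖ ∧ 2 * Real.pi * ‖ξ‖ ≤ 8 / 3 := by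
  rw [← norm_two_pi_smul]
  exact P.φ_support _ (by simpa [shell] using h)

lemma compact_of_bound {f : Space n → ℂ} {R : ℝ} (h : ∀ ξ, f ξ ≠ 0 → 2 * Real.pi * ‖ξ‖ ≤ R) :
    HasCompactSupport f := by
  refine HasCompactSupport.of_support_subset_isCompact (isCompact_closedBall 0 (R / (2 * Real.pi)))
    fun ξ hξ => ?_
  rw [mem_closedBall_zero_iff, le_div_iff₀ (by positivity), mul_comm]
  exact h ξ hξ

lemma low_smooth : ContDiff ℝ ∞ P.low :=
  Complex.ofRealCLM.contDiff.comp (P.χ_smooth.comp (contDiff_const_smul _))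

lemma low_compact : HasCompactSupport P.low := compact_of_bound fun _ => P.low_support

lemma shell_smooth : ContDiff ℝ ∞ P.shell :=
  Complex.ofRealCLM.contDiff.comp (P.φ_smooth.comp (contDiff_const_smul _))

lemma shell_shell : Shell P.shell := by
  refine ⟨P.shell_smooth, compact_of_bound fun _ h => (P.shell_support h).2,
    3 / 4 / (2 * Real.pi), by positivity, fun ξ hξ => ?_⟩
  by_contra h
  rw [lt_div_iff₀ (by positivity), mul_comm] at hξ
  linarith [(P.shell_support h).1]

lemma shellT_support {ξ : Space n} (h : P.shellT ξ ≠ 0) :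
    3 / 8 ≤ 2 * Real.pi * ‖ξ‖ ∧ 2 * Real.pi * ‖ξ‖ ≤ 16 / 3 := by
  have h3 : P.shell ((2 : ℝ) • ξ) ≠ 0 ∨ P.shell ξ ≠ 0 ∨ P.shell ((2 : ℝ)⁻¹ • ξ) ≠ 0 := by
    by_contra hc
    push Not at hc
    exact h (by simp [shellT, hc.1, hc.2.1, hc.2.2])
  rcases h3 with h | h | h
  all_goals
    have h1 := P.shell_support h
    try simp only [norm_smul, Real.norm_eq_abs, abs_inv, abs_two] at h1
    constructor <;> linarith [h1.1, h1.2]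

lemma shell_shellT : Shell P.shellT := by
  refine ⟨?_, compact_of_bound fun _ h => (P.shellT_support h).2,
    3 / 8 / (2 * Real.pi), by positivity, fun ξ hξ => ?_⟩
  · exact ((P.shell_smooth.comp (contDiff_const_smul _)).add P.shell_smooth).add
      (P.shell_smooth.comp (contDiff_const_smul _))
  · by_contra h
    rw [lt_div_iff₀ (by positivity), mul_comm] at hξ
    linarith [(P.shellT_support h).1]

/-- Partial sums of the partition of unity. -/
lemma sum_symbol (K : ℕ) (ξ : Space n) :
    ∑ k ∈ Finset.range (K + 1), P.symbol k ξ = P.cut K ξ := by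
  have h1 := P.sum_inhomogeneous ((2 * Real.pi) • ξ)
  have h2 := P.sum_inhomogeneous (((2 : ℝ) ^ K)⁻¹ • (2 * Real.pi) • ξ)
  have e : ∀ q : ℕ, ((2 : ℝ) ^ q)⁻¹ • ((2 : ℝ) ^ K)⁻¹ • (2 * Real.pi) • ξ
      = ((2 : ℝ) ^ (q + K))⁻¹ • (2 * Real.pi) • ξ := fun q => by
    rw [smul_smul, ← mul_inv, ← pow_add]
  simp only [e] at h2
  have h3 := h1.summable.sum_add_tsum_nat_add K
  rw [h1.tsum_eq, h2.tsum_eq] at h3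
  rw [Finset.sum_range_succ', cut, low, symbol_zero, low]
  simp only [symbol]
  rw [smul_comm (2 * Real.pi) (((2 : ℝ) ^ K)⁻¹) ξ, ← Complex.ofReal_sum, ← Complex.ofReal_add]
  congr 1
  linarith

lemma lowT_eq (ξ : Space n) : P.lowT ξ = P.low ξ + P.shell ξ := by
  have := P.sum_symbol 1 ξ
  simp only [Finset.sum_range_succ, Finset.sum_range_zero, zero_add, symbol_succ, symbol_zero,
    pow_zero, inv_one, one_smul, cut, pow_one] at this
  rw [lowT, this]

lemma low_eq_one {ξ : Space n} (h : 2 * Real.pi * ‖ξ‖ < 3 / 4) : P.low ξ = 1 := by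
  have h1 := P.sum_inhomogeneous ((2 * Real.pi) • ξ)
  have h0 : (fun q : ℕ => P.φ (((2 : ℝ) ^ q)⁻¹ • (2 * Real.pi) • ξ)) = fun _ => 0 := by
    ext q
    by_contra hq
    have := (P.φ_support _ hq).1
    rw [norm_smul, norm_two_pi_smul, Real.norm_of_nonneg (by positivity)] at this
    have h2 : ((2 : ℝ) ^ q)⁻¹ ≤ 1 := inv_le_one_of_one_le₀ (one_le_pow₀ one_le_two)
    nlinarith [norm_nonneg ξ, Real.pi_pos, mul_nonneg (mul_pos two_pos Real.pi_pos).le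
      (norm_nonneg ξ)]
  rw [h0] at h1
  have := h1.unique hasSum_zero
  have h2 : P.χ ((2 * Real.pi) • ξ) = 1 := by linarith
  simp [low, h2]

lemma shellT_eq_one {ξ : Space n} (h : P.shell ξ ≠ 0) : P.shellT ξ = 1 := by
  obtain ⟨h1, h2⟩ := P.shell_support h
  have hξ : (2 * Real.pi) • ξ ≠ 0 := by
    intro h0
    rw [← norm_two_pi_smul, h0, norm_zero] at h1
    linarith
  have hs := P.sum_homogeneous _ hξ
  have hf : ∀ q ∉ ({-1, 0, 1} : Finset ℤ), P.φ (((2 : ℝ) ^ q)⁻¹ • (2 * Real.pi) • ξ) = 0 := by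
    intro q hq
    by_contra hne
    have h3 := P.φ_support _ hne
    rw [norm_smul, norm_two_pi_smul, Real.norm_of_nonneg (by positivity)] at h3
    simp only [Finset.mem_insert, Finset.mem_singleton, not_or] at hq
    rcases le_or_gt 2 q with hq2 | hq2
    · have : (2 : ℝ) ^ (2 : ℤ) ≤ (2 : ℝ) ^ q := zpow_le_zpow_right₀ one_le_two hq2
      have h4 : ((2 : ℝ) ^ q)⁻¹ ≤ 1 / 4 := by
        rw [inv_le_comm₀ (by positivity) (by norm_num)]
        norm_num at this ⊢; exact this
      nlinarith [h3.1]
    · have hq3 : q ≤ -2 := by omega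
      have : (2 : ℝ) ^ q ≤ (2 : ℝ) ^ (-2 : ℤ) := zpow_le_zpow_right₀ one_le_two hq3
      have h4 : 4 ≤ ((2 : ℝ) ^ q)⁻¹ := by
        rw [le_inv_comm₀ (by norm_num) (by positivity)]
        refine this.trans (by norm_num)
      nlinarith [h3.2]
  have h5 := (hasSum_sum_of_ne_finset_zero hf).unique hs
  rw [Finset.sum_insert (by decide), Finset.sum_insert (by decide), Finset.sum_singleton,
    zpow_neg_one, inv_inv, zpow_zero, inv_one, one_smul, zpow_one] at h5
  rw [shellT, shell, shell, shell, ← Complex.ofReal_add, ← Complex.ofReal_add,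
    smul_comm _ (2 : ℝ), smul_comm _ (2 : ℝ)⁻¹, add_assoc, h5, Complex.ofReal_one]

lemma symbol_mul_symT (k : ℕ) (ξ : Space n) : P.symbol k ξ * P.symT k ξ = P.symbol k ξ := by
  by_cases h : P.symbol k ξ = 0
  · simp [h]
  cases k with
  | zero =>
    rw [symbol_zero] at h ⊢
    have h1 := P.low_support h
    have h2 : P.symT 0 ξ = 1 := by
      refine P.low_eq_one ?_
      rw [norm_smul, Real.norm_of_nonneg (by norm_num)]
      linarith
    rw [h2, mul_one]
  | succ k =>
    rw [symbol_succ] at h ⊢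
    have h2 : P.symT (k + 1) ξ = 1 := P.shellT_eq_one h
    rw [h2, mul_one]

lemma symbol_support {k : ℕ} {ξ : Space n} (h : P.symbol k ξ ≠ 0) :
    2 * Real.pi * ‖ξ‖ ≤ 4 / 3 * 2 ^ k := by
  cases k with
  | zero => simpa using P.low_support h
  | succ k =>
    rw [symbol_succ] at h
    have := (P.shell_support h).2
    rw [norm_smul, Real.norm_of_nonneg (by positivity), ← mul_assoc, mul_comm _ ((2 : ℝ) ^ k)⁻¹,
      mul_assoc, inv_mul_le_iff₀ (by positivity)] at this
    rw [pow_succ]; linarith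

lemma symT_support {k : ℕ} {ξ : Space n} (h : P.symT k ξ ≠ 0) :
    2 * Real.pi * ‖ξ‖ ≤ 8 / 3 * 2 ^ k ∧ (k ≠ 0 → 3 / 16 * 2 ^ k ≤ 2 * Real.pi * ‖ξ‖) := by
  cases k with
  | zero =>
    have := P.low_support (ξ := (2 : ℝ)⁻¹ • ξ) h
    rw [norm_smul, Real.norm_of_nonneg (by norm_num)] at this
    refine ⟨by linarith, by simp⟩
  | succ k =>
    have := P.shellT_support (ξ := ((2 : ℝ) ^ k)⁻¹ • ξ) h
    rw [norm_smul, Real.norm_of_nonneg (by positivity), ← mul_assoc, mul_comm _ ((2 : ℝ) ^ k)⁻¹,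
      mul_assoc, inv_mul_le_iff₀ (by positivity), le_inv_mul_iff₀ (by positivity)] at this
    rw [pow_succ]
    exact ⟨by linarith [this.2], fun _ => by linarith [this.1]⟩

/-- Blocks that are far apart annihilate each other. -/
lemma symbol_mul_symT_eq_zero {j q : ℕ} (h : j + 3 ≤ q) (ξ : Space n) :
    P.symbol j ξ * P.symT q ξ = 0 := by
  by_contra hne
  have h1 := P.symbol_support (left_ne_zero_of_mul hne)
  have h2 := (P.symT_support (right_ne_zero_of_mul hne)).2 (by omega)
  have h3 : (2 : ℝ) ^ (j + 3) ≤ 2 ^ q := pow_le_pow_right₀ one_le_two h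
  rw [pow_add] at h3
  have : (0 : ℝ) < 2 ^ j := by positivity
  linarith

lemma low_neg (ξ : Space n) : P.low (-ξ) = P.low ξ := by
  simp only [low]; congr 1; exact P.χ_radial _ _ (by simp)

lemma shell_neg (ξ : Space n) : P.shell (-ξ) = P.shell ξ := by
  simp only [shell]; congr 1; exact P.φ_radial _ _ (by simp)

lemma symbol_neg (k : ℕ) (ξ : Space n) : P.symbol k (-ξ) = P.symbol k ξ := by
  cases k with
  | zero => exact P.low_neg ξ
  | succ k => rw [symbol_succ, symbol_succ, smul_neg, shell_neg]

lemma symT_neg (k : ℕ) (ξ : Space n) : P.symT k (-ξ) = P.symT k ξ := by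
  cases k with
  | zero => simp only [symT, lowT, smul_neg, low_neg]
  | succ k => simp only [symT, shellT, smul_neg, shell_neg]

lemma cut_neg (k : ℕ) (ξ : Space n) : P.cut k (-ξ) = P.cut k ξ := by
  simp only [cut, smul_neg, low_neg]

end DyadicPartition

namespace RieszCommutator

variable {n : ℕ}

/-! ### Low frequency parts of homogeneous symbols -/

lemma tsum_geo_real_le {ε : ℝ} (hε : 0 ≤ ε) (L : ℝ) :
    ∑' q : ℕ, pw (-ε * |L - (q + 1)|) ≤ pw ε * geo ε := by
  have h := tsum_geo_le ε ((⌊L⌋ - 1 : ℤ) : ℝ) ⟨_, rfl⟩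
  refine le_trans ?_ (mul_le_mul_right h _)
  rw [← ENNReal.tsum_mul_left]
  refine ENNReal.tsum_le_tsum fun q => ?_
  rw [← pw_add]
  refine pw_mono ?_
  have h1 := Int.floor_le L
  have h2 := Int.lt_floor_add_one L
  have h3 : |((⌊L⌋ - 1 : ℤ) : ℝ) - q| ≤ |L - (q + 1)| + 1 := by
    push_cast
    have h4 : ((⌊L⌋ : ℝ) - 1) - q = (L - (q + 1)) + (⌊L⌋ - L) := by ring
    rw [h4]
    refine (abs_add_le _ _).trans ?_
    gcongr
    rw [abs_le]; constructor <;> linarith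
  nlinarith

/-- The scales of a low frequency symbol sum up to the decay dictated by the homogeneity. -/
lemma dyadic_decay {N : ℝ} (hN : 0 < N) (x : Space n) (q : ℕ) :
    (((2 : ℝ) ^ (q + 1))⁻¹) ^ N * wt (N + 1) ((((2 : ℝ) ^ (q + 1))⁻¹) • x)
      ≤ wt N x * 2 ^ (-(min N 1) * |Real.logb 2 (1 + ‖x‖) - (q + 1)|) := by
  have hx : 0 < 1 + ‖x‖ := by positivity
  set t : ℝ := ((2 : ℝ) ^ (q + 1))⁻¹ with ht
  have ht0 : 0 < t := by positivity
  have ht1 : t ≤ 1 := inv_le_one_of_one_le₀ (one_le_pow₀ one_le_two)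
  set z := Real.logb 2 (1 + ‖x‖) - (q + 1) with hz
  have hy : t * (1 + ‖x‖) = 2 ^ z := by
    rw [hz, Real.rpow_sub two_pos, Real.rpow_logb two_pos (by norm_num) hx, ht]
    rw [show (q : ℝ) + 1 = ((q + 1 : ℕ) : ℝ) by push_cast; ring, Real.rpow_natCast]
    field_simp
  have e1 : t ^ N = wt N x * 2 ^ (z * N) := by
    rw [Real.rpow_mul two_pos.le, ← hy, Real.mul_rpow ht0.le hx.le, wt, Real.rpow_neg hx.le]
    field_simp
  rw [e1, mul_assoc]
  refine mul_le_mul_of_nonneg_left ?_ (wt_pos N x).le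
  have hw : wt (N + 1) (t • x) ≤ 2 ^ (-(N + 1) * z) ∧ wt (N + 1) (t • x) ≤ 1 := by
    refine ⟨?_, wt_le_one (by linarith) _⟩
    rw [wt, norm_smul, Real.norm_of_nonneg ht0.le, mul_comm _ z, Real.rpow_mul two_pos.le, ← hy]
    refine Real.rpow_le_rpow_of_nonpos (by positivity) ?_ (by linarith)
    rw [mul_add, mul_one]
    linarith
  rcases le_total z 0 with h0 | h0
  · calc (2 : ℝ) ^ (z * N) * wt (N + 1) (t • x) ≤ 2 ^ (z * N) * 1 := by gcongr; exact hw.2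
      _ ≤ _ := by
        rw [mul_one, abs_of_nonpos h0]
        refine Real.rpow_le_rpow_of_exponent_le one_le_two ?_
        nlinarith [min_le_left N 1]
  · calc (2 : ℝ) ^ (z * N) * wt (N + 1) (t • x) ≤ 2 ^ (z * N) * 2 ^ (-(N + 1) * z) := by
          gcongr; exact hw.1
      _ ≤ _ := by
        rw [← Real.rpow_add two_pos, abs_of_nonneg h0]
        refine Real.rpow_le_rpow_of_exponent_le one_le_two ?_
        nlinarith [min_le_right N 1]

/-- A series `∑ q, 2^{-(q+1) d} a(2^{q+1} ξ)` of shells shrinking to the origin, with `d > 0`, has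
a kernel of size `O((1 + |x|)^{-(n+d)})`: the sum of the dilated kernels is dominated by the terms
with `2^q` of the order of `1 + |x|`. -/
lemma Symb.of_shell_series {a : Space n → ℂ} (ha : Shell a) {d : ℝ} (hd : 0 < d)
    {σ : Space n → ℂ} (hσ : ∀ ξ, HasSum (fun q : ℕ =>
      (((((2 : ℝ) ^ (q + 1))⁻¹) ^ d : ℝ) : ℂ) * a ((((2 : ℝ) ^ (q + 1))⁻¹)⁻¹ • ξ)) (σ ξ))
    (hc : HasCompactSupport σ) : Symb (n + d) σ := by
  set t : ℕ → ℝ := fun q => ((2 : ℝ) ^ (q + 1))⁻¹ with ht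
  have ht0 : ∀ q, 0 < t q := fun q => by positivity
  have hN : 0 < (n : ℝ) + d := by positivity
  have hsymb : Symb ((n : ℝ) + d + 1) a := Symb.of_smooth _ ha.smooth ha.compact
  have hsum : Summable fun q => (t q) ^ d := by
    have : (fun q => (t q) ^ d) = fun q => ((2 : ℝ)⁻¹ ^ d) * ((2 : ℝ)⁻¹ ^ d) ^ q := by
      ext q
      simp only [ht]
      rw [← pow_succ', ← inv_pow, ← Real.rpow_natCast, ← Real.rpow_natCast,
        ← Real.rpow_mul (by norm_num), ← Real.rpow_mul (by norm_num), mul_comm]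
    rw [this]
    refine (summable_geometric_of_lt_one (by positivity) ?_).mul_left _
    exact Real.rpow_lt_one (by norm_num) (by norm_num) hd
  obtain ⟨B, hB⟩ : ∃ B, ∀ ξ, ‖a ξ‖ ≤ B := hsymb.bounded (by linarith)
  have hcont : Continuous σ := by
    have : σ = fun ξ => ∑' q, (((t q) ^ d : ℝ) : ℂ) * a ((t q)⁻¹ • ξ) :=
      funext fun ξ => (hσ ξ).tsum_eq.symm
    rw [this]
    refine continuous_tsum (u := fun q => (t q) ^ d * B)
      (fun q => continuous_const.mul (ha.smooth.continuous.comp (continuous_const_smul _)))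
      (hsum.mul_right B) fun q ξ => ?_
    rw [norm_mul, Complex.norm_real, Real.norm_of_nonneg (by have := ht0 q; positivity)]
    have := ht0 q
    gcongr
    exact hB _
  have hint : Integrable σ := hcont.integrable_of_hasCompactSupport hc
  have haint : ∀ q, Integrable fun ξ => a ((t q)⁻¹ • ξ) := fun q =>
    hsymb.integ.comp_smul (inv_ne_zero (ht0 q).ne')
  -- the kernel of the sum is the sum of the dilated kernels
  have hker : ∀ x, HasSum (fun q => (((t q) ^ d : ℝ) : ℂ) *
      ((((t q) ^ n : ℝ) : ℂ) * 𝓕⁻ a (t q • x))) (𝓕⁻ σ x) := by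
    intro x
    have h := hasSum_integral_of_summable_integral_norm (μ := (volume : Measure (Space n)))
      (F := fun q ξ => Real.fourierChar (inner ℝ ξ x) • ((((t q) ^ d : ℝ) : ℂ) * a ((t q)⁻¹ • ξ)))
      (fun q => by
        have := (haint q).const_mul (((t q) ^ d : ℝ) : ℂ)
        exact (Real.fourierIntegral_convergent_iff (-x)).2 this |>.congr
          (Eventually.of_forall fun ξ => by simp [inner_neg_right])) (by
        have e : ∀ q, ∫ ξ, ‖Real.fourierChar (inner ℝ ξ x) •
            ((((t q) ^ d : ℝ) : ℂ) * a ((t q)⁻¹ • ξ))‖ = (t q) ^ d * ((t q) ^ n * ∫ ξ, ‖a ξ‖) := by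
          intro q
          have hp : 0 ≤ (t q) ^ d := by have := ht0 q; positivity
          simp only [Circle.norm_smul, norm_mul, Complex.norm_real, Real.norm_of_nonneg hp]
          rw [integral_const_mul, Measure.integral_comp_inv_smul_of_nonneg volume
            (fun ξ => ‖a ξ‖) (ht0 q).le]
          simp
        simp only [e]
        refine Summable.of_nonneg_of_le (fun q => ?_) (fun q => ?_)
          (hsum.mul_right (∫ ξ, ‖a ξ‖))
        · have := ht0 q
          have : 0 ≤ ∫ ξ, ‖a ξ‖ := integral_nonneg fun _ => norm_nonneg _
          positivity
        · have := ht0 q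
          refine mul_le_mul_of_nonneg_left ?_ (by positivity)
          refine mul_le_of_le_one_left (integral_nonneg fun _ => norm_nonneg _) ?_
          exact pow_le_one₀ this.le (inv_le_one_of_one_le₀ (one_le_pow₀ one_le_two)))
    have e2 : ∫ ξ, ∑' q, Real.fourierChar (inner ℝ ξ x) •
        ((((t q) ^ d : ℝ) : ℂ) * a ((t q)⁻¹ • ξ)) = 𝓕⁻ σ x := by
      rw [Real.fourierInv_eq]
      refine integral_congr_ae (Eventually.of_forall fun ξ => ?_)
      simp only [Circle.smul_def]
      rw [(hσ ξ).summable.tsum_const_smul, (hσ ξ).tsum_eq]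
    rw [e2] at h
    refine h.congr_fun ?_
    intro q
    have e3 := congrFun (fourierInv_comp_smul a (ht0 q)) x
    have e4 := congrFun (fourierInv_const_mul (fun ξ => a ((t q)⁻¹ • ξ)) (((t q) ^ d : ℝ) : ℂ)) x
    rw [← e3, ← e4, Real.fourierInv_eq]
  refine ⟨hcont, hint, ?_, ?_⟩
  · have : 𝓕⁻ σ = fun x => 𝓕 σ (-x) := by
      ext x; rw [Real.fourierInv_eq_fourier_neg]
    rw [this]
    exact (VectorFourier.fourierIntegral_continuous Real.continuous_fourierChar
      continuous_inner hint).comp continuous_neg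
  · obtain ⟨C, hC0, hC⟩ := hsymb.decay.bound'
    -- decay: the kernel of `a` decays with one more power than needed, which leaves a geometric
    -- factor in the distance of `q` from `log₂ (1 + |x|)`
    set ε := min ((n : ℝ) + d) 1
    have hε : 0 < ε := lt_min hN one_pos
    refine ⟨C * (pw ε * geo ε).toReal, fun x => ?_⟩
    have hfin : pw ε * geo ε ≠ ⊤ := ENNReal.mul_ne_top (pw_ne_top _) (geo_lt_top hε).ne
    have hb : ‖𝓕⁻ σ x‖ₑ ≤ ENNReal.ofReal C * (pw ε * geo ε) * ENNReal.ofReal (wt (n + d) x) := by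
      rw [← (hker x).tsum_eq]
      refine enorm_tsum_le_tsum_enorm.trans ?_
      refine le_trans (ENNReal.tsum_le_tsum fun q => ?_) (b := ∑' q : ℕ, ENNReal.ofReal C *
        ENNReal.ofReal (wt (n + d) x) * pw (-ε * |Real.logb 2 (1 + ‖x‖) - (q + 1)|)) ?_
      · have := ht0 q
        rw [← ofReal_norm, pw, ← ENNReal.ofReal_mul hC0,
          ← ENNReal.ofReal_mul (mul_nonneg hC0 (wt_pos _ _).le)]
        refine ENNReal.ofReal_le_ofReal ?_
        rw [norm_mul, norm_mul, Complex.norm_real, Complex.norm_real,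
          Real.norm_of_nonneg (by positivity), Real.norm_of_nonneg (by positivity)]
        calc t q ^ d * (t q ^ n * ‖𝓕⁻ a (t q • x)‖)
            ≤ t q ^ d * (t q ^ n * (C * wt (n + d + 1) (t q • x))) := by gcongr; exact hC _
          _ = C * (t q ^ ((n : ℝ) + d) * wt (n + d + 1) (t q • x)) := by
            rw [Real.rpow_add this, Real.rpow_natCast]; ring
          _ ≤ C * (wt (n + d) x * 2 ^ (-ε * |Real.logb 2 (1 + ‖x‖) - (q + 1)|)) := by
            exact mul_le_mul_of_nonneg_left (dyadic_decay hN x q) hC0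
          _ = _ := by ring
      · rw [ENNReal.tsum_mul_left, mul_right_comm]
        gcongr
        exact tsum_geo_real_le hε.le _
    have := ENNReal.toReal_mono (by finiteness) hb
    rw [toReal_enorm, ENNReal.toReal_mul, ENNReal.toReal_mul, ENNReal.toReal_ofReal hC0,
      ENNReal.toReal_ofReal (wt_pos _ _).le] at this
    exact this

end RieszCommutator

namespace DyadicPartition

open RieszCommutator

variable {n : ℕ} (P : DyadicPartition n)

/-- Away from the origin the low frequency cutoff is a sum of shells of negative index, the
difference of the homogeneous and the inhomogeneous partition of unity. -/
lemma hasSum_low {ξ : Space n} (hξ : ξ ≠ 0) :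
    HasSum (fun q : ℕ => P.shell ((((2 : ℝ) ^ (q + 1))⁻¹)⁻¹ • ξ)) (P.low ξ) := by
  have hξ' : (2 * Real.pi) • ξ ≠ 0 := smul_ne_zero (by positivity) hξ
  have h1 := P.sum_homogeneous _ hξ'
  have h2 := P.sum_inhomogeneous ((2 * Real.pi) • ξ)
  have h3 := h1.summable
  have h4 := h3.comp_injective (i := fun q : ℕ => -((q : ℤ) + 1)) (fun a b h => by
    simp only [neg_inj, add_left_inj, Nat.cast_inj] at h; exact h)
  have h5 := HasSum.of_nat_of_neg_add_one (f := fun q : ℤ =>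
    P.φ (((2 : ℝ) ^ q)⁻¹ • (2 * Real.pi) • ξ)) (by simpa using h2) h4.hasSum
  have h6 := h5.unique h1
  have h7 := h4.hasSum
  rw [show ∑' q, ((fun q : ℤ => P.φ (((2 : ℝ) ^ q)⁻¹ • (2 * Real.pi) • ξ)) ∘
    fun q : ℕ => -((q : ℤ) + 1)) q = P.χ ((2 * Real.pi) • ξ) by linarith [h6]] at h7
  have h8 := Complex.hasSum_ofReal.2 h7
  refine h8.congr_fun ?_
  intro q
  simp only [Function.comp_def, shell, smul_comm _ (2 * Real.pi) ξ]
  congr 4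

/-- The kernel of the low frequency part of a symbol homogeneous of degree `d > 0` decays like
`|x|^{-n-d}`. -/
lemma symb_low {d : ℝ} (hd : 0 < d) {h : Space n → ℂ} (hh : Homog d h) :
    Symb (n + d) (fun ξ => P.low ξ * h ξ) := by
  refine Symb.of_shell_series (P.shell_shell.mul hh) hd (fun ξ => ?_) P.low_compact.mul_right
  by_cases hξ : ξ = 0
  · simp only [hξ, smul_zero, hh.apply_zero hd.ne', mul_zero]
    exact hasSum_zero
  · refine ((P.hasSum_low hξ).mul_right (h ξ)).congr_fun ?_
    intro q
    have h2 : (0 : ℝ) < ((2 : ℝ) ^ (q + 1))⁻¹ := by positivity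
    have e := hh.homog _ h2 ((((2 : ℝ) ^ (q + 1))⁻¹)⁻¹ • ξ)
    rw [smul_smul, mul_inv_cancel₀ h2.ne', one_smul] at e
    rw [e]; ring

end DyadicPartition

namespace RieszCommutator

variable {n : ℕ}

/-! ### Homogeneous multipliers acting on test functions -/

/-- A function homogeneous of degree `d` whose high frequency part has temperate growth. -/
structure Mult (P : DyadicPartition n) (d : ℝ) (h : Space n → ℂ) : Prop extends Homog d h where
  temperate : (fun ξ => (1 - P.low ξ) * h ξ).HasTemperateGrowth

lemma Homog.comp_neg {d : ℝ} {h : Space n → ℂ} (hh : Homog d h) : Homog d (fun ξ => h (-ξ)) :=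
  ⟨hh.smooth.comp contDiff_neg.contDiffOn (fun ξ hξ => by simpa using hξ), fun l hl ξ => by
    rw [← smul_neg, hh.homog l hl]⟩

lemma Mult.comp_neg {P : DyadicPartition n} {d : ℝ} {h : Space n → ℂ} (hh : Mult P d h) :
    Mult P d (fun ξ => h (-ξ)) := by
  refine ⟨hh.toHomog.comp_neg, ?_⟩
  have := hh.temperate.comp (Function.HasTemperateGrowth.neg (f := (id : Space n → Space n))
    Function.HasTemperateGrowth.id)
  convert this using 2 with ξ
  simp [P.low_neg]

lemma Mult.mul_temperate {P : DyadicPartition n} {d e : ℝ} {h g : Space n → ℂ} (hh : Mult P d h)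
    (hg : Homog e g) (hg' : g.HasTemperateGrowth) : Mult P (d + e) (fun ξ => h ξ * g ξ) := by
  refine ⟨hh.toHomog.mul hg, ?_⟩
  have e : (fun ξ => (1 - P.low ξ) * (h ξ * g ξ)) = (fun ξ => (1 - P.low ξ) * h ξ) * g := by
    ext ξ; simp [mul_assoc]
  rw [e]
  exact hh.temperate.mul hg'

lemma hasTemperateGrowth_coord (i : Fin n) : (fun ξ : Space n => (ξ i : ℂ)).HasTemperateGrowth :=
  (Complex.ofRealCLM.comp (EuclideanSpace.proj (𝕜 := ℝ) i)).hasTemperateGrowth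

lemma hasTemperateGrowth_two_pi_smul :
    (fun ξ : Space n => (2 * Real.pi) • ξ).HasTemperateGrowth :=
  ((2 * Real.pi) • ContinuousLinearMap.id ℝ (Space n)).hasTemperateGrowth

/-- The high frequency part of `|ξ|^a` is a power of `1 + |ξ|²` times a smooth function of
`(1 + |ξ|²)⁻¹`. -/
lemma mult_norm_rpow (P : DyadicPartition n) (a : ℝ) :
    Mult P a (fun ξ : Space n => (((2 * Real.pi * ‖ξ‖) ^ a : ℝ) : ℂ)) := by
  refine ⟨Homog.norm_rpow a, ?_⟩
  let bump : ContDiffBump (0 : ℝ) := ⟨3 / 4, 7 / 8, by norm_num, by norm_num⟩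
  -- `|2πξ|^a = (1 + |2πξ|²)^{a/2} (1 - t)^{a/2}` with `t = (1 + |2πξ|²)⁻¹`, and `t ≤ 3/4` where
  -- the cutoff differs from `1`
  set g : ℝ → ℝ := fun t => bump t * (1 - t) ^ (a / 2) with hg
  have hgs : ContDiff ℝ ∞ g := by
    rw [contDiff_iff_contDiffAt]
    intro t
    by_cases ht : 1 - t = 0
    · have : g =ᶠ[𝓝 t] fun _ => 0 := by
        have hU : Set.Ioi (7 / 8 : ℝ) ∈ 𝓝 t := Ioi_mem_nhds (by linarith)
        filter_upwards [hU] with y hy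
        simp only [hg]
        rw [bump.zero_of_le_dist, zero_mul]
        simp only [Set.mem_Ioi] at hy
        rw [Real.dist_eq, sub_zero]
        exact hy.le.trans (le_abs_self y)
      exact contDiffAt_const.congr_of_eventuallyEq this
    · exact bump.contDiffAt.mul ((contDiffAt_const.sub contDiffAt_id).rpow_const_of_ne ht)
  have hgc : HasCompactSupport g := bump.hasCompactSupport.mul_right
  have hgt : g.HasTemperateGrowth := hgc.hasTemperateGrowth hgs
  have hlow : P.low.HasTemperateGrowth := P.low_compact.hasTemperateGrowth P.low_smooth
  have ht : (fun ξ : Space n => (1 + ‖(2 * Real.pi) • ξ‖ ^ 2) ^ (-1 : ℝ)).HasTemperateGrowth :=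
    (Function.hasTemperateGrowth_one_add_norm_sq_rpow (Space n) (-1)).comp
      hasTemperateGrowth_two_pi_smul
  have hp : (fun ξ : Space n => (1 + ‖(2 * Real.pi) • ξ‖ ^ 2) ^ (a / 2)).HasTemperateGrowth :=
    (Function.hasTemperateGrowth_one_add_norm_sq_rpow (Space n) (a / 2)).comp
      hasTemperateGrowth_two_pi_smul
  have hall := ((Function.HasTemperateGrowth.const (1 : ℂ)).sub hlow).mul
    (Function.HasTemperateGrowth.comp Complex.ofRealCLM.hasTemperateGrowth (hp.mul (hgt.comp ht)))
  suffices e : (fun ξ => (1 - P.low ξ) * (((2 * Real.pi * ‖ξ‖) ^ a : ℝ) : ℂ)) =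
      ((fun _ => (1 : ℂ)) - P.low) * (Complex.ofRealCLM ∘
        ((fun ξ : Space n => (1 + ‖(2 * Real.pi) • ξ‖ ^ 2) ^ (a / 2)) *
          (g ∘ fun ξ : Space n => (1 + ‖(2 * Real.pi) • ξ‖ ^ 2) ^ (-1 : ℝ)))) by
    rw [e]; exact hall
  ext ξ
  simp only [Pi.sub_apply, Pi.mul_apply, Function.comp_apply, Complex.ofRealCLM_apply]
  by_cases h1 : P.low ξ = 1
  · simp [h1]
  congr 2
  have h3 : 3 / 4 ≤ 2 * Real.pi * ‖ξ‖ := by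
    by_contra hc
    exact h1 (P.low_eq_one (not_le.1 hc))
  rw [DyadicPartition.norm_two_pi_smul]
  set y := 2 * Real.pi * ‖ξ‖
  have hy : 0 < 1 + y ^ 2 := by positivity
  have h4 : (1 + y ^ 2) ^ (-1 : ℝ) ≤ 3 / 4 := by
    rw [Real.rpow_neg_one, inv_le_comm₀ hy (by norm_num)]
    nlinarith
  have h5 : bump ((1 + y ^ 2) ^ (-1 : ℝ)) = 1 := by
    refine bump.one_of_mem_closedBall ?_
    rw [Metric.mem_closedBall, Real.dist_eq, sub_zero, abs_of_nonneg (by positivity)]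
    exact h4
  simp only [hg]
  rw [h5, one_mul, ← Real.mul_rpow hy.le (by linarith), mul_sub, mul_one, Real.rpow_neg_one,
    mul_inv_cancel₀ hy.ne', add_sub_cancel_left, ← Real.rpow_natCast, ← Real.rpow_mul (by linarith)]
  congr 1
  push_cast; ring

/-- The symbol of a partial derivative. -/
def dsym (i : Fin n) (ξ : Space n) : ℂ := 2 * Real.pi * Complex.I * (ξ i : ℂ)

lemma dsym_homog (i : Fin n) : Homog 1 (dsym (n := n) i) := (Homog.coord i).const_mul _

lemma dsym_temperate (i : Fin n) : (dsym (n := n) i).HasTemperateGrowth :=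
  (Function.HasTemperateGrowth.const _).mul (hasTemperateGrowth_coord i)

lemma dsym_neg (i : Fin n) (ξ : Space n) : dsym i (-ξ) = -dsym i ξ := by simp [dsym]

lemma mult_riesz [NeZero n] (P : DyadicPartition n) (α : ℝ) :
    Mult P (1 - α) (rieszSymbol (n := n) α) := by
  have := (mult_norm_rpow P (-α)).mul_temperate (dsym_homog 0) (dsym_temperate 0)
  rw [neg_add_eq_sub] at this
  exact this

/-- The transpose of the Fourier multiplier with symbol `h`. -/
def tr (h ψ : Space n → ℂ) : Space n → ℂ := 𝓕⁻ (fun ξ => h (-ξ) * 𝓕 ψ ξ)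

lemma fourier_mul_fourierInv (h ψ : Space n → ℂ) :
    𝓕 (fun ξ => h ξ * 𝓕⁻ ψ ξ) = tr h ψ := by
  ext x
  have h1 := congrFun (fourierInv_comp_neg (fun ξ => h ξ * 𝓕⁻ ψ ξ)) x
  have e : (fun ξ => h (-ξ) * 𝓕⁻ ψ (-ξ)) = fun ξ => h (-ξ) * 𝓕 ψ ξ := by
    ext ξ; rw [Real.fourierInv_eq_fourier_neg, neg_neg]
  rw [e] at h1
  rw [tr, h1, Real.fourierInv_eq_fourier_neg, neg_neg]

lemma riesz_eq [NeZero n] (α : ℝ) (f : Space n → ℝ) (ψ : Space n → ℂ) :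
    riesz α f ψ = ∫ x, (f x : ℂ) * tr (rieszSymbol α) ψ x := by
  rw [riesz, fourier_mul_fourierInv]

lemma Mult.symb_mul_schwartz {P : DyadicPartition n} {d : ℝ} (hd : 0 < d) {h : Space n → ℂ}
    (hh : Mult P d h) (φ : 𝓢(Space n, ℂ)) : Symb (n + d) (fun ξ => h ξ * φ ξ) := by
  have h1 := (P.symb_low hd hh.toHomog).mul (by linarith) (Symb.of_schwartz (n + d) φ)
  have h2 := Symb.of_schwartz (n + d)
    (SchwartzMap.smulLeftCLM ℂ (fun ξ => (1 - P.low ξ) * h ξ) φ)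
  convert h1.add h2 using 2 with ξ
  rw [SchwartzMap.smulLeftCLM_apply_apply hh.temperate, smul_eq_mul]
  ring

lemma Mult.symb_tr {P : DyadicPartition n} {d : ℝ} (hd : 0 < d) {h : Space n → ℂ}
    (hh : Mult P d h) (ψ : 𝓢(Space n, ℂ)) :
    Symb (n + d) (fun ξ => h (-ξ) * 𝓕 (ψ : Space n → ℂ) ξ) := by
  rw [← SchwartzMap.fourier_coe]
  exact hh.comp_neg.symb_mul_schwartz hd (𝓕 ψ)

lemma Mult.decays_tr {P : DyadicPartition n} {d : ℝ} (hd : 0 < d) {h : Space n → ℂ}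
    (hh : Mult P d h) (ψ : 𝓢(Space n, ℂ)) : Decays (n + d) (tr h ψ) :=
  (hh.symb_tr hd ψ).decay

/-- Localizing the transposed multiplier. -/
lemma Mult.op_tr {P : DyadicPartition n} {d : ℝ} (hd : 0 < d) {h : Space n → ℂ}
    (hh : Mult P d h) (ψ : 𝓢(Space n, ℂ)) {σ : Space n → ℂ} (hσ : Symb (n + d) σ)
    (hσh : Symb (n + d) (fun ξ => σ ξ * h (-ξ))) :
    op σ (tr h ψ) = op (fun ξ => σ ξ * h (-ξ)) ψ := by
  rw [op_schwartz (by linarith) hσh, op, tr, ← Symb.mul_ker (by linarith) hσ (hh.symb_tr hd ψ)]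
  simp only [mul_assoc]

lemma Mult.integral_op_mul {P : DyadicPartition n} {d : ℝ} (hd : 0 < d) {h : Space n → ℂ}
    (hh : Mult P d h) (ψ : 𝓢(Space n, ℂ)) {σ f : Space n → ℂ} (hσ : Symb (n + d) σ)
    (hσh : Symb (n + d) (fun ξ => σ ξ * h ξ)) (hf : WInt (n + d) f) :
    ∫ x, op (fun ξ => σ ξ * h ξ) f x * ψ x
      = ∫ x, f x * op (fun ξ => σ (-ξ)) (tr h ψ) x := by
  have h1 := integral_mul_op (by linarith) hσh (schwartz_decays (n + d) ψ) hf
  rw [hh.op_tr hd ψ hσ.comp_neg hσh.comp_neg]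
  simpa only [mul_comm] using h1

/-! ### Second order kernel bounds -/

/-- The second moment of the kernel of a symbol. -/
def N3 (σ : Space n → ℂ) : ℝ≥0∞ := ∫⁻ y, ‖𝓕⁻ σ y‖ₑ * ‖y‖ₑ ^ 2

lemma N3_dil (d : ℝ) (a : Space n → ℂ) (k : ℕ) :
    N3 (dil d a k) = pw (k * (d - 2)) * N3 a := by
  have h2 : (0 : ℝ) < 2 ^ k := by positivity
  have e : ∀ y : Space n, ‖𝓕⁻ (dil d a k) y‖ₑ * ‖y‖ₑ ^ 2
      = pw (k * (d - 2)) * (ENNReal.ofReal (((2 : ℝ) ^ k) ^ n) *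
        (fun z => ‖𝓕⁻ a z‖ₑ * ‖z‖ₑ ^ 2) (((2 : ℝ) ^ k) • y)) := by
    intro y
    have hk : ‖((2 : ℝ) ^ k) • y‖ₑ = pw k * ‖y‖ₑ := by
      rw [enorm_smul, pw, Real.rpow_natCast, Real.enorm_of_nonneg h2.le]
    have h3 : pw (k * d) = pw (k * (d - 2)) * (pw k * pw k) := by
      rw [← pw_add, ← pw_add]; congr 1; ring
    simp only [enorm_dil_ker, hk, h3]
    ring
  rw [N3]
  simp only [e]
  rw [lintegral_const_mul' _ _ (pw_ne_top _), lintegral_const_mul' _ _ ENNReal.ofReal_ne_top,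
    lintegral_comp_smul' (fun z => ‖𝓕⁻ a z‖ₑ * ‖z‖ₑ ^ 2) h2, ← mul_assoc (ENNReal.ofReal _),
        ofReal_mul_inv (by positivity),
    one_mul]
  rfl

lemma N3_lt_top {M : ℝ} (hn : n + 2 < M) {σ : Space n → ℂ} (hσ : Symb M σ) : N3 σ < ⊤ := by
  obtain ⟨C, hC0, hC⟩ := hσ.decay.bound'
  have hi : Integrable (fun x : Space n => C * wt (M - 2) x) :=
    (wt_integrable (by linarith)).const_mul C
  refine lt_of_le_of_lt (lintegral_mono fun y => ?_) hi.hasFiniteIntegral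
  rw [← ofReal_norm, ← ofReal_norm, ← ofReal_norm, ← ENNReal.ofReal_pow (norm_nonneg _),
    ← ENNReal.ofReal_mul (norm_nonneg _)]
  refine ENNReal.ofReal_le_ofReal ?_
  rw [Real.norm_of_nonneg (mul_nonneg hC0 (wt_pos _ _).le)]
  have hy : ‖y‖ ^ 2 ≤ wt (-2) y := by
    rw [wt, neg_neg, Real.rpow_two]
    gcongr; linarith
  calc ‖𝓕⁻ σ y‖ * ‖y‖ ^ 2 ≤ C * wt M y * wt (-2) y :=
        mul_le_mul (hC y) hy (by positivity) (mul_nonneg hC0 (wt_pos _ _).le)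
    _ = C * wt (M - 2) y := by rw [mul_assoc, ← wt_add]; rfl

/-! ### Sizes of the localized symbols -/

/-- Kernel bounds for shells at the scale `2^{k+1}` times a homogeneous symbol. -/
lemma Shell.bounds {Ψ : Space n → ℂ} (hΨ : Shell Ψ) {d : ℝ} {h : Space n → ℂ}
    (hh : Homog d h) : ∃ C : ℝ≥0∞, C ≠ ⊤ ∧ ∀ k : ℕ,
      N1 (fun ξ => Ψ (((2 : ℝ) ^ k)⁻¹ • ξ) * h ξ) ≤ C * pw ((k + 1 : ℕ) * d) ∧
      N2 (fun ξ => Ψ (((2 : ℝ) ^ k)⁻¹ • ξ) * h ξ) ≤ C * pw ((k + 1 : ℕ) * (d - 1)) ∧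
      N3 (fun ξ => Ψ (((2 : ℝ) ^ k)⁻¹ • ξ) * h ξ) ≤ C * pw ((k + 1 : ℕ) * (d - 2)) ∧
      LipLp 1 (C * pw ((k + 1 : ℕ) * (d + 1))) (𝓕⁻ fun ξ => Ψ (((2 : ℝ) ^ k)⁻¹ • ξ) * h ξ) := by
  obtain ⟨C, hC, hb⟩ := hΨ.kernel_bounds hh
  have h3 : N3 (fun ξ => Ψ ξ * h ξ) < ⊤ := N3_lt_top (M := n + 3) (by linarith)
    (Symb.of_smooth _ (hΨ.mul hh).smooth (hΨ.mul hh).compact)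
  have e : ∀ k, dil d (fun ξ => Ψ ξ * h ξ) k = fun ξ => Ψ (((2 : ℝ) ^ k)⁻¹ • ξ) * h ξ :=
    fun k => funext (dil_eq hh k)
  have sh : ∀ (k : ℕ) (x : ℝ), pw (k * x) = pw (-x) * pw ((k + 1 : ℕ) * x) := fun k x => by
    rw [← pw_add]; congr 1; push_cast; ring
  refine ⟨C * (pw (-d) + pw (-(d - 1)) + pw (-(d + 1))) + N3 (fun ξ => Ψ ξ * h ξ) * pw (-(d - 2)),
    ?_, fun k => ?_⟩
  · have := pw_ne_top
    finiteness [h3.ne, pw_ne_top (-d), pw_ne_top (-(d-1)), pw_ne_top (-(d+1)), pw_ne_top (-(d-2))]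
  · obtain ⟨b1, b2, b3⟩ := hb k
    have b4 := (N3_dil d (fun ξ => Ψ ξ * h ξ) k).le
    rw [e] at b1 b2 b3 b4
    rw [sh] at b1 b2 b3 b4
    refine ⟨b1.trans ?_, b2.trans ?_, b4.trans ?_, b3.mono ?_⟩
    · rw [← mul_assoc]; gcongr
      refine le_add_right ?_; gcongr
      rw [add_assoc]; exact le_self_add
    · rw [← mul_assoc]; gcongr
      refine le_add_right ?_; gcongr
      exact le_add_right le_add_self
    · rw [mul_right_comm, mul_comm (pw _)]; gcongr
      exact le_add_self
    · rw [← mul_assoc]; gcongr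
      refine le_add_right ?_; gcongr
      exact le_add_self

lemma Shell.symb {Ψ : Space n → ℂ} (hΨ : Shell Ψ) {d : ℝ} {h : Space n → ℂ} (hh : Homog d h)
    {M : ℝ} (hM : 0 ≤ M) (k : ℕ) : Symb M (fun ξ => Ψ (((2 : ℝ) ^ k)⁻¹ • ξ) * h ξ) := by
  have := Symb.dil hM (Symb.of_smooth M (hΨ.mul hh).smooth (hΨ.mul hh).compact) d k
  rwa [funext (dil_eq hh k)] at this

/-! ### Functions as distributions -/

lemma ae_eq_of_test {f g : Space n → ℂ} (hf : LocallyIntegrable f) (hg : LocallyIntegrable g)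
    (h : ∀ ψ : 𝓢(Space n, ℂ), HasCompactSupport ψ → ∫ x, ψ x * f x = ∫ x, ψ x * g x) :
    f =ᵐ[volume] g := by
  refine ae_eq_of_integral_contDiff_smul_eq hf hg fun φ hφ hc => ?_
  have hφc : HasCompactSupport (fun x => (φ x : ℂ)) := hc.comp_left Complex.ofReal_zero
  have hφs : ContDiff ℝ ∞ (fun x => (φ x : ℂ)) := Complex.ofRealCLM.contDiff.comp hφ
  have := h (hφc.toSchwartzMap hφs) hφc
  simpa using this

lemma distLpNorm_le {p : ℝ≥0∞} {G : 𝓢'(Space n, ℂ)} {f : Space n → ℂ} (hf : MemLp f p volume)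
    (h : ∀ ψ : 𝓢(Space n, ℂ), G ψ = ∫ x, ψ x * f x) : distLpNorm p G ≤ eLpNorm f p volume :=
  iInf₂_le f ⟨hf, h⟩

lemma le_distLpNorm {p : ℝ≥0∞} (hp : 1 ≤ p) {G : 𝓢'(Space n, ℂ)} {f : Space n → ℂ}
    (hf : LocallyIntegrable f) (h : ∀ ψ : 𝓢(Space n, ℂ), G ψ = ∫ x, ψ x * f x) :
    eLpNorm f p volume ≤ distLpNorm p G := by
  refine le_iInf₂ fun g hg => (eLpNorm_congr_ae ?_).le
  exact ae_eq_of_test hf (hg.1.locallyIntegrable hp) fun ψ _ => by rw [← h, ← hg.2]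

lemma exists_of_distLpNorm_lt_top {p : ℝ≥0∞} (hp : 1 ≤ p) {G : 𝓢'(Space n, ℂ)}
    (h : distLpNorm p G < ⊤) : ∃ f : Space n → ℂ, MemLp f p volume ∧
      (∀ ψ : 𝓢(Space n, ℂ), G ψ = ∫ x, ψ x * f x) ∧ eLpNorm f p volume ≤ distLpNorm p G := by
  rw [distLpNorm] at h
  obtain ⟨f, hf⟩ := iInf_lt_iff.1 h
  obtain ⟨hf', -⟩ := iInf_lt_iff.1 hf
  exact ⟨f, hf'.1, hf'.2, le_distLpNorm hp (hf'.1.locallyIntegrable hp) hf'.2⟩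

lemma lpDist_apply {p : ℝ≥0∞} [Fact (1 ≤ p)] {f : Space n → ℝ} (hf : MemLp f p volume)
    (ψ : 𝓢(Space n, ℂ)) : lpDist hf ψ = ∫ x, ψ x * (f x : ℂ) := by
  rw [lpDist, Lp.toTemperedDistribution_apply]
  refine integral_congr_ae ?_
  filter_upwards [(hf.ofReal (K := ℂ)).coeFn_toLp] with x hx
  rw [hx]; rfl

lemma memLp_op {M : ℝ} (hn : n < M) {p : ℝ≥0∞} (hp : 1 ≤ p) {σ f : Space n → ℂ} (hσ : Symb M σ)
    (hf : MemLp f p volume) : MemLp (op σ f) p volume :=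
  ⟨((WInt.of_memLp hn hp hf).op hn hσ).meas,
    (eLpNorm_op_le hp hσ hf.1).trans_lt (ENNReal.mul_lt_top (N1_lt_top hn hσ) hf.2)⟩

/-- The Fourier multiplier with a test function as its symbol, acting on Schwartz functions. -/
lemma fourier_smulLeft_fourierInv {τ : Space n → ℂ} (hτ : ContDiff ℝ ∞ τ)
    (hc : HasCompactSupport τ) (ψ : 𝓢(Space n, ℂ)) :
    ((𝓕 (SchwartzMap.smulLeftCLM ℂ τ (𝓕⁻ ψ)) : 𝓢(Space n, ℂ)) : Space n → ℂ) = op (fun ξ => τ (-ξ))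
        ψ := by
  have hS : Symb (n + 1) τ := Symb.of_smooth _ hτ hc
  have ht : τ.HasTemperateGrowth := hc.hasTemperateGrowth hτ
  rw [op_schwartz (by linarith) hS.comp_neg, SchwartzMap.fourier_coe]
  have := fourier_mul_fourierInv τ (ψ : Space n → ℂ)
  rw [tr] at this
  rw [← this]
  congr 1
  ext ξ
  rw [SchwartzMap.smulLeftCLM_apply_apply ht, smul_eq_mul, SchwartzMap.fourierInv_coe]

lemma fourierMultiplier_apply_of_function {M : ℝ} (hn : n < M) {τ : Space n → ℂ}
    (hτ : ContDiff ℝ ∞ τ) (hc : HasCompactSupport τ) {G : 𝓢'(Space n, ℂ)} {f : Space n → ℂ}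
    (hf : WInt M f) (h : ∀ ψ : 𝓢(Space n, ℂ), G ψ = ∫ x, ψ x * f x) (ψ : 𝓢(Space n, ℂ)) :
    TemperedDistribution.fourierMultiplierCLM ℂ τ G ψ = ∫ x, ψ x * op τ f x := by
  rw [TemperedDistribution.fourierMultiplierCLM_apply_apply, h, fourier_smulLeft_fourierInv hτ hc,
    integral_mul_op hn (Symb.of_smooth M hτ hc) (schwartz_decays M ψ) hf]

/-! ### Plancherel's theorem -/

/-- The Fourier transform of a square integrable function. -/
def FL {f : Space n → ℂ} (hf : MemLp f 2 volume) : Space n → ℂ :=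
  (𝓕 (hf.toLp f) : Lp ℂ 2 (volume : Measure (Space n)))

lemma memLp_FL {f : Space n → ℂ} (hf : MemLp f 2 volume) : MemLp (FL hf) 2 volume := Lp.memLp _

lemma eLpNorm_FL {f : Space n → ℂ} (hf : MemLp f 2 volume) :
    eLpNorm (FL hf) 2 volume = eLpNorm f 2 volume := by
  have h := Lp.norm_fourier_eq (hf.toLp f)
  rw [Lp.norm_toLp, Lp.norm_def] at h
  exact (ENNReal.toReal_eq_toReal_iff' (memLp_FL hf).2.ne hf.2.ne).1 h

lemma integral_FL {f : Space n → ℂ} (hf : MemLp f 2 volume) (ψ : 𝓢(Space n, ℂ)) :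
    ∫ x, ψ x * FL hf x = ∫ x, 𝓕 (ψ : Space n → ℂ) x * f x := by
  have h := congrArg (fun G : 𝓢'(Space n, ℂ) => G ψ)
    (Lp.fourier_toTemperedDistribution_eq (hf.toLp f))
  simp only [TemperedDistribution.fourier_apply, Lp.toTemperedDistribution_apply,
    smul_eq_mul] at h
  rw [FL, ← h]
  refine integral_congr_ae ?_
  filter_upwards [hf.coeFn_toLp] with x hx
  rw [hx, SchwartzMap.fourier_coe]

lemma FL_op {τ : Space n → ℂ} (hτ : ContDiff ℝ ∞ τ) (hc : HasCompactSupport τ) {f : Space n → ℂ}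
    (hf : MemLp f 2 volume) (hf' : MemLp (op τ f) 2 volume) :
    FL hf' =ᵐ[volume] fun ξ => τ ξ * FL hf ξ := by
  have hS : Symb (n + 1) τ := Symb.of_smooth _ hτ hc
  have ht : τ.HasTemperateGrowth := hc.hasTemperateGrowth hτ
  refine ae_eq_of_test ((memLp_FL hf').locallyIntegrable one_le_two)
    (((memLp_FL hf).locallyIntegrable one_le_two).continuous_mul hτ.continuous) fun ψ _ => ?_
  rw [integral_FL]
  have h1 := integral_mul_op (by linarith) hS (schwartz_decays (n + 1) (𝓕 ψ))
    (WInt.of_memLp (by linarith) one_le_two hf)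
  have h2 := integral_FL hf (SchwartzMap.smulLeftCLM ℂ τ ψ)
  have h3 := fourier_smulLeft_fourierInv hτ hc (𝓕 ψ)
  rw [FourierTransform.fourierInv_fourier_eq] at h3
  rw [← h3, SchwartzMap.fourier_coe, SchwartzMap.fourier_coe, ← h2] at h1
  rw [h1]
  refine integral_congr_ae (Eventually.of_forall fun ξ => ?_)
  simp only [SchwartzMap.smulLeftCLM_apply_apply ht, smul_eq_mul]
  ring

lemma eLpNorm_op_two {τ : Space n → ℂ} (hτ : ContDiff ℝ ∞ τ) (hc : HasCompactSupport τ)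
    {f : Space n → ℂ} (hf : MemLp f 2 volume) :
    eLpNorm (op τ f) 2 volume = eLpNorm (fun ξ => τ ξ * FL hf ξ) 2 volume := by
  have hf' : MemLp (op τ f) 2 volume :=
    memLp_op (M := n + 1) (by linarith) one_le_two (Symb.of_smooth _ hτ hc) hf
  rw [← eLpNorm_FL hf', eLpNorm_congr_ae (FL_op hτ hc hf hf')]

lemma eLpNorm_op_two_le {τ : Space n → ℂ} (hτ : ContDiff ℝ ∞ τ) (hc : HasCompactSupport τ)
    {f : Space n → ℂ} (hf : MemLp f 2 volume) {C : ℝ≥0} (hC : ∀ ξ, ‖τ ξ‖₊ ≤ C) :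
    eLpNorm (op τ f) 2 volume ≤ C * eLpNorm f 2 volume := by
  rw [eLpNorm_op_two hτ hc hf, ← eLpNorm_FL hf]
  refine eLpNorm_le_nnreal_smul_eLpNorm_of_ae_le_mul (Eventually.of_forall fun ξ => ?_) 2
  rw [nnnorm_mul]
  gcongr
  exact hC ξ

/-- Square function estimate. -/
lemma tsum_eLpNorm_op_two_le {τ : ℕ → Space n → ℂ} (hτ : ∀ k, ContDiff ℝ ∞ (τ k))
    (hc : ∀ k, HasCompactSupport (τ k)) {c : ℕ → ℝ≥0∞} (hcc : ∀ k, c k ≠ ⊤) {C : ℝ≥0∞} (hC' : C ≠ ⊤)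
    (hC : ∀ ξ, ∑' k, c k * ‖τ k ξ‖ₑ ^ 2 ≤ C) {f : Space n → ℂ} (hf : MemLp f 2 volume) :
    ∑' k, c k * eLpNorm (op (τ k) f) 2 volume ^ 2 ≤ C * eLpNorm f 2 volume ^ 2 := by
  have e : ∀ g : Space n → ℂ, eLpNorm g 2 volume ^ 2 = ∫⁻ ξ, ‖g ξ‖ₑ ^ 2 := fun g => by
    have := eLpNorm_nnreal_pow_eq_lintegral (f := g) (p := 2) (μ := volume) (by norm_num)
    simpa using this
  have hm : AEStronglyMeasurable (FL hf) volume := (memLp_FL hf).1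
  have e2 : ∀ k, c k * eLpNorm (op (τ k) f) 2 volume ^ 2
      = ∫⁻ ξ, c k * ‖τ k ξ‖ₑ ^ 2 * ‖FL hf ξ‖ₑ ^ 2 := fun k => by
    rw [eLpNorm_op_two (hτ k) (hc k) hf, e, ← lintegral_const_mul' _ _ (hcc k)]
    simp only [enorm_mul, mul_pow, mul_assoc]
  simp only [e2]
  rw [← lintegral_tsum, ← eLpNorm_FL hf, e, ← lintegral_const_mul' _ _ hC']
  · refine lintegral_mono fun ξ => ?_
    rw [ENNReal.tsum_mul_right]
    gcongr
    exact hC ξ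
  · intro k
    exact (((hτ k).continuous.enorm.measurable.pow_const 2).const_mul _).aemeasurable.mul
      (hm.enorm.pow_const 2)

end RieszCommutator

namespace DyadicPartition

open RieszCommutator

variable {n : ℕ} (P : DyadicPartition n)

/-! ### Approximation by low frequencies -/

lemma cut_eq_dil (k : ℕ) : P.cut k = dil 0 P.low k := by
  ext ξ; simp [cut, dil]

lemma low_symb (M : ℝ) : Symb M P.low := Symb.of_smooth M P.low_smooth P.low_compact

lemma cut_symb {M : ℝ} (hM : 0 ≤ M) (k : ℕ) : Symb M (P.cut k) := by
  rw [cut_eq_dil]; exact Symb.dil hM (P.low_symb M) 0 k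

lemma N1_cut (k : ℕ) : N1 (P.cut k) = N1 P.low := by
  rw [cut_eq_dil, N1_dil]; simp

lemma N2_cut (k : ℕ) : N2 (P.cut k) = pw (-k) * N2 P.low := by
  rw [cut_eq_dil, N2_dil]; simp

lemma low_zero : P.low 0 = 1 := P.low_eq_one (by simp)

lemma op_cut_one (k : ℕ) : op (P.cut k) (fun _ => 1) = fun _ => 1 := by
  ext x
  have h := congrFun ((P.cut_symb (M := n + 1) (by positivity) k).fourier_ker (by linarith)) 0
  rw [Real.fourier_eq] at h
  simp only [inner_zero_right, neg_zero, AddChar.map_zero_eq_one, one_smul] at h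
  rw [op_eq]
  simp only [mul_one]
  rw [h, cut, smul_zero, P.low_zero]

lemma wint_one {M : ℝ} (hn : n < M) : WInt M (fun _ : Space n => (1 : ℂ)) :=
  ⟨aestronglyMeasurable_const, by simpa using wt_integrable hn⟩

/-- Functions that are Lipschitz in `L^p` are approximated at a rate. -/
lemma eLpNorm_op_cut_sub_le {p A : ℝ≥0∞} (hp : 1 ≤ p) {u : Space n → ℂ} (hu : LipLp p A u)
    (hm : WInt ((n : ℝ) + 1) u) (k : ℕ) :
    eLpNorm (fun x => op (P.cut k) u x - u x) p volume ≤ pw (-k) * N2 P.low * A := by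
  have h := eLpNorm_com_le (M := n + 1) (q := ⊤) (by positivity) hp
    (P.cut_symb (by positivity) k) (wint_one (by linarith)) (by simpa using hm) hm.meas hu
  have e : com (P.cut k) u (fun _ => 1) = fun x => op (P.cut k) u x - u x := by
    ext x; rw [com, P.op_cut_one]; simp
  rw [e, P.N2_cut] at h
  refine h.trans ?_
  have : eLpNorm (fun _ : Space n => (1 : ℂ)) ⊤ volume ≤ 1 := by
    simpa using eLpNormEssSup_le_of_ae_enorm_bound (μ := (volume : Measure (Space n)))
      (f := fun _ => (1 : ℂ)) (C := 1) (by simp)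
  exact (mul_le_mul_right this _).trans (by rw [mul_one])

lemma tendsto_pw_neg : Tendsto (fun k : ℕ => pw (-k)) atTop (𝓝 0) := by
  have : (fun k : ℕ => pw (-k)) = fun k => (pw (-1)) ^ k := by
    ext k; rw [← pw_nat_mul]; simp
  rw [this]
  refine ENNReal.tendsto_pow_atTop_nhds_zero_of_lt_one ?_
  rw [pw, ENNReal.ofReal_lt_one]
  exact Real.rpow_lt_one_of_one_lt_of_neg one_lt_two (by norm_num)

/-- The low frequency cutoffs converge in `L^p`, `p < ∞`: on the dense set of Schwartz functions
by the gradient bound, and in general because they are uniformly bounded. -/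
lemma tendsto_op_cut {p : ℝ≥0∞} (hp : 1 ≤ p) (hp' : p ≠ ⊤) {f : Space n → ℂ}
    (hf : MemLp f p volume) :
    Tendsto (fun k => eLpNorm (fun x => op (P.cut k) f x - f x) p volume) atTop (𝓝 0) := by
  have : Fact (1 ≤ p) := ⟨hp⟩
  have hM : (n : ℝ) < n + 1 := by linarith
  have hM0 : (0 : ℝ) ≤ n + 1 := by positivity
  rw [ENNReal.tendsto_nhds_zero]
  intro ε hε
  have hN : N1 P.low < ⊤ := N1_lt_top hM (P.low_symb _)
  obtain ⟨δ, hδ, hδε⟩ : ∃ δ : ℝ≥0, 0 < δ ∧ (N1 P.low + 1) * δ ≤ ε / 2 := by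
    rcases eq_or_ne ε ⊤ with rfl | hε'
    · exact ⟨1, one_pos, by simp [ENNReal.top_div]⟩
    have h1 : 0 < ε / 2 / (N1 P.low + 1) :=
      ENNReal.div_pos (ENNReal.half_pos hε.ne').ne' (by finiteness [hN.ne])
    obtain ⟨δ, h2, h3⟩ := ENNReal.lt_iff_exists_nnreal_btwn.1 h1
    refine ⟨δ, by exact_mod_cast h2, ?_⟩
    rw [mul_comm]
    exact ENNReal.mul_le_of_le_div h3.le
  obtain ⟨ψ, hψ⟩ : ∃ ψ : 𝓢(Space n, ℂ), eLpNorm (fun x => f x - ψ x) p volume ≤ δ := by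
    obtain ⟨ψ, h⟩ := (SchwartzMap.denseRange_toLpCLM (E := Space n) (F := ℂ) (μ := volume)
      hp').exists_dist_lt (hf.toLp f) (ε := δ) hδ
    refine ⟨ψ, ?_⟩
    rw [SchwartzMap.toLpCLM_apply, SchwartzMap.toLp, Lp.dist_def] at h
    have e : eLpNorm (⇑(hf.toLp f) - ⇑(ψ.memLp p volume |>.toLp ψ)) p volume
        = eLpNorm (fun x => f x - ψ x) p volume := by
      refine eLpNorm_congr_ae ?_
      filter_upwards [hf.coeFn_toLp, (ψ.memLp p volume).coeFn_toLp] with x h1 h2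
      rw [Pi.sub_apply, h1, h2]
    rw [e] at h
    have hfin : eLpNorm (fun x => f x - ψ x) p volume ≠ ⊤ := (hf.sub (ψ.memLp p volume)).2.ne
    rw [← ENNReal.ofReal_toReal hfin, ← ENNReal.ofReal_coe_nnreal]
    exact ENNReal.ofReal_le_ofReal h.le
  have hψm := ψ.memLp p volume
  set A := eLpNorm (fderiv ℝ (ψ : Space n → ℂ)) p volume
  have hA : A < ⊤ := (SchwartzMap.fderivCLM ℝ (Space n) ℂ ψ).memLp p volume |>.2
  have hL : LipLp p A ψ := lipLp_of_fderiv hp (ψ.smooth 1)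
  have ht : Tendsto (fun k : ℕ => pw (-k) * N2 P.low * A) atTop (𝓝 0) := by
    have hN2 : N2 P.low < ⊤ := N2_lt_top (M := n + 2) (by linarith) (P.low_symb _)
    have := ENNReal.Tendsto.mul_const (b := N2 P.low * A) tendsto_pw_neg (Or.inr (by finiteness))
    simpa [mul_assoc] using this
  filter_upwards [(ENNReal.tendsto_nhds_zero.1 ht) (ε / 2) (ENNReal.half_pos hε.ne')] with k hk
  have hfw := WInt.of_memLp hM hp hf
  have hψw := WInt.of_memLp hM hp hψm
  have hS := P.cut_symb hM0 k
  have e : (fun x => op (P.cut k) f x - f x) = fun x =>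
      (op (P.cut k) (fun y => f y - ψ y) x + (op (P.cut k) ψ x - ψ x)) + (-(f x - ψ x)) := by
    ext x
    rw [op, op, op, cv_sub hM0 hS.decay hfw hψw]
    ring
  have m1 : AEStronglyMeasurable (op (P.cut k) (fun y => f y - ψ y)) volume :=
    ((hfw.sub hψw).op hM hS).meas
  have m2 : AEStronglyMeasurable (fun x => op (P.cut k) ψ x - ψ x) volume :=
    (hψw.op hM hS).meas.sub hψm.1
  rw [e]
  calc _ ≤ N1 P.low * δ + ε / 2 + δ := by
        refine (eLpNorm_add_le (m1.add m2) (hf.1.sub hψm.1).neg hp).trans ?_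
        gcongr
        · refine (eLpNorm_add_le m1 m2 hp).trans ?_
          gcongr
          · refine (eLpNorm_op_le hp hS (hf.1.sub hψm.1)).trans ?_
            rw [P.N1_cut]
            exact mul_le_mul_right hψ _
          · exact (P.eLpNorm_op_cut_sub_le hp hL hψw k).trans hk
        · exact (eLpNorm_neg (fun x => f x - ψ x) p volume).le.trans hψ
    _ = (N1 P.low + 1) * δ + ε / 2 := by ring
    _ ≤ ε / 2 + ε / 2 := by gcongr
    _ = ε := ENNReal.add_halves ε

end DyadicPartition

namespace RieszCommutator

variable {n : ℕ}

/-! ### Sequence spaces -/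

lemma le_eLpNorm_top_count (b : ℕ → ℝ≥0∞) (k : ℕ) : b k ≤ eLpNorm b ⊤ Measure.count := by
  rw [eLpNorm_exponent_top]
  have h := enorm_ae_le_eLpNormEssSup b (Measure.count : Measure ℕ)
  simpa using Measure.ae_count_iff.1 h k

lemma eLpNorm_count_eq {r : ℝ≥0∞} (h0 : r ≠ 0) (ht : r ≠ ⊤) (b : ℕ → ℝ≥0∞) :
    eLpNorm b r Measure.count = (∑' k, b k ^ r.toReal) ^ (1 / r.toReal) := by
  rw [eLpNorm_eq_lintegral_rpow_enorm_toReal h0 ht, lintegral_count]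
  simp

lemma eLpNorm_count_two (b : ℕ → ℝ≥0∞) :
    eLpNorm b 2 Measure.count ^ 2 = ∑' k, b k ^ 2 := by
  rw [eLpNorm_count_eq two_ne_zero ENNReal.ofNat_ne_top]
  simp only [ENNReal.toReal_ofNat]
  rw [← ENNReal.rpow_natCast, ← ENNReal.rpow_mul]
  norm_num

lemma le_eLpNorm_count {r : ℝ≥0∞} (hr : 1 ≤ r) (b : ℕ → ℝ≥0∞) (k : ℕ) :
    b k ≤ eLpNorm b r Measure.count := by
  rcases eq_or_ne r ⊤ with rfl | ht
  · exact le_eLpNorm_top_count b k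
  have h0 : r ≠ 0 := (one_pos.trans_le hr).ne'
  have h1 : 0 < r.toReal := ENNReal.toReal_pos h0 ht
  rw [eLpNorm_count_eq h0 ht]
  calc b k = (b k ^ r.toReal) ^ (1 / r.toReal) := by
        rw [← ENNReal.rpow_mul, mul_one_div_cancel h1.ne', ENNReal.rpow_one]
    _ ≤ _ := by gcongr; exact ENNReal.le_tsum k

lemma eLpNorm_count_mono (r : ℝ≥0∞) {a b : ℕ → ℝ≥0∞} (h : ∀ k, a k ≤ b k) :
    eLpNorm a r Measure.count ≤ eLpNorm b r Measure.count :=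
  eLpNorm_mono_enorm (by simpa using h)

lemma eLpNorm_count_const_mul (r : ℝ≥0∞) {c : ℝ≥0∞} (hc : c ≠ ⊤) (b : ℕ → ℝ≥0∞) :
    eLpNorm (fun k => c * b k) r Measure.count ≤ c * eLpNorm b r Measure.count := by
  lift c to ℝ≥0 using hc
  exact eLpNorm_le_nnreal_smul_eLpNorm_of_ae_le_mul' (Eventually.of_forall fun k => by simp) r

lemma eLpNorm_count_add_le {r : ℝ≥0∞} (hr : 1 ≤ r) (a b : ℕ → ℝ≥0∞) :
    eLpNorm (fun k => a k + b k) r Measure.count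
      ≤ eLpNorm a r Measure.count + eLpNorm b r Measure.count := by
  have h := eLpNorm_add_le (f := a) (g := b) (μ := (Measure.count : Measure ℕ)) (p := r)
    (by fun_prop) (by fun_prop) hr
  exact h

/-- Cauchy-Schwarz for sequences. -/
lemma tsum_mul_le_count (a b : ℕ → ℝ≥0∞) :
    ∑' k, a k * b k ≤ eLpNorm a 2 Measure.count * eLpNorm b 2 Measure.count := by
  have h := ENNReal.lintegral_mul_le_Lp_mul_Lq (μ := (Measure.count : Measure ℕ))
    (p := 2) (q := 2) ⟨by norm_num, by norm_num, by norm_num⟩ (f := a) (g := b)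
    (by fun_prop) (by fun_prop)
  simp only [lintegral_count, Pi.mul_apply] at h
  rw [eLpNorm_count_eq two_ne_zero ENNReal.ofNat_ne_top,
    eLpNorm_count_eq two_ne_zero ENNReal.ofNat_ne_top]
  simpa using h

/-- A sequence, extended by zero to the integers. -/
def extZ (b : ℕ → ℝ≥0∞) : ℤ → ℝ≥0∞ := Function.extend ((↑) : ℕ → ℤ) b 0

lemma extZ_natCast (b : ℕ → ℝ≥0∞) (k : ℕ) : extZ b k = b k :=
  Nat.cast_injective.extend_apply _ _ _

lemma extZ_cases (b : ℕ → ℝ≥0∞) (z : ℤ) : extZ b z = 0 ∨ ∃ k : ℕ, z = k ∧ extZ b z = b k := by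
  by_cases h : ∃ k : ℕ, (k : ℤ) = z
  · obtain ⟨k, rfl⟩ := h
    exact Or.inr ⟨k, rfl, extZ_natCast b k⟩
  · left; rw [extZ, Function.extend_apply' _ _ _ h]; rfl

lemma eLpNorm_extZ_le {r : ℝ≥0∞} (hr : 1 ≤ r) (b : ℕ → ℝ≥0∞) (z : ℤ) :
    eLpNorm (fun j : ℕ => extZ b (j - z)) r Measure.count ≤ eLpNorm b r Measure.count := by
  rcases eq_or_ne r ⊤ with rfl | ht
  · nth_rewrite 1 [eLpNorm_exponent_top]
    refine essSup_le_of_ae_le _ (Eventually.of_forall fun j => ?_)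
    rcases extZ_cases b (j - z) with h | ⟨k, -, h⟩
    · simp [h]
    · simpa [h] using le_eLpNorm_top_count b k
  have h0 : r ≠ 0 := (one_pos.trans_le hr).ne'
  have h1 : 0 < r.toReal := ENNReal.toReal_pos h0 ht
  rw [eLpNorm_count_eq h0 ht, eLpNorm_count_eq h0 ht]
  refine ENNReal.rpow_le_rpow ?_ (by positivity)
  have e : ∀ y : ℤ, extZ b y ^ r.toReal = extZ (fun k => b k ^ r.toReal) y := fun y => by
    rcases extZ_cases b y with h | ⟨k, rfl, -⟩
    · by_cases hy : ∃ k : ℕ, (k : ℤ) = y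
      · obtain ⟨k, rfl⟩ := hy
        rw [extZ_natCast, extZ_natCast]
      · rw [h, extZ, Function.extend_apply' _ _ _ hy, ENNReal.zero_rpow_of_pos h1]; rfl
    · rw [extZ_natCast, extZ_natCast]
  simp only [e]
  refine (ENNReal.tsum_comp_le_tsum_of_injective (f := fun j : ℕ => (j : ℤ) - z)
    (fun a b h => by simpa using h) (extZ fun k => b k ^ r.toReal)).trans ?_
  exact (tsum_extend_zero Nat.cast_injective (fun k => b k ^ r.toReal)).le

/-- Convolution with a two-sided geometric sequence is bounded on `ℓ^r`. -/
lemma eLpNorm_geo_le {ε : ℝ} {r : ℝ≥0∞} (hr : 1 ≤ r) (b : ℕ → ℝ≥0∞) :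
    eLpNorm (fun j : ℕ => ∑' q : ℕ, pw (-ε * |(j : ℝ) - q|) * b q) r Measure.count
      ≤ geo ε * eLpNorm b r Measure.count := by
  have key := eLpNorm_lintegral_le (μ := (Measure.count : Measure ℕ))
    (ν := (Measure.count : Measure ℤ)) (G := fun j z => pw (-ε * |(z : ℝ)|) * extZ b (j - z))
    (c := fun z => pw (-ε * |(z : ℝ)|) * eLpNorm b r Measure.count)
    (Measurable.of_discrete.aemeasurable) Measurable.of_discrete hr (fun z =>
      (eLpNorm_count_const_mul r (pw_ne_top _) _).trans (by gcongr; exact eLpNorm_extZ_le hr b z))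
  simp only [lintegral_count, ENNReal.tsum_mul_right] at key
  refine le_trans (eLpNorm_count_mono r fun j => ?_) key
  have h := ENNReal.tsum_comp_le_tsum_of_injective (f := fun q : ℕ => (j : ℤ) - (q : ℤ))
    (fun a b h => by simpa using h) (fun z : ℤ => pw (-ε * |(z : ℝ)|) * extZ b (j - z))
  refine le_trans (le_of_eq ?_) h
  simp [extZ_natCast]

end RieszCommutator

namespace DyadicPartition

open RieszCommutator

variable {n : ℕ} (P : DyadicPartition n)

/-! ### Sobolev weights -/

/-- The weight `(1 + |ξ|²)^{s/2}`. -/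
def _root_.RieszCommutator.bw (s : ℝ) (ξ : Space n) : ℂ := (((1 + ‖ξ‖ ^ 2) ^ (s / 2) : ℝ) : ℂ)

lemma _root_.RieszCommutator.bw_smooth (s : ℝ) : ContDiff ℝ ∞ (bw (n := n) s) :=
  (by fun_prop : (fun x : Space n => (1 + ‖x‖ ^ 2) ^ (s / 2)).HasTemperateGrowth).1 |>
    Complex.ofRealCLM.contDiff.comp

lemma _root_.RieszCommutator.bw_temperate (s : ℝ) : (bw (n := n) s).HasTemperateGrowth :=
  Function.HasTemperateGrowth.comp Complex.ofRealCLM.hasTemperateGrowth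
    (Function.hasTemperateGrowth_one_add_norm_sq_rpow (Space n) (s / 2))

lemma _root_.RieszCommutator.bw_add (s t : ℝ) (ξ : Space n) : bw (s + t) ξ = bw s ξ * bw t ξ := by
  rw [bw, bw, bw, ← Complex.ofReal_mul, ← Real.rpow_add (by positivity)]
  congr 2; ring

lemma symT_smooth (k : ℕ) : ContDiff ℝ ∞ (P.symT k) := by
  cases k with
  | zero => exact P.low_smooth.comp (contDiff_const_smul _)
  | succ k => exact P.shell_shellT.smooth.comp (contDiff_const_smul _)

lemma symT_compact (k : ℕ) : HasCompactSupport (P.symT k) :=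
  compact_of_bound fun _ h => (P.symT_support h).1

lemma symbol_smooth (k : ℕ) : ContDiff ℝ ∞ (P.symbol k) := by
  cases k with
  | zero => exact P.low_smooth
  | succ k =>
    have : P.symbol (k + 1) = fun ξ => P.shell (((2 : ℝ) ^ k)⁻¹ • ξ) := funext (P.symbol_succ k)
    rw [this]
    exact P.shell_smooth.comp (contDiff_const_smul _)

lemma symbol_compact (k : ℕ) : HasCompactSupport (P.symbol k) :=
  compact_of_bound fun _ h => P.symbol_support h

lemma symT_bounded : ∃ B : ℝ, 0 ≤ B ∧ ∀ k ξ, ‖P.symT k ξ‖ ≤ B := by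
  obtain ⟨B1, h1⟩ := P.low_compact.exists_bound_of_continuous P.low_smooth.continuous
  obtain ⟨B2, h2⟩ := P.shell_shellT.compact.exists_bound_of_continuous
    P.shell_shellT.smooth.continuous
  refine ⟨max B1 B2, (norm_nonneg _).trans ((h1 0).trans (le_max_left _ _)), fun k ξ => ?_⟩
  cases k with
  | zero => exact (h1 _).trans (le_max_left _ _)
  | succ k => exact (h2 _).trans (le_max_right _ _)

/-- On the support of the `k`-th symbol the weight `(1 + |ξ|²)^{1/2}` is comparable to `2^k`. -/
lemma abs_logb_le {k : ℕ} {ξ : Space n} (h : P.symT k ξ ≠ 0) :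
    |Real.logb 2 (1 + ‖ξ‖ ^ 2) / 2 - k| ≤ 6 := by
  obtain ⟨h1, h2⟩ := P.symT_support h
  have hk : (1 : ℝ) ≤ 2 ^ k := one_le_pow₀ one_le_two
  have hpi := Real.pi_gt_three
  have hpi4 := Real.pi_lt_four
  have hξ0 := norm_nonneg ξ
  have hup : ‖ξ‖ ≤ 2 ^ k := by nlinarith
  have u : Real.logb 2 (1 + ‖ξ‖ ^ 2) ≤ 2 * k + 1 := by
    have e : (2 : ℝ) ^ (2 * (k : ℝ) + 1) = (2 ^ k) ^ 2 * 2 := by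
      rw [Real.rpow_add two_pos, mul_comm 2 (k : ℝ), Real.rpow_mul two_pos.le, Real.rpow_two,
        Real.rpow_natCast, Real.rpow_one]
    rw [Real.logb_le_iff_le_rpow one_lt_two (by positivity), e]
    nlinarith
  have l : 2 * (k : ℝ) - 12 ≤ Real.logb 2 (1 + ‖ξ‖ ^ 2) := by
    have e : (2 : ℝ) ^ (2 * (k : ℝ) - 12) = (2 ^ k) ^ 2 / 2 ^ (12 : ℝ) := by
      rw [Real.rpow_sub two_pos, mul_comm 2 (k : ℝ), Real.rpow_mul two_pos.le, Real.rpow_two,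
        Real.rpow_natCast]
    rw [Real.le_logb_iff_rpow_le one_lt_two (by positivity), e]
    rcases Nat.eq_zero_or_pos k with rfl | hk0
    · norm_num; nlinarith
    have h3 := h2 hk0.ne'
    have h4 : 2 ^ k ≤ 64 * ‖ξ‖ := by nlinarith
    have h5 : ((2 : ℝ) ^ k) ^ 2 ≤ (64 * ‖ξ‖) ^ 2 := by gcongr
    have h6 : (2 : ℝ) ^ (12 : ℝ) = 4096 := by
      rw [show (12 : ℝ) = ((12 : ℕ) : ℝ) by norm_num, Real.rpow_natCast]; norm_num
    rw [h6, div_le_iff₀ (by norm_num)]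
    nlinarith
  rw [abs_le]; constructor <;> linarith

lemma enorm_bw_eq (s : ℝ) (ξ : Space n) :
    ‖bw s ξ‖ₑ = pw (s * (Real.logb 2 (1 + ‖ξ‖ ^ 2) / 2)) := by
  rw [← ofReal_norm, bw, Complex.norm_real, Real.norm_of_nonneg (by positivity), pw]
  congr 1
  nth_rewrite 1 [← Real.rpow_logb two_pos (by norm_num) (by positivity : 0 < 1 + ‖ξ‖ ^ 2)]
  rw [← Real.rpow_mul two_pos.le]
  congr 1; ring

/-- On the support of the `k`-th symbol the weight `⟨ξ⟩^{-s}` is comparable to `2^{-ks}`, and only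
finitely many of these supports meet. -/
lemma exists_weight_bound (s : ℝ) : ∃ C : ℝ≥0∞, C ≠ ⊤ ∧ ∀ ξ,
    ∑' k : ℕ, pw (k * s) ^ 2 * ‖P.symT k ξ * bw (-s) ξ‖ₑ ^ 2 ≤ C := by
  obtain ⟨B, hB0, hB⟩ := P.symT_bounded
  refine ⟨pw (6 * |s|) ^ 2 * ENNReal.ofReal B ^ 2 * (pw 7 * (pw 1 * geo 1)), ?_, fun ξ => ?_⟩
  · finiteness [pw_ne_top (6 * |s|), pw_ne_top 7, pw_ne_top 1, (geo_lt_top one_pos).ne]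
  · set L := Real.logb 2 (1 + ‖ξ‖ ^ 2) / 2
    have hterm : ∀ k : ℕ, pw (k * s) ^ 2 * ‖P.symT k ξ * bw (-s) ξ‖ₑ ^ 2 ≤
        pw (6 * |s|) ^ 2 * ENNReal.ofReal B ^ 2 * (pw 7 * pw (-1 * |L - (k + 1)|)) := by
      intro k
      by_cases h : P.symT k ξ = 0
      · simp [h]
      have h1 := P.abs_logb_le h
      have h2 : ‖P.symT k ξ‖ₑ ≤ ENNReal.ofReal B := by
        rw [← ofReal_norm]; exact ENNReal.ofReal_le_ofReal (hB k ξ)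
      have h3 : pw (k * s) * pw (-s * L) ≤ pw (6 * |s|) := by
        rw [← pw_add]
        refine pw_mono ?_
        calc k * s + -s * L = -(s * (L - k)) := by ring
          _ ≤ |s * (L - k)| := neg_le_abs _
          _ = |L - k| * |s| := by rw [abs_mul, mul_comm]
          _ ≤ _ := by gcongr
      have h4 : 1 ≤ pw 7 * pw (-1 * |L - (k + 1)|) := by
        rw [← pw_add, ← pw_zero]
        refine pw_mono ?_
        have : |L - (k + 1)| ≤ |L - k| + 1 := by
          rw [show L - (k + 1) = (L - k) + (-1) by ring]
          refine (abs_add_le _ _).trans ?_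
          norm_num
        linarith
      rw [enorm_mul, enorm_bw_eq]
      calc pw (k * s) ^ 2 * (‖P.symT k ξ‖ₑ * pw (-s * L)) ^ 2
          = (pw (k * s) * pw (-s * L)) ^ 2 * ‖P.symT k ξ‖ₑ ^ 2 * 1 := by ring
        _ ≤ _ := by gcongr
    refine (ENNReal.tsum_le_tsum hterm).trans ?_
    rw [ENNReal.tsum_mul_left, ENNReal.tsum_mul_left]
    gcongr
    exact tsum_geo_real_le zero_le_one L

/-! ### Sobolev norms and Littlewood-Paley blocks -/

/-- The Bessel potential of a Schwartz function. -/
def _root_.RieszCommutator.bessel (s : ℝ) (ψ : 𝓢(Space n, ℂ)) : 𝓢(Space n, ℂ) :=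
  𝓕 (SchwartzMap.smulLeftCLM ℂ (bw s) (𝓕⁻ ψ))

lemma _root_.RieszCommutator.besselPotential_apply (s : ℝ) (G : 𝓢'(Space n, ℂ))
    (ψ : 𝓢(Space n, ℂ)) : besselPotential (Space n) ℂ s G ψ = G (bessel s ψ) := rfl

lemma _root_.RieszCommutator.bw_neg (s : ℝ) (ξ : Space n) : bw s (-ξ) = bw s ξ := by simp [bw]

lemma _root_.RieszCommutator.fourier_bessel (s : ℝ) (ψ : 𝓢(Space n, ℂ)) (ξ : Space n) :
    𝓕 (bessel s ψ : Space n → ℂ) ξ = bw s ξ * 𝓕 (ψ : Space n → ℂ) ξ := by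
  have h : 𝓕⁻ (bessel s ψ) = SchwartzMap.smulLeftCLM ℂ (bw s) (𝓕⁻ ψ) :=
    FourierTransform.fourierInv_fourier_eq _
  have h1 := congrArg (fun f : 𝓢(Space n, ℂ) => f (-ξ)) h
  simp only [SchwartzMap.smulLeftCLM_apply_apply (bw_temperate s), SchwartzMap.fourierInv_coe,
    Real.fourierInv_eq_fourier_neg, neg_neg, bw_neg, smul_eq_mul] at h1
  exact h1

/-- The blocks of a Schwartz function are controlled in a weighted `ℓ²` by its Bessel potential. -/
lemma exists_blocks_le_bessel (s : ℝ) : ∃ C : ℝ≥0∞, C ≠ ⊤ ∧ ∀ ψ : 𝓢(Space n, ℂ),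
    eLpNorm (fun j : ℕ => pw (j * s) * eLpNorm (op (P.symT j) ψ) 2 volume) 2 Measure.count
      ≤ C * eLpNorm (bessel s ψ) 2 volume := by
  obtain ⟨C, hC, h⟩ := P.exists_weight_bound s
  refine ⟨C ^ (1 / 2 : ℝ), by finiteness, fun ψ => ?_⟩
  have hM : (n : ℝ) < n + 1 := by linarith
  have hs : ∀ k, ContDiff ℝ ∞ fun ξ => P.symT k ξ * bw (-s) ξ :=
    fun k => (P.symT_smooth k).mul (bw_smooth _)
  have hc : ∀ k, HasCompactSupport fun ξ => P.symT k ξ * bw (-s) ξ :=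
    fun k => (P.symT_compact k).mul_right
  have hb : MemLp (bessel s ψ) 2 volume := (bessel s ψ).memLp 2 volume
  have key := tsum_eLpNorm_op_two_le hs hc (c := fun k => pw (k * s) ^ 2)
    (fun k => by finiteness [pw_ne_top (k * s)]) hC h hb
  have e : ∀ k, op (fun ξ => P.symT k ξ * bw (-s) ξ) (bessel s ψ) = op (P.symT k) ψ := fun k => by
    rw [op_schwartz hM (Symb.of_smooth _ (hs k) (hc k)),
      op_schwartz hM (Symb.of_smooth _ (P.symT_smooth k) (P.symT_compact k))]
    congr 1
    ext ξ
    rw [fourier_bessel, mul_assoc, ← mul_assoc (bw (-s) ξ), ← bw_add]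
    simp [bw]
  simp only [e, ← mul_pow] at key
  rw [← eLpNorm_count_two] at key
  have h2 := ENNReal.rpow_le_rpow key (by norm_num : (0 : ℝ) ≤ 1 / 2)
  rw [ENNReal.mul_rpow_of_nonneg _ _ (by norm_num), ← ENNReal.rpow_natCast, ← ENNReal.rpow_mul,
    ← ENNReal.rpow_natCast, ← ENNReal.rpow_mul] at h2
  norm_num at h2
  simpa using h2

lemma symbol_bound (k : ℕ) (ξ : Space n) : ‖P.symbol k ξ‖ ≤ ‖P.symT k ξ‖ := by
  by_cases h : P.symbol k ξ = 0
  · rw [h, norm_zero]; exact norm_nonneg _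
  have h1 := P.symbol_mul_symT k ξ
  have h2 : P.symT k ξ = 1 := mul_left_cancel₀ h (by rw [h1, mul_one])
  rw [h2, norm_one]
  have hle : ∀ η, P.φ η ≤ 1 := fun η => by
    have h3 := le_hasSum (P.sum_inhomogeneous η) 0 (fun q _ => P.φ_nonneg _)
    simp only [pow_zero, inv_one, one_smul] at h3
    linarith [P.χ_nonneg η]
  have hle' : ∀ η, P.χ η ≤ 1 := fun η => by
    have h3 := (P.sum_inhomogeneous η).nonneg (fun q => P.φ_nonneg _)
    linarith
  cases k with
  | zero =>
    rw [symbol_zero, low, Complex.norm_real, Real.norm_of_nonneg (P.χ_nonneg _)]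
    exact hle' _
  | succ k =>
    rw [symbol_succ, shell, Complex.norm_real, Real.norm_of_nonneg (P.φ_nonneg _)]
    exact hle _

/-- The blocks of a function in a Sobolev space are controlled in a weighted `ℓ²`. -/
lemma exists_blocks_le_sobolev (t : ℝ) : ∃ C : ℝ≥0∞, C ≠ ⊤ ∧
    ∀ {θ : Space n → ℂ} (_ : MemLp θ 2 volume) {G : 𝓢'(Space n, ℂ)}
      (_ : ∀ ψ : 𝓢(Space n, ℂ), G ψ = ∫ x, ψ x * θ x) (_ : sobolevNorm t G < ⊤),
    eLpNorm (fun j : ℕ => pw (j * t) * eLpNorm (op (P.symbol j) θ) 2 volume) 2 Measure.count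
      ≤ C * sobolevNorm t G := by
  obtain ⟨C, hC, h⟩ := P.exists_weight_bound t
  refine ⟨C ^ (1 / 2 : ℝ), by finiteness, fun {θ} hθ {G} hG hfin => ?_⟩
  have hM : (n : ℝ) < n + 1 := by linarith
  obtain ⟨g, hg, hgD, hgn⟩ := exists_of_distLpNorm_lt_top one_le_two hfin
  have hs : ∀ k, ContDiff ℝ ∞ fun ξ => P.symbol k ξ * bw (-t) ξ :=
    fun k => (P.symbol_smooth k).mul (bw_smooth _)
  have hc : ∀ k, HasCompactSupport fun ξ => P.symbol k ξ * bw (-t) ξ :=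
    fun k => (P.symbol_compact k).mul_right
  have key := tsum_eLpNorm_op_two_le hs hc (c := fun k => pw (k * t) ^ 2) (C := C)
    (fun k => by finiteness [pw_ne_top (k * t)]) hC (fun ξ => by
      refine le_trans (ENNReal.tsum_le_tsum fun k => ?_) (h ξ)
      rw [enorm_mul, enorm_mul]
      gcongr
      rw [← ofReal_norm, ← ofReal_norm]
      exact ENNReal.ofReal_le_ofReal (P.symbol_bound k ξ)) hg
  have e : ∀ k, op (fun ξ => P.symbol k ξ * bw (-t) ξ) g =ᵐ[volume] op (P.symbol k) θ := by
    intro k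
    have m1 := memLp_op hM one_le_two (Symb.of_smooth _ (hs k) (hc k)) hg
    have m2 := memLp_op hM one_le_two
      (Symb.of_smooth _ (P.symbol_smooth k) (P.symbol_compact k)) hθ
    refine ae_eq_of_test (m1.locallyIntegrable one_le_two) (m2.locallyIntegrable one_le_two)
      fun ψ _ => ?_
    rw [← fourierMultiplier_apply_of_function hM (hs k) (hc k)
        (WInt.of_memLp hM one_le_two hg) hgD,
      ← fourierMultiplier_apply_of_function hM (P.symbol_smooth k) (P.symbol_compact k)
        (WInt.of_memLp hM one_le_two hθ) hG]
    have h1 : besselPotential (Space n) ℂ (-t) (besselPotential (Space n) ℂ t G) = G := by simp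
    nth_rewrite 2 [← h1]
    rw [show besselPotential (Space n) ℂ (-t) = TemperedDistribution.fourierMultiplierCLM ℂ
        (bw (-t))
      from rfl, TemperedDistribution.fourierMultiplierCLM_fourierMultiplierCLM_apply
        (bw_temperate _) ((P.symbol_compact k).hasTemperateGrowth (P.symbol_smooth k)), mul_comm]
    rfl
  simp only [eLpNorm_congr_ae (e _), ← mul_pow] at key
  rw [← eLpNorm_count_two] at key
  have h2 := ENNReal.rpow_le_rpow key (by norm_num : (0 : ℝ) ≤ 1 / 2)
  rw [ENNReal.mul_rpow_of_nonneg _ _ (by norm_num), ← ENNReal.rpow_natCast, ← ENNReal.rpow_mul,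
    ← ENNReal.rpow_natCast, ← ENNReal.rpow_mul] at h2
  norm_num at h2
  have h3 : eLpNorm (fun k : ℕ => pw (k * t) * eLpNorm (op (P.symbol k) θ) 2 volume) 2
      Measure.count ≤ C ^ (1 / 2 : ℝ) * eLpNorm g 2 volume := by simpa using h2
  exact h3.trans (by gcongr; exact hgn)

/-- The Bessel potential of Schwartz functions, with values in `L²`. -/
def _root_.RieszCommutator.besselL2 (s : ℝ) :
    𝓢(Space n, ℂ) →ₗ[ℂ] Lp ℂ 2 (volume : Measure (Space n)) where
  toFun ψ := (bessel s ψ).toLp 2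
  map_add' a b := by
    have : bessel s (a + b) = bessel s a + bessel s b := by
      simp only [bessel, FourierTransform.fourierInv_add, map_add, FourierTransform.fourier_add]
    rw [this]; rfl
  map_smul' c a := by
    have : bessel s (c • a) = c • bessel s a := by
      simp only [bessel, FourierTransform.fourierInv_smul, map_smul, FourierTransform.fourier_smul]
    rw [this]; rfl

lemma _root_.RieszCommutator.besselL2_apply (s : ℝ) (ψ : 𝓢(Space n, ℂ)) :
    besselL2 s ψ = (bessel s ψ).toLp 2 := rfl

/-- The Hahn-Banach theorem and the Riesz representation theorem combined. -/
lemma _root_.RieszCommutator.exists_inner_eq_of_bound {V H : Type*} [AddCommGroup V] [Module ℂ V]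
    [NormedAddCommGroup H] [InnerProductSpace ℂ H] [CompleteSpace H] (T : V →ₗ[ℂ] ℂ)
    (L : V →ₗ[ℂ] H) {K : ℝ} (hK : 0 ≤ K) (h : ∀ v, ‖T v‖ ≤ K * ‖L v‖) :
    ∃ y : H, ‖y‖ ≤ K ∧ ∀ v, T v = inner ℂ y (L v) := by
  have hker : LinearMap.ker L ≤ LinearMap.ker T := fun v hv => by
    rw [LinearMap.mem_ker] at hv ⊢
    have := h v
    rw [hv, norm_zero, mul_zero] at this
    exact norm_le_zero_iff.1 this
  let ℓ : LinearMap.range L →ₗ[ℂ] ℂ :=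
    (LinearMap.ker L).liftQ T hker ∘ₗ L.quotKerEquivRange.symm.toLinearMap
  have hℓ : ∀ v : V, ℓ ⟨L v, LinearMap.mem_range_self L v⟩ = T v := fun v => by
    have h1 := LinearMap.quotKerEquivRange_symm_apply_image L v (LinearMap.mem_range_self L v)
    have h2 : ℓ ⟨L v, LinearMap.mem_range_self L v⟩ = (LinearMap.ker L).liftQ T hker
      (L.quotKerEquivRange.symm ⟨L v, LinearMap.mem_range_self L v⟩) := rfl
    rw [h2, h1]
    simp
  let ℓc : StrongDual ℂ (LinearMap.range L) := ℓ.mkContinuous K (by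
    rintro ⟨_, v, rfl⟩
    rw [hℓ]
    exact h v)
  obtain ⟨g, hg, hgn⟩ := exists_extension_norm_eq (LinearMap.range L) ℓc
  refine ⟨(InnerProductSpace.toDual ℂ H).symm g, ?_, fun v => ?_⟩
  · rw [LinearIsometryEquiv.norm_map, hgn]
    exact LinearMap.mkContinuous_norm_le _ hK _
  · rw [InnerProductSpace.toDual_symm_apply, ← hℓ]
    exact (hg ⟨L v, LinearMap.mem_range_self L v⟩).symm

/-- A functional on test functions that is bounded by `A` in terms of the Littlewood-Paley blocks
extends to an element of `H^s`, with norm a multiple of `A`: it is bounded with respect to the `L²`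
norm of the Bessel potential of order `-s`, so it is represented by a square integrable function. -/
lemma exists_sobolev_extension (s : ℝ) : ∃ C : ℝ≥0∞, C ≠ ⊤ ∧
    ∀ (T : (Space n → ℂ) → ℂ)
      (_ : ∀ ψ φ : 𝓢(Space n, ℂ), HasCompactSupport ψ → HasCompactSupport φ →
        T (fun x => ψ x + φ x) = T ψ + T φ)
      (_ : ∀ (c : ℂ) (ψ : 𝓢(Space n, ℂ)), HasCompactSupport ψ → T (fun x => c * ψ x) = c * T ψ)
      {A : ℝ≥0∞} (_ : A ≠ ⊤)
      (_ : ∀ ψ : 𝓢(Space n, ℂ), HasCompactSupport ψ → ‖T ψ‖ₑ ≤ A *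
        eLpNorm (fun j : ℕ => pw (j * -s) * eLpNorm (op (P.symT j) ψ) 2 volume) 2 Measure.count),
    ∃ F : 𝓢'(Space n, ℂ), Extends F T ∧ sobolevNorm s F ≤ C * A := by
  obtain ⟨C, hC, hb⟩ := P.exists_blocks_le_bessel (-s)
  refine ⟨C, hC, fun T hadd hsmul {A} hA hT => ?_⟩
  let V : Submodule ℂ 𝓢(Space n, ℂ) :=
    { carrier := {ψ | HasCompactSupport (ψ : Space n → ℂ)}
      add_mem' := fun {a b} ha hb => HasCompactSupport.add ha hb
      zero_mem' := HasCompactSupport.zero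
      smul_mem' := fun c ψ hψ => HasCompactSupport.smul_left (f := fun _ => c) hψ }
  let L : V →ₗ[ℂ] Lp ℂ 2 (volume : Measure (Space n)) := (besselL2 (-s)).domRestrict V
  let T' : V →ₗ[ℂ] ℂ :=
    { toFun := fun v => T v.1
      map_add' := fun a b => hadd a.1 b.1 a.2 b.2
      map_smul' := fun c a => hsmul c a.1 a.2 }
  have hbound : ∀ v : V, ‖T' v‖ ≤ (C * A).toReal * ‖L v‖ := fun v => by
    have h1 := (hT v.1 v.2).trans (mul_le_mul_right (hb v.1) A)
    rw [← mul_assoc, mul_comm A] at h1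
    have h2 := ENNReal.toReal_mono (by
      have := ((bessel (-s) v.1).memLp 2 volume).2.ne
      finiteness) h1
    rw [toReal_enorm, ENNReal.toReal_mul] at h2
    have h3 : ‖L v‖ = (eLpNorm (bessel (-s) v.1) 2 volume).toReal := by
      rw [show L v = (bessel (-s) v.1).toLp 2 from besselL2_apply _ _, SchwartzMap.norm_toLp]
    rw [h3]
    exact h2
  -- the functional is represented by `y ∈ L²`, and `F` is the Bessel potential of order `-s` of
  -- `conj y`
  obtain ⟨y, hyn, hy⟩ := exists_inner_eq_of_bound T' L ENNReal.toReal_nonneg hbound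
  have hym : MemLp (fun x => (starRingEnd ℂ) (y x)) 2 volume := (Lp.memLp y).star
  let D : 𝓢'(Space n, ℂ) := Lp.toTemperedDistribution (hym.toLp _)
  have hD : ∀ ψ : 𝓢(Space n, ℂ), D ψ = ∫ x, ψ x * (starRingEnd ℂ) (y x) := fun ψ => by
    change Lp.toTemperedDistribution (hym.toLp _) ψ = _
    rw [Lp.toTemperedDistribution_apply]
    refine integral_congr_ae ?_
    filter_upwards [hym.coeFn_toLp] with x hx
    rw [hx]; rfl
  refine ⟨besselPotential (Space n) ℂ (-s) D, fun ψ hψ => ?_, ?_⟩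
  · rw [besselPotential_apply, hD]
    have h1 := (hy ⟨ψ, hψ⟩).symm
    rw [L2.inner_def] at h1
    refine Eq.trans ?_ h1
    refine integral_congr_ae ?_
    have h3 : L ⟨ψ, hψ⟩ = (bessel (-s) ψ).toLp 2 := besselL2_apply _ _
    rw [h3]
    filter_upwards [(bessel (-s) ψ).coeFn_toLp 2 volume] with x hx
    rw [hx, RCLike.inner_apply]
  · have h1 : besselPotential (Space n) ℂ s (besselPotential (Space n) ℂ (-s) D) = D := by simp
    rw [sobolevNorm, h1]
    refine (distLpNorm_le hym hD).trans ?_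
    have h2 : eLpNorm (fun x => (starRingEnd ℂ) (y x)) 2 volume = eLpNorm y 2 volume := by
      refine eLpNorm_congr_norm_ae (Eventually.of_forall fun x => ?_)
      simp
    rw [h2]
    rw [Lp.norm_def] at hyn
    exact (ENNReal.toReal_le_toReal (Lp.memLp y).2.ne (by finiteness)).1 hyn

end DyadicPartition

namespace RieszCommutator

variable {n : ℕ}

/-! ### Bounds for the localized multipliers -/

/-- The kernel of `σ` has the size of a multiplier of degree `d` localized at frequency `2^k`. -/
structure Bds (C : ℝ≥0∞) (d : ℝ) (k : ℕ) (σ : Space n → ℂ) : Prop where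
  one : N1 σ ≤ C * pw (k * d)
  two : N2 σ ≤ C * pw (k * (d - 1))
  three : N3 σ ≤ C * pw (k * (d - 2))
  lip : LipLp 1 (C * pw (k * (d + 1))) (𝓕⁻ σ)

lemma Bds.mono {C D : ℝ≥0∞} {d : ℝ} {k : ℕ} {σ : Space n → ℂ} (h : Bds C d k σ) (hCD : C ≤ D) :
    Bds D d k σ :=
  ⟨h.one.trans (by gcongr), h.two.trans (by gcongr), h.three.trans (by gcongr),
    h.lip.mono (by gcongr)⟩

end RieszCommutator

namespace DyadicPartition

open RieszCommutator

variable {n : ℕ} (P : DyadicPartition n)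

lemma symbol_bds {d : ℝ} {h : Space n → ℂ} (hh : Homog d h) : ∃ C : ℝ≥0∞, C ≠ ⊤ ∧
    ∀ k, k ≠ 0 → Bds C d k (fun ξ => P.symbol k ξ * h ξ) ∧
      Bds C d k (fun ξ => P.symT k ξ * h ξ) := by
  obtain ⟨C1, hC1, h1⟩ := P.shell_shell.bounds hh
  obtain ⟨C2, hC2, h2⟩ := P.shell_shellT.bounds hh
  refine ⟨max C1 C2, by simp [hC1, hC2], fun k hk => ?_⟩
  obtain ⟨k, rfl⟩ := Nat.exists_eq_succ_of_ne_zero hk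
  refine ⟨?_, ?_⟩
  · obtain ⟨b1, b2, b3, b4⟩ := h1 k
    simp only [Nat.succ_eq_add_one, P.symbol_succ]
    exact Bds.mono ⟨b1, b2, b3, b4⟩ (le_max_left _ _)
  · obtain ⟨b1, b2, b3, b4⟩ := h2 k
    exact Bds.mono ⟨b1, b2, b3, b4⟩ (le_max_right _ _)

lemma symbol_symb {M d : ℝ} (hM : 0 ≤ M) {h : Space n → ℂ} (hh : Homog d h) {k : ℕ} (hk : k ≠ 0) :
    Symb M (fun ξ => P.symbol k ξ * h ξ) := by
  obtain ⟨k, rfl⟩ := Nat.exists_eq_succ_of_ne_zero hk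
  simp only [Nat.succ_eq_add_one, P.symbol_succ]
  exact P.shell_shell.symb hh hM k

lemma symT_symb {M d : ℝ} (hM : 0 ≤ M) {h : Space n → ℂ} (hh : Homog d h) {k : ℕ} (hk : k ≠ 0) :
    Symb M (fun ξ => P.symT k ξ * h ξ) := by
  obtain ⟨k, rfl⟩ := Nat.exists_eq_succ_of_ne_zero hk
  exact P.shell_shellT.symb hh hM k

lemma symbol_symb' {M d : ℝ} (hM : 0 ≤ M) {h : Space n → ℂ} (hh : Homog d h)
    (hl : Symb M (fun ξ => P.low ξ * h ξ)) (k : ℕ) : Symb M (fun ξ => P.symbol k ξ * h ξ) := by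
  rcases eq_or_ne k 0 with rfl | hk
  · exact hl
  · exact P.symbol_symb hM hh hk

lemma symT_symb' {M d : ℝ} (hM : 0 ≤ M) {h : Space n → ℂ} (hh : Homog d h)
    (hl : Symb M (fun ξ => P.low ξ * h ξ)) (k : ℕ) : Symb M (fun ξ => P.symT k ξ * h ξ) := by
  rcases eq_or_ne k 0 with rfl | hk
  · have h1 := hl.add (P.symbol_symb hM hh one_ne_zero)
    convert h1 using 2 with ξ
    rw [← add_mul]
    congr 1
    rw [show P.symbol 1 ξ = P.shell ξ by simpa using P.symbol_succ 0 ξ]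
    exact P.lowT_eq ξ
  · exact P.symT_symb hM hh hk

lemma N1_bds {M d : ℝ} (hn : n < M) {h : Space n → ℂ} (hh : Homog d h)
    (hl : Symb M (fun ξ => P.low ξ * h ξ)) : ∃ C : ℝ≥0∞, C ≠ ⊤ ∧
    ∀ k : ℕ, N1 (fun ξ => P.symbol k ξ * h ξ) ≤ C * pw (k * d) ∧
      N1 (fun ξ => P.symT k ξ * h ξ) ≤ C * pw (k * d) := by
  have hM : 0 ≤ M := (Nat.cast_nonneg n).trans hn.le
  obtain ⟨C, hC, hb⟩ := P.symbol_bds hh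
  have h0 := N1_lt_top hn (P.symbol_symb' hM hh hl 0)
  have h1 := N1_lt_top hn (P.symT_symb' hM hh hl 0)
  refine ⟨C + (N1 (fun ξ => P.symbol 0 ξ * h ξ) + N1 (fun ξ => P.symT 0 ξ * h ξ)),
    by finiteness [h0.ne, h1.ne], fun k => ?_⟩
  rcases eq_or_ne k 0 with rfl | hk
  · simp only [Nat.cast_zero, zero_mul, pw_zero, mul_one]
    exact ⟨le_add_left le_self_add, le_add_left le_add_self⟩
  · exact ⟨(hb k hk).1.one.trans (by gcongr; exact le_self_add),
      (hb k hk).2.one.trans (by gcongr; exact le_self_add)⟩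

lemma symbol_symb_one (M : ℝ) (k : ℕ) : Symb M (P.symbol k) :=
  Symb.of_smooth M (P.symbol_smooth k) (P.symbol_compact k)

lemma symT_symb_one (M : ℝ) (k : ℕ) : Symb M (P.symT k) :=
  Symb.of_smooth M (P.symT_smooth k) (P.symT_compact k)

/-- The multipliers of degree zero. -/
lemma one_bds : ∃ C : ℝ≥0∞, C ≠ ⊤ ∧ ∀ k : ℕ, N1 (P.symbol k) ≤ C ∧ N1 (P.symT k) ≤ C ∧
    (k ≠ 0 → N2 (P.symbol k) ≤ C * pw (-k) ∧ N2 (P.symT k) ≤ C * pw (-k) ∧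
      LipLp 1 (C * pw k) (𝓕⁻ (P.symT k))) := by
  obtain ⟨C1, hC1, h1⟩ := P.N1_bds (M := n + 1) (by linarith) Homog.one
    (by simpa using P.low_symb (n + 1))
  obtain ⟨C2, hC2, h2⟩ := P.symbol_bds (n := n) Homog.one
  simp only [mul_one, mul_zero, pw_zero] at h1 h2
  refine ⟨max C1 C2, by simp [hC1, hC2], fun k => ⟨(h1 k).1.trans (le_max_left _ _),
    (h1 k).2.trans (le_max_left _ _), fun hk => ⟨?_, ?_, ?_⟩⟩⟩
  · have := (h2 k hk).1.two
    rw [zero_sub, mul_neg_one] at this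
    exact this.trans (by gcongr; exact le_max_right _ _)
  · have := (h2 k hk).2.two
    rw [zero_sub, mul_neg_one] at this
    exact this.trans (by gcongr; exact le_max_right _ _)
  · have := (h2 k hk).2.lip
    rw [zero_add, mul_one] at this
    exact this.mono (by gcongr; exact le_max_right _ _)

/-! ### Commutator blocks -/

/-- The block of index `j` of `h(D)(u f) - u g`, where `g` stands for `h(D) f`. -/
def cblk (h : Space n → ℂ) (j : ℕ) (u f g : Space n → ℂ) (x : Space n) : ℂ :=
  op (fun ξ => P.symbol j ξ * h ξ) (fun y => u y * f y) x - op (P.symbol j) (fun y => u y * g y) x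

variable {P}

lemma cblk_aesm {M : ℝ} (hn : n < M) {h : Space n → ℂ} {j : ℕ}
    (hS : Symb M (fun ξ => P.symbol j ξ * h ξ)) {u f g : Space n → ℂ}
    (hf : WInt M (fun y => u y * f y)) (hg : WInt M (fun y => u y * g y)) :
    WInt M (P.cblk h j u f g) :=
  (hf.op hn hS).sub (hg.op hn (P.symbol_symb_one M j))

/-- If `u` is Lipschitz and `σ_j h(D) f = σ_j g`, the block is a difference of two commutators of
`u` with the localized multipliers. -/
lemma eLpNorm_cblk_le_com {M : ℝ} (hn : n < M) {h : Space n → ℂ} {j : ℕ}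
    (hS : Symb M (fun ξ => P.symbol j ξ * h ξ)) {p q r A : ℝ≥0∞} [ENNReal.HolderTriple p q r]
    (hr : 1 ≤ r) {u f g : Space n → ℂ} (hum : AEStronglyMeasurable u volume) (hu : LipLp p A u)
    (hf : WInt M f) (hg : WInt M g) (huf : WInt M (fun y => u y * f y))
    (hug : WInt M (fun y => u y * g y))
    (hfg : op (fun ξ => P.symbol j ξ * h ξ) f = op (P.symbol j) g) :
    eLpNorm (P.cblk h j u f g) r volume ≤ N2 (fun ξ => P.symbol j ξ * h ξ) * A * eLpNorm f q volume
      + N2 (P.symbol j) * A * eLpNorm g q volume := by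
  have hM : 0 ≤ M := (Nat.cast_nonneg n).trans hn.le
  have hS1 := P.symbol_symb_one M j
  have e : P.cblk h j u f g = fun x => com (fun ξ => P.symbol j ξ * h ξ) u f x
      - com (P.symbol j) u g x := by
    ext x
    rw [cblk, com, com, hfg]; ring
  have m1 : AEStronglyMeasurable (com (fun ξ => P.symbol j ξ * h ξ) u f) volume :=
    (huf.op hn hS).meas.sub (hum.mul (hf.op hn hS).meas)
  have m2 : AEStronglyMeasurable (com (P.symbol j) u g) volume :=
    (hug.op hn hS1).meas.sub (hum.mul (hg.op hn hS1).meas)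
  rw [e]
  exact (eLpNorm_sub_le m1 m2 hr).trans
    (add_le_add (eLpNorm_com_le hM hr hS hf huf hum hu) (eLpNorm_com_le hM hr hS1 hg hug hum hu))

/-- Multiplying by `u` a function localized at a high frequency `2^q`, only the commutator of `u`
with the localization contributes to low frequencies. -/
lemma eLpNorm_op_mul_le_com {M : ℝ} (hn : n < M) {σ τ : Space n → ℂ} (hσ : Symb M σ)
    (hτ : Symb M τ) (hστ : ∀ ξ, σ ξ * τ ξ = 0) {p q r A : ℝ≥0∞} [ENNReal.HolderTriple p q r]
    (hr : 1 ≤ r) {u f : Space n → ℂ} (hum : AEStronglyMeasurable u volume) (hu : LipLp p A u)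
    (hf : WInt M f) (huf : WInt M (fun y => u y * f y)) (hfτ : op τ f = f) :
    eLpNorm (op σ (fun y => u y * f y)) r volume ≤ N1 σ * (N2 τ * A * eLpNorm f q volume) := by
  have hM : 0 ≤ M := (Nat.cast_nonneg n).trans hn.le
  have h0 : op σ (op τ (fun y => u y * f y)) = fun _ => 0 := by
    rw [op_op hn hσ hτ huf]
    simp only [hστ]
    exact op_zero _
  have e1 : com τ u f = fun x => op τ (fun y => u y * f y) x - u x * f x := by
    ext x; rw [com, hfτ]
  have e : op σ (fun y => u y * f y) = fun x => -op σ (com τ u f) x := by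
    ext x
    rw [e1, op, op, cv_sub hM hσ.decay (huf.op hn hτ) huf]
    have := congrFun h0 x
    rw [op] at this
    rw [this]; ring
  have hw : WInt M (com τ u f) := by rw [e1]; exact (huf.op hn hτ).sub huf
  rw [e]
  refine (eLpNorm_neg (op σ (com τ u f)) r volume).le.trans ?_
  refine (eLpNorm_op_le hr hσ hw.meas).trans ?_
  gcongr
  exact eLpNorm_com_le hM hr hτ hf huf hum hu

lemma eLpNorm_cblk_le_of_high {M : ℝ} (hn : n < M) {h : Space n → ℂ} {j k : ℕ}
    (hS : Symb M (fun ξ => P.symbol j ξ * h ξ)) (hjk : j + 3 ≤ k)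
    {p q r A : ℝ≥0∞} [ENNReal.HolderTriple p q r]
    (hr : 1 ≤ r) {u f g : Space n → ℂ} (hum : AEStronglyMeasurable u volume) (hu : LipLp p A u)
    (hf : WInt M f) (hg : WInt M g) (huf : WInt M (fun y => u y * f y))
    (hug : WInt M (fun y => u y * g y)) (hfk : op (P.symT k) f = f) (hgk : op (P.symT k) g = g) :
    eLpNorm (P.cblk h j u f g) r volume
      ≤ N1 (fun ξ => P.symbol j ξ * h ξ) * (N2 (P.symT k) * A * eLpNorm f q volume)
      + N1 (P.symbol j) * (N2 (P.symT k) * A * eLpNorm g q volume) := by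
  have hS1 := P.symbol_symb_one M j
  have hST := P.symT_symb_one M k
  have h0 := P.symbol_mul_symT_eq_zero hjk
  refine (eLpNorm_sub_le (huf.op hn hS).meas (hug.op hn hS1).meas hr).trans (add_le_add ?_ ?_)
  · exact eLpNorm_op_mul_le_com hn hS hST (fun ξ => by rw [mul_right_comm, h0, zero_mul]) hr hum hu
      hf huf hfk
  · exact eLpNorm_op_mul_le_com hn hS1 hST h0 hr hum hu hg hug hgk

lemma eLpNorm_cblk_le_mul {M : ℝ} (hn : n < M) {h : Space n → ℂ} {j : ℕ}
    (hS : Symb M (fun ξ => P.symbol j ξ * h ξ)) {p q r : ℝ≥0∞} [ENNReal.HolderTriple p q r]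
    (hr : 1 ≤ r) {u f g : Space n → ℂ} (hum : AEStronglyMeasurable u volume)
    (hf : AEStronglyMeasurable f volume) (hg : AEStronglyMeasurable g volume)
    (huf : WInt M (fun y => u y * f y)) (hug : WInt M (fun y => u y * g y)) :
    eLpNorm (P.cblk h j u f g) r volume ≤ eLpNorm u p volume *
      (N1 (fun ξ => P.symbol j ξ * h ξ) * eLpNorm f q volume
        + N1 (P.symbol j) * eLpNorm g q volume) := by
  have hS1 := P.symbol_symb_one M j
  refine (eLpNorm_sub_le (huf.op hn hS).meas (hug.op hn hS1).meas hr).trans ?_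
  rw [mul_add]
  have h1 := eLpNorm_smul_le_mul_eLpNorm (p := p) (q := q) (r := r) hf hum
  have h2 := eLpNorm_smul_le_mul_eLpNorm (p := p) (q := q) (r := r) hg hum
  refine add_le_add ?_ ?_
  · refine (eLpNorm_op_le hr hS huf.meas).trans ?_
    rw [mul_left_comm]
    gcongr
    exact h1
  · refine (eLpNorm_op_le hr hS1 hug.meas).trans ?_
    rw [mul_left_comm]
    gcongr
    exact h2

lemma cblk_sum_right {M : ℝ} (hn : n < M) {h : Space n → ℂ} {j : ℕ}
    (hS : Symb M (fun ξ => P.symbol j ξ * h ξ)) {ι : Type*} (s : Finset ι) {u : Space n → ℂ}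
    {f g : ι → Space n → ℂ} (hf : ∀ i ∈ s, WInt M (fun y => u y * f i y))
    (hg : ∀ i ∈ s, WInt M (fun y => u y * g i y)) :
    P.cblk h j u (fun y => ∑ i ∈ s, f i y) (fun y => ∑ i ∈ s, g i y)
      = fun x => ∑ i ∈ s, P.cblk h j u (f i) (g i) x := by
  have hM : 0 ≤ M := (Nat.cast_nonneg n).trans hn.le
  ext x
  simp only [cblk, op, Finset.mul_sum]
  rw [cv_sum hM s hS.decay hf, cv_sum hM s (P.symbol_symb_one M j).decay hg,
    Finset.sum_sub_distrib]

lemma cblk_sum_left {M : ℝ} (hn : n < M) {h : Space n → ℂ} {j : ℕ}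
    (hS : Symb M (fun ξ => P.symbol j ξ * h ξ)) {ι : Type*} (s : Finset ι) {u : ι → Space n → ℂ}
    {f g : Space n → ℂ} (hf : ∀ i ∈ s, WInt M (fun y => u i y * f y))
    (hg : ∀ i ∈ s, WInt M (fun y => u i y * g y)) :
    P.cblk h j (fun y => ∑ i ∈ s, u i y) f g
      = fun x => ∑ i ∈ s, P.cblk h j (u i) f g x := by
  have hM : 0 ≤ M := (Nat.cast_nonneg n).trans hn.le
  ext x
  simp only [cblk, op, Finset.sum_mul]
  rw [cv_sum hM s hS.decay hf, cv_sum hM s (P.symbol_symb_one M j).decay hg,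
    Finset.sum_sub_distrib]

end DyadicPartition

namespace RieszCommutator

variable {n : ℕ}

lemma op_mul_op_comm {M : ℝ} (hn : n < M) {σ τ h θ : Space n → ℂ} (hσ : Symb M σ) (hτ : Symb M τ)
    (hσh : Symb M (fun ξ => σ ξ * h ξ)) (hτh : Symb M (fun ξ => τ ξ * h ξ)) (hθ : WInt M θ) :
    op (fun ξ => σ ξ * h ξ) (op τ θ) = op σ (op (fun ξ => τ ξ * h ξ) θ) := by
  rw [op_op hn hσh hτ hθ, op_op hn hσ hτh hθ]
  congr 1
  ext ξ; ring

end RieszCommutator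

namespace DyadicPartition

open RieszCommutator

variable {n : ℕ} {P : DyadicPartition n}

/-! ### Estimates for the commutator with one block -/

lemma op_symT_block {M : ℝ} (hn : n < M) {h θ : Space n → ℂ} {k : ℕ}
    (hS : Symb M (fun ξ => P.symbol k ξ * h ξ)) (hθ : WInt M θ) :
    op (P.symT k) (op (fun ξ => P.symbol k ξ * h ξ) θ) = op (fun ξ => P.symbol k ξ * h ξ) θ := by
  rw [op_op hn (P.symT_symb_one M k) hS hθ]
  congr 1
  ext ξ
  rw [← mul_assoc, mul_comm (P.symT k ξ), symbol_mul_symT]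

lemma op_symT_symbol {M : ℝ} (hn : n < M) {θ : Space n → ℂ} (k : ℕ) (hθ : WInt M θ) :
    op (P.symT k) (op (P.symbol k) θ) = op (P.symbol k) θ := by
  have := op_symT_block (P := P) (h := fun _ => 1) hn (by simpa using P.symbol_symb_one M k) hθ
  simpa using this

lemma op_symT_mul_symbol {M : ℝ} (hn : n < M) {h θ : Space n → ℂ} {k : ℕ}
    (hS : Symb M (fun ξ => P.symT k ξ * h ξ)) (hθ : WInt M θ) :
    op (fun ξ => P.symT k ξ * h ξ) (op (P.symbol k) θ) = op (fun ξ => P.symbol k ξ * h ξ) θ := by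
  rw [op_op hn hS (P.symbol_symb_one M k) hθ]
  congr 1
  ext ξ
  rw [mul_right_comm, mul_comm (P.symT k ξ), symbol_mul_symT]

/-- The commutator of a Lipschitz function with a multiplier of degree `d < 1`, applied to a
frequency block: the bound is governed by the larger of the two frequencies. -/
lemma exists_block_estimate {M d : ℝ} (hn : n < M) (hd0 : 0 ≤ d) {h : Space n → ℂ}
    (hh : Homog d h) (hl : Symb M (fun ξ => P.low ξ * h ξ)) : ∃ C : ℝ≥0∞, C ≠ ⊤ ∧
    ∀ {p q r A : ℝ≥0∞} [ENNReal.HolderTriple p q r] (_ : 1 ≤ r) (_ : 1 ≤ q) {u θ : Space n → ℂ}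
      (_ : AEStronglyMeasurable u volume) (_ : LipLp p A u) (_ : WInt M θ) {j k : ℕ}
      (_ : WInt M (fun y => u y * op (P.symbol k) θ y))
      (_ : WInt M (fun y => u y * op (fun ξ => P.symbol k ξ * h ξ) θ y)) (_ : j ≠ 0 ∨ 3 ≤ k),
    eLpNorm (P.cblk h j u (op (P.symbol k) θ) (op (fun ξ => P.symbol k ξ * h ξ) θ)) r volume
      ≤ C * A * (pw (-(1 - d) * max (j : ℝ) k) * eLpNorm (op (P.symbol k) θ) q volume) := by
  have hM : 0 ≤ M := (Nat.cast_nonneg n).trans hn.le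
  obtain ⟨C1, hC1, b1⟩ := P.symbol_bds hh
  obtain ⟨C2, hC2, b2⟩ := P.N1_bds hn hh hl
  obtain ⟨C3, hC3, b3⟩ := P.one_bds
  refine ⟨C1 * pw (2 * |1 - d|) + C3 * C2 * (pw (2 * d) * pw (2 * |1 - d|)) + C2 * C3 + C3 * C3 *
      C2, ?_, ?_⟩
  · finiteness [pw_ne_top (2 * |1 - d|), pw_ne_top (2 * d)]
  intro p q r A _ hr hq u θ hum hu hθ j k huf hug hjk
  have hS := fun k => P.symbol_symb' hM hh hl k
  have hST := fun k => P.symT_symb' hM hh hl k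
  have hf := hθ.op hn (P.symbol_symb_one M k)
  have hg := hθ.op hn (hS k)
  set f := op (P.symbol k) θ with hf_def
  set g := op (fun ξ => P.symbol k ξ * h ξ) θ with hg_def
  set t := eLpNorm f q volume
  have hgt : eLpNorm g q volume ≤ C2 * pw (k * d) * t := by
    rw [hg_def, ← op_symT_mul_symbol hn (hST k) hθ]
    exact (eLpNorm_op_le hq (hST k) hf.meas).trans (by gcongr; exact (b2 k).2)
  -- the input frequency is at most comparable to the output frequency, or it is much larger
  rcases Nat.lt_or_ge k (j + 3) with hkj | hkj
  · have hj : j ≠ 0 := by rcases hjk with h | h; exacts [h, by omega]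
    have hfg : op (fun ξ => P.symbol j ξ * h ξ) f = op (P.symbol j) g :=
      op_mul_op_comm hn (P.symbol_symb_one M j) (P.symbol_symb_one M k) (hS j) (hS k) hθ
    have e1 : pw (j * (d - 1)) ≤ pw (2 * |1 - d|) * pw (-(1 - d) * max (j : ℝ) k) := by
      rw [← pw_add]
      refine pw_mono ?_
      have h1 : max (j : ℝ) k - j ≤ 2 := by
        have : (k : ℝ) ≤ j + 2 := by exact_mod_cast (by omega : k ≤ j + 2)
        rcases max_cases (j : ℝ) k with h | h <;> linarith [h.1]
      have h2 : 0 ≤ max (j : ℝ) k - j := by linarith [le_max_left (j : ℝ) k]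
      have h3 : (1 - d) * (max (j : ℝ) k - j) ≤ |1 - d| * 2 :=
        mul_le_mul (le_abs_self _) h1 h2 (abs_nonneg _)
      linarith
    have e2 : pw (-j) * pw (k * d) ≤ pw (2 * d) *
        (pw (2 * |1 - d|) * pw (-(1 - d) * max (j : ℝ) k)) := by
      refine le_trans ?_ (mul_le_mul_right e1 _)
      rw [← pw_add, ← pw_add]
      refine pw_mono ?_
      have : (k : ℝ) ≤ j + 2 := by exact_mod_cast (by omega : k ≤ j + 2)
      nlinarith
    refine (eLpNorm_cblk_le_com (q := q) hn (hS j) hr hum hu hf hg huf hug hfg).trans ?_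
    calc _ ≤ (C1 * pw (j * (d - 1))) * A * t + C3 * pw (-j) * A * (C2 * pw (k * d) * t) := by
          gcongr
          · exact (b1 j hj).1.two
          · exact ((b3 j).2.2 hj).1
      _ = (C1 * pw (j * (d - 1)) + C3 * C2 * (pw (-j) * pw (k * d))) * A * t := by ring
      _ ≤ (C1 * (pw (2 * |1 - d|) * pw (-(1 - d) * max (j : ℝ) k)) + C3 * C2 *
            (pw (2 * d) * (pw (2 * |1 - d|) * pw (-(1 - d) * max (j : ℝ) k)))) * A * t := by gcongr
      _ = (C1 * pw (2 * |1 - d|) + C3 * C2 * (pw (2 * d) * pw (2 * |1 - d|))) * A *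
          (pw (-(1 - d) * max (j : ℝ) k) * t) := by ring
      _ ≤ _ := by
          gcongr ?_ * _ * _
          rw [add_assoc]; exact le_self_add
  · have hk0 : k ≠ 0 := by omega
    have hmax : max (j : ℝ) k = k := max_eq_right (by exact_mod_cast (by omega : j ≤ k))
    have e1 : pw (j * d) * pw (-k) ≤ pw (-(1 - d) * max (j : ℝ) k) := by
      rw [hmax, ← pw_add]
      refine pw_mono ?_
      have : (j : ℝ) ≤ k := by exact_mod_cast (by omega : j ≤ k)
      nlinarith
    have e2 : pw (-k) * pw (k * d) = pw (-(1 - d) * max (j : ℝ) k) := by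
      rw [hmax, ← pw_add]
      congr 1; ring
    refine (eLpNorm_cblk_le_of_high (q := q) hn (hS j) hkj hr hum hu hf hg huf hug
      (op_symT_symbol hn k hθ) (op_symT_block hn (hS k) hθ)).trans ?_
    calc _ ≤ C2 * pw (j * d) * (C3 * pw (-k) * A * t) +
          C3 * (C3 * pw (-k) * A * (C2 * pw (k * d) * t)) := by
          gcongr
          · exact (b2 j).1
          · exact ((b3 k).2.2 hk0).2.1
          · exact (b3 j).1
          · exact ((b3 k).2.2 hk0).2.1
      _ = (C2 * C3 * (pw (j * d) * pw (-k)) + C3 * C3 * C2 * (pw (-k) * pw (k * d))) * A * t := by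
          ring
      _ ≤ (C2 * C3 * pw (-(1 - d) * max (j : ℝ) k) + C3 * C3 * C2 * pw
          (-(1 - d) * max (j : ℝ) k)) * A * t := by
          rw [e2]; gcongr
      _ = (C2 * C3 + C3 * C3 * C2) * A * (pw (-(1 - d) * max (j : ℝ) k) * t) := by ring
      _ ≤ _ := by
          gcongr ?_ * _ * _
          rw [add_assoc (C1 * pw (2 * |1 - d|) + _)]
          exact le_add_self

/-- The lowest frequencies, where no derivative of `u` is gained and the product is estimated
directly. -/
lemma exists_low_block_estimate {M d : ℝ} (hn : n < M) (hd0 : 0 ≤ d) {h : Space n → ℂ}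
    (hh : Homog d h) (hl : Symb M (fun ξ => P.low ξ * h ξ)) : ∃ C : ℝ≥0∞, C ≠ ⊤ ∧
    ∀ {p q r : ℝ≥0∞} [ENNReal.HolderTriple p q r] (_ : 1 ≤ r) (_ : 1 ≤ q) {u θ : Space n → ℂ}
      (_ : AEStronglyMeasurable u volume) (_ : WInt M θ) {k : ℕ}
      (_ : WInt M (fun y => u y * op (P.symbol k) θ y))
      (_ : WInt M (fun y => u y * op (fun ξ => P.symbol k ξ * h ξ) θ y)) (_ : k < 3),
    eLpNorm (P.cblk h 0 u (op (P.symbol k) θ) (op (fun ξ => P.symbol k ξ * h ξ) θ)) r volume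
      ≤ C * (eLpNorm u p volume * eLpNorm (op (P.symbol k) θ) q volume) := by
  have hM : 0 ≤ M := (Nat.cast_nonneg n).trans hn.le
  obtain ⟨C2, hC2, b2⟩ := P.N1_bds hn hh hl
  obtain ⟨C3, hC3, b3⟩ := P.one_bds
  refine ⟨C2 + C3 * (C2 * pw (2 * d)), by finiteness [pw_ne_top (2 * d)], ?_⟩
  intro p q r _ hr hq u θ hum hθ k huf hug hk
  have hS := fun k => P.symbol_symb' hM hh hl k
  have hST := fun k => P.symT_symb' hM hh hl k
  have hf := hθ.op hn (P.symbol_symb_one M k)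
  have hg := hθ.op hn (hS k)
  have hgt : eLpNorm (op (fun ξ => P.symbol k ξ * h ξ) θ) q volume
      ≤ C2 * pw (2 * d) * eLpNorm (op (P.symbol k) θ) q volume := by
    rw [← op_symT_mul_symbol hn (hST k) hθ]
    refine (eLpNorm_op_le hq (hST k) hf.meas).trans ?_
    gcongr
    refine (b2 k).2.trans ?_
    gcongr
    refine pw_mono ?_
    have : (k : ℝ) ≤ 2 := by exact_mod_cast (by omega : k ≤ 2)
    gcongr
  refine (eLpNorm_cblk_le_mul (p := p) (q := q) hn (hS 0) hr hum hf.meas hg.meas huf hug).trans ?_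
  have b20 := (b2 0).1
  simp only [Nat.cast_zero, zero_mul, pw_zero, mul_one] at b20
  calc _ ≤ eLpNorm u p volume * (C2 * eLpNorm (op (P.symbol k) θ) q volume +
        C3 * (C2 * pw (2 * d) * eLpNorm (op (P.symbol k) θ) q volume)) := by
        gcongr
        exact (b3 0).1
    _ = _ := by ring

end DyadicPartition

namespace RieszCommutator

variable {n : ℕ}

lemma enorm_integral_mul_le {p q : ℝ≥0∞} [ENNReal.HolderConjugate p q] {F w : Space n → ℂ}
    (hF : AEStronglyMeasurable F volume) (hw : AEStronglyMeasurable w volume) :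
    ‖∫ x, F x * w x‖ₑ ≤ eLpNorm F p volume * eLpNorm w q volume := by
  refine (enorm_integral_le_lintegral_enorm _).trans ?_
  rw [← eLpNorm_one_eq_lintegral_enorm]
  have h := eLpNorm_smul_le_mul_eLpNorm (p := p) (q := q) (r := 1) hw hF
  exact h

lemma integrable_mul_of_memLp {p q : ℝ≥0∞} [ENNReal.HolderConjugate p q] {F w : Space n → ℂ}
    (hF : MemLp F p volume) (hw : MemLp w q volume) : Integrable (fun x => F x * w x) :=
  memLp_one_iff_integrable.1 (MemLp.smul (r := 1) hw hF)

lemma tendsto_integral_mul {p q : ℝ≥0∞} [ENNReal.HolderConjugate p q] {F : ℕ → Space n → ℂ}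
    {G w : Space n → ℂ} (hF : ∀ k, MemLp (F k) p volume) (hG : MemLp G p volume)
    (hw : MemLp w q volume)
    (h : Tendsto (fun k => eLpNorm (fun x => F k x - G x) p volume) atTop (𝓝 0)) :
    Tendsto (fun k => ∫ x, F k x * w x) atTop (𝓝 (∫ x, G x * w x)) := by
  rw [tendsto_iff_edist_tendsto_0]
  have h1 : Tendsto (fun k => eLpNorm (fun x => F k x - G x) p volume * eLpNorm w q volume) atTop
      (𝓝 0) := by
    simpa using ENNReal.Tendsto.mul_const h (Or.inr hw.2.ne)
  refine tendsto_of_tendsto_of_tendsto_of_le_of_le tendsto_const_nhds h1 (fun _ => zero_le)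
    fun k => ?_
  rw [edist_eq_enorm_sub, ← integral_sub (integrable_mul_of_memLp (hF k) hw)
    (integrable_mul_of_memLp hG hw)]
  simp only [← sub_mul]
  exact enorm_integral_mul_le ((hF k).1.sub hG.1) hw.1

end RieszCommutator

namespace DyadicPartition

open RieszCommutator

variable {n : ℕ} (P : DyadicPartition n)

/-! ### Synthesis of the blocks -/

lemma symT_neg' (k : ℕ) : (fun ξ => P.symT k (-ξ)) = P.symT k := funext (P.symT_neg k)

lemma symbol_neg' (k : ℕ) : (fun ξ => P.symbol k (-ξ)) = P.symbol k := funext (P.symbol_neg k)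

lemma cut_neg' (k : ℕ) : (fun ξ => P.cut k (-ξ)) = P.cut k := funext (P.cut_neg k)

lemma integral_block_mul {M : ℝ} (hn : n < M) {h F : Space n → ℂ} {j : ℕ}
    (hS : Symb M (fun ξ => P.symbol j ξ * h ξ)) (hF : WInt M F) (ψ : 𝓢(Space n, ℂ)) :
    ∫ x, op (fun ξ => P.symbol j ξ * h ξ) F x * op (P.symT j) ψ x
      = ∫ x, op (fun ξ => P.symbol j ξ * h ξ) F x * ψ x := by
  have h1 := integral_mul_op hn (P.symT_symb_one M j) (schwartz_decays M ψ) (hF.op hn hS)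
  rw [op_symT_block hn hS hF, symT_neg'] at h1
  simp only [mul_comm _ (op (P.symT j) ψ _), mul_comm _ (ψ _)]
  exact h1.symm

lemma sum_op_symbol {M : ℝ} (hM : 0 ≤ M) {F : Space n → ℂ} (hF : WInt M F) (J : ℕ) :
    op (P.cut J) F = fun x => ∑ j ∈ Finset.range (J + 1), op (P.symbol j) F x := by
  have h := op_symb_sum hM (Finset.range (J + 1)) (fun i _ => P.symbol_symb_one M i) hF
  rw [← h]
  congr 1
  ext ξ
  exact (P.sum_symbol J ξ).symm

/-- The localized pieces of `h(D) F`, tested against the blocks of `ψ`, sum up to `F` truncated to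
low frequencies, tested against the transpose. -/
lemma sum_integral_block {d : ℝ} (hd : 0 < d) {h F : Space n → ℂ} (hh : Mult P d h)
    (hF : WInt (n + d) F) (ψ : 𝓢(Space n, ℂ)) (J : ℕ) :
    ∑ j ∈ Finset.range (J + 1),
      ∫ x, op (fun ξ => P.symbol j ξ * h ξ) F x * op (P.symT j) ψ x
        = ∫ x, op (P.cut J) F x * tr h ψ x := by
  have hn : (n : ℝ) < n + d := by linarith
  have hM : (0 : ℝ) ≤ n + d := by positivity
  have hS := fun j => P.symbol_symb' hM hh.toHomog (P.symb_low hd hh.toHomog) j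
  have hD := hh.decays_tr hd ψ
  have e : ∀ j, ∫ x, op (fun ξ => P.symbol j ξ * h ξ) F x * op (P.symT j) ψ x
      = ∫ x, op (P.symbol j) F x * tr h ψ x := fun j => by
    rw [P.integral_block_mul hn (hS j) hF,
      hh.integral_op_mul hd ψ (P.symbol_symb_one _ j) (hS j) hF, symbol_neg']
    have h1 := integral_mul_op hn (P.symbol_symb_one (n + d) j) hD hF
    rw [symbol_neg'] at h1
    simp only [mul_comm _ (tr h ψ _), mul_comm (F _)]
    exact h1.symm
  simp only [e]
  rw [← integral_finsetSum _ fun j _ => ?_]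
  · rw [P.sum_op_symbol hM hF]
    simp only [Finset.sum_mul]
  · have := hD.integrable_mul (hF.op hn (P.symbol_symb_one _ j))
    simpa only [mul_comm] using this

lemma sum_integral_block_one {M : ℝ} (hn : n < M) {F : Space n → ℂ}
    (hF : WInt M F) (ψ : 𝓢(Space n, ℂ)) (J : ℕ) :
    ∑ j ∈ Finset.range (J + 1), ∫ x, op (P.symbol j) F x * op (P.symT j) ψ x
        = ∫ x, op (P.cut J) F x * ψ x := by
  have hM : 0 ≤ M := (Nat.cast_nonneg n).trans hn.le
  have e : ∀ j, ∫ x, op (P.symbol j) F x * op (P.symT j) ψ x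
      = ∫ x, op (P.symbol j) F x * ψ x := fun j => by
    have := P.integral_block_mul (h := fun _ => 1) (j := j) hn
      (by simpa using P.symbol_symb_one M j) hF ψ
    simpa using this
  simp only [e]
  rw [← integral_finsetSum _ fun j _ => ?_]
  · rw [P.sum_op_symbol hM hF]
    simp only [Finset.sum_mul]
  · have := (schwartz_decays M ψ).integrable_mul (hF.op hn (P.symbol_symb_one _ j))
    simpa only [mul_comm] using this

/-- The commutator with smoothed factors, tested against `ψ`, is controlled by its blocks. -/
lemma enorm_pairing_le {d : ℝ} (hd : 0 < d) {h : Space n → ℂ} (hh : Mult P d h)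
    {u f g : Space n → ℂ} (huf : MemLp (fun x => u x * f x) 2 volume)
    (hug : MemLp (fun x => u x * g x) 2 volume) (ψ : 𝓢(Space n, ℂ)) (s : ℝ) :
    ‖(∫ x, u x * f x * tr h ψ x) - ∫ x, u x * g x * ψ x‖ₑ ≤
      eLpNorm (fun j : ℕ => pw (j * s) * eLpNorm (P.cblk h j u f g) 2 volume) 2 Measure.count *
      eLpNorm (fun j : ℕ => pw (j * -s) * eLpNorm (op (P.symT j) ψ) 2 volume) 2
        Measure.count := by
  have hn : (n : ℝ) < n + d := by linarith
  have hM : (0 : ℝ) ≤ n + d := by positivity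
  have hS := fun j => P.symbol_symb' hM hh.toHomog (P.symb_low hd hh.toHomog) j
  have w1 := WInt.of_memLp hn one_le_two huf
  have w2 := WInt.of_memLp hn one_le_two hug
  have hψ := ψ.memLp 2 (volume : Measure (Space n))
  have hD := (hh.decays_tr hd ψ).memLp hn one_le_two
  have t1 := tendsto_integral_mul (fun k => memLp_op hn one_le_two (P.cut_symb hM k) huf) huf hD
    (P.tendsto_op_cut one_le_two ENNReal.ofNat_ne_top huf)
  have t2 := tendsto_integral_mul (fun k => memLp_op hn one_le_two (P.cut_symb hM k) hug) hug hψ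
    (P.tendsto_op_cut one_le_two ENNReal.ofNat_ne_top hug)
  refine le_of_tendsto (t1.sub t2).enorm (Eventually.of_forall fun J => ?_)
  rw [← P.sum_integral_block hd hh w1, ← P.sum_integral_block_one hn w2, ← Finset.sum_sub_distrib]
  have m : ∀ j, MemLp (op (P.symT j) ψ) 2 volume := fun j =>
    memLp_op hn one_le_two (P.symT_symb_one _ j) hψ
  have e : ∀ j, (∫ x, op (fun ξ => P.symbol j ξ * h ξ) (fun x => u x * f x) x * op (P.symT j) ψ x) -
      ∫ x, op (P.symbol j) (fun x => u x * g x) x * op (P.symT j) ψ x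
        = ∫ x, P.cblk h j u f g x * op (P.symT j) ψ x := fun j => by
    rw [← integral_sub (integrable_mul_of_memLp (memLp_op hn one_le_two (hS j) huf) (m j))
      (integrable_mul_of_memLp (memLp_op hn one_le_two (P.symbol_symb_one _ j) hug) (m j))]
    simp only [cblk, sub_mul]
  simp only [e]
  refine (enorm_sum_le _ _).trans (le_trans (Finset.sum_le_sum fun j _ => ?_)
    ((ENNReal.sum_le_tsum (Finset.range (J + 1))).trans (tsum_mul_le_count _ _)))
  refine (enorm_integral_mul_le (p := 2) (q := 2) (cblk_aesm hn (hS j) w1 w2).meas (m j).1).trans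
    (le_of_eq ?_)
  have : pw (j * s) * pw (j * -s) = 1 := by rw [mul_neg, mul_comm, pw_neg_mul]
  rw [mul_mul_mul_comm, this, one_mul]

/-! ### Summation over the frequencies -/

lemma _root_.RieszCommutator.eLpNorm_single_le (c : ℝ≥0∞) :
    eLpNorm (fun j : ℕ => if j = 0 then c else 0) 2 Measure.count ≤ c := by
  rw [eLpNorm_count_eq two_ne_zero ENNReal.ofNat_ne_top]
  rw [tsum_eq_single 0 (fun j hj => by simp [hj])]
  simp only [ENNReal.toReal_ofNat, if_true]
  rw [← ENNReal.rpow_mul]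
  norm_num

variable {P}

/-- The gain `2^{-a max(j, k)}` leaves a geometric kernel in `|j - k|` for `0 < s < a`. -/
lemma pw_weight_le {s a : ℝ} (j k : ℕ) :
    pw (j * s) * pw (-a * max (j : ℝ) k) ≤ pw (-(min s (a - s)) * |(j : ℝ) - k|) * pw
        (k * (s - a)) := by
  rw [← pw_add, ← pw_add]
  refine pw_mono ?_
  rcases le_total (j : ℝ) k with hjk | hjk
  · rw [max_eq_right hjk, abs_of_nonpos (by linarith)]
    nlinarith [min_le_left s (a - s)]
  · rw [max_eq_left hjk, abs_of_nonneg (by linarith)]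
    nlinarith [min_le_right s (a - s)]

/-- The sum over all frequencies of `θ` of the commutators with a Lipschitz function `u`. -/
lemma exists_lipschitz_estimate {d s : ℝ} (hd : 0 < d) (hs : 0 < s) (hsd : s < 1 - d)
    {h : Space n → ℂ} (hh : Mult P d h) : ∃ C : ℝ≥0∞, C ≠ ⊤ ∧
    ∀ {p q A : ℝ≥0∞} [ENNReal.HolderTriple p q 2] (_ : 1 ≤ q) (_ : A ≠ ⊤) {u θ : Space n → ℂ}
      (_ : AEStronglyMeasurable u volume) (_ : LipLp p A u) (_ : WInt (n + d) θ)
      (_ : ∀ k, WInt (n + d) (fun y => u y * op (P.symbol k) θ y))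
      (_ : ∀ k, WInt (n + d) (fun y => u y * op (fun ξ => P.symbol k ξ * h ξ) θ y))
      {X : ℝ≥0∞} (_ : ∀ k < 3, eLpNorm (op (P.symbol k) θ) q volume ≤ X),
    eLpNorm (fun j : ℕ => pw (j * s) * ∑' k, eLpNorm (P.cblk h j u (op (P.symbol k) θ)
        (op (fun ξ => P.symbol k ξ * h ξ) θ)) 2 volume) 2 Measure.count ≤
      C * (A * eLpNorm (fun k : ℕ => pw (k * (s - (1 - d))) * eLpNorm (op (P.symbol k) θ) q volume)
        2 Measure.count + eLpNorm u p volume * X) := by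
  have hn : (n : ℝ) < n + d := by linarith
  obtain ⟨C1, hC1, h1⟩ := exists_block_estimate (P := P) hn hd.le hh.toHomog
    (P.symb_low hd hh.toHomog)
  obtain ⟨C2, hC2, h2⟩ := exists_low_block_estimate (P := P) hn hd.le hh.toHomog
    (P.symb_low hd hh.toHomog)
  set ε := min s (1 - d - s)
  have hε : 0 < ε := lt_min hs (by linarith)
  have hg := (geo_lt_top hε).ne
  refine ⟨C1 * geo ε + 3 * C2, by finiteness, ?_⟩
  intro p q A _ hq hA u θ hum hu hθ huf hug X hX
  set t := fun k : ℕ => eLpNorm (op (P.symbol k) θ) q volume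
  set b := fun k : ℕ => pw (k * (s - (1 - d))) * t k
  set c := fun j k : ℕ => eLpNorm (P.cblk h j u (op (P.symbol k) θ)
    (op (fun ξ => P.symbol k ξ * h ξ) θ)) 2 volume
  set y := 3 * C2 * (eLpNorm u p volume * X)
  -- the block `j = 0`, `k < 3` has no gain and is collected in `y`
  have hc : ∀ j k : ℕ, pw (j * s) * c j k ≤ C1 * A * (pw (-ε * |(j : ℝ) - k|) * b k) +
      if j = 0 ∧ k < 3 then C2 * (eLpNorm u p volume * X) else 0 := by
    intro j k
    split_ifs with hjk
    · obtain ⟨rfl, hk⟩ := hjk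
      simp only [Nat.cast_zero, zero_mul, pw_zero, one_mul]
      refine le_add_left ((h2 (p := p) (q := q) one_le_two hq hum hθ (huf k) (hug k) hk).trans ?_)
      gcongr
      exact hX k hk
    · rw [add_zero]
      have h3 := h1 (p := p) (q := q) one_le_two hq hum hu hθ (huf k) (hug k) (j := j)
        (by omega)
      calc pw (j * s) * c j k ≤ pw (j * s) * (C1 * A * (pw (-(1 - d) * max (j : ℝ) k) * t k)) := by
            gcongr
        _ = C1 * A * (pw (j * s) * pw (-(1 - d) * max (j : ℝ) k) * t k) := by ring
        _ ≤ C1 * A * (pw (-ε * |(j : ℝ) - k|) * pw (k * (s - (1 - d))) * t k) := by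
            gcongr _ * ?_
            gcongr ?_ * _
            exact pw_weight_le j k
        _ = _ := by rw [mul_assoc (pw _) (pw _)]
  have hsum : ∀ j : ℕ, pw (j * s) * ∑' k, c j k ≤
      C1 * A * (∑' k : ℕ, pw (-ε * |(j : ℝ) - k|) * b k) + if j = 0 then y else 0 := by
    intro j
    rw [← ENNReal.tsum_mul_left]
    refine (ENNReal.tsum_le_tsum (hc j)).trans ?_
    rw [ENNReal.tsum_add, ENNReal.tsum_mul_left]
    gcongr
    split_ifs with hj
    · simp only [hj, true_and]
      rw [tsum_eq_sum (s := Finset.range 3) (fun k hk => by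
        rw [if_neg (by simpa using hk)])]
      refine (Finset.sum_le_card_nsmul _ _ (C2 * (eLpNorm u p volume * X)) fun k _ => ?_).trans ?_
      · split_ifs <;> simp
      · simp [y, mul_assoc]
    · simp [hj]
  refine (eLpNorm_count_mono 2 hsum).trans ((eLpNorm_count_add_le one_le_two _ _).trans ?_)
  calc _ ≤ C1 * A * (geo ε * eLpNorm b 2 Measure.count) + y := by
        refine add_le_add ?_ (eLpNorm_single_le y)
        refine (eLpNorm_count_const_mul 2 (by finiteness) _).trans ?_
        gcongr
        exact eLpNorm_geo_le one_le_two b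
    _ = C1 * geo ε * (A * eLpNorm b 2 Measure.count) + 3 * C2 * (eLpNorm u p volume * X) := by
        ring
    _ ≤ _ := by
        rw [mul_add]
        gcongr
        · exact le_self_add
        · exact le_add_self

end DyadicPartition

namespace RieszCommutator

variable {n : ℕ}

/-! ### The commutator `[R_α, u]` as a limit of frequency truncations -/

lemma eLpNorm_op_top_le {M : ℝ} {p p' : ℝ≥0∞} [ENNReal.HolderConjugate p' p] {σ f : Space n → ℂ}
    (hσ : Symb M σ) (hf : AEStronglyMeasurable f volume) :
    eLpNorm (op σ f) ⊤ volume ≤ eLpNorm (𝓕⁻ σ) p' volume * eLpNorm f p volume := by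
  refine eLpNormEssSup_le_of_ae_enorm_bound (Eventually.of_forall fun x => ?_)
  have hmp := Measure.measurePreserving_sub_left (volume : Measure (Space n)) x
  refine (enorm_integral_mul_le (p := p') (q := p)
    (hσ.decay.cont.comp (continuous_const.sub continuous_id)).aestronglyMeasurable hf).trans ?_
  rw [← eLpNorm_comp_measurePreserving hσ.decay.cont.aestronglyMeasurable hmp]
  exact le_rfl

lemma memLp_op_top {M : ℝ} (hn : n < M) {p : ℝ≥0∞} (hp : 1 ≤ p) {σ f : Space n → ℂ}
    (hσ : Symb M σ) (hf : MemLp f p volume) : MemLp (op σ f) ⊤ volume := by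
  obtain ⟨p', hp', hpp⟩ := exists_holderConjugate hp
  have : ENNReal.HolderConjugate p' p := hpp.symm
  exact ⟨(memLp_op hn hp hσ hf).1, (eLpNorm_op_top_le (p' := p') hσ hf.1).trans_lt
    (ENNReal.mul_lt_top (hσ.decay.memLp hn hp').2 hf.2)⟩

lemma memLp_mul {p q r : ℝ≥0∞} [ENNReal.HolderTriple p q r] {f g : Space n → ℂ}
    (hf : MemLp f p volume) (hg : MemLp g q volume) : MemLp (fun x => f x * g x) r volume :=
  MemLp.smul (p := p) (q := q) (r := r) hg hf

lemma tr_add {P : DyadicPartition n} {d : ℝ} (hd : 0 < d) {h : Space n → ℂ} (hh : Mult P d h)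
    (ψ φ : 𝓢(Space n, ℂ)) : tr h (fun x => ψ x + φ x) = fun x => tr h ψ x + tr h φ x := by
  have h1 : 𝓕 (fun x => ψ x + φ x) = fun ξ => 𝓕 (ψ : Space n → ℂ) ξ + 𝓕 (φ : Space n → ℂ) ξ := by
    have := congrArg (fun f : 𝓢(Space n, ℂ) => (f : Space n → ℂ)) (FourierTransform.fourier_add ψ φ)
    simp only [SchwartzMap.fourier_coe] at this
    refine this.trans (funext fun ξ => ?_)
    rw [add_apply, SchwartzMap.fourier_coe, SchwartzMap.fourier_coe]
  unfold tr
  simp only [h1, mul_add]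
  exact fourierInv_fun_add (hh.symb_tr hd ψ).integ (hh.symb_tr hd φ).integ

lemma tr_const_mul (h : Space n → ℂ) (c : ℂ) (ψ : 𝓢(Space n, ℂ)) :
    tr h (fun x => c * ψ x) = fun x => c * tr h ψ x := by
  have h1 : 𝓕 (fun x => c * ψ x) = fun ξ => c * 𝓕 (ψ : Space n → ℂ) ξ := by
    have := congrArg (fun f : 𝓢(Space n, ℂ) => (f : Space n → ℂ))
        (FourierTransform.fourier_smul c ψ)
    simp only [SchwartzMap.fourier_coe] at this
    refine this.trans (funext fun ξ => ?_)
    rw [smul_apply, SchwartzMap.fourier_coe, smul_eq_mul]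
  unfold tr
  simp only [h1, mul_left_comm _ c]
  exact fourierInv_const_mul _ c

/-- The product of a smooth function and a compactly supported Schwartz function. -/
def mulSchwartz (a : Space n → ℂ) (ha : ContDiff ℝ ∞ a) (ψ : 𝓢(Space n, ℂ))
    (hψ : HasCompactSupport ψ) : 𝓢(Space n, ℂ) :=
  HasCompactSupport.toSchwartzMap (f := fun x => a x * ψ x) hψ.mul_left (ha.mul (ψ.smooth _))

lemma mulSchwartz_coe (a : Space n → ℂ) (ha : ContDiff ℝ ∞ a) (ψ : 𝓢(Space n, ℂ))
    (hψ : HasCompactSupport ψ) : (mulSchwartz a ha ψ hψ : Space n → ℂ) = fun x => a x * ψ x := rfl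

lemma commMul_eq [NeZero n] (α : ℝ) (u : Space n → Space n) (θ : Space n → ℝ) (i : Fin n)
    (ψ : Space n → ℂ) : commMul α u θ i ψ =
      (∫ x, (u x i : ℂ) * (θ x : ℂ) * tr (rieszSymbol α) ψ x) -
        ∫ x, (θ x : ℂ) * tr (rieszSymbol α) (fun x => (u x i : ℂ) * ψ x) x := by
  simp only [commMul, Pi.sub_apply, mulDist, riesz_eq, Complex.ofReal_mul]

lemma contDiff_component {k : WithTop ℕ∞} {u : Space n → Space n} (hu : ContDiff ℝ k u)
    (i : Fin n) :
    ContDiff ℝ k (fun x => (u x i : ℂ)) :=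
  Complex.ofRealCLM.contDiff.comp ((EuclideanSpace.proj (𝕜 := ℝ) i).contDiff.comp hu)

lemma memLp_component {p : ℝ≥0∞} {u : Space n → Space n} (hu : MemLp u p volume) (i : Fin n) :
    MemLp (fun x => (u x i : ℂ)) p volume := by
  refine hu.of_le ((Complex.ofRealCLM.continuous.comp
    (EuclideanSpace.proj (𝕜 := ℝ) i).continuous).comp_aestronglyMeasurable hu.1)
    (Eventually.of_forall fun x => ?_)
  rw [Complex.norm_real]
  exact PiLp.norm_apply_le (u x) i

lemma eLpNorm_component_le {p : ℝ≥0∞} (u : Space n → Space n) (i : Fin n) :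
    eLpNorm (fun x => (u x i : ℂ)) p volume ≤ eLpNorm u p volume := by
  refine eLpNorm_mono fun x => ?_
  rw [Complex.norm_real]
  exact PiLp.norm_apply_le (u x) i

lemma fderiv_component {u : Space n → Space n} (hu : ContDiff ℝ 1 u) (i : Fin n) (x v : Space n) :
    fderiv ℝ (fun x => (u x i : ℂ)) x v = (fderiv ℝ u x v i : ℂ) := by
  have h1 : HasFDerivAt (fun x => (u x i : ℂ))
      ((Complex.ofRealCLM.comp (EuclideanSpace.proj (𝕜 := ℝ) i)).comp (fderiv ℝ u x)) x :=
    (Complex.ofRealCLM.comp (EuclideanSpace.proj (𝕜 := ℝ) i)).hasFDerivAt.comp x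
      (hu.differentiable one_ne_zero x).hasFDerivAt
  rw [h1.fderiv]; rfl

lemma eLpNorm_fderiv_component_le {p : ℝ≥0∞} {u : Space n → Space n} (hu : ContDiff ℝ 1 u)
    (i : Fin n) :
    eLpNorm (fderiv ℝ (fun x => (u x i : ℂ))) p volume ≤ eLpNorm (fderiv ℝ u) p volume := by
  refine eLpNorm_mono fun x => ContinuousLinearMap.opNorm_le_bound _ (norm_nonneg _) fun v => ?_
  rw [fderiv_component hu, Complex.norm_real]
  exact (PiLp.norm_apply_le _ i).trans ((fderiv ℝ u x).le_opNorm v)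

lemma lipLp_component {p : ℝ≥0∞} (hp : 1 ≤ p) {u : Space n → Space n} (hu : ContDiff ℝ 1 u)
    (i : Fin n) : LipLp p (eLpNorm (fderiv ℝ u) p volume) (fun x => (u x i : ℂ)) :=
  (lipLp_of_fderiv hp (contDiff_component hu i)).mono (eLpNorm_fderiv_component_le hu i)

lemma eLpNorm_ofReal {p : ℝ≥0∞} (f : Space n → ℝ) :
    eLpNorm (fun x => (f x : ℂ)) p volume = eLpNorm f p volume :=
  eLpNorm_congr_norm_ae (Eventually.of_forall fun _ => Complex.norm_real _)

end RieszCommutator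

namespace DyadicPartition

open RieszCommutator

variable {n : ℕ} (P : DyadicPartition n)

lemma cut_mul_eq (h : Space n → ℂ) (Q : ℕ) :
    (fun ξ => P.cut Q ξ * h ξ) = fun ξ => ∑ k ∈ Finset.range (Q + 1), P.symbol k ξ * h ξ := by
  ext ξ
  rw [← Finset.sum_mul, P.sum_symbol]

lemma cut_symb' {M d : ℝ} (hM : 0 ≤ M) {h : Space n → ℂ} (hh : Homog d h)
    (hl : Symb M (fun ξ => P.low ξ * h ξ)) (Q : ℕ) : Symb M (fun ξ => P.cut Q ξ * h ξ) := by
  rw [cut_mul_eq]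
  exact Symb.sum _ fun k _ => P.symbol_symb' hM hh hl k

lemma op_cut_mul {M d : ℝ} (hM : 0 ≤ M) {h : Space n → ℂ} (hh : Homog d h)
    (hl : Symb M (fun ξ => P.low ξ * h ξ)) {f : Space n → ℂ} (hf : WInt M f) (Q : ℕ) :
    op (fun ξ => P.cut Q ξ * h ξ) f
      = fun x => ∑ k ∈ Finset.range (Q + 1), op (fun ξ => P.symbol k ξ * h ξ) f x := by
  rw [cut_mul_eq]
  exact op_symb_sum hM _ (fun k _ => P.symbol_symb' hM hh hl k) hf

/-- If the commutators with the truncated functions are bounded, so is `[h(D), u] θ`. -/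
lemma enorm_pairing_le_of_cut {d : ℝ} (hd : 0 < d) {h : Space n → ℂ} (hh : Mult P d h)
    {u θ : Space n → ℂ} (hus : ContDiff ℝ ∞ u) (hu : MemLp u 2 volume) (hθ : MemLp θ 2 volume)
    (ψ : 𝓢(Space n, ℂ)) (hψ : HasCompactSupport ψ) {B : ℝ≥0∞}
    (hB : ∀ Q, ‖(∫ x, u x * op (P.cut Q) θ x * tr h ψ x) -
      ∫ x, u x * op (fun ξ => P.cut Q ξ * h ξ) θ x * ψ x‖ₑ ≤ B) :
    ‖(∫ x, u x * θ x * tr h ψ x) - ∫ x, θ x * tr h (fun x => u x * ψ x) x‖ₑ ≤ B := by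
  have hn : (n : ℝ) < n + d := by linarith
  have hM : (0 : ℝ) ≤ n + d := by positivity
  have hD := hh.decays_tr hd ψ
  set w := mulSchwartz u hus ψ hψ with hw
  have hE := hh.decays_tr hd w
  rw [hw, mulSchwartz_coe] at hE
  have m1 : MemLp (fun x => u x * tr h ψ x) 2 volume :=
    memLp_mul (p := 2) (q := ⊤) hu (hD.memLp hn le_top)
  have t1 := tendsto_integral_mul (fun Q => memLp_op hn one_le_two (P.cut_symb hM Q) hθ) hθ m1
    (P.tendsto_op_cut one_le_two ENNReal.ofNat_ne_top hθ)
  have m2 := hE.memLp hn one_le_two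
  -- in the second term the cutoff is moved to the transpose applied to `u ψ`
  have t2 := tendsto_integral_mul (fun Q => memLp_op hn one_le_two (P.cut_symb hM Q) m2) m2 hθ
    (P.tendsto_op_cut one_le_two ENNReal.ofNat_ne_top m2)
  have e1 : ∀ Q, ∫ x, op (P.cut Q) θ x * (u x * tr h ψ x)
      = ∫ x, u x * op (P.cut Q) θ x * tr h ψ x := fun Q => by
    congr 1; ext x; ring
  have e2 : ∀ Q, ∫ x, op (P.cut Q) (tr h fun x => u x * ψ x) x * θ x
      = ∫ x, u x * op (fun ξ => P.cut Q ξ * h ξ) θ x * ψ x := fun Q => by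
    have := hh.integral_op_mul hd w (P.cut_symb hM Q)
      (P.cut_symb' hM hh.toHomog (P.symb_low hd hh.toHomog) Q) (WInt.of_memLp hn one_le_two hθ)
    rw [cut_neg', hw, mulSchwartz_coe] at this
    simp only [mul_comm _ (θ _)]
    rw [← this]
    congr 1; ext x; ring
  simp only [e1] at t1
  simp only [e2] at t2
  have e3 : ∫ x, θ x * (u x * tr h ψ x) = ∫ x, u x * θ x * tr h ψ x := by
    congr 1; ext x; ring
  rw [e3] at t1
  simp only [mul_comm _ (θ _)] at t2
  simp only [mul_comm _ (θ _)] at t1 ⊢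
  exact le_of_tendsto (t1.sub t2).enorm (Eventually.of_forall hB)

/-- If the commutators with the truncated `θ` are bounded by `A` when tested against `ψ`, then
`[R_α, u_i] θ` belongs to `H^s`, with norm a multiple of `A`. -/
lemma exists_commMul_extension [NeZero n] {α : ℝ} (hα : α < 1) (s : ℝ) :
    ∃ C : ℝ≥0∞, C ≠ ⊤ ∧ ∀ {u : Space n → Space n} {θ : Space n → ℝ} (_ : ContDiff ℝ ∞ u)
      (_ : MemLp u 2 volume) (_ : MemLp θ 2 volume) (i : Fin n) {A : ℝ≥0∞} (_ : A ≠ ⊤)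
      (_ : ∀ ψ : 𝓢(Space n, ℂ), HasCompactSupport ψ → ∀ Q : ℕ,
        ‖(∫ x, (u x i : ℂ) * op (P.cut Q) (fun x => (θ x : ℂ)) x * tr (rieszSymbol α) ψ x) -
          ∫ x, (u x i : ℂ) *
            op (fun ξ => P.cut Q ξ * rieszSymbol α ξ) (fun x => (θ x : ℂ)) x * ψ x‖ₑ ≤
        A * eLpNorm (fun j : ℕ => pw (j * -s) * eLpNorm (op (P.symT j) ψ) 2 volume) 2
          Measure.count),
    ∃ F : 𝓢'(Space n, ℂ), Extends F (commMul α u θ i) ∧ sobolevNorm s F ≤ C * A := by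
  obtain ⟨C, hC, h⟩ := P.exists_sobolev_extension s
  refine ⟨C, hC, fun {u θ} hus hu hθ i {A} hA hB => h _ ?_ ?_ hA fun ψ hψ => ?_⟩
  · intro ψ φ hψ hφ
    have hd : 0 < 1 - α := by linarith
    have hn : (n : ℝ) < n + (1 - α) := by linarith
    have hm := mult_riesz P α
    have hθ' : MemLp (fun x => (θ x : ℂ)) 2 volume := hθ.ofReal
    have i1 : ∀ ψ : 𝓢(Space n, ℂ),
        Integrable fun x => (u x i : ℂ) * (θ x : ℂ) * tr (rieszSymbol α) ψ x := fun ψ =>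
      integrable_mul_of_memLp (p := 1) (q := ⊤)
        (memLp_mul (p := 2) (q := 2) (memLp_component hu i) hθ')
        ((hm.decays_tr hd ψ).memLp hn le_top)
    have i2 : ∀ ψ : 𝓢(Space n, ℂ), HasCompactSupport ψ →
        Integrable fun x => (θ x : ℂ) * tr (rieszSymbol α) (fun x => (u x i : ℂ) * ψ x) x :=
      fun ψ hψ => integrable_mul_of_memLp hθ' ((hm.decays_tr hd
        (mulSchwartz _ (contDiff_component hus i) ψ hψ)).memLp hn one_le_two)
    have e := tr_add hd hm (mulSchwartz _ (contDiff_component hus i) ψ hψ)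
      (mulSchwartz _ (contDiff_component hus i) φ hφ)
    simp only [mulSchwartz_coe] at e
    simp only [commMul_eq, tr_add hd hm, mul_add, e]
    rw [integral_add (i1 ψ) (i1 φ), integral_add (i2 ψ hψ) (i2 φ hφ)]
    ring
  · intro c ψ hψ
    have e := tr_const_mul (rieszSymbol α) c (mulSchwartz _ (contDiff_component hus i) ψ hψ)
    simp only [mulSchwartz_coe] at e
    simp only [commMul_eq, tr_const_mul, mul_left_comm _ c, e, integral_const_mul, mul_sub]
  · rw [commMul_eq]
    exact P.enorm_pairing_le_of_cut (by linarith) (mult_riesz P α) (contDiff_component hus i)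
      (memLp_component hu i) hθ.ofReal ψ hψ (hB ψ hψ)

/-! ### Besov norms of functions -/

lemma block_lpDist_apply {p : ℝ≥0∞} [Fact (1 ≤ p)] {f : Space n → ℝ} (hf : MemLp f p volume)
    (k : ℕ) (ψ : 𝓢(Space n, ℂ)) :
    P.block k (lpDist hf) ψ = ∫ x, ψ x * op (P.symbol k) (fun x => (f x : ℂ)) x := by
  have hn : (n : ℝ) < n + 1 := by linarith
  exact fourierMultiplier_apply_of_function hn (P.symbol_smooth k) (P.symbol_compact k)
    (WInt.of_memLp hn Fact.out hf.ofReal) (lpDist_apply hf) ψ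

lemma blocks_le_besovNorm {p : ℝ≥0∞} [Fact (1 ≤ p)] {f : Space n → ℝ} (hf : MemLp f p volume)
    (s : ℝ) {q : ℝ≥0∞} (hq : 1 ≤ q) (r : ℝ≥0∞) :
    eLpNorm (fun k : ℕ => pw (k * s) * eLpNorm (op (P.symbol k) (fun x => (f x : ℂ))) q volume) r
      Measure.count ≤ pw s * besovNorm P s q r (lpDist hf) := by
  have hn : (n : ℝ) < n + 1 := by linarith
  refine le_trans (eLpNorm_count_mono r fun k => ?_) (eLpNorm_count_const_mul r (pw_ne_top s) _)
  have h1 : pw (k * s) = pw s * pw (((k : ℝ) - 1) * s) := by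
    rw [← pw_add]; congr 1; ring
  rw [h1, mul_assoc]
  refine mul_le_mul' le_rfl (mul_le_mul' le_rfl ?_)
  exact le_distLpNorm hq ((memLp_op hn Fact.out (P.symbol_symb_one _ k)
    hf.ofReal).locallyIntegrable Fact.out) (P.block_lpDist_apply hf k)

/-- Bernstein's inequality for the lowest frequencies. -/
lemma exists_bernstein {n : ℕ} (P : DyadicPartition n) : ∃ C : ℝ≥0∞, C ≠ ⊤ ∧
    ∀ {θ : Space n → ℂ} (_ : MemLp θ 2 volume), ∀ k < 3,
      eLpNorm (op (P.symbol k) θ) ⊤ volume ≤ C * eLpNorm θ 2 volume := by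
  have hn : (n : ℝ) < n + 1 := by linarith
  refine ⟨∑ k ∈ Finset.range 3, eLpNorm (𝓕⁻ (P.symbol k)) 2 volume, ?_, fun {θ} hθ k hk => ?_⟩
  · exact (ENNReal.sum_lt_top.2 fun k _ =>
      ((P.symbol_symb_one _ k).decay.memLp hn one_le_two).2).ne
  · refine (eLpNorm_op_top_le (p := 2) (p' := 2) (P.symbol_symb_one (n + 1) k) hθ.1).trans ?_
    gcongr
    exact Finset.single_le_sum (f := fun k => eLpNorm (𝓕⁻ (P.symbol k)) 2 volume)
      (fun _ _ => zero_le) (Finset.mem_range.2 hk)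

lemma eLpNorm_cblk_cut_le {M d : ℝ} (hn : n < M) {h : Space n → ℂ} (hh : Homog d h)
    (hl : Symb M (fun ξ => P.low ξ * h ξ)) {r : ℝ≥0∞} (hr : 1 ≤ r) {u θ : Space n → ℂ}
    (hθ : WInt M θ) (huf : ∀ k, WInt M (fun y => u y * op (P.symbol k) θ y))
    (hug : ∀ k, WInt M (fun y => u y * op (fun ξ => P.symbol k ξ * h ξ) θ y)) (j Q : ℕ) :
    eLpNorm (P.cblk h j u (op (P.cut Q) θ) (op (fun ξ => P.cut Q ξ * h ξ) θ)) r volume ≤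
      ∑ k ∈ Finset.range (Q + 1), eLpNorm (P.cblk h j u (op (P.symbol k) θ)
        (op (fun ξ => P.symbol k ξ * h ξ) θ)) r volume := by
  have hM : 0 ≤ M := (Nat.cast_nonneg n).trans hn.le
  have hS := fun k => P.symbol_symb' hM hh hl k
  rw [P.sum_op_symbol hM hθ, P.op_cut_mul hM hh hl hθ,
    cblk_sum_right hn (hS j) _ (fun k _ => huf k) (fun k _ => hug k)]
  exact (eLpNorm_sum_le (fun k _ => (cblk_aesm hn (hS j) (huf k) (hug k)).meas) hr).trans' (by
    rw [← Finset.sum_fn])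

end DyadicPartition

namespace DyadicPartition

open RieszCommutator

variable {n : ℕ} {P : DyadicPartition n}

/-! ### The estimate of `[R_α, u] θ` by the gradient of `u` -/

/-- The commutator with a Lipschitz function `u` and truncated `θ`, tested against `ψ`. -/
lemma exists_pairing_estimate {d s : ℝ} (hd : 0 < d) (hs : 0 < s) (hsd : s < 1 - d)
    {h : Space n → ℂ} (hh : Mult P d h) : ∃ C : ℝ≥0∞, C ≠ ⊤ ∧
    ∀ {p q A X : ℝ≥0∞} [ENNReal.HolderTriple p q 2] (_ : 1 ≤ q) (_ : A ≠ ⊤) {u θ : Space n → ℂ}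
      (_ : AEStronglyMeasurable u volume) (_ : LipLp p A u) (_ : WInt (n + d) θ)
      (_ : ∀ σ, Symb (n + d) σ → MemLp (fun y => u y * op σ θ y) 2 volume)
      (_ : ∀ k < 3, eLpNorm (op (P.symbol k) θ) q volume ≤ X) (ψ : 𝓢(Space n, ℂ)) (Q : ℕ),
    ‖(∫ x, u x * op (P.cut Q) θ x * tr h ψ x) -
        ∫ x, u x * op (fun ξ => P.cut Q ξ * h ξ) θ x * ψ x‖ₑ ≤
      C * (A * eLpNorm (fun k : ℕ => pw (k * (s - (1 - d))) * eLpNorm (op (P.symbol k) θ) q volume)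
        2 Measure.count + eLpNorm u p volume * X) *
        eLpNorm (fun j : ℕ => pw (j * -s) * eLpNorm (op (P.symT j) ψ) 2 volume) 2
          Measure.count := by
  have hn : (n : ℝ) < n + d := by linarith
  have hM : (0 : ℝ) ≤ n + d := by positivity
  have hl := P.symb_low hd hh.toHomog
  have hS := fun k => P.symbol_symb' hM hh.toHomog hl k
  obtain ⟨C, hC, h1⟩ := exists_lipschitz_estimate hd hs hsd hh
  refine ⟨C, hC, fun {p q A X} _ hq hA {u θ} hu hA' w0 huf hX ψ Q => ?_⟩
  have hw : ∀ {σ}, Symb (n + d) σ → WInt (n + d) (fun y => u y * op σ θ y) := fun hσ =>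
    WInt.of_memLp hn one_le_two (huf _ hσ)
  refine (P.enorm_pairing_le hd hh (huf _ (P.cut_symb hM Q))
    (huf _ (P.cut_symb' hM hh.toHomog hl Q)) ψ s).trans ?_
  gcongr ?_ * _
  have h3 := h1 (p := p) (q := q) hq hA hu hA' w0 (fun k => hw (P.symbol_symb_one _ k))
    (fun k => hw (hS k)) hX
  refine (eLpNorm_count_mono 2 fun j => ?_).trans h3
  gcongr
  exact (P.eLpNorm_cblk_cut_le hn hh.toHomog hl one_le_two w0
    (fun k => hw (P.symbol_symb_one _ k)) (fun k => hw (hS k)) j Q).trans (ENNReal.sum_le_tsum _)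

/-- The estimate of `[R_α, u] θ` in `H^s`, `0 < s < α`, by the gradient of `u`. -/
theorem exists_commMul_bound [NeZero n] (P : DyadicPartition n) {α s : ℝ} (hα1 : α < 1)
    (hs : 0 < s) (hsα : s < α) :
    ∃ C : ℝ≥0, ∀ (u : Space n → Space n) (θ : Space n → ℝ),
      ContDiff ℝ ∞ u → MemLp u 2 volume → MemLp (fderiv ℝ u) 2 volume →
      ∀ hθ : MemLp θ 2 volume, besovNorm P (s - α) ⊤ 2 (lpDist hθ) < ⊤ →
      ∃ F : Fin n → 𝓢'(Space n, ℂ), (∀ i, Extends (F i) (commMul α u θ i)) ∧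
        ∑ i, sobolevNorm s (F i) ≤
          C * (eLpNorm (fderiv ℝ u) 2 volume * besovNorm P (s - α) ⊤ 2 (lpDist hθ)
            + eLpNorm u 2 volume * eLpNorm θ 2 volume) := by
  have hd : 0 < 1 - α := by linarith
  obtain ⟨C1, hC1, h1⟩ := exists_pairing_estimate hd hs (by linarith) (mult_riesz P α)
  obtain ⟨C2, hC2, h2⟩ := P.exists_commMul_extension hα1 s
  obtain ⟨B, hB, h3⟩ := exists_bernstein P
  have hC : n * (C2 * (C1 * (pw (s - α) + B))) ≠ ⊤ := by
    finiteness [pw_ne_top (s - α)]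
  refine ⟨(n * (C2 * (C1 * (pw (s - α) + B)))).toNNReal, fun u θ hus hu hdu hθ hb => ?_⟩
  rw [ENNReal.coe_toNNReal hC]
  set N := eLpNorm (fderiv ℝ u) 2 volume * besovNorm P (s - α) ⊤ 2 (lpDist hθ)
            + eLpNorm u 2 volume * eLpNorm θ 2 volume with hN
  have hNt : N ≠ ⊤ := by
    have := hdu.2.ne; have := hu.2.ne; have := hθ.2.ne; have := hb.ne
    finiteness
  have key : ∀ i, ∃ F : 𝓢'(Space n, ℂ), Extends F (commMul α u θ i) ∧
      sobolevNorm s F ≤ C2 * (C1 * (pw (s - α) + B) * N) := fun i => by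
    refine h2 hus hu hθ i (by finiteness [pw_ne_top (s - α)]) fun ψ _ Q => ?_
    have hn : (n : ℝ) < n + (1 - α) := by linarith
    have hui := memLp_component hu i
    refine (h1 (p := 2) (q := ⊤) le_top hdu.2.ne hui.1 (lipLp_component one_le_two
      (hus.of_le (mod_cast le_top)) i) (WInt.of_memLp hn one_le_two hθ.ofReal)
      (fun σ hσ => memLp_mul (p := 2) (q := ⊤) hui (memLp_op_top hn one_le_two hσ hθ.ofReal))
      (h3 hθ.ofReal) ψ Q).trans ?_
    gcongr ?_ * _
    rw [mul_assoc]
    gcongr _ * ?_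
    have hbb := P.blocks_le_besovNorm hθ (s - α) le_top 2 (q := ⊤)
    rw [show s - (1 - (1 - α)) = s - α by ring]
    have e1 : eLpNorm (fun x => (θ x : ℂ)) 2 volume = eLpNorm θ 2 volume := eLpNorm_ofReal θ
    calc _ ≤ eLpNorm (fderiv ℝ u) 2 volume * (pw (s - α) * besovNorm P (s - α) ⊤ 2 (lpDist hθ))
          + eLpNorm u 2 volume * (B * eLpNorm θ 2 volume) := by
          refine add_le_add ?_ (mul_le_mul' ?_ ?_)
          · gcongr
            exact hbb
          · exact eLpNorm_component_le u i
          · exact (congrArg _ e1).le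
      _ ≤ (pw (s - α) + B) * (eLpNorm (fderiv ℝ u) 2 volume *
            besovNorm P (s - α) ⊤ 2 (lpDist hθ)) + (pw (s - α) + B) *
            (eLpNorm u 2 volume * eLpNorm θ 2 volume) := by
          gcongr ?_ + ?_
          · rw [mul_left_comm]
            gcongr
            exact le_self_add
          · rw [mul_left_comm]
            gcongr
            exact le_add_self
      _ = _ := by rw [hN, mul_add]
  choose F hF hF' using key
  refine ⟨F, hF, (Finset.sum_le_card_nsmul _ _ _ fun i _ => hF' i).trans (le_of_eq ?_)⟩
  rw [Finset.card_univ, Fintype.card_fin, nsmul_eq_mul]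
  ring

end DyadicPartition

namespace RieszCommutator

variable {n : ℕ}

lemma lipLp_sum {p : ℝ≥0∞} (hp : 1 ≤ p) {ι : Type*} (s : Finset ι) {A : ι → ℝ≥0∞}
    {u : ι → Space n → ℂ} (hu : ∀ i ∈ s, AEStronglyMeasurable (u i) volume)
    (h : ∀ i ∈ s, LipLp p (A i) (u i)) : LipLp p (∑ i ∈ s, A i) (fun x => ∑ i ∈ s, u i x) := by
  intro v
  have e : (fun x => ∑ i ∈ s, u i (x - v) - ∑ i ∈ s, u i x)
      = ∑ i ∈ s, fun x => u i (x - v) - u i x := by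
    ext x; simp [Finset.sum_apply]
  rw [e, Finset.mul_sum]
  refine (eLpNorm_sum_le (fun i hi => ?_) hp).trans (Finset.sum_le_sum fun i hi => h i hi v)
  exact ((hu i hi).comp_measurePreserving (measurePreserving_sub_right volume v)).sub (hu i hi)

lemma sum_pw_le (d : ℝ) (K : ℕ) :
    ∑ k ∈ Finset.range (K + 1), pw (k * d) ≤ geo d * pw (K * d) := by
  calc _ = ∑ k ∈ Finset.range (K + 1), pw (-d * |(K : ℝ) - k|) * pw (K * d) := by
        refine Finset.sum_congr rfl fun k hk => ?_
        have : (k : ℝ) ≤ K := by exact_mod_cast Finset.mem_range_succ_iff.1 hk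
        rw [← pw_add, abs_of_nonneg (by linarith)]
        congr 1; ring
    _ = (∑ k ∈ Finset.range (K + 1), pw (-d * |(K : ℝ) - k|)) * pw (K * d) := by
        rw [Finset.sum_mul]
    _ ≤ _ := by
        gcongr ?_ * _
        exact (ENNReal.sum_le_tsum _).trans (tsum_geo_le d K ⟨K, by simp⟩)

end RieszCommutator

namespace DyadicPartition

open RieszCommutator

variable {n : ℕ} {P : DyadicPartition n}

/-! ### Velocities of negative order in `θ` -/

/-- The part of the commutator in which the frequency of the velocity `κ(D) θ` is larger than that
of the transported function, up to a constant factor. -/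
lemma exists_high_velocity_estimate {d : ℝ} (hd : 0 < d) {h κ : Space n → ℂ} (hh : Mult P d h)
    (hκ : Homog (d - 1) κ) : ∃ C : ℝ≥0∞, C ≠ ⊤ ∧
    ∀ {θ : Space n → ℂ} (_ : MemLp θ 2 volume) (_ : MemLp θ ⊤ volume) (j K l : ℕ) (_ : l ≠ 0)
      (_ : K ≤ l + 2),
    eLpNorm (P.cblk h j (op (fun ξ => P.symbol l ξ * κ ξ) θ) (op (P.cut K) θ)
      (op (fun ξ => P.cut K ξ * h ξ) θ)) 2 volume ≤ C * eLpNorm θ ⊤ volume *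
        (pw (-(1 - d) * max (j : ℝ) l) * (pw (l * d) * eLpNorm (op (P.symbol l) θ) 2 volume)) := by
  have hn : (n : ℝ) < n + d := by linarith
  have hM : (0 : ℝ) ≤ n + d := by positivity
  have hl := P.symb_low hd hh.toHomog
  have hS := fun k => P.symbol_symb' hM hh.toHomog hl k
  obtain ⟨C1, hC1, b1⟩ := P.symbol_bds hh.toHomog
  obtain ⟨C2, hC2, b2⟩ := P.N1_bds hn hh.toHomog hl
  obtain ⟨C3, hC3, b3⟩ := P.one_bds
  obtain ⟨C4, hC4, b4⟩ := P.symbol_bds hκ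
  have h0 : N1 P.low ≠ ⊤ := (N1_lt_top hn (P.low_symb _)).ne
  have hg := (geo_lt_top hd).ne
  set D := C2 * (geo d * pw (2 * d))
  have hD : D ≠ ⊤ := by finiteness [pw_ne_top (2 * d)]
  refine ⟨C4 * (C1 * N1 P.low + C3 * D) + C4 * (C2 * N1 P.low + C3 * D), by finiteness, ?_⟩
  intro θ h2 ht j K l hl0 hKl
  have w0 := WInt.of_memLp hn one_le_two h2
  set t := eLpNorm (op (P.symbol l) θ) 2 volume
  set m := eLpNorm θ ⊤ volume
  set w := op (fun ξ => P.symbol l ξ * κ ξ) θ with hw_def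
  have hw : w = op (fun ξ => P.symT l ξ * κ ξ) (op (P.symbol l) θ) :=
    (op_symT_mul_symbol hn (P.symT_symb hM hκ hl0) w0).symm
  have hw2 : MemLp w 2 volume := memLp_op hn one_le_two (P.symbol_symb hM hκ hl0) h2
  -- the velocity `w` and its gradient, in terms of the block of `θ`
  have hwn : eLpNorm w 2 volume ≤ C4 * pw (l * (d - 1)) * t := by
    rw [hw]
    refine (eLpNorm_op_le one_le_two (P.symT_symb hM hκ hl0)
      (memLp_op hn one_le_two (P.symbol_symb_one _ l) h2).1).trans ?_
    gcongr
    exact (b4 l hl0).2.one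
  have hwl : LipLp 2 (C4 * pw (l * d) * t) w := by
    rw [hw]
    have := lipLp_op hM one_le_two (P.symT_symb hM hκ hl0) (b4 l hl0).2.lip
      (w0.op hn (P.symbol_symb_one _ l))
    simpa only [sub_add_cancel] using this
  have hft : MemLp (op (P.cut K) θ) ⊤ volume := memLp_op hn le_top (P.cut_symb hM K) ht
  have hgt : MemLp (op (fun ξ => P.cut K ξ * h ξ) θ) ⊤ volume :=
    memLp_op hn le_top (P.cut_symb' hM hh.toHomog hl K) ht
  -- the transported functions in `L^∞`; the sum of `2^{kd}` over `k ≤ K` is a geometric one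
  have hfn : eLpNorm (op (P.cut K) θ) ⊤ volume ≤ N1 P.low * m := by
    rw [← P.N1_cut K]
    exact eLpNorm_op_le le_top (P.cut_symb hM K) ht.1
  have hgn : eLpNorm (op (fun ξ => P.cut K ξ * h ξ) θ) ⊤ volume ≤ D * pw (l * d) * m := by
    rw [P.op_cut_mul hM hh.toHomog hl w0]
    have e : (fun x => ∑ k ∈ Finset.range (K + 1), op (fun ξ => P.symbol k ξ * h ξ) θ x)
        = ∑ k ∈ Finset.range (K + 1), op (fun ξ => P.symbol k ξ * h ξ) θ := by
      ext x; simp [Finset.sum_apply]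
    rw [e]
    refine (eLpNorm_sum_le (fun k _ => (w0.op hn (hS k)).meas) le_top).trans ?_
    calc _ ≤ ∑ k ∈ Finset.range (K + 1), C2 * pw (k * d) * m :=
          Finset.sum_le_sum fun k _ => (eLpNorm_op_le le_top (hS k) ht.1).trans (by
            gcongr; exact (b2 k).1)
      _ = C2 * (∑ k ∈ Finset.range (K + 1), pw (k * d)) * m := by
          rw [Finset.mul_sum, Finset.sum_mul]
      _ ≤ C2 * (geo d * pw (K * d)) * m := by gcongr; exact sum_pw_le d K
      _ ≤ C2 * (geo d * (pw (2 * d) * pw (l * d))) * m := by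
          gcongr _ * (_ * ?_) * _
          rw [← pw_add]
          refine pw_mono ?_
          have : (K : ℝ) ≤ l + 2 := by exact_mod_cast hKl
          nlinarith
      _ = _ := by simp only [D]; ring
  have huf : WInt (n + d) (fun y => w y * op (P.cut K) θ y) :=
    WInt.of_memLp hn one_le_two (memLp_mul (p := 2) (q := ⊤) hw2 hft)
  have hug : WInt (n + d) (fun y => w y * op (fun ξ => P.cut K ξ * h ξ) θ y) :=
    WInt.of_memLp hn one_le_two (memLp_mul (p := 2) (q := ⊤) hw2 hgt)
  -- for `l < j` the gradient of `w` is used, and for `l ≥ j` the product is estimated directly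
  rcases lt_or_ge l j with hlj | hlj
  · have hj0 : j ≠ 0 := by omega
    have hlj' : (l : ℝ) ≤ j := by exact_mod_cast hlj.le
    have hfg : op (fun ξ => P.symbol j ξ * h ξ) (op (P.cut K) θ)
        = op (P.symbol j) (op (fun ξ => P.cut K ξ * h ξ) θ) :=
      op_mul_op_comm hn (P.symbol_symb_one _ j) (P.cut_symb hM K) (hS j)
        (P.cut_symb' hM hh.toHomog hl K) w0
    refine (eLpNorm_cblk_le_com (p := 2) (q := ⊤) hn (hS j) one_le_two hw2.1 hwl
      (w0.op hn (P.cut_symb hM K)) (w0.op hn (P.cut_symb' hM hh.toHomog hl K)) huf hug hfg).trans ?_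
    rw [max_eq_left hlj']
    have e1 : pw (-j) * pw (l * d) ≤ pw (-(1 - d) * j) := by
      rw [← pw_add]
      exact pw_mono (by nlinarith)
    calc _ ≤ (C1 * pw (j * (d - 1))) * (C4 * pw (l * d) * t) * (N1 P.low * m)
          + (C3 * pw (-j)) * (C4 * pw (l * d) * t) * (D * pw (l * d) * m) := by
          gcongr
          · exact (b1 j hj0).1.two
          · exact ((b3 j).2.2 hj0).1
      _ = C4 * (C1 * N1 P.low * pw (j * (d - 1)) + C3 * D * (pw (-j) * pw (l * d))) * m *
          (pw (l * d) * t) := by ring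
      _ ≤ C4 * (C1 * N1 P.low * pw (-(1 - d) * j) + C3 * D * pw (-(1 - d) * j)) * m *
          (pw (l * d) * t) := by
          rw [show (j : ℝ) * (d - 1) = -(1 - d) * j by ring]
          gcongr
      _ = C4 * (C1 * N1 P.low + C3 * D) * m * (pw (-(1 - d) * j) * (pw (l * d) * t)) := by ring
      _ ≤ _ := by
          gcongr ?_ * _ * _
          exact le_self_add
  · have hlj' : (j : ℝ) ≤ l := by exact_mod_cast hlj
    refine (eLpNorm_cblk_le_mul (p := 2) (q := ⊤) hn (hS j) one_le_two hw2.1 hft.1 hgt.1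
      huf hug).trans ?_
    rw [max_eq_right hlj']
    calc _ ≤ (C4 * pw (l * (d - 1)) * t) * ((C2 * pw (l * d)) * (N1 P.low * m)
          + C3 * (D * pw (l * d) * m)) := by
          gcongr
          · exact (b2 j).1.trans (by gcongr; exact pw_mono (by gcongr))
          · exact (b3 j).1
      _ = C4 * (C2 * N1 P.low + C3 * D) * m * (pw (-(1 - d) * l) * (pw (l * d) * t)) := by
          rw [show (l : ℝ) * (d - 1) = -(1 - d) * l by ring]
          ring
      _ ≤ _ := by
          gcongr ?_ * _ * _
          exact le_add_self

/-- The part of the commutator in which the frequency of the velocity `κ(D) θ` is much smaller than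
that of the transported function. -/
lemma exists_low_velocity_estimate {d : ℝ} (hd : 0 < d) {h κ : Space n → ℂ} (hh : Mult P d h)
    (hκ : Homog (d - 1) κ) : ∃ C : ℝ≥0∞, C ≠ ⊤ ∧
    ∀ {θ : Space n → ℂ} (_ : MemLp θ 2 volume) (_ : MemLp θ ⊤ volume) (j q : ℕ) (s : Finset ℕ)
      (_ : ∀ l ∈ s, l ≠ 0 ∧ l + 3 ≤ q),
    eLpNorm (P.cblk h j (fun x => ∑ l ∈ s, op (fun ξ => P.symbol l ξ * κ ξ) θ x) (op (P.symbol q) θ)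
      (op (fun ξ => P.symbol q ξ * h ξ) θ)) 2 volume ≤ C * eLpNorm θ ⊤ volume *
        (pw (-(1 - d) * max (j : ℝ) q) * (pw (q * d) * eLpNorm (op (P.symbol q) θ) 2 volume)) := by
  have hn : (n : ℝ) < n + d := by linarith
  have hM : (0 : ℝ) ≤ n + d := by positivity
  have hl := P.symb_low hd hh.toHomog
  obtain ⟨C1, hC1, h1⟩ := exists_block_estimate (P := P) hn hd.le hh.toHomog hl
  obtain ⟨C4, hC4, b4⟩ := P.symbol_bds hκ
  have hg := (geo_lt_top hd).ne
  refine ⟨C1 * (C4 * geo d), by finiteness, ?_⟩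
  intro θ h2 ht j q s hs
  rcases Nat.lt_or_ge q 3 with hq | hq
  · have : s = ∅ := Finset.eq_empty_of_forall_notMem fun l hl => by have := hs l hl; omega
    have e : P.cblk h j (fun x => ∑ l ∈ s, op (fun ξ => P.symbol l ξ * κ ξ) θ x)
        (op (P.symbol q) θ) (op (fun ξ => P.symbol q ξ * h ξ) θ) = fun _ => 0 := by
      ext x; simp [this, cblk, op, cv]
    rw [e, show (fun _ : Space n => (0 : ℂ)) = 0 from rfl, eLpNorm_zero]
    exact zero_le
  have w0 := WInt.of_memLp hn one_le_two h2
  have hwt : ∀ l ∈ s, MemLp (op (fun ξ => P.symbol l ξ * κ ξ) θ) ⊤ volume := fun l hl =>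
    memLp_op hn le_top (P.symbol_symb hM hκ (hs l hl).1) ht
  have hwl : LipLp ⊤ (∑ l ∈ s, C4 * pw (l * d) * eLpNorm θ ⊤ volume)
      (fun x => ∑ l ∈ s, op (fun ξ => P.symbol l ξ * κ ξ) θ x) := by
    refine lipLp_sum le_top s (fun l hl => (hwt l hl).1) fun l hl => ?_
    have := lipLp_op hM le_top (P.symbol_symb hM hκ (hs l hl).1) (b4 l (hs l hl).1).1.lip w0
      (p := ⊤)
    simpa only [sub_add_cancel] using this
  have hsum : ∑ l ∈ s, C4 * pw (l * d) * eLpNorm θ ⊤ volume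
      ≤ C4 * geo d * eLpNorm θ ⊤ volume * pw (q * d) := by
    rw [← Finset.sum_mul, ← Finset.mul_sum]
    calc _ ≤ C4 * (∑ l ∈ Finset.range (q + 1), pw (l * d)) * eLpNorm θ ⊤ volume := by
          gcongr _ * ?_ * _
          exact Finset.sum_le_sum_of_subset fun l hl => by
            have := (hs l hl).2
            exact Finset.mem_range.2 (by omega)
      _ ≤ C4 * (geo d * pw (q * d)) * eLpNorm θ ⊤ volume := by gcongr; exact sum_pw_le d q
      _ = _ := by ring
  have hu : MemLp (fun x => ∑ l ∈ s, op (fun ξ => P.symbol l ξ * κ ξ) θ x) ⊤ volume :=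
    memLp_finsetSum s hwt
  have key := h1 (p := ⊤) (q := 2) (r := 2) one_le_two one_le_two hu.1 (hwl.mono hsum) w0
    (j := j) (k := q)
    (WInt.of_memLp hn one_le_two (memLp_mul (p := ⊤) (q := 2) hu
      (memLp_op hn one_le_two (P.symbol_symb_one _ q) h2)))
    (WInt.of_memLp hn one_le_two (memLp_mul (p := ⊤) (q := 2) hu
      (memLp_op hn one_le_two (P.symbol_symb' hM hh.toHomog hl q) h2))) (Or.inr hq)
  refine key.trans (le_of_eq ?_)
  ring

/-- The commutator with the velocity `κ(D) θ`, truncated to the frequencies `1, …, L`: for each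
frequency `l` of the velocity the transported frequencies up to `l + 2` are taken together, and
for each higher transported frequency `q` the velocities with `l + 3 ≤ q`. -/
lemma exists_velocity_estimate {d : ℝ} (hd : 0 < d) {h κ : Space n → ℂ} (hh : Mult P d h)
    (hκ : Homog (d - 1) κ) : ∃ C : ℝ≥0∞, C ≠ ⊤ ∧
    ∀ {θ : Space n → ℂ} (_ : MemLp θ 2 volume) (_ : MemLp θ ⊤ volume) (j Q L : ℕ),
    eLpNorm (P.cblk h j (fun x => ∑ l ∈ Finset.Icc 1 L, op (fun ξ => P.symbol l ξ * κ ξ) θ x)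
      (op (P.cut Q) θ) (op (fun ξ => P.cut Q ξ * h ξ) θ)) 2 volume ≤ C * eLpNorm θ ⊤ volume *
        ∑' l : ℕ, pw (-(1 - d) * max (j : ℝ) l) *
          (pw (l * d) * eLpNorm (op (P.symbol l) θ) 2 volume) := by
  have hn : (n : ℝ) < n + d := by linarith
  have hM : (0 : ℝ) ≤ n + d := by positivity
  have hl := P.symb_low hd hh.toHomog
  have hS := fun k => P.symbol_symb' hM hh.toHomog hl k
  obtain ⟨C1, hC1, h1⟩ := exists_high_velocity_estimate hd hh hκ
  obtain ⟨C2, hC2, h2⟩ := exists_low_velocity_estimate hd hh hκ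
  refine ⟨C1 + C2, by finiteness, fun {θ} hθ2 hθt j Q L => ?_⟩
  have w0 := WInt.of_memLp hn one_le_two hθ2
  set w : ℕ → Space n → ℂ := fun l => op (fun ξ => P.symbol l ξ * κ ξ) θ
  have hwt : ∀ l, l ≠ 0 → MemLp (w l) ⊤ volume := fun l hl =>
    memLp_op hn le_top (P.symbol_symb hM hκ hl) hθt
  have hp : ∀ {σ}, Symb (n + d) σ → ∀ l, l ≠ 0 → WInt (n + d) (fun y => w l y * op σ θ y) :=
    fun hσ l hl => WInt.of_memLp hn one_le_two (memLp_mul (p := ⊤) (q := 2) (hwt l hl)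
      (memLp_op hn one_le_two hσ hθ2))
  set c : ℕ → ℕ → Space n → ℂ := fun l q =>
    P.cblk h j (w l) (op (P.symbol q) θ) (op (fun ξ => P.symbol q ξ * h ξ) θ)
  have hl1 : ∀ l ∈ Finset.Icc 1 L, l ≠ 0 := fun l hl => by
    have := Finset.mem_Icc.1 hl; omega
  -- the sum over the frequencies `q` of the transported function up to `K`
  have hK : ∀ l, l ≠ 0 → ∀ K, P.cblk h j (w l) (op (P.cut K) θ) (op (fun ξ => P.cut K ξ * h ξ) θ)
      = fun x => ∑ q ∈ Finset.range (K + 1), c l q x := fun l hl K => by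
    rw [P.sum_op_symbol hM w0, P.op_cut_mul hM hh.toHomog (P.symb_low hd hh.toHomog) w0,
      cblk_sum_right hn (hS j) _ (fun k _ => hp (P.symbol_symb_one _ k) l hl)
        (fun k _ => hp (hS k) l hl)]
  have hdec : P.cblk h j (fun x => ∑ l ∈ Finset.Icc 1 L, w l x) (op (P.cut Q) θ)
      (op (fun ξ => P.cut Q ξ * h ξ) θ)
      = (∑ l ∈ Finset.Icc 1 L, P.cblk h j (w l) (op (P.cut (min Q (l + 2))) θ)
          (op (fun ξ => P.cut (min Q (l + 2)) ξ * h ξ) θ)) +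
        ∑ q ∈ Finset.range (Q + 1), P.cblk h j
          (fun x => ∑ l ∈ (Finset.Icc 1 L).filter (fun l => l + 3 ≤ q), w l x)
          (op (P.symbol q) θ) (op (fun ξ => P.symbol q ξ * h ξ) θ) := by
    rw [cblk_sum_left hn (hS j) _ (fun l hl => hp (P.cut_symb hM Q) l (hl1 l hl))
      (fun l hl => hp (P.cut_symb' hM hh.toHomog (P.symb_low hd hh.toHomog) Q) l (hl1 l hl))]
    ext x
    rw [Pi.add_apply, Finset.sum_apply, Finset.sum_apply]
    have e1 : ∀ q, P.cblk h j
          (fun x => ∑ l ∈ (Finset.Icc 1 L).filter (fun l => l + 3 ≤ q), w l x)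
          (op (P.symbol q) θ) (op (fun ξ => P.symbol q ξ * h ξ) θ) x
        = ∑ l ∈ Finset.Icc 1 L, if l + 3 ≤ q then c l q x else 0 := fun q => by
      rw [cblk_sum_left hn (hS j) _
        (fun l hl => hp (P.symbol_symb_one _ q) l (hl1 l (Finset.mem_filter.1 hl).1))
        (fun l hl => hp (hS q) l (hl1 l (Finset.mem_filter.1 hl).1))]
      exact Finset.sum_filter _ _
    simp only [e1]
    rw [Finset.sum_comm (s := Finset.range (Q + 1)), ← Finset.sum_add_distrib]
    refine Finset.sum_congr rfl fun l hl => ?_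
    rw [hK l (hl1 l hl), hK l (hl1 l hl)]
    simp only
    rw [← Finset.sum_filter_not_add_sum_filter _ (fun q => l + 3 ≤ q),
      Finset.sum_filter (fun q => l + 3 ≤ q)]
    congr 1
    refine Finset.sum_congr ?_ fun _ _ => rfl
    ext q
    simp only [Finset.mem_filter, Finset.mem_range]
    omega
  rw [hdec]
  have hm : ∀ l ∈ Finset.Icc 1 L, AEStronglyMeasurable (P.cblk h j (w l)
      (op (P.cut (min Q (l + 2))) θ) (op (fun ξ => P.cut (min Q (l + 2)) ξ * h ξ) θ)) volume :=
    fun l hl => (cblk_aesm hn (hS j) (hp (P.cut_symb hM _) l (hl1 l hl))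
      (hp (P.cut_symb' hM hh.toHomog (P.symb_low hd hh.toHomog) _) l (hl1 l hl))).meas
  have hut : ∀ q : ℕ, MemLp (fun x => ∑ l ∈ (Finset.Icc 1 L).filter (fun l => l + 3 ≤ q), w l x)
      ⊤ volume := fun q =>
    memLp_finsetSum _ fun l hl => hwt l (hl1 l (Finset.mem_filter.1 hl).1)
  have hm' : ∀ q ∈ Finset.range (Q + 1), AEStronglyMeasurable (P.cblk h j
      (fun x => ∑ l ∈ (Finset.Icc 1 L).filter (fun l => l + 3 ≤ q), w l x)
      (op (P.symbol q) θ) (op (fun ξ => P.symbol q ξ * h ξ) θ)) volume := fun q _ =>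
    (cblk_aesm hn (hS j)
      (WInt.of_memLp hn one_le_two (memLp_mul (p := ⊤) (q := 2) (hut q)
        (memLp_op hn one_le_two (P.symbol_symb_one _ q) hθ2)))
      (WInt.of_memLp hn one_le_two (memLp_mul (p := ⊤) (q := 2) (hut q)
        (memLp_op hn one_le_two (hS q) hθ2)))).meas
  refine (eLpNorm_add_le (Finset.aestronglyMeasurable_sum _ hm)
    (Finset.aestronglyMeasurable_sum _ hm') one_le_two).trans ?_
  rw [add_mul, add_mul]
  refine add_le_add ?_ ?_
  · refine (eLpNorm_sum_le hm one_le_two).trans ((Finset.sum_le_sum fun l hl =>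
      h1 hθ2 hθt j _ l (hl1 l hl) (min_le_right _ _)).trans ?_)
    rw [← Finset.mul_sum]
    gcongr _ * ?_
    exact ENNReal.sum_le_tsum _
  · refine (eLpNorm_sum_le hm' one_le_two).trans ((Finset.sum_le_sum fun q _ =>
      h2 hθ2 hθt j q _ fun l hl => ⟨hl1 l (Finset.mem_filter.1 hl).1,
        (Finset.mem_filter.1 hl).2⟩).trans ?_)
    rw [← Finset.mul_sum]
    gcongr _ * ?_
    exact ENNReal.sum_le_tsum (f := fun q : ℕ => pw (-(1 - d) * max (j : ℝ) q) *
          (pw (q * d) * eLpNorm (op (P.symbol q) θ) 2 volume)) _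

end DyadicPartition

namespace RieszCommutator

variable {n : ℕ}

/-! ### Velocities of order `-1` in a square integrable function -/

lemma Homog.exists_bound {d : ℝ} {b : Space n → ℂ} (hb : Homog d b) :
    ∃ C, 0 ≤ C ∧ ∀ ξ, ξ ≠ 0 → ‖b ξ‖ ≤ C * ‖ξ‖ ^ d := by
  have hc : ContinuousOn b (Metric.sphere 0 1) :=
    hb.smooth.continuousOn.mono fun ξ hξ h0 => by simp_all
  obtain ⟨C, hC⟩ := (isCompact_sphere (0 : Space n) 1).exists_bound_of_continuousOn hc
  refine ⟨max C 0, le_max_right _ _, fun ξ hξ => ?_⟩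
  have h0 : 0 < ‖ξ‖ := norm_pos_iff.2 hξ
  have e : b ξ = ((‖ξ‖ ^ d : ℝ) : ℂ) * b (‖ξ‖⁻¹ • ξ) := by
    rw [← hb.homog _ h0, smul_smul, mul_inv_cancel₀ h0.ne', one_smul]
  rw [e, norm_mul, Complex.norm_real, Real.norm_of_nonneg (by positivity), mul_comm]
  gcongr
  refine (hC _ ?_).trans (le_max_left _ _)
  rw [mem_sphere_zero_iff_norm, norm_smul, norm_inv, norm_norm, inv_mul_cancel₀ h0.ne']

/-- The symbol of the translation by `v`. -/
def translationSymbol (v ξ : Space n) : ℂ := Complex.exp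
    (Complex.I * ((-2 * Real.pi * inner ℝ ξ v : ℝ) : ℂ))

lemma fourierInv_translation (v : Space n) (τ : Space n → ℂ) (x : Space n) :
    𝓕⁻ (fun ξ => translationSymbol v ξ * τ ξ) x = 𝓕⁻ τ (x - v) := by
  rw [Real.fourierInv_eq', Real.fourierInv_eq']
  congr 1
  ext ξ
  rw [translationSymbol, smul_eq_mul, smul_eq_mul, ← mul_assoc, ← Complex.exp_add, inner_sub_right]
  congr 2
  push_cast
  ring

lemma translationSymbol_smooth (v : Space n) : ContDiff ℝ ∞ (translationSymbol v) := by
  have h1 : ContDiff ℝ ∞ (fun ξ : Space n => (-2 * Real.pi * inner ℝ ξ v : ℝ)) :=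
    contDiff_const.mul (contDiff_id.inner ℝ contDiff_const)
  exact (contDiff_const.mul (Complex.ofRealCLM.contDiff.comp h1)).cexp

/-- By Plancherel's theorem, `σ(D)` maps `L²` to functions Lipschitz in `L²` if `|ξ| |σ(ξ)|` is
bounded. -/
lemma lipLp_two_of_bound {σ : Space n → ℂ} (hσ : ContDiff ℝ ∞ σ) (hc : HasCompactSupport σ)
    {C : ℝ} (hC : 0 ≤ C) (h : ∀ ξ, ‖ξ‖ * ‖σ ξ‖ ≤ C) {f : Space n → ℂ} (hf : MemLp f 2 volume) :
    LipLp 2 (ENNReal.ofReal (2 * Real.pi * C) * eLpNorm f 2 volume) (op σ f) := by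
  have hn : (n : ℝ) < n + 1 := by linarith
  have hM : (0 : ℝ) ≤ n + 1 := by positivity
  have w0 := WInt.of_memLp hn one_le_two hf
  intro v
  set δ : Space n → ℂ := fun ξ => (translationSymbol v ξ - 1) * σ ξ with hδ
  have hδs : ContDiff ℝ ∞ δ := ((translationSymbol_smooth v).sub contDiff_const).mul hσ
  have hδc : HasCompactSupport δ := hc.mul_left
  have e : (fun x => op σ f (x - v) - op σ f x) = op δ f := by
    have h1 : op (fun ξ => σ ξ + δ ξ) f = fun x => op σ f x + op δ f x :=
      op_symb_add hM (Symb.of_smooth _ hσ hc) (Symb.of_smooth _ hδs hδc) w0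
    have h2 : (fun ξ => σ ξ + δ ξ) = fun ξ => translationSymbol v ξ * σ ξ := by
      ext ξ; simp only [hδ]; ring
    have h3 : ∀ x, op (fun ξ => translationSymbol v ξ * σ ξ) f x = op σ f (x - v) := fun x => by
      simp only [op, cv, fourierInv_translation, sub_right_comm]
    ext x
    rw [← h3, ← h2, h1]
    ring
  rw [e]
  have hb : ∀ ξ, ‖δ ξ‖₊ ≤ (‖v‖ * (2 * Real.pi * C)).toNNReal := fun ξ => by
    rw [← NNReal.coe_le_coe, coe_nnnorm, Real.coe_toNNReal _ (by positivity)]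
    have h1 : ‖translationSymbol v ξ - 1‖ ≤ 2 * Real.pi * (‖ξ‖ * ‖v‖) := by
      refine Real.norm_exp_I_mul_ofReal_sub_one_le.trans ?_
      rw [norm_mul, norm_mul, norm_neg, Real.norm_ofNat, Real.norm_of_nonneg Real.pi_pos.le]
      gcongr
      exact norm_inner_le_norm _ _
    calc ‖δ ξ‖ ≤ 2 * Real.pi * (‖ξ‖ * ‖v‖) * ‖σ ξ‖ := by
          rw [hδ, norm_mul]; gcongr
      _ = ‖v‖ * (2 * Real.pi * (‖ξ‖ * ‖σ ξ‖)) := by ring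
      _ ≤ _ := by gcongr; exact h ξ
  refine (eLpNorm_op_two_le hδs hδc hf hb).trans (le_of_eq ?_)
  have h2 : ‖v‖ₑ * ENNReal.ofReal (2 * Real.pi * C) =
      ((‖v‖ * (2 * Real.pi * C)).toNNReal : ℝ≥0∞) := by
    rw [← ofReal_norm, ← ENNReal.ofReal_mul (norm_nonneg v)]
    rfl
  rw [← h2, mul_assoc]

lemma ae_eq_of_FL {f g : Space n → ℂ} (hf : MemLp f 2 volume) (hg : MemLp g 2 volume)
    (h : FL hf =ᵐ[volume] FL hg) : f =ᵐ[volume] g := by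
  have h1 : (𝓕 (hf.toLp f) : Lp ℂ 2 (volume : Measure (Space n))) = 𝓕 (hg.toLp g) := Lp.ext h
  have h2 : hf.toLp f = hg.toLp g := by
    have h3 := congrArg (fun g : Lp ℂ 2 (volume : Measure (Space n)) =>
      (𝓕⁻ g : Lp ℂ 2 (volume : Measure (Space n)))) h1
    simpa only [FourierTransform.fourierInv_fourier_eq] using h3
  exact (MemLp.toLp_eq_toLp_iff hf hg).1 h2

lemma FL_add {f g : Space n → ℂ} (hf : MemLp f 2 volume) (hg : MemLp g 2 volume) :
    FL (hf.add hg) =ᵐ[volume] fun ξ => FL hf ξ + FL hg ξ := by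
  have : (𝓕 ((hf.add hg).toLp _) : Lp ℂ 2 (volume : Measure (Space n)))
      = 𝓕 (hf.toLp f) + 𝓕 (hg.toLp g) := by
    rw [MemLp.toLp_add, FourierTransform.fourier_add]
  unfold FL
  rw [this]
  exact Lp.coeFn_add _ _

lemma sum_range_eq_add_Icc {E : Type*} [AddCommMonoid E] (f : ℕ → E) (L : ℕ) :
    ∑ l ∈ Finset.range (L + 1), f l = f 0 + ∑ l ∈ Finset.Icc 1 L, f l := by
  induction L with
  | zero => simp
  | succ L ih => rw [Finset.sum_range_succ, ih, Finset.sum_Icc_succ_top (by omega), add_assoc]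

end RieszCommutator

namespace DyadicPartition

open RieszCommutator

variable {n : ℕ} (P : DyadicPartition n)

lemma symbol_mul_smooth {d : ℝ} {h : Space n → ℂ} (hh : Homog d h) {k : ℕ} (hk : k ≠ 0) :
    ContDiff ℝ ∞ (fun ξ => P.symbol k ξ * h ξ) := by
  obtain ⟨k, rfl⟩ := Nat.exists_eq_succ_of_ne_zero hk
  simp only [Nat.succ_eq_add_one, P.symbol_succ, ← dil_eq (Ψ := P.shell) hh k]
  exact contDiff_const.mul ((P.shell_shell.mul hh).smooth.comp (contDiff_const_smul _))

/-- If `u` is given by a multiplier of degree `-1` applied to a function in `L²`, the gradients of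
its truncations are bounded in `L²`. -/
lemma exists_truncation_estimate {b : Space n → ℂ} (hb : Homog (-1) b) : ∃ C : ℝ≥0∞, C ≠ ⊤ ∧
    ∀ {Γ : Space n → ℂ} (_ : MemLp Γ 2 volume) (L : ℕ),
      LipLp 2 (C * eLpNorm Γ 2 volume)
        (fun x => ∑ l ∈ Finset.Icc 1 L, op (fun ξ => P.symbol l ξ * b ξ) Γ x) ∧
      eLpNorm (fun x => ∑ l ∈ Finset.Icc 1 L, op (fun ξ => P.symbol l ξ * b ξ) Γ x) 2 volume
        ≤ C * eLpNorm Γ 2 volume := by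
  have hn : (n : ℝ) < n + 1 := by linarith
  have hM : (0 : ℝ) ≤ n + 1 := by positivity
  obtain ⟨C1, hC1, b1⟩ := P.symbol_bds hb
  obtain ⟨B, hB, h1⟩ := hb.exists_bound
  obtain ⟨K, hK⟩ := (P.low_symb (n + 1)).bounded hn
  have hK0 : 0 ≤ K := (norm_nonneg _).trans (hK 0)
  refine ⟨ENNReal.ofReal (2 * Real.pi * (2 * K * B)) + C1 * geo 1,
    by finiteness [(geo_lt_top one_pos).ne], fun {Γ} hΓ L => ⟨?_, ?_⟩⟩
  -- the gradient is bounded by Plancherel: `|ξ| |b(ξ)|` is bounded, and the symbols `σ_l` sum up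
  -- to a difference of two cutoffs
  · have w0 := WInt.of_memLp hn one_le_two hΓ
    have hl : ∀ l ∈ Finset.Icc 1 L, l ≠ 0 := fun l hl => by
      have := Finset.mem_Icc.1 hl; omega
    rw [← op_symb_sum hM _ (fun l h => P.symbol_symb hM hb (hl l h)) w0]
    refine (lipLp_two_of_bound (C := 2 * K * B) (ContDiff.sum fun l h =>
      P.symbol_mul_smooth hb (hl l h)) ?_ (by positivity) (fun ξ => ?_) hΓ).mono
      (by gcongr; exact le_self_add)
    · have e : (fun ξ => ∑ l ∈ Finset.Icc 1 L, P.symbol l ξ * b ξ)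
          = fun ξ => (P.cut L ξ - P.low ξ) * b ξ := by
        ext ξ
        rw [← Finset.sum_mul, ← P.sum_symbol, sum_range_eq_add_Icc, ← P.symbol_zero,
          add_sub_cancel_left]
      rw [e]
      have hc : HasCompactSupport (P.cut L) :=
        P.low_compact.comp_smul (inv_ne_zero (pow_ne_zero _ two_ne_zero))
      exact (hc.sub P.low_compact).mul_right
    · rcases eq_or_ne ξ 0 with rfl | hξ
      · simp; positivity
      have h0 : 0 < ‖ξ‖ := norm_pos_iff.2 hξ
      have e : ∑ l ∈ Finset.Icc 1 L, P.symbol l ξ * b ξ = (P.cut L ξ - P.low ξ) * b ξ := by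
        rw [← Finset.sum_mul, ← P.sum_symbol, sum_range_eq_add_Icc, ← P.symbol_zero,
          add_sub_cancel_left]
      have h2 : ‖P.cut L ξ - P.low ξ‖ ≤ 2 * K :=
        (norm_sub_le _ _).trans ((add_le_add (hK _) (hK ξ)).trans (by linarith))
      rw [e, norm_mul]
      calc ‖ξ‖ * (‖P.cut L ξ - P.low ξ‖ * ‖b ξ‖) ≤ ‖ξ‖ * (2 * K * (B * ‖ξ‖ ^ (-1 : ℝ))) := by
            gcongr
            exact h1 ξ hξ
        _ = 2 * K * B * (‖ξ‖ * ‖ξ‖ ^ (-1 : ℝ)) := by ring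
        _ = _ := by rw [Real.rpow_neg_one, mul_inv_cancel₀ h0.ne', mul_one]
  · have hl : ∀ l ∈ Finset.Icc 1 L, l ≠ 0 := fun l hl => by
      have := Finset.mem_Icc.1 hl; omega
    have e : (fun x => ∑ l ∈ Finset.Icc 1 L, op (fun ξ => P.symbol l ξ * b ξ) Γ x)
        = ∑ l ∈ Finset.Icc 1 L, op (fun ξ => P.symbol l ξ * b ξ) Γ := by
      ext x; simp [Finset.sum_apply]
    rw [e]
    refine (eLpNorm_sum_le (fun l h => (memLp_op hn one_le_two
      (P.symbol_symb hM hb (hl l h)) hΓ).1) one_le_two).trans ?_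
    calc _ ≤ ∑ l ∈ Finset.Icc 1 L, C1 * pw (l * (-1)) * eLpNorm Γ 2 volume :=
          Finset.sum_le_sum fun l h => (eLpNorm_op_le one_le_two
            (P.symbol_symb hM hb (hl l h)) hΓ.1).trans (by gcongr; exact (b1 l (hl l h)).1.one)
      _ = C1 * (∑ l ∈ Finset.Icc 1 L, pw (l * (-1))) * eLpNorm Γ 2 volume := by
          rw [Finset.mul_sum, Finset.sum_mul]
      _ ≤ C1 * geo 1 * eLpNorm Γ 2 volume := by
          gcongr _ * ?_ * _
          refine (ENNReal.sum_le_tsum _).trans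
              (le_trans (le_of_eq ?_) (tsum_geo_le 1 0 ⟨0, by simp⟩))
          congr 1; ext l
          rw [zero_sub, abs_neg, Nat.abs_cast, mul_comm]
      _ ≤ _ := by
          gcongr
          exact le_add_self

/-- The blocks of the Biot-Savart velocity: the parts generated by `Γ` and by `h(D) θ`. -/
lemma op_symbol_ae_eq {d : ℝ} {U Γ θ b h : Space n → ℂ} (hb : Homog (-1) b)
    (hκ : Homog d (fun ξ => b ξ * h ξ)) (hU : MemLp U 2 volume) (hΓ : MemLp Γ 2 volume)
    (hθ : MemLp θ 2 volume)
    (hFL : FL hU =ᵐ[volume] fun ξ => b ξ * (FL hΓ ξ + h ξ * FL hθ ξ)) {l : ℕ} (hl : l ≠ 0) :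
    op (P.symbol l) U =ᵐ[volume] fun x => op (fun ξ => P.symbol l ξ * b ξ) Γ x +
      op (fun ξ => P.symbol l ξ * (b ξ * h ξ)) θ x := by
  have hn : (n : ℝ) < n + 1 := by linarith
  have hM : (0 : ℝ) ≤ n + 1 := by positivity
  have m0 := memLp_op hn one_le_two (P.symbol_symb_one _ l) hU
  have m1 := memLp_op hn one_le_two (P.symbol_symb hM hb hl) hΓ
  have m2 := memLp_op hn one_le_two (P.symbol_symb hM hκ hl) hθ
  refine ae_eq_of_FL m0 (m1.add m2) ?_
  filter_upwards [FL_op (P.symbol_smooth l) (P.symbol_compact l) hU m0,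
    FL_op (P.symbol_mul_smooth hb hl) (P.symbol_compact l).mul_right hΓ m1,
    FL_op (P.symbol_mul_smooth hκ hl) (P.symbol_compact l).mul_right hθ m2, FL_add m1 m2, hFL]
    with ξ h0 h1 h2 h3 h4
  rw [h0, h3, h1, h2, h4]
  ring

end DyadicPartition

namespace DyadicPartition

open RieszCommutator

variable {n : ℕ} {P : DyadicPartition n}

/-! ### The estimate of `[R_α, u] θ` for the Biot-Savart velocity -/

lemma _root_.RieszCommutator.eLpNorm_geo_single_le (ε : ℝ) (c : ℝ≥0∞) :
    eLpNorm (fun k : ℕ => pw (-ε * k) * c) 2 Measure.count ≤ geo ε * c := by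
  have h := eLpNorm_geo_le (ε := ε) (r := 2) one_le_two (fun q : ℕ => if q = 0 then c else 0)
  refine le_trans (eLpNorm_count_mono 2 fun k => ?_)
    (h.trans (mul_le_mul' le_rfl (eLpNorm_single_le c)))
  refine le_trans (le_of_eq ?_) (ENNReal.le_tsum 0)
  simp

/-- The lowest frequencies of the velocity are bounded and smooth. -/
lemma exists_lowest_velocity_pairing {d s : ℝ} (hd : 0 < d) (hs : 0 < s) (hsd : s < 1 - d)
    {h : Space n → ℂ} (hh : Mult P d h) : ∃ C : ℝ≥0∞, C ≠ ⊤ ∧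
    ∀ {u θ : Space n → ℂ} (_ : MemLp u 2 volume) (_ : MemLp θ 2 volume) (ψ : 𝓢(Space n, ℂ)) (Q : ℕ),
    ‖(∫ x, op (P.symbol 0) u x * op (P.cut Q) θ x * tr h ψ x) -
        ∫ x, op (P.symbol 0) u x * op (fun ξ => P.cut Q ξ * h ξ) θ x * ψ x‖ₑ ≤
      C * (eLpNorm u 2 volume * eLpNorm θ 2 volume) *
        eLpNorm (fun j : ℕ => pw (j * -s) * eLpNorm (op (P.symT j) ψ) 2 volume) 2
          Measure.count := by
  have hn : (n : ℝ) < n + d := by linarith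
  have hM : (0 : ℝ) ≤ n + d := by positivity
  obtain ⟨C1, hC1, h1⟩ := exists_pairing_estimate hd hs hsd hh
  obtain ⟨B, hB, h2⟩ := exists_bernstein P
  obtain ⟨B0, hB0, h3⟩ := exists_lipLp_of_smooth (P.symT_smooth 0) (P.symT_compact 0)
  obtain ⟨C3, hC3, b3⟩ := P.one_bds
  have hg := (geo_lt_top (ε := 1 - d - s) (by linarith)).ne
  refine ⟨C1 * (B0 * B * (geo (1 - d - s) * C3) + B * C3), by finiteness, ?_⟩
  intro u θ hu hθ ψ Q
  have w0 := WInt.of_memLp hn one_le_two hu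
  have hut : MemLp (op (P.symbol 0) u) ⊤ volume := memLp_op_top hn one_le_two
      (P.symbol_symb_one _ 0) hu
  have hlip : LipLp ⊤ (B0 * (B * eLpNorm u 2 volume)) (op (P.symbol 0) u) := by
    rw [← op_symT_symbol hn 0 w0]
    exact (lipLp_op hM le_top (P.symT_symb_one _ 0) h3
      (w0.op hn (P.symbol_symb_one _ 0))).mono (by gcongr; exact h2 hu 0 (by norm_num))
  have ht : ∀ k, eLpNorm (op (P.symbol k) θ) 2 volume ≤ C3 * eLpNorm θ 2 volume := fun k =>
    (eLpNorm_op_le one_le_two (P.symbol_symb_one (n + d) k) hθ.1).trans (by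
      gcongr; exact (b3 k).1)
  have hu2 := hu.2.ne
  refine (h1 (p := ⊤) (q := 2) one_le_two (by finiteness) hut.1 hlip
    (WInt.of_memLp hn one_le_two hθ)
    (fun σ hσ => memLp_mul (p := ⊤) (q := 2) hut (memLp_op hn one_le_two hσ hθ))
    (fun k _ => ht k) ψ Q).trans ?_
  gcongr ?_ * _
  rw [mul_assoc C1]
  gcongr _ * ?_
  calc _ ≤ B0 * (B * eLpNorm u 2 volume) * (geo (1 - d - s) * (C3 * eLpNorm θ 2 volume)) +
        B * eLpNorm u 2 volume * (C3 * eLpNorm θ 2 volume) := by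
        refine add_le_add (mul_le_mul' le_rfl ?_) (mul_le_mul' ?_ le_rfl)
        · refine le_trans (eLpNorm_count_mono 2 fun k => ?_) (eLpNorm_geo_single_le _ _)
          refine mul_le_mul' (le_of_eq ?_) (ht k)
          congr 1; ring
        · exact h2 hu 0 (by norm_num)
    _ = _ := by ring

/-- The part of the velocity coming from a function in `L²` is controlled by its gradient. -/
lemma exists_regular_velocity_pairing {d s : ℝ} (hd : 0 < d) (hs : 0 < s) (hsd : s < 1 - d)
    {h b : Space n → ℂ} (hh : Mult P d h) (hb : Homog (-1) b) : ∃ C : ℝ≥0∞, C ≠ ⊤ ∧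
    ∀ {Γ θ : Space n → ℂ} (_ : MemLp Γ 2 volume) (_ : MemLp θ 2 volume) (ψ : 𝓢(Space n, ℂ))
      (Q L : ℕ),
    ‖(∫ x, (∑ l ∈ Finset.Icc 1 L, op (fun ξ => P.symbol l ξ * b ξ) Γ x) *
          op (P.cut Q) θ x * tr h ψ x) -
        ∫ x, (∑ l ∈ Finset.Icc 1 L, op (fun ξ => P.symbol l ξ * b ξ) Γ x) *
          op (fun ξ => P.cut Q ξ * h ξ) θ x * ψ x‖ₑ ≤
      C * (eLpNorm Γ 2 volume *
        eLpNorm (fun k : ℕ => pw (k * (s - (1 - d))) * eLpNorm (op (P.symbol k) θ) ⊤ volume)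
          2 Measure.count) *
        eLpNorm (fun j : ℕ => pw (j * -s) * eLpNorm (op (P.symT j) ψ) 2 volume) 2
          Measure.count := by
  have hn : (n : ℝ) < n + d := by linarith
  have hM : (0 : ℝ) ≤ n + d := by positivity
  obtain ⟨C1, hC1, h1⟩ := exists_pairing_estimate hd hs hsd hh
  obtain ⟨C2, hC2, h2⟩ := P.exists_truncation_estimate hb
  refine ⟨C1 * (C2 + C2 * pw (2 * (1 - d - s))), by finiteness [pw_ne_top (2 * (1 - d - s))], ?_⟩
  intro Γ θ hΓ hθ ψ Q L
  obtain ⟨h3, h4⟩ := h2 hΓ L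
  set v := fun x => ∑ l ∈ Finset.Icc 1 L, op (fun ξ => P.symbol l ξ * b ξ) Γ x
  have hv : MemLp v 2 volume := memLp_finsetSum _ fun l hl => memLp_op hn one_le_two
    (P.symbol_symb hM hb (by have := Finset.mem_Icc.1 hl; omega)) hΓ
  set B := eLpNorm (fun k : ℕ => pw (k * (s - (1 - d))) * eLpNorm (op (P.symbol k) θ) ⊤ volume)
    2 Measure.count
  have hΓ2 := hΓ.2.ne
  have hX : ∀ k < 3, eLpNorm (op (P.symbol k) θ) ⊤ volume ≤ pw (2 * (1 - d - s)) * B := by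
    intro k hk
    have h5 := le_eLpNorm_count (r := 2) one_le_two (fun k : ℕ => pw (k * (s - (1 - d))) *
      eLpNorm (op (P.symbol k) θ) ⊤ volume) k
    calc _ = pw (k * (1 - d - s)) * (pw (k * (s - (1 - d))) *
          eLpNorm (op (P.symbol k) θ) ⊤ volume) := by
          rw [← mul_assoc, ← pw_add, show (k : ℝ) * (1 - d - s) + k * (s - (1 - d)) = 0 by ring,
            pw_zero, one_mul]
      _ ≤ _ := by
          refine mul_le_mul' (pw_mono ?_) h5
          have : (k : ℝ) ≤ 2 := by exact_mod_cast (by omega : k ≤ 2)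
          gcongr
  refine (h1 (p := 2) (q := ⊤) le_top (by finiteness) hv.1 h3 (WInt.of_memLp hn one_le_two hθ)
    (fun σ hσ => memLp_mul (p := 2) (q := ⊤) hv (memLp_op_top hn one_le_two hσ hθ)) hX ψ Q).trans ?_
  gcongr ?_ * _
  rw [mul_assoc C1]
  gcongr _ * ?_
  calc _ ≤ C2 * eLpNorm Γ 2 volume * B + C2 * eLpNorm Γ 2 volume * (pw (2 * (1 - d - s)) * B) := by
        gcongr
    _ = _ := by ring

/-- The part of the velocity that is a multiplier of negative order in `θ` itself. -/
lemma exists_rough_velocity_pairing {d s : ℝ} (hd : 0 < d) (hs : 0 < s) (hsd : s < 1 - d)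
    {h κ : Space n → ℂ} (hh : Mult P d h) (hκ : Homog (d - 1) κ) : ∃ C : ℝ≥0∞, C ≠ ⊤ ∧
    ∀ {θ : Space n → ℂ} (_ : MemLp θ 2 volume) (_ : MemLp θ ⊤ volume) (ψ : 𝓢(Space n, ℂ))
      (Q L : ℕ),
    ‖(∫ x, (∑ l ∈ Finset.Icc 1 L, op (fun ξ => P.symbol l ξ * κ ξ) θ x) *
          op (P.cut Q) θ x * tr h ψ x) -
        ∫ x, (∑ l ∈ Finset.Icc 1 L, op (fun ξ => P.symbol l ξ * κ ξ) θ x) *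
          op (fun ξ => P.cut Q ξ * h ξ) θ x * ψ x‖ₑ ≤
      C * (eLpNorm θ ⊤ volume *
        eLpNorm (fun k : ℕ => pw (k * (s - (1 - d) + d)) * eLpNorm (op (P.symbol k) θ) 2 volume)
          2 Measure.count) *
        eLpNorm (fun j : ℕ => pw (j * -s) * eLpNorm (op (P.symT j) ψ) 2 volume) 2
          Measure.count := by
  have hn : (n : ℝ) < n + d := by linarith
  have hM : (0 : ℝ) ≤ n + d := by positivity
  obtain ⟨C1, hC1, h1⟩ := exists_velocity_estimate hd hh hκ
  set ε := min s (1 - d - s)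
  have hg := (geo_lt_top (lt_min hs (by linarith) : 0 < ε)).ne
  refine ⟨C1 * geo ε, by finiteness, fun {θ} hθ2 hθt ψ Q L => ?_⟩
  have hw : MemLp (fun x => ∑ l ∈ Finset.Icc 1 L, op (fun ξ => P.symbol l ξ * κ ξ) θ x) 2 volume :=
    memLp_finsetSum _ fun l hl => memLp_op hn one_le_two
      (P.symbol_symb hM hκ (by have := Finset.mem_Icc.1 hl; omega)) hθ2
  refine (P.enorm_pairing_le hd hh
    (memLp_mul (p := 2) (q := ⊤) hw (memLp_op_top hn one_le_two (P.cut_symb hM Q) hθ2))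
    (memLp_mul (p := 2) (q := ⊤) hw (memLp_op_top hn one_le_two
      (P.cut_symb' hM hh.toHomog (P.symb_low hd hh.toHomog) Q) hθ2)) ψ s).trans ?_
  gcongr ?_ * _
  set t := fun l : ℕ => eLpNorm (op (P.symbol l) θ) 2 volume
  have hθt' := hθt.2.ne
  calc _ ≤ eLpNorm (fun j : ℕ => C1 * eLpNorm θ ⊤ volume *
        ∑' l : ℕ, pw (-ε * |(j : ℝ) - l|) * (pw (l * (s - (1 - d) + d)) * t l)) 2
            Measure.count := by
        refine eLpNorm_count_mono 2 fun j => ?_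
        refine (mul_le_mul' le_rfl (h1 hθ2 hθt j Q L)).trans ?_
        rw [mul_left_comm]
        gcongr _ * ?_
        rw [← ENNReal.tsum_mul_left]
        refine ENNReal.tsum_le_tsum fun l => ?_
        rw [← mul_assoc, ← mul_assoc, ← mul_assoc]
        refine mul_le_mul' ?_ le_rfl
        refine (mul_le_mul' (pw_weight_le j l) le_rfl).trans (le_of_eq ?_)
        rw [mul_assoc, ← pw_add, ← mul_add]
    _ ≤ C1 * eLpNorm θ ⊤ volume * (geo ε *
          eLpNorm (fun l : ℕ => pw (l * (s - (1 - d) + d)) * t l) 2 Measure.count) := by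
        refine (eLpNorm_count_const_mul 2 (by finiteness) _).trans ?_
        gcongr _ * ?_
        exact eLpNorm_geo_le one_le_two _
    _ = _ := by ring

/-- The commutator with a function `U` whose Fourier transform is `b (Γ^ + h θ^)`, tested against
`ψ`. -/
lemma exists_velocity_pairing {d s : ℝ} (hd : 0 < d) (hs : 0 < s) (hsd : s < 1 - d)
    {h b : Space n → ℂ} (hh : Mult P d h) (hb : Homog (-1) b) : ∃ C : ℝ≥0∞, C ≠ ⊤ ∧
    ∀ {U Γ θ : Space n → ℂ} (hU : MemLp U 2 volume) (hΓ : MemLp Γ 2 volume) (hθ : MemLp θ 2 volume)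
      (_ : MemLp θ ⊤ volume)
      (_ : FL hU =ᵐ[volume] fun ξ => b ξ * (FL hΓ ξ + h ξ * FL hθ ξ)) (ψ : 𝓢(Space n, ℂ)) (Q : ℕ),
    ‖(∫ x, U x * op (P.cut Q) θ x * tr h ψ x) -
        ∫ x, U x * op (fun ξ => P.cut Q ξ * h ξ) θ x * ψ x‖ₑ ≤
      C * (eLpNorm Γ 2 volume *
        eLpNorm (fun k : ℕ => pw (k * (s - (1 - d))) * eLpNorm (op (P.symbol k) θ) ⊤ volume)
          2 Measure.count + eLpNorm θ ⊤ volume *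
        eLpNorm (fun k : ℕ => pw (k * (s - (1 - d) + d)) * eLpNorm (op (P.symbol k) θ) 2 volume)
          2 Measure.count + eLpNorm U 2 volume * eLpNorm θ 2 volume) *
        eLpNorm (fun j : ℕ => pw (j * -s) * eLpNorm (op (P.symT j) ψ) 2 volume) 2
          Measure.count := by
  have hn : (n : ℝ) < n + d := by linarith
  have hM : (0 : ℝ) ≤ n + d := by positivity
  have hκ : Homog (d - 1) (fun ξ => b ξ * h ξ) := by
    have := hb.mul hh.toHomog
    rwa [neg_add_eq_sub] at this
  obtain ⟨C1, hC1, h1⟩ := exists_lowest_velocity_pairing hd hs hsd hh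
  obtain ⟨C2, hC2, h2⟩ := exists_regular_velocity_pairing hd hs hsd hh hb
  obtain ⟨C3, hC3, h3⟩ := exists_rough_velocity_pairing hd hs hsd hh hκ
  refine ⟨C1 + C2 + C3, by finiteness, ?_⟩
  intro U Γ θ hU hΓ hθ hθt hFL ψ Q
  set f := op (P.cut Q) θ with hf
  set g := op (fun ξ => P.cut Q ξ * h ξ) θ with hg
  have hft : MemLp f ⊤ volume := memLp_op_top hn one_le_two (P.cut_symb hM Q) hθ
  have hgt : MemLp g ⊤ volume :=
    memLp_op_top hn one_le_two (P.cut_symb' hM hh.toHomog (P.symb_low hd hh.toHomog) Q) hθ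
  have hψ := ψ.memLp 2 (volume : Measure (Space n))
  have hfW : MemLp (fun x => f x * tr h ψ x) 2 volume :=
    memLp_mul (p := ⊤) (q := 2) hft ((hh.decays_tr hd ψ).memLp hn one_le_two)
  have hgψ : MemLp (fun x => g x * ψ x) 2 volume := memLp_mul (p := ⊤) (q := 2) hgt hψ
  set pr : (Space n → ℂ) → ℂ := fun u =>
    (∫ x, u x * (f x * tr h ψ x)) - ∫ x, u x * (g x * ψ x) with hpr
  have e : ∀ u : Space n → ℂ, (∫ x, u x * f x * tr h ψ x) - ∫ x, u x * g x * ψ x = pr u :=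
    fun u => by simp only [hpr, mul_assoc]
  have hadd : ∀ u v, MemLp u 2 volume → MemLp v 2 volume → pr (fun x => u x + v x) = pr u + pr
      v := by
    intro u v hu hv
    simp only [hpr, add_mul]
    rw [integral_add (integrable_mul_of_memLp hu hfW) (integrable_mul_of_memLp hv hfW),
      integral_add (integrable_mul_of_memLp hu hgψ) (integrable_mul_of_memLp hv hgψ)]
    ring
  have k1 := h1 hU hθ ψ Q
  have k2 := h2 hΓ hθ ψ Q
  have k3 := h3 hθ hθt ψ Q
  simp only [← hf, ← hg] at k1 k2 k3
  rw [e] at k1 ⊢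
  simp only [e] at k2 k3
  have mc : ∀ L, MemLp (op (P.cut L) U) 2 volume := fun L =>
    memLp_op hn one_le_two (P.cut_symb hM L) hU
  -- truncation of `U`, which makes the splitting a finite one
  have t : Tendsto (fun L => pr (op (P.cut L) U)) atTop (𝓝 (pr U)) :=
    (tendsto_integral_mul mc hU hfW (P.tendsto_op_cut one_le_two ENNReal.ofNat_ne_top hU)).sub
      (tendsto_integral_mul mc hU hgψ (P.tendsto_op_cut one_le_two ENNReal.ofNat_ne_top hU))
  refine le_of_tendsto t.enorm (Eventually.of_forall fun L => ?_)
  have hl : ∀ l ∈ Finset.Icc 1 L, l ≠ 0 := fun l hl => by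
    have := Finset.mem_Icc.1 hl; omega
  -- the lowest frequencies, the part generated by `Γ` and the part generated by `h(D) θ`
  have hae : op (P.cut L) U =ᵐ[volume] fun x => op (P.symbol 0) U x +
      ((∑ l ∈ Finset.Icc 1 L, op (fun ξ => P.symbol l ξ * b ξ) Γ x) +
        ∑ l ∈ Finset.Icc 1 L, op (fun ξ => P.symbol l ξ * (b ξ * h ξ)) θ x) := by
    rw [P.sum_op_symbol hM (WInt.of_memLp hn one_le_two hU)]
    have := (Finset.Icc 1 L).eventually_all.2 fun l h => P.op_symbol_ae_eq hb hκ hU hΓ hθ hFL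
        (hl l h)
    filter_upwards [this] with x hx
    rw [sum_range_eq_add_Icc, ← Finset.sum_add_distrib]
    congr 1
    exact Finset.sum_congr rfl hx
  have hpr_eq : pr (op (P.cut L) U) = pr (fun x => op (P.symbol 0) U x +
      ((∑ l ∈ Finset.Icc 1 L, op (fun ξ => P.symbol l ξ * b ξ) Γ x) +
        ∑ l ∈ Finset.Icc 1 L, op (fun ξ => P.symbol l ξ * (b ξ * h ξ)) θ x)) := by
    simp only [hpr]
    congr 1
    · refine integral_congr_ae ?_
      filter_upwards [hae] with x hx
      rw [hx]
    · refine integral_congr_ae ?_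
      filter_upwards [hae] with x hx
      rw [hx]
  have m0 := memLp_op hn one_le_two (P.symbol_symb_one (n + d) 0) hU
  have m1 : MemLp (fun x => ∑ l ∈ Finset.Icc 1 L, op (fun ξ => P.symbol l ξ * b ξ) Γ x) 2 volume :=
    memLp_finsetSum _ fun l h => memLp_op hn one_le_two (P.symbol_symb hM hb (hl l h)) hΓ
  have m2 : MemLp (fun x => ∑ l ∈ Finset.Icc 1 L, op (fun ξ => P.symbol l ξ * (b ξ * h ξ)) θ x) 2
      volume :=
    memLp_finsetSum _ fun l h => memLp_op hn one_le_two (P.symbol_symb hM hκ (hl l h)) hθ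
  rw [hpr_eq.trans ((hadd _ _ m0 (m1.add m2)).trans
    (congrArg (pr (op (P.symbol 0) U) + ·) (hadd _ _ m1 m2)))]
  refine ((enorm_add_le _ _).trans (add_le_add k1 ((enorm_add_le _ _).trans
    (add_le_add (k2 L) (k3 L))))).trans ?_
  rw [← add_mul, ← add_mul]
  gcongr ?_ * _
  generalize eLpNorm Γ 2 volume * _ = a1
  generalize eLpNorm θ ⊤ volume * _ = a2
  generalize eLpNorm U 2 volume * _ = a3
  calc _ ≤ (C1 + C2 + C3) * a3 + ((C1 + C2 + C3) * a1 + (C1 + C2 + C3) * a2) := by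
        gcongr
        · rw [add_assoc]; exact le_self_add
        · rw [add_right_comm]; exact le_add_self
        · exact le_add_self
    _ = _ := by ring

end DyadicPartition

namespace DyadicPartition

open RieszCommutator

/-- The symbols of the components of `Δ⁻¹ ∇^⊥`. -/
def _root_.RieszCommutator.biotSavartSymbol (i : Fin 2) (ξ : Space 2) : ℂ :=
  (if i = 0 then 2 * Real.pi * Complex.I else -(2 * Real.pi * Complex.I)) *
    ((((2 * Real.pi * ‖ξ‖) ^ (-2 : ℝ) : ℝ) : ℂ) * (ξ (1 - i) : ℂ))

lemma _root_.RieszCommutator.biotSavartSymbol_homog (i : Fin 2) :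
    Homog (-1) (biotSavartSymbol i) := by
  have := ((Homog.norm_rpow (n := 2) (-2)).mul (Homog.coord (1 - i))).const_mul
    (if i = 0 then 2 * Real.pi * Complex.I else -(2 * Real.pi * Complex.I))
  rwa [show (-2 : ℝ) + 1 = -1 by norm_num] at this

lemma _root_.RieszCommutator.isBiotSavart_component {u : Space 2 → Space 2}
    {hu : ∀ i, MemLp (fun x => u x i) 2 volume} {w : Space 2 → ℂ} (h : IsBiotSavart hu w)
    (i : Fin 2) : fourierL2 (hu i) =ᵐ[volume] fun ξ => biotSavartSymbol i ξ * w ξ := by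
  have e : ∀ x : ℝ, 0 ≤ x → ((x ^ (-2 : ℝ) : ℝ) : ℂ) = ((x ^ 2 : ℝ) : ℂ)⁻¹ := fun x hx => by
    rw [Real.rpow_neg hx, Real.rpow_two, Complex.ofReal_inv]
  have hx : ∀ ξ : Space 2, 0 ≤ 2 * Real.pi * ‖ξ‖ := fun ξ => by positivity
  fin_cases i
  · filter_upwards [h.1] with ξ hξ
    simp only [Fin.zero_eta, hξ, biotSavartSymbol, if_true, e _ (hx ξ), inv_neg, sub_zero]
    ring
  · filter_upwards [h.2] with ξ hξ
    simp only [Fin.mk_one, hξ, biotSavartSymbol, one_ne_zero, if_false, e _ (hx ξ), inv_neg,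
        sub_self]
    ring

/-- The estimate of `[R_α, u] θ` in `H^s`, `0 < s < α`, for a planar velocity given by the
Biot-Savart law with vorticity `Γ + R_α θ`. -/
theorem exists_commMul_bound_biotSavart (P : DyadicPartition 2) {α s : ℝ} (hα1 : α < 1)
    (hs : 0 < s) (hsα : s < α) :
    ∃ C : ℝ≥0, ∀ (u : Space 2 → Space 2) (θ Γ : Space 2 → ℝ),
      ContDiff ℝ ∞ u → MemLp u 2 volume → MemLp θ ⊤ volume →
      ∀ (hu : ∀ i, MemLp (fun x => u x i) 2 volume)
        (hθ : MemLp θ 2 volume) (hΓ : MemLp Γ 2 volume),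
      IsBiotSavart hu (fun ξ => fourierL2 hΓ ξ + rieszSymbol α ξ * fourierL2 hθ ξ) →
      sobolevNorm (s + 1 - 2 * α) (lpDist hθ) < ⊤ →
      ∃ F : Fin 2 → 𝓢'(Space 2, ℂ), (∀ i, Extends (F i) (commMul α u θ i)) ∧
        ∑ i, sobolevNorm s (F i) ≤
          C * (eLpNorm Γ 2 volume * besovNorm P (s - α) ⊤ 2 (lpDist hθ)
            + eLpNorm θ ⊤ volume * sobolevNorm (s + 1 - 2 * α) (lpDist hθ)
            + eLpNorm u 2 volume * eLpNorm θ 2 volume) := by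
  have hd : 0 < 1 - α := by linarith
  choose C1 hC1 h1 using fun i => exists_velocity_pairing hd hs (by linarith) (mult_riesz P α)
    (biotSavartSymbol_homog i)
  obtain ⟨C2, hC2, h2⟩ := P.exists_commMul_extension hα1 s
  obtain ⟨C3, hC3, h3⟩ := P.exists_blocks_le_sobolev (s + 1 - 2 * α)
  obtain ⟨C4, hC4, b4⟩ := P.one_bds
  set D := C1 0 + C1 1
  have hD : D ≠ ⊤ := ENNReal.add_ne_top.2 ⟨hC1 0, hC1 1⟩
  have hCD : ∀ i, C1 i ≤ D := fun i => by
    fin_cases i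
    · exact le_self_add
    · exact le_add_self
  have hC : 2 * (C2 * (D * (pw (s - α) + C3 + 1))) ≠ ⊤ := by finiteness [pw_ne_top (s - α)]
  refine ⟨(2 * (C2 * (D * (pw (s - α) + C3 + 1)))).toNNReal,
    fun u θ Γ hus hu hθt hu' hθ hΓ hbs hsob => ?_⟩
  rw [ENNReal.coe_toNNReal hC]
  set θ' : Space 2 → ℂ := fun x => (θ x : ℂ)
  have hθ' : MemLp θ' 2 volume := hθ.ofReal
  have hΓ' : MemLp (fun x => (Γ x : ℂ)) 2 volume := hΓ.ofReal
  have hθt' : MemLp θ' ⊤ volume := hθt.ofReal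
  have eθ : eLpNorm θ' 2 volume = eLpNorm θ 2 volume := eLpNorm_ofReal θ
  have eθt : eLpNorm θ' ⊤ volume = eLpNorm θ ⊤ volume := eLpNorm_ofReal θ
  have eΓ : eLpNorm (fun x => (Γ x : ℂ)) 2 volume = eLpNorm Γ 2 volume := eLpNorm_ofReal Γ
  set B := eLpNorm (fun k : ℕ => pw (k * (s - α)) * eLpNorm (op (P.symbol k) θ') ⊤ volume) 2
    Measure.count with hB
  set S := eLpNorm (fun k : ℕ => pw (k * (s + 1 - 2 * α)) * eLpNorm (op (P.symbol k) θ') 2 volume) 2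
    Measure.count with hS
  -- this norm is finite without further assumptions, since `θ` is bounded and `s < α`
  have hBt : B ≠ ⊤ := by
    have hg := (geo_lt_top (ε := α - s) (by linarith)).ne
    have ht := hθt'.2.ne
    refine ne_top_of_le_ne_top (b := geo (α - s) * (C4 * eLpNorm θ' ⊤ volume)) (by finiteness)
      (le_trans (eLpNorm_count_mono 2 fun k => ?_) (eLpNorm_geo_single_le _ _))
    rw [show (k : ℝ) * (s - α) = -(α - s) * k by ring]
    gcongr _ * ?_
    exact (eLpNorm_op_le le_top (P.symbol_symb_one 3 k) hθt'.1).trans (by gcongr; exact (b4 k).1)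
  have hS1 : S ≤ C3 * sobolevNorm (s + 1 - 2 * α) (lpDist hθ) :=
    h3 hθ' (lpDist_apply hθ) hsob
  have hSt : S ≠ ⊤ := ne_top_of_le_ne_top (by finiteness [hsob.ne]) hS1
  have hB1 : B ≤ pw (s - α) * besovNorm P (s - α) ⊤ 2 (lpDist hθ) :=
    P.blocks_le_besovNorm hθ (s - α) le_top 2
  set N := eLpNorm Γ 2 volume * B + eLpNorm θ ⊤ volume * S
    + eLpNorm u 2 volume * eLpNorm θ 2 volume with hN
  have hNt : N ≠ ⊤ := by
    have := hΓ.2.ne; have := hu.2.ne; have := hθ.2.ne; have := hθt.2.ne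
    finiteness
  have key : ∀ i, ∃ F : 𝓢'(Space 2, ℂ), Extends F (commMul α u θ i) ∧
      sobolevNorm s F ≤ C2 * (D * N) := fun i => by
    refine h2 hus hu hθ i (by finiteness) fun ψ _ Q => ?_
    have hFL := isBiotSavart_component hbs i
    have h4 := h1 i (memLp_component hu i) hΓ' hθ' hθt' hFL ψ Q
    rw [show s - (1 - (1 - α)) = s - α by ring,
      show s - α + (1 - α) = s + 1 - 2 * α by ring, eθ, eθt, eΓ, ← hB, ← hS] at h4
    refine h4.trans ?_
    gcongr ?_ * _
    refine mul_le_mul' (hCD i) ?_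
    rw [hN]
    gcongr
    exact eLpNorm_component_le u i
  choose F hF hF' using key
  refine ⟨F, hF, (Finset.sum_le_card_nsmul _ _ _ fun i _ => hF' i).trans ?_⟩
  rw [Finset.card_univ, Fintype.card_fin, nsmul_eq_mul, Nat.cast_ofNat, mul_assoc, mul_assoc,
    mul_assoc]
  gcongr _ * (_ * (_ * ?_))
  set E := pw (s - α) + C3 + 1
  have e1 : pw (s - α) ≤ E := by
    simp only [E]; rw [add_assoc]; exact le_self_add
  have e2 : C3 ≤ E := le_add_right le_add_self
  have e3 : 1 ≤ E := le_add_self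
  calc _ ≤ eLpNorm Γ 2 volume * (E * besovNorm P (s - α) ⊤ 2 (lpDist hθ)) +
        eLpNorm θ ⊤ volume * (E * sobolevNorm (s + 1 - 2 * α) (lpDist hθ)) +
        E * (eLpNorm u 2 volume * eLpNorm θ 2 volume) := by
        refine add_le_add (add_le_add ?_ ?_) (le_mul_of_one_le_left zero_le e3)
        · exact mul_le_mul' le_rfl (hB1.trans (mul_le_mul' e1 le_rfl))
        · exact mul_le_mul' le_rfl (hS1.trans (mul_le_mul' e2 le_rfl))
    _ = _ := by ring

end DyadicPartition

namespace RieszCommutator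

variable {n : ℕ}

/-! ### Growth of functions with gradient in `L^p` -/

/-- A function with gradient in `L^p` is the sum of a function in `L^p` and one of at most linear
growth. -/
lemma exists_growth_decomposition {p A : ℝ≥0∞} (hp : 1 ≤ p) (hA : A ≠ ⊤) {u : Space n → ℂ}
    (hu : Continuous u) (h : LipLp p A u) :
    ∃ (b : Space n → ℂ) (C : ℝ), Continuous b ∧ MemLp (fun x => b x - u x) p volume ∧
      ∀ x, ‖b x‖ ≤ C * (1 + ‖x‖) := by
  obtain ⟨p', hp', hpp⟩ := exists_holderConjugate hp
  let φ : ContDiffBump (0 : Space n) := ⟨1, 2, one_pos, one_lt_two⟩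
  set ρ : Space n → ℂ := fun x => (φ.normed volume x : ℂ)
  have hρc : Continuous ρ := Complex.continuous_ofReal.comp φ.continuous_normed
  have hρs : HasCompactSupport ρ := φ.hasCompactSupport_normed.comp_left Complex.ofReal_zero
  have hρi : ∫ y, ρ y = 1 := by
    have : ∫ y, ρ y = ((∫ y, φ.normed volume y : ℝ) : ℂ) := integral_ofReal
    rw [this, φ.integral_normed, Complex.ofReal_one]
  -- `b` is a mollification: `b - u` is controlled by differences of `u`, and `b` is Lipschitz
  set b : Space n → ℂ := fun x => ∫ y, ρ y * u (x - y) with hb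
  have hi : ∀ x, Integrable (fun y => ρ y * u (x - y)) := fun x =>
    (hρc.mul (hu.comp (continuous_const.sub continuous_id))).integrable_of_hasCompactSupport
      hρs.mul_right
  have hbc : Continuous b := by
    have := hρs.continuous_convolution_left (ContinuousLinearMap.mul ℂ ℂ) hρc
      (hu.locallyIntegrable (μ := volume))
    exact this
  have hρm : MemLp ρ p' volume := hρc.memLp_of_hasCompactSupport hρs
  have hsub : ∀ x, b x - u x = ∫ y, ρ y * (u (x - y) - u x) := fun x => by
    simp only [mul_sub]
    rw [integral_sub (hi x) ((hρc.integrable_of_hasCompactSupport hρs).mul_const _),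
      integral_mul_const, hρi, one_mul]
  have h1 : eLpNorm (fun x => b x - u x) p volume ≤ (∫⁻ y, ‖ρ y‖ₑ * ‖y‖ₑ) * A :=
    eLpNorm_kernel_le hp hρc (by
      exact ((hu.comp (continuous_fst.sub continuous_snd)).sub
        (hu.comp continuous_fst)).aestronglyMeasurable) (by fun_prop) h hsub
  have h2 : ∫⁻ y, ‖ρ y‖ₑ * ‖y‖ₑ < ⊤ := by
    have : Integrable (fun y => ‖ρ y‖ * ‖y‖) :=
      (hρc.norm.mul continuous_norm).integrable_of_hasCompactSupport hρs.norm.mul_right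
    have h3 := this.2
    rw [HasFiniteIntegral] at h3
    simpa only [enorm_mul, enorm_norm] using h3
  have hlip : ∀ x v, ‖b (x - v) - b x‖ₑ ≤ eLpNorm ρ p' volume * (‖v‖ₑ * A) := fun x v => by
    have e : b (x - v) - b x = ∫ y, (u (x - y - v) - u (x - y)) * ρ y := by
      simp only [hb]
      rw [← integral_sub (hi _) (hi _)]
      congr 1; ext y
      rw [sub_right_comm]; ring
    rw [e, mul_comm]
    refine (enorm_integral_mul_le (p := p) (q := p') ?_ hρm.1).trans ?_
    · exact ((hu.comp ((continuous_const.sub continuous_id).sub continuous_const)).sub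
        (hu.comp (continuous_const.sub continuous_id))).aestronglyMeasurable
    gcongr
    have := eLpNorm_comp_measurePreserving (p := p)
      (g := fun x => u (x - v) - u x) (f := fun y : Space n => x - y) (μ := volume) (ν := volume)
      ((hu.comp (continuous_id.sub continuous_const)).sub hu).aestronglyMeasurable
      (Measure.measurePreserving_sub_left volume x)
    exact this.le.trans (h v)
  refine ⟨b, ‖b 0‖ + (eLpNorm ρ p' volume * A).toReal, hbc,
    ⟨(hbc.sub hu).aestronglyMeasurable, h1.trans_lt (ENNReal.mul_lt_top h2 hA.lt_top)⟩, fun x => ?_⟩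
  have h3 := hlip 0 (-x)
  rw [sub_neg_eq_add, zero_add, enorm_neg, mul_left_comm, mul_comm ‖x‖ₑ] at h3
  have h4 : ‖b x - b 0‖ ≤ (eLpNorm ρ p' volume * A).toReal * ‖x‖ := by
    have := ENNReal.toReal_mono (by finiteness [hρm.2.ne]) h3
    rwa [toReal_enorm, ENNReal.toReal_mul, toReal_enorm] at this
  have h5 : ‖b x‖ ≤ ‖b 0‖ + ‖b x - b 0‖ := by
    have := norm_add_le (b 0) (b x - b 0)
    rwa [add_sub_cancel] at this
  have := norm_nonneg (b 0); have := norm_nonneg x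
  have := ENNReal.toReal_nonneg (a := eLpNorm ρ p' volume * A)
  nlinarith

lemma memLp_wt {M : ℝ} {q : ℝ≥0∞} (hq : 1 ≤ q) (hqt : q ≠ ⊤) (h : n < M * q.toReal) :
    MemLp (wt (n := n) M) q volume := by
  have hq0 : q ≠ 0 := (one_pos.trans_le hq).ne'
  rw [← integrable_norm_rpow_iff (wt_continuous M).aestronglyMeasurable hq0 hqt]
  refine (wt_integrable h).congr (Eventually.of_forall fun x => ?_)
  simp only
  rw [Real.norm_of_nonneg (wt_pos M x).le, wt, wt, ← Real.rpow_mul (by positivity), neg_mul]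

/-- For `2 ≤ p < ∞`, a function with gradient in `L^p` times a function of size
`O((1 + |x|)^{-(n+1)})` belongs to the dual space. -/
lemma memLp_mul_decays [NeZero n] {p p' A : ℝ≥0∞} [ENNReal.HolderConjugate p p'] (hp : 2 ≤ p)
    (hpt : p ≠ ⊤) (hA : A ≠ ⊤) {u : Space n → ℂ} (hu : Continuous u) (h : LipLp p A u)
    {w : Space n → ℂ} (hw : Decays (n + 1) w) : MemLp (fun x => u x * w x) p' volume := by
  have hp1 : 1 ≤ p := one_le_two.trans hp
  have hn : (0 : ℝ) < n := by exact_mod_cast NeZero.pos n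
  have hc : p⁻¹ + p'⁻¹ = 1 := by
    have := ENNReal.HolderTriple.inv_add_inv_eq_inv p p' 1
    rwa [inv_one] at this
  have hp2 : p⁻¹ ≤ 2⁻¹ := ENNReal.inv_le_inv.2 hp
  have hpp : p⁻¹ ≤ p'⁻¹ := by
    by_contra hlt
    push Not at hlt
    have : p⁻¹ + p'⁻¹ < 2⁻¹ + 2⁻¹ :=
      ENNReal.add_lt_add_of_le_of_lt (by simp; exact (two_pos.trans_le hp).ne') hp2
          (hlt.trans_le hp2)
    rw [hc, ENNReal.inv_two_add_inv_two] at this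
    exact lt_irrefl _ this
  have hp'1 : 1 ≤ p' := by
    rw [← ENNReal.inv_le_inv, inv_one, ← hc]; exact le_add_self
  have hp't : p' ≠ ⊤ := by
    rintro rfl
    rw [ENNReal.inv_top, add_zero] at hc
    rw [hc] at hp2
    norm_num at hp2
  have hp'lt : 1 < p' := by
    refine lt_of_le_of_ne hp'1 fun h1 => ?_
    rw [← h1, inv_one] at hc
    have : p⁻¹ = 0 := by
      have h2 : p⁻¹ + 1 = 0 + 1 := by rw [hc, zero_add]
      exact (ENNReal.add_left_inj ENNReal.one_ne_top).1 h2
    exact hpt (ENNReal.inv_eq_zero.1 this)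
  -- `u = b - (b - u)` with `b` of linear growth and `b - u ∈ L^p`, and `p' ≤ 2 ≤ p`
  obtain ⟨b, C, hbc, hbm, hb⟩ := exists_growth_decomposition hp1 hA hu h
  have e : (fun x => u x * w x) = fun x => b x * w x - (b x - u x) * w x := by ext x; ring
  rw [e]
  have m1 : MemLp (fun x => (b x - u x) * w x) p' volume := by
    have hT : ENNReal.HolderTriple p (p'⁻¹ - p⁻¹)⁻¹ p' := ⟨by
      rw [inv_inv, add_tsub_cancel_of_le hpp]⟩
    have h1 : 1 ≤ (p'⁻¹ - p⁻¹)⁻¹ := by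
      rw [ENNReal.one_le_inv]
      exact tsub_le_self.trans (by rw [← hc]; exact le_add_self)
    exact memLp_mul (p := p) (q := (p'⁻¹ - p⁻¹)⁻¹) hbm (hw.memLp (by linarith) h1)
  have m2 : MemLp (fun x => b x * w x) p' volume := by
    obtain ⟨B, hB0, hB⟩ := hw.bound'
    have h2 : (n : ℝ) < n * p'.toReal := by
      have : 1 < p'.toReal := by
        rw [← ENNReal.toReal_one]
        exact (ENNReal.toReal_lt_toReal ENNReal.one_ne_top hp't).2 hp'lt
      nlinarith
    refine ((memLp_wt hp'1 hp't h2).const_mul (C * B)).mono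
      (hbc.mul hw.cont).aestronglyMeasurable (Eventually.of_forall fun x => ?_)
    have hx : 0 < 1 + ‖x‖ := by positivity
    have hC : 0 ≤ C := by
      have := (norm_nonneg _).trans (hb 0)
      simpa using this
    rw [norm_mul]
    calc ‖b x‖ * ‖w x‖ ≤ C * (1 + ‖x‖) * (B * wt (n + 1) x) := by
          gcongr
          · exact hb x
          · exact hB x
      _ = C * B * wt n x := by
          have : (1 + ‖x‖) * wt (n + 1) x = wt n x := by
            rw [wt, wt, neg_add, Real.rpow_add hx, Real.rpow_neg_one]
            field_simp
          rw [← this]; ring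
      _ ≤ _ := le_abs_self _
  exact m2.sub m1

lemma decays_wt {M : ℝ} : Decays M (fun x : Space n => (wt M x : ℂ)) :=
  ⟨Complex.continuous_ofReal.comp (wt_continuous M), 1, fun x => by
    rw [Complex.norm_real, Real.norm_of_nonneg (wt_pos M x).le, one_mul]⟩

lemma wint_mul [NeZero n] {p A : ℝ≥0∞} (hp : 2 ≤ p) (hpt : p ≠ ⊤) (hA : A ≠ ⊤) {u : Space n → ℂ}
    (hu : Continuous u) (h : LipLp p A u) {f : Space n → ℂ} (hf : MemLp f p volume) :
    WInt (n + 1) (fun x => u x * f x) := by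
  obtain ⟨p', hp', hpp⟩ := exists_holderConjugate (one_le_two.trans hp)
  refine ⟨hu.aestronglyMeasurable.mul hf.1, ?_⟩
  have := (integrable_mul_of_memLp hf
    (memLp_mul_decays (p := p) (p' := p') hp hpt hA hu h decays_wt)).norm
  refine this.congr (Eventually.of_forall fun x => ?_)
  simp only [norm_mul, Complex.norm_real]
  rw [Real.norm_of_nonneg (wt_pos _ x).le]
  ring

lemma wint_of_lipLp {p A : ℝ≥0∞} (hp : 1 ≤ p) (hA : A ≠ ⊤) {u : Space n → ℂ}
    (hu : Continuous u) (h : LipLp p A u) : WInt (n + 2) u := by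
  obtain ⟨b, C, hbc, hbm, hb⟩ := exists_growth_decomposition hp hA hu h
  have h1 : WInt ((n : ℝ) + 2) (fun x => b x - u x) := WInt.of_memLp (by linarith) hp hbm
  have h2 : WInt ((n : ℝ) + 2) b := by
    refine ⟨hbc.aestronglyMeasurable, ?_⟩
    refine ((wt_integrable (n := n) (M := n + 1) (by linarith)).const_mul C).mono'
      ((wt_continuous _).mul hbc.norm).aestronglyMeasurable (Eventually.of_forall fun x => ?_)
    rw [Real.norm_of_nonneg (mul_nonneg (wt_pos _ x).le (norm_nonneg _))]
    have hx : 0 < 1 + ‖x‖ := by positivity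
    calc _ ≤ wt (n + 2) x * (C * (1 + ‖x‖)) :=
          mul_le_mul_of_nonneg_left (hb x) (wt_pos _ x).le
      _ = _ := by
          have : (1 + ‖x‖) * wt (n + 2) x = wt (n + 1) x := by
            rw [wt, wt, show -((n : ℝ) + 2) = -(n + 1) + -1 by ring, Real.rpow_add hx,
              Real.rpow_neg_one]
            field_simp
          rw [← this]; ring
  have := h2.sub h1
  simpa using this

/-! ### The second order commutator -/

/-- The second order commutator of a multiplier with two functions. -/
def com₂ (σ u f : Space n → ℂ) (x : Space n) : ℂ :=
  op σ (fun y => u y * f y) x - u x * op σ f x - f x * op σ u x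

lemma integral_ker {M : ℝ} (hn : n < M) {σ : Space n → ℂ} (hσ : Symb M σ) :
    ∫ y, 𝓕⁻ σ y = σ 0 := by
  have := congrFun (hσ.fourier_ker hn) 0
  rw [Real.fourier_eq'] at this
  simpa using this

/-- The second order commutator costs two derivatives. -/
lemma eLpNorm_com₂_le {M : ℝ} (hn : n < M) {p A B : ℝ≥0∞} (hp : 1 ≤ p) {σ u f : Space n → ℂ}
    (hσ : Symb M σ) (h0 : σ 0 = 0) (hu : WInt M u) (hf : WInt M f)
    (huf : WInt M fun y => u y * f y) (hA : LipLp p A u) (hB : LipLp ⊤ B f) :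
    eLpNorm (com₂ σ u f) p volume ≤ N3 σ * (A * B) := by
  have hM : 0 ≤ M := (Nat.cast_nonneg n).trans hn.le
  refine eLpNorm_kernel_le hp hσ.decay.cont (D := fun x y => (u (x - y) - u x) * (f (x - y) - f x))
    ?_ (w := fun y => ‖y‖ₑ ^ 2) (by fun_prop) (fun y => ?_) fun x => ?_
  · exact ((aestronglyMeasurable_sub_prod hu.meas).sub hu.meas.comp_fst).mul
      ((aestronglyMeasurable_sub_prod hf.meas).sub hf.meas.comp_fst)
  · have hs : ∀ {g : Space n → ℂ}, AEStronglyMeasurable g volume →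
        AEStronglyMeasurable (fun x => g (x - y) - g x) volume := fun hg =>
      (hg.comp_measurePreserving (measurePreserving_sub_right volume y)).sub hg
    have := eLpNorm_smul_le_mul_eLpNorm (p := p) (q := ⊤) (r := p) (hs hf.meas) (hs hu.meas)
    refine (this.trans (mul_le_mul' (hA y) (hB y))).trans (le_of_eq ?_)
    ring
  · have i : ∀ {g : Space n → ℂ}, WInt M g → Integrable (fun y => 𝓕⁻ σ y * g (x - y)) := by
      intro g hg
      have := (hσ.decay.integrable_cv hM hg x).comp_sub_left x
      simpa only [sub_sub_cancel] using this
    have i0 := hσ.decay.integrable hn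
    have e : (fun y => 𝓕⁻ σ y * ((u (x - y) - u x) * (f (x - y) - f x)))
        = fun y => 𝓕⁻ σ y * (u (x - y) * f (x - y)) - u x * (𝓕⁻ σ y * f (x - y)) -
          f x * (𝓕⁻ σ y * u (x - y)) + u x * f x * 𝓕⁻ σ y := by
      ext y; ring
    have k1 := i huf
    have k2 := (i hf).const_mul (u x)
    have k3 := (i hu).const_mul (f x)
    have q1 := integral_add (f := fun y => 𝓕⁻ σ y * (u (x - y) * f (x - y)) -
      u x * (𝓕⁻ σ y * f (x - y)) - f x * (𝓕⁻ σ y * u (x - y)))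
      (g := fun y => u x * f x * 𝓕⁻ σ y) ((k1.sub k2).sub k3) (i0.const_mul _)
    have q2 := integral_sub (f := fun y => 𝓕⁻ σ y * (u (x - y) * f (x - y)) -
      u x * (𝓕⁻ σ y * f (x - y))) (k1.sub k2) k3
    rw [e, q1, q2, integral_sub k1 k2, integral_const_mul, integral_const_mul, integral_const_mul,
      integral_ker hn hσ, h0, mul_zero, add_zero, com₂, op_eq, op_eq, op_eq]

/-! ### Differentiation of kernels -/

lemma integrable_norm_mul {σ : Space n → ℂ} (hσ : Integrable σ)
    (h : ∀ i, Integrable (fun ξ => σ ξ * dsym i ξ)) : Integrable (fun ξ => ‖ξ‖ * ‖σ ξ‖) := by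
  have h1 : Integrable (fun ξ => ∑ i, ‖σ ξ * dsym i ξ‖) :=
    integrable_finsetSum _ fun i _ => (h i).norm
  refine h1.mono' (continuous_norm.aestronglyMeasurable.mul hσ.1.norm) (.of_forall fun ξ => ?_)
  have h2 : ‖ξ‖ ≤ ∑ i, ‖ξ i‖ := by
    have := (EuclideanSpace.basisFun (Fin n) ℝ).sum_repr ξ
    calc ‖ξ‖ = ‖∑ i, ξ i • EuclideanSpace.basisFun (Fin n) ℝ i‖ := by
          conv_lhs => rw [← this]
          rfl
      _ ≤ ∑ i, ‖ξ i • EuclideanSpace.basisFun (Fin n) ℝ i‖ := norm_sum_le _ _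
      _ = _ := by simp [norm_smul]
  rw [norm_mul, norm_norm, norm_norm]
  calc ‖ξ‖ * ‖σ ξ‖ ≤ (∑ i, ‖ξ i‖) * ‖σ ξ‖ := by gcongr
    _ = ∑ i, ‖ξ i‖ * ‖σ ξ‖ := Finset.sum_mul _ _ _
    _ ≤ _ := Finset.sum_le_sum fun i _ => by
      rw [norm_mul, mul_comm]
      gcongr
      have : ‖dsym i ξ‖ = 2 * Real.pi * ‖ξ i‖ := by
        simp [dsym, abs_of_pos Real.pi_pos]
      rw [this]
      have := Real.pi_gt_three
      nlinarith [norm_nonneg (ξ i)]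

lemma hasFDerivAt_fourierInv {σ : Space n → ℂ} (hσ : Integrable σ)
    (h : ∀ i, Integrable (fun ξ => σ ξ * dsym i ξ)) (x : Space n) :
    ∃ D : Space n →L[ℝ] ℂ, HasFDerivAt (𝓕⁻ σ) D x ∧
      ∀ i, D (EuclideanSpace.single i 1) = 𝓕⁻ (fun ξ => σ ξ * dsym i ξ) x := by
  have h1 := Real.hasFDerivAt_fourier hσ (integrable_norm_mul hσ h) (-x)
  have h2 : HasFDerivAt (fun y : Space n => -y) (-ContinuousLinearMap.id ℝ (Space n)) x :=
    (hasFDerivAt_id x).neg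
  have h3 := HasFDerivAt.comp x h1 h2
  have e : (𝓕 σ ∘ fun y : Space n => -y) = 𝓕⁻ σ := by
    ext y
    rw [Function.comp, Real.fourierInv_eq_fourier_neg]
  rw [e] at h3
  refine ⟨_, h3, fun i => ?_⟩
  rw [ContinuousLinearMap.comp_apply, Real.fourierInv_eq_fourier_neg]
  have hint : Integrable (VectorFourier.fourierSMulRight (innerSL ℝ) σ) := by
    refine ((integrable_norm_mul hσ h).const_mul
        (2 * Real.pi * ‖(innerSL ℝ : Space n →L[ℝ] Space n →L[ℝ] ℝ)‖)).mono' ?_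
            (.of_forall fun ξ => ?_)
    · exact hσ.1.fourierSMulRight
    · refine (VectorFourier.norm_fourierSMulRight_le _ _ _).trans (le_of_eq ?_)
      ring
  rw [Real.fourier_eq, Real.fourier_eq, ContinuousLinearMap.integral_apply]
  · refine integral_congr_ae (.of_forall fun ξ => ?_)
    have e2 : VectorFourier.fourierSMulRight (innerSL ℝ) σ ξ (-EuclideanSpace.single i 1)
        = σ ξ * dsym i ξ := by
      have e3 : (inner ℝ ξ (-EuclideanSpace.single i (1 : ℝ)) : ℝ) = -ξ i := by
        simp [EuclideanSpace.inner_single_right]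
      change -(2 * Real.pi * Complex.I) * (((inner ℝ ξ (-EuclideanSpace.single i (1 : ℝ)) : ℝ) : ℂ)
        * σ ξ) = _
      rw [e3, dsym]
      push_cast
      ring
    exact congrArg (fun z : ℂ => 𝐞 (-inner ℝ ξ (-x)) • z) e2
  · exact (Real.fourierIntegral_convergent_iff _).2 hint

/-- A solenoidal velocity field of class `C¹` whose components have translates that are
Lipschitz in `L^p`, with constant `A`. -/
structure Velocity (p A : ℝ≥0∞) (u : Fin n → Space n → ℂ) : Prop where
  smooth : ∀ i, ContDiff ℝ 1 (u i)
  deriv : ∀ i, MemLp (fderiv ℝ (u i)) p volume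
  lip : ∀ i, LipLp p A (u i)
  div : ∀ x, ∑ i, fderiv ℝ (u i) x (EuclideanSpace.single i 1) = 0

lemma Velocity.cont {p A : ℝ≥0∞} {u : Fin n → Space n → ℂ} (hu : Velocity p A u) (i : Fin n) :
    Continuous (u i) := (hu.smooth i).continuous

lemma memLp_fderiv_single {p : ℝ≥0∞} {f : Space n → ℂ} (h : MemLp (fderiv ℝ f) p volume)
    (v : Space n) : MemLp (fun x => fderiv ℝ f x v) p volume :=
  (ContinuousLinearMap.apply ℝ ℂ v).comp_memLp' h

/-- The divergence of `u` vanishes, also after a frequency cutoff. -/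
lemma Velocity.op_div {p A : ℝ≥0∞} (hp : 1 ≤ p) (hA : A ≠ ⊤) {u : Fin n → Space n → ℂ}
    (hu : Velocity p A u) {τ : Space n → ℂ} (hτ : ContDiff ℝ ∞ τ) (hc : HasCompactSupport τ)
    (x : Space n) : ∑ i, op (fun ξ => τ ξ * dsym i ξ) (u i) x = 0 := by
  have hτi : ∀ M i, Symb M (fun ξ => τ ξ * dsym i ξ) := fun M i =>
    Symb.of_smooth M (hτ.mul (dsym_temperate i).1) hc.mul_right
  have hn : (n : ℝ) < n + 2 := by linarith
  have hn0 : (0 : ℝ) ≤ n + 2 := by positivity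
  have hS := Symb.of_smooth ((n : ℝ) + 2) hτ hc
  obtain ⟨p', hp', hpp⟩ := exists_holderConjugate hp
  have hdec := (hS.decay.comp_sub_left hn0 x)
  have hder : ∀ i y, HasFDerivAt (fun y => 𝓕⁻ τ (x - y))
      (fderiv ℝ (fun y => 𝓕⁻ τ (x - y)) y) y ∧
      fderiv ℝ (fun y => 𝓕⁻ τ (x - y)) y (EuclideanSpace.single i 1)
        = -𝓕⁻ (fun ξ => τ ξ * dsym i ξ) (x - y) := fun i y => by
    obtain ⟨D, hD, hD'⟩ := hasFDerivAt_fourierInv hS.integ (fun i => (hτi 0 i).integ) (x - y)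
    have h2 : HasFDerivAt (fun y : Space n => x - y) (-ContinuousLinearMap.id ℝ (Space n)) y :=
      (hasFDerivAt_id y).const_sub x
    have h3 := HasFDerivAt.comp y hD h2
    have h4 : fderiv ℝ (fun y => 𝓕⁻ τ (x - y)) y = _ := h3.fderiv
    refine ⟨h4 ▸ h3, ?_⟩
    rw [h4, ← hD' i]
    simp
  -- integration by parts: `∂_i` is moved from the kernel to `u_i`
  have key : ∀ i, op (fun ξ => τ ξ * dsym i ξ) (u i) x
      = ∫ y, 𝓕⁻ τ (x - y) * fderiv ℝ (u i) y (EuclideanSpace.single i 1) := fun i => by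
    have hw := wint_of_lipLp hp hA (hu.cont i) (hu.lip i)
    rw [integral_mul_fderiv_eq_neg_fderiv_mul_of_integrable, ← integral_neg]
    · refine integral_congr_ae (.of_forall fun y => ?_)
      simp only [(hder i y).2, neg_mul, neg_neg]
    · simp only [(hder i _).2, neg_mul]
      exact ((hτi _ i).decay.integrable_cv hn0 hw x).neg
    · exact integrable_mul_of_memLp (p := p') (q := p) (hdec.memLp hn hp')
        (memLp_fderiv_single (hu.deriv i) _)
    · exact hS.decay.integrable_cv hn0 hw x
    · exact fun y _ => (hder i y).1.differentiableAt
    · exact fun y _ => ((hu.smooth i).differentiable one_ne_zero) y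
  simp only [key]
  rw [← integral_finsetSum]
  · simp only [← Finset.mul_sum, hu.div, mul_zero, integral_zero]
  · exact fun i _ => integrable_mul_of_memLp (p := p') (q := p) (hdec.memLp hn hp')
        (memLp_fderiv_single (hu.deriv i) _)

end RieszCommutator

namespace DyadicPartition

open RieszCommutator

variable {n : ℕ} (P : DyadicPartition n)

/-! ### The advection commutator with one block -/

/-- The `j`-th frequency block of `∑ i, (∂_i h(D) (u_i f) - ∂_i (u_i g))`; for `g = h(D) f` and
solenoidal `u` this is the block of `[h(D), u · ∇] f`. -/
def ablk (h : Space n → ℂ) (j : ℕ) (u : Fin n → Space n → ℂ) (f g : Space n → ℂ) (x : Space n) :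
    ℂ :=
  ∑ i, (op (fun ξ => P.symbol j ξ * (h ξ * dsym i ξ)) (fun y => u i y * f y) x
    - op (fun ξ => P.symbol j ξ * dsym i ξ) (fun y => u i y * g y) x)

lemma _root_.RieszCommutator.eLpNorm_fun_sum_le {ι : Type*} {s : Finset ι} {p : ℝ≥0∞}
    {f : ι → Space n → ℂ} (hf : ∀ i ∈ s, AEStronglyMeasurable (f i) volume) (hp : 1 ≤ p) :
    eLpNorm (fun x => ∑ i ∈ s, f i x) p volume ≤ ∑ i ∈ s, eLpNorm (f i) p volume := by
  have := eLpNorm_sum_le hf hp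
  rwa [show (∑ i ∈ s, f i) = fun x => ∑ i ∈ s, f i x from by ext x; simp] at this

lemma exists_lipLp_symT : ∃ C : ℝ≥0∞, C ≠ ⊤ ∧ ∀ k : ℕ, LipLp 1 (C * pw k) (𝓕⁻ (P.symT k)) := by
  obtain ⟨C, hC, h⟩ := P.one_bds
  obtain ⟨B, hB, h0⟩ := exists_lipLp_of_smooth (P.symT_smooth 0) (P.symT_compact 0)
  refine ⟨C + B, by finiteness, fun k => ?_⟩
  rcases eq_or_ne k 0 with rfl | hk
  · refine h0.mono ?_
    simp
  · refine ((h k).2.2 hk).2.2.mono ?_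
    gcongr
    exact le_self_add

lemma low_mul_smooth_symb (M : ℝ) {g : Space n → ℂ} (hg : ContDiff ℝ ∞ g) :
    Symb M (fun ξ => P.low ξ * g ξ) :=
  Symb.of_smooth M (P.low_smooth.mul hg) P.low_compact.mul_right

lemma symbol_dsym_symb (M : ℝ) (k : ℕ) (i : Fin n) : Symb M (fun ξ => P.symbol k ξ * dsym i ξ) :=
  Symb.of_smooth M ((P.symbol_smooth k).mul (dsym_temperate i).1) (P.symbol_compact k).mul_right

lemma symbol_apply_zero {k : ℕ} (hk : k ≠ 0) : P.symbol k 0 = 0 := by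
  obtain ⟨k, rfl⟩ := Nat.exists_eq_succ_of_ne_zero hk
  by_contra h
  rw [Nat.succ_eq_add_one, symbol_succ, smul_zero] at h
  have := (P.shell_support h).1
  simp at this
  linarith

variable {P}

lemma _root_.RieszCommutator.Mult.mul_dsym {d : ℝ} {h : Space n → ℂ} (hh : Mult P d h) (i : Fin n) :
    Mult P (d + 1) (fun ξ => h ξ * dsym i ξ) :=
  hh.mul_temperate (dsym_homog i) (dsym_temperate i)

variable [NeZero n]

/-- The block `j` of the commutator applied to the block `q`, in the regime `j ≠ 0`, `q ≤ j + 2`.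
As `h(D) f = g` and `∑ i, ∂_i u_i = 0`, the terms completing the two products to second order
commutators cancel. -/
lemma exists_ablk_estimate_low {d : ℝ} {h : Space n → ℂ} (hh : Mult P d h) :
    ∃ C : ℝ≥0∞, C ≠ ⊤ ∧ ∀ {p A : ℝ≥0∞} (_ : 2 ≤ p) (_ : p ≠ ⊤) (_ : A ≠ ⊤)
      {u : Fin n → Space n → ℂ} (_ : Velocity p A u) {f g : Space n → ℂ} (_ : MemLp f p volume)
      (_ : MemLp g p volume) {j : ℕ} (_ : j ≠ 0)
      (_ : ∀ i, op (fun ξ => P.symbol j ξ * (h ξ * dsym i ξ)) f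
        = op (fun ξ => P.symbol j ξ * dsym i ξ) g) {B B' : ℝ≥0∞} (_ : LipLp ⊤ B f)
      (_ : LipLp ⊤ B' g),
    eLpNorm (P.ablk h j u f g) p volume ≤ C * (pw (j * (d - 1)) * (A * B) + pw (-j) *
        (A * B')) := by
  choose C1 hC1 b1 using fun i => P.symbol_bds (hh.mul_dsym i).toHomog
  choose C2 hC2 b2 using fun i => P.symbol_bds (dsym_homog (n := n) i)
  refine ⟨∑ i, (C1 i + C2 i), ENNReal.sum_ne_top.2 fun i _ => by finiteness [hC1 i, hC2 i], ?_⟩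
  intro p A hp hpt hA u hu f g hf hg j hj hfg B B' hB hB'
  have hp1 : 1 ≤ p := one_le_two.trans hp
  have hn : (n : ℝ) < n + 2 := by linarith
  have hn0 : (0 : ℝ) ≤ n + 2 := by positivity
  have hw := fun i => (wint_of_lipLp hp1 hA (hu.cont i) (hu.lip i))
  have huF : ∀ {F}, MemLp F p volume → ∀ i, WInt (n + 2) (fun y => u i y * F y) := fun hF i =>
    (wint_mul hp hpt hA (hu.cont i) (hu.lip i) hF).mono (by linarith)
  have hS := fun i => P.symbol_symb hn0 (hh.mul_dsym i).toHomog hj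
  have hS' := P.symbol_dsym_symb ((n : ℝ) + 2) j
  -- the terms `f σ(D) u_i` added here sum up to zero as `u` is solenoidal, and the terms
  -- `u_i σ(D) f` cancel by `hfg`
  have e : P.ablk h j u f g = fun x => ∑ i,
      (com₂ (fun ξ => P.symbol j ξ * (h ξ * dsym i ξ)) (u i) f x
        - com₂ (fun ξ => P.symbol j ξ * dsym i ξ) (u i) g x) := by
    ext x
    have d1 := hu.op_div hp1 hA (P.symbol_mul_smooth hh.toHomog hj)
      ((P.symbol_compact j).mul_right) x
    have d2 := hu.op_div hp1 hA (P.symbol_smooth j) (P.symbol_compact j) x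
    simp only [mul_assoc] at d1
    simp only [ablk, com₂, Finset.sum_sub_distrib, hfg, ← Finset.mul_sum, d1, d2]
    ring
  rw [e]
  have hz : ∀ z : ℂ, P.symbol j 0 * z = 0 := fun z => by rw [P.symbol_apply_zero hj, zero_mul]
  have m1 : ∀ i, AEStronglyMeasurable
      (com₂ (fun ξ => P.symbol j ξ * (h ξ * dsym i ξ)) (u i) f) volume := fun i =>
    (((huF hf i).op hn (hS i)).meas.sub ((hw i).meas.mul
      ((WInt.of_memLp hn hp1 hf).op hn (hS i)).meas)).sub (hf.1.mul ((hw i).op hn (hS i)).meas)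
  have m2 : ∀ i, AEStronglyMeasurable
      (com₂ (fun ξ => P.symbol j ξ * dsym i ξ) (u i) g) volume := fun i =>
    (((huF hg i).op hn (hS' i)).meas.sub ((hw i).meas.mul
      ((WInt.of_memLp hn hp1 hg).op hn (hS' i)).meas)).sub (hg.1.mul ((hw i).op hn (hS' i)).meas)
  refine (eLpNorm_fun_sum_le (fun i _ => (m1 i).sub (m2 i)) hp1).trans ?_
  rw [Finset.sum_mul]
  refine Finset.sum_le_sum fun i _ => ?_
  refine (eLpNorm_sub_le (m1 i) (m2 i) hp1).trans ?_
  calc _ ≤ C1 i * pw (j * (d + 1 - 2)) * (A * B) + C2 i * pw (j * (1 - 2)) * (A * B') := by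
        refine add_le_add ?_ ?_
        · refine (eLpNorm_com₂_le hn hp1 (hS i) (hz _) (hw i) (WInt.of_memLp hn hp1 hf)
            (huF hf i) (hu.lip i) hB).trans ?_
          gcongr
          exact (b1 i j hj).1.three
        · refine (eLpNorm_com₂_le hn hp1 (hS' i) (hz _) (hw i) (WInt.of_memLp hn hp1 hg)
            (huF hg i) (hu.lip i) hB').trans ?_
          gcongr
          exact (b2 i j hj).1.three
    _ = C1 i * (pw (j * (d - 1)) * (A * B)) + C2 i * (pw (-j) * (A * B')) := by
        rw [show (j : ℝ) * (d + 1 - 2) = j * (d - 1) by ring, show (j : ℝ) * (1 - 2) = -j by ring]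
        ring
    _ ≤ _ := by
        rw [add_mul, mul_add, mul_add]
        exact add_le_add le_self_add le_add_self

/-- The block `j` of the commutator applied to the block `q`, in the regime `q ≥ j + 3`, where both
terms are commutators because the supports of the symbols are disjoint. -/
lemma exists_ablk_estimate_high {d : ℝ} (hd : 0 < d) {h : Space n → ℂ} (hh : Mult P d h) :
    ∃ C : ℝ≥0∞, C ≠ ⊤ ∧ ∀ {p A : ℝ≥0∞} (_ : 2 ≤ p) (_ : p ≠ ⊤) (_ : A ≠ ⊤)
      {u : Fin n → Space n → ℂ} (_ : Velocity p A u) {f g : Space n → ℂ} (_ : MemLp f p volume)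
      (_ : MemLp g p volume) {j q : ℕ} (_ : j + 3 ≤ q) (_ : op (P.symT q) f = f)
      (_ : op (P.symT q) g = g),
    eLpNorm (P.ablk h j u f g) p volume ≤ C * A * (pw (j * (d + 1) - q) * eLpNorm f ⊤ volume
      + pw (j - q) * eLpNorm g ⊤ volume) := by
  have hn' : (n : ℝ) < n + 1 := by linarith
  have hM : (0 : ℝ) ≤ n + 1 := by positivity
  have hl := fun i => (P.symb_low (by linarith) (hh.mul_dsym i).toHomog).mono
    (N := (n : ℝ) + 1) (by linarith)
  have hl' := fun i : Fin n => P.low_mul_smooth_symb ((n : ℝ) + 1) (dsym_temperate i).1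
  choose C1 hC1 b1 using fun i => P.N1_bds hn' (hh.mul_dsym i).toHomog (hl i)
  choose C2 hC2 b2 using fun i : Fin n => P.N1_bds hn' (dsym_homog i) (hl' i)
  obtain ⟨C3, hC3, b3⟩ := P.one_bds
  refine ⟨∑ i, (C1 i + C2 i) * C3, ENNReal.sum_ne_top.2 fun i _ => by
    finiteness [hC1 i, hC2 i], ?_⟩
  intro p A hp hpt hA u hu f g hf hg j q hjq hfq hgq
  have hp1 : 1 ≤ p := one_le_two.trans hp
  have huF : ∀ {F}, MemLp F p volume → ∀ i, WInt (n + 1) (fun y => u i y * F y) := fun hF i =>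
    (wint_mul hp hpt hA (hu.cont i) (hu.lip i) hF)
  have hS := fun i => P.symbol_symb' hM (hh.mul_dsym i).toHomog (hl i) j
  have hS' := P.symbol_dsym_symb ((n : ℝ) + 1) j
  have hq0 : q ≠ 0 := by omega
  have m1 := fun i => ((huF hf i).op hn' (hS i)).meas
  have m2 := fun i => ((huF hg i).op hn' (hS' i)).meas
  unfold ablk
  refine (eLpNorm_fun_sum_le (fun i _ => (m1 i).sub (m2 i)) hp1).trans ?_
  rw [Finset.sum_mul, Finset.sum_mul]
  refine Finset.sum_le_sum fun i _ => ?_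
  refine (eLpNorm_sub_le (m1 i) (m2 i) hp1).trans ?_
  have hz : ∀ (κ : Space n → ℂ) ξ, P.symbol j ξ * κ ξ * P.symT q ξ = 0 := fun κ ξ => by
    rw [mul_right_comm, symbol_mul_symT_eq_zero P hjq, zero_mul]
  calc _ ≤ C1 i * pw (j * (d + 1)) * (C3 * pw (-q) * A * eLpNorm f ⊤ volume)
        + C2 i * pw (j * 1) * (C3 * pw (-q) * A * eLpNorm g ⊤ volume) := by
        refine add_le_add ?_ ?_
        · refine (eLpNorm_op_mul_le_com (p := p) (q := ⊤) hn' (hS i) (P.symT_symb_one _ q)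
            (hz _) hp1 (hu.cont i).aestronglyMeasurable (hu.lip i) (WInt.of_memLp hn' hp1 hf)
            (huF hf i) hfq).trans ?_
          gcongr
          · exact (b1 i j).1
          · exact ((b3 q).2.2 hq0).2.1
        · refine (eLpNorm_op_mul_le_com (p := p) (q := ⊤) hn' (hS' i) (P.symT_symb_one _ q)
            (hz _) hp1 (hu.cont i).aestronglyMeasurable (hu.lip i) (WInt.of_memLp hn' hp1 hg)
            (huF hg i) hgq).trans ?_
          gcongr
          · exact (b2 i j).1
          · exact ((b3 q).2.2 hq0).2.1
    _ = C1 i * C3 * A * (pw (j * (d + 1) - q) * eLpNorm f ⊤ volume)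
        + C2 i * C3 * A * (pw (j - q) * eLpNorm g ⊤ volume) := by
        rw [sub_eq_add_neg, pw_add, sub_eq_add_neg, pw_add, mul_one]
        ring
    _ ≤ _ := by
        rw [mul_add ((C1 i + C2 i) * C3 * A)]
        gcongr
        · exact le_self_add
        · exact le_add_self

/-- The lowest block of the commutator. -/
lemma exists_ablk_estimate_zero {d : ℝ} (hd : 0 < d) {h : Space n → ℂ} (hh : Mult P d h) :
    ∃ C : ℝ≥0∞, C ≠ ⊤ ∧ ∀ {p A : ℝ≥0∞} (_ : 2 ≤ p) (_ : p ≠ ⊤) (_ : A ≠ ⊤)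
      {u : Fin n → Space n → ℂ} (_ : Velocity p A u) {f g : Space n → ℂ} (_ : MemLp f p volume)
      (_ : MemLp g p volume)
      (_ : ∀ i, op (fun ξ => P.symbol 0 ξ * (h ξ * dsym i ξ)) f
        = op (fun ξ => P.symbol 0 ξ * dsym i ξ) g),
    eLpNorm (P.ablk h 0 u f g) p volume
      ≤ C * A * (eLpNorm f ⊤ volume + eLpNorm g ⊤ volume) := by
  have hn' : (n : ℝ) < n + 1 := by linarith
  have hn'' : (n : ℝ) + 1 < n + (d + 1) := by linarith
  have hM : (0 : ℝ) ≤ n + 1 := by positivity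
  have hS := fun i => (P.symb_low (by linarith) (hh.mul_dsym i).toHomog)
  have hS' := P.symbol_dsym_symb ((n : ℝ) + 2) 0
  refine ⟨∑ i, (N2 (fun ξ => P.low ξ * (h ξ * dsym i ξ)) + N2 (fun ξ => P.low ξ * dsym i ξ)),
    ENNReal.sum_ne_top.2 fun i _ => ?_, ?_⟩
  · have h1 := (N2_lt_top hn'' (hS i)).ne
    have h2 := (N2_lt_top (by linarith) (hS' i)).ne
    exact ENNReal.add_ne_top.2 ⟨h1, h2⟩
  intro p A hp hpt hA u hu f g hf hg hfg
  have hp1 : 1 ≤ p := one_le_two.trans hp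
  have huF : ∀ {F}, MemLp F p volume → ∀ i, WInt (n + 1) (fun y => u i y * F y) := fun hF i =>
    (wint_mul hp hpt hA (hu.cont i) (hu.lip i) hF)
  have s1 := fun i => (hS i).mono hn''.le
  have s2 := fun i => (hS' i).mono (N := (n : ℝ) + 1) (by linarith)
  have e : P.ablk h 0 u f g = fun x => ∑ i,
      (com (fun ξ => P.symbol 0 ξ * (h ξ * dsym i ξ)) (u i) f x
        - com (fun ξ => P.symbol 0 ξ * dsym i ξ) (u i) g x) := by
    ext x
    simp only [ablk, com, Finset.sum_sub_distrib, hfg]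
    ring
  have hf' := WInt.of_memLp hn' hp1 hf
  have hg' := WInt.of_memLp hn' hp1 hg
  have m1 : ∀ i, AEStronglyMeasurable
      (com (fun ξ => P.symbol 0 ξ * (h ξ * dsym i ξ)) (u i) f) volume := fun i =>
    ((huF hf i).op hn' (s1 i)).meas.sub ((hu.cont i).aestronglyMeasurable.mul
      (hf'.op hn' (s1 i)).meas)
  have m2 : ∀ i, AEStronglyMeasurable
      (com (fun ξ => P.symbol 0 ξ * dsym i ξ) (u i) g) volume := fun i =>
    ((huF hg i).op hn' (s2 i)).meas.sub ((hu.cont i).aestronglyMeasurable.mul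
      (hg'.op hn' (s2 i)).meas)
  rw [e]
  refine (eLpNorm_fun_sum_le (fun i _ => (m1 i).sub (m2 i)) hp1).trans ?_
  rw [Finset.sum_mul, Finset.sum_mul]
  refine Finset.sum_le_sum fun i _ => ?_
  refine (eLpNorm_sub_le (m1 i) (m2 i) hp1).trans ?_
  refine (add_le_add (eLpNorm_com_le (p := p) (q := ⊤) hM hp1 (s1 i) hf' (huF hf i)
    (hu.cont i).aestronglyMeasurable (hu.lip i)) (eLpNorm_com_le (p := p) (q := ⊤) hM hp1 (s2 i) hg'
    (huF hg i) (hu.cont i).aestronglyMeasurable (hu.lip i))).trans ?_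
  rw [mul_add]
  gcongr
  · exact le_self_add
  · exact le_add_self

end DyadicPartition

namespace DyadicPartition

open RieszCommutator

variable {n : ℕ} {P : DyadicPartition n} [NeZero n]

/-- The commutator applied to one frequency block: the derivative falls on the lower frequency and
the multiplier, of degree `d < 1`, gains on the higher one. -/
lemma exists_ablk_estimate {d : ℝ} (hd : 0 < d) (hd1 : d < 1) {h : Space n → ℂ}
    (hh : Mult P d h) :
    ∃ C : ℝ≥0∞, C ≠ ⊤ ∧ ∀ {p A : ℝ≥0∞} (_ : 2 ≤ p) (_ : p ≠ ⊤) (_ : A ≠ ⊤)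
      {u : Fin n → Space n → ℂ} (_ : Velocity p A u) {θ : Space n → ℂ} (_ : MemLp θ p volume)
      (j q : ℕ),
    eLpNorm (P.ablk h j u (op (P.symbol q) θ) (op (fun ξ => P.symbol q ξ * h ξ) θ)) p volume ≤
      C * A * (pw (min (j : ℝ) q - (1 - d) * max (j : ℝ) q) *
        eLpNorm (op (P.symbol q) θ) ⊤ volume) := by
  have hn : (n : ℝ) < n + d := by linarith
  have hM : (0 : ℝ) ≤ n + d := by positivity
  have hl := P.symb_low hd hh.toHomog
  obtain ⟨C1, hC1, b1⟩ := exists_ablk_estimate_low hh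
  obtain ⟨C2, hC2, b2⟩ := exists_ablk_estimate_high hd hh
  obtain ⟨C3, hC3, b3⟩ := exists_ablk_estimate_zero hd hh
  obtain ⟨D, hD, hD'⟩ := P.N1_bds hn hh.toHomog hl
  obtain ⟨L, hL, hL'⟩ := P.exists_lipLp_symT
  refine ⟨C1 * (L + L * D * pw 2) * pw 4 + C2 * (1 + D) + C3 * (1 + D * pw 2) * pw 2, by
    finiteness [pw_ne_top 2, pw_ne_top 4], ?_⟩
  intro p A hp hpt hA u hu θ hθ j q
  have hp1 : 1 ≤ p := one_le_two.trans hp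
  have hθ' := WInt.of_memLp hn hp1 hθ
  have hS := fun k => P.symbol_symb' hM hh.toHomog hl k
  have hST := fun k => P.symT_symb' hM hh.toHomog hl k
  have hSi : ∀ k i, Symb (n + d) (fun ξ => P.symbol k ξ * (h ξ * dsym i ξ)) := fun k i =>
    P.symbol_symb' hM (hh.mul_dsym i).toHomog ((P.symb_low (by linarith)
      (hh.mul_dsym i).toHomog).mono (by linarith)) k
  have hf := memLp_op hn hp1 (P.symbol_symb_one _ q) hθ
  have hg := memLp_op hn hp1 (hS q) hθ
  have hTf : op (P.symT q) (op (P.symbol q) θ) = op (P.symbol q) θ := op_symT_symbol hn q hθ'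
  have hTg := op_symT_block hn (hS q) hθ'
  have hfg : ∀ i, op (fun ξ => P.symbol j ξ * (h ξ * dsym i ξ)) (op (P.symbol q) θ)
      = op (fun ξ => P.symbol j ξ * dsym i ξ) (op (fun ξ => P.symbol q ξ * h ξ) θ) := fun i => by
    rw [op_op hn (hSi j i) (P.symbol_symb_one _ q) hθ',
      op_op hn (P.symbol_dsym_symb _ j i) (hS q) hθ']
    congr 1
    ext ξ; ring
  set t := eLpNorm (op (P.symbol q) θ) ⊤ volume with ht
  have hgt : eLpNorm (op (fun ξ => P.symbol q ξ * h ξ) θ) ⊤ volume ≤ D * pw (q * d) * t := by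
    rw [← op_symT_mul_symbol hn (hST q) hθ']
    exact (eLpNorm_op_le le_top (hST q) hf.1).trans (by gcongr; exact (hD' q).2)
  have hBf : LipLp ⊤ (L * pw q * t) (op (P.symbol q) θ) := by
    have := lipLp_op hM le_top (P.symT_symb_one _ q) (hL' q) (WInt.of_memLp hn hp1 hf)
    rwa [hTf] at this
  have hBg : LipLp ⊤ (L * pw q * (D * pw (q * d) * t)) (op (fun ξ => P.symbol q ξ * h ξ) θ) := by
    have := lipLp_op hM le_top (P.symT_symb_one _ q) (hL' q) (WInt.of_memLp hn hp1 hg)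
    rw [hTg] at this
    exact this.mono (by gcongr)
  have hq0 : (0 : ℝ) ≤ q := q.cast_nonneg
  set E := min (j : ℝ) q - (1 - d) * max (j : ℝ) q with hE
  -- each regime gives the bound with one of the three parts of the constant
  have fin : ∀ {K X : ℝ≥0∞}, X ≤ K * A * (pw E * t) →
      K ≤ C1 * (L + L * D * pw 2) * pw 4 + C2 * (1 + D) + C3 * (1 + D * pw 2) * pw 2 →
      X ≤ (C1 * (L + L * D * pw 2) * pw 4 + C2 * (1 + D) + C3 * (1 + D * pw 2) * pw 2) * A *
        (pw E * t) := fun hX hK => hX.trans (by gcongr)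
  rcases Nat.lt_or_ge q (j + 3) with hqj | hqj
  · have hqj' : (q : ℝ) ≤ j + 2 := by exact_mod_cast (by omega : q ≤ j + 2)
    rcases eq_or_ne j 0 with rfl | hj
    · refine fin (K := C3 * (1 + D * pw 2) * pw 2) ?_ le_add_self
      have e1 : pw (q * d) ≤ pw 2 := pw_mono (by push_cast at hqj'; nlinarith)
      have e2 : 1 ≤ pw 2 * pw E := by
        rw [← pw_add, ← pw_zero]
        refine pw_mono ?_
        have hmax : max ((0 : ℕ) : ℝ) q = q := by rw [Nat.cast_zero]; exact max_eq_right hq0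
        have hmin : min ((0 : ℕ) : ℝ) q = 0 := by rw [Nat.cast_zero]; exact min_eq_left hq0
        rw [hE, hmax, hmin]
        push_cast at hqj'
        nlinarith
      calc _ ≤ C3 * A * (t + D * pw (q * d) * t) :=
            (b3 hp hpt hA hu hf hg hfg).trans (by gcongr)
        _ ≤ C3 * A * (t + D * pw 2 * t) * 1 := by rw [mul_one]; gcongr
        _ ≤ C3 * A * (t + D * pw 2 * t) * (pw 2 * pw E) := by gcongr
        _ = _ := by ring
    · refine fin (K := C1 * (L + L * D * pw 2) * pw 4) ?_
        (by rw [add_assoc]; exact le_self_add)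
      have e3 : (q : ℝ) - (1 - d) * j ≤ E + 4 := by
        rw [hE]
        rcases le_total (j : ℝ) q with h' | h'
        · rw [min_eq_left h', max_eq_right h']; nlinarith
        · rw [min_eq_right h', max_eq_left h']; linarith
      have e1 : pw (j * (d - 1)) * pw q ≤ pw 4 * pw E := by
        rw [← pw_add, ← pw_add]
        exact pw_mono (by linarith)
      have e2 : pw (-j) * (pw q * pw (q * d)) ≤ pw 2 * (pw 4 * pw E) := by
        rw [← pw_add, ← pw_add, ← pw_add, ← pw_add]
        exact pw_mono (by nlinarith)
      calc _ ≤ C1 * (pw (j * (d - 1)) * (A * (L * pw q * t)) +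
            pw (-j) * (A * (L * pw q * (D * pw (q * d) * t)))) :=
            b1 hp hpt hA hu hf hg hj hfg hBf hBg
        _ = C1 * A * (L * (pw (j * (d - 1)) * pw q) +
            L * D * (pw (-j) * (pw q * pw (q * d)))) * t := by ring
        _ ≤ C1 * A * (L * (pw 4 * pw E) + L * D * (pw 2 * (pw 4 * pw E))) * t := by gcongr
        _ = _ := by ring
  · refine fin (K := C2 * (1 + D)) ?_ (le_add_self.trans le_self_add)
    have hjq : (j : ℝ) ≤ q := by exact_mod_cast (by omega : j ≤ q)
    have hE' : E = j - (1 - d) * q := by rw [hE, min_eq_left hjq, max_eq_right hjq]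
    have e1 : pw (j * (d + 1) - q) ≤ pw E := pw_mono (by rw [hE']; nlinarith)
    have e2 : pw (j - q) * pw (q * d) = pw E := by
      rw [← pw_add, hE']
      congr 1; ring
    calc _ ≤ C2 * A * (pw (j * (d + 1) - q) * t + pw (j - q) * (D * pw (q * d) * t)) :=
          (b2 hp hpt hA hu hf hg hqj hTf hTg).trans (by gcongr)
      _ = C2 * A * (pw (j * (d + 1) - q) * t + D * (pw (j - q) * pw (q * d)) * t) := by ring
      _ ≤ C2 * A * (pw E * t + D * pw E * t) := by rw [e2]; gcongr
      _ = _ := by ring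

/-- The gain `2^{min(j, q) - (1 - d) max(j, q)}` leaves a geometric kernel in `|j - q|` for
`-1 < s < 1 - d`. -/
lemma pw_advection_weight_le {s d : ℝ} (j q : ℕ) :
    pw (j * s) * pw (min (j : ℝ) q - (1 - d) * max (j : ℝ) q) ≤
      pw (-(min (s + 1) (1 - d - s)) * |(j : ℝ) - q|) * pw (q * (s + d)) := by
  rw [← pw_add, ← pw_add]
  refine pw_mono ?_
  rcases le_total (j : ℝ) q with h | h
  · rw [min_eq_left h, max_eq_right h, abs_of_nonpos (by linarith)]
    nlinarith [min_le_left (s + 1) (1 - d - s)]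
  · rw [min_eq_right h, max_eq_left h, abs_of_nonneg (by linarith)]
    nlinarith [min_le_right (s + 1) (1 - d - s)]

/-- Summation of the block estimates against the weights `2^{js}`. -/
lemma exists_ablk_series_estimate {d s : ℝ} (hd : 0 < d) (hd1 : d < 1) (hs : -1 < s)
    (hsd : s < 1 - d) {h : Space n → ℂ} (hh : Mult P d h) :
    ∃ C : ℝ≥0∞, C ≠ ⊤ ∧ ∀ {p r A : ℝ≥0∞} (_ : 2 ≤ p) (_ : p ≠ ⊤) (_ : 1 ≤ r) (_ : A ≠ ⊤)
      {u : Fin n → Space n → ℂ} (_ : Velocity p A u) {θ : Space n → ℂ} (_ : MemLp θ p volume),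
    eLpNorm (fun j : ℕ => pw (j * s) * ∑' q : ℕ,
      eLpNorm (P.ablk h j u (op (P.symbol q) θ) (op (fun ξ => P.symbol q ξ * h ξ) θ)) p volume)
        r Measure.count ≤
      C * A * eLpNorm (fun q : ℕ => pw (q * (s + d)) * eLpNorm (op (P.symbol q) θ) ⊤ volume)
        r Measure.count := by
  obtain ⟨C, hC, b⟩ := exists_ablk_estimate hd hd1 hh
  set ε := min (s + 1) (1 - d - s) with hε
  have hε0 : 0 < ε := lt_min (by linarith) (by linarith)
  refine ⟨C * geo ε, ENNReal.mul_ne_top hC (geo_lt_top hε0).ne, ?_⟩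
  intro p r A hp hpt hr hA u hu θ hθ
  set t := fun q : ℕ => eLpNorm (op (P.symbol q) θ) ⊤ volume with ht
  have h1 : ∀ j : ℕ, pw (j * s) * ∑' q : ℕ,
      eLpNorm (P.ablk h j u (op (P.symbol q) θ) (op (fun ξ => P.symbol q ξ * h ξ) θ)) p volume
      ≤ (C * A) * ∑' q : ℕ, pw (-ε * |(j : ℝ) - q|) * (pw (q * (s + d)) * t q) := fun j => by
    rw [← ENNReal.tsum_mul_left, ← ENNReal.tsum_mul_left]
    refine ENNReal.tsum_le_tsum fun q => ?_
    calc _ ≤ pw (j * s) * (C * A * (pw (min (j : ℝ) q - (1 - d) * max (j : ℝ) q) * t q)) := by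
          gcongr
          exact b hp hpt hA hu hθ j q
      _ = C * A * ((pw (j * s) * pw (min (j : ℝ) q - (1 - d) * max (j : ℝ) q)) * t q) := by ring
      _ ≤ C * A * ((pw (-ε * |(j : ℝ) - q|) * pw (q * (s + d))) * t q) := by
          exact mul_le_mul' le_rfl (mul_le_mul' (pw_advection_weight_le j q) le_rfl)
      _ = _ := by ring
  refine (eLpNorm_count_mono r h1).trans ((eLpNorm_count_const_mul r (by finiteness) _).trans ?_)
  calc _ ≤ C * A * (geo ε * eLpNorm (fun q : ℕ => pw (q * (s + d)) * t q) r Measure.count) := by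
        gcongr
        exact eLpNorm_geo_le hr _
    _ = _ := by ring

end DyadicPartition

namespace RieszCommutator

variable {n : ℕ}

/-! ### Besov functions as sums of frequency localized pieces -/

/-- An absolutely convergent series in `L^p`, as a weak sum. -/
lemma exists_hasSum_integral_mul {ι : Type*} {p : ℝ≥0∞} (hp : 1 ≤ p)
    {e : ι → Space n → ℂ} (he : ∀ i, MemLp (e i) p volume)
    (hs : ∑' i, eLpNorm (e i) p volume ≠ ⊤) :
    ∃ G : Space n → ℂ, MemLp G p volume ∧ eLpNorm G p volume ≤ ∑' i, eLpNorm (e i) p volume ∧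
      ∀ {p' : ℝ≥0∞} [ENNReal.HolderConjugate p p'] {w : Space n → ℂ}, MemLp w p' volume →
        HasSum (fun i => ∫ x, e i x * w x) (∫ x, G x * w x) := by
  have : Fact (1 ≤ p) := ⟨hp⟩
  set E : ι → Lp ℂ p (volume : Measure (Space n)) := fun i => (he i).toLp with hE
  have hnorm : ∀ i, ‖E i‖ₑ = eLpNorm (e i) p volume := fun i => by rw [hE, Lp.enorm_toLp]
  have hsum : Summable E := by
    refine Summable.of_norm ?_
    have h1 : Summable fun i => (eLpNorm (e i) p volume).toReal := ENNReal.summable_toReal hs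
    refine h1.congr fun i => ?_
    rw [← hnorm, toReal_enorm]
  have hG := Lp.memLp (∑' i, E i)
  refine ⟨(∑' i, E i : Lp ℂ p volume), hG, ?_, fun {p'} _ {w} hw => ?_⟩
  · rw [← Lp.enorm_def]
    exact enorm_tsum_le_tsum_enorm.trans (le_of_eq (by simp only [hnorm]))
  · let Λ : Lp ℂ p (volume : Measure (Space n)) →L[ℂ] ℂ := LinearMap.mkContinuous
      { toFun := fun f => ∫ x, f x * w x
        map_add' := fun f g => by
          rw [← integral_add (f := fun x => f x * w x) (g := fun x => g x * w x)
            (integrable_mul_of_memLp (Lp.memLp f) hw) (integrable_mul_of_memLp (Lp.memLp g) hw)]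
          refine integral_congr_ae ?_
          filter_upwards [Lp.coeFn_add f g] with x hx
          rw [hx, Pi.add_apply, add_mul]
        map_smul' := fun c f => by
          rw [RingHom.id_apply, smul_eq_mul, ← integral_const_mul]
          refine integral_congr_ae ?_
          filter_upwards [Lp.coeFn_smul c f] with x hx
          rw [hx, Pi.smul_apply, smul_eq_mul, mul_assoc] }
      (eLpNorm w p' volume).toReal (fun f => by
        have h1 := enorm_integral_mul_le (p := p) (q := p') (Lp.aestronglyMeasurable f) hw.1
        rw [← Lp.enorm_def] at h1
        have h2 := ENNReal.toReal_mono (by finiteness [hw.2.ne, (enorm_ne_top : ‖f‖ₑ ≠ ⊤)]) h1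
        rw [ENNReal.toReal_mul, toReal_enorm, toReal_enorm, mul_comm] at h2
        exact h2)
    have h1 := Λ.hasSum hsum.hasSum
    have h2 : ∀ i, Λ (E i) = ∫ x, e i x * w x := fun i => by
      refine integral_congr_ae ?_
      filter_upwards [(he i).coeFn_toLp] with x hx
      simp only [hE, hx]
    simp only [h2] at h1
    exact h1

/-- The tempered distribution of a complex `L^p` function. -/
def lpDistC {p : ℝ≥0∞} [Fact (1 ≤ p)] {f : Space n → ℂ} (hf : MemLp f p volume) :
    𝓢'(Space n, ℂ) :=
  Lp.toTemperedDistribution hf.toLp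

lemma lpDistC_apply {p : ℝ≥0∞} [Fact (1 ≤ p)] {f : Space n → ℂ} (hf : MemLp f p volume)
    (ψ : 𝓢(Space n, ℂ)) : lpDistC hf ψ = ∫ x, f x * ψ x := by
  rw [lpDistC, Lp.toTemperedDistribution_apply]
  refine integral_congr_ae ?_
  filter_upwards [hf.coeFn_toLp] with x hx
  rw [hx, smul_eq_mul, mul_comm]

/-- The function `|ξ|^{-2}`, the inverse of `|ξ|² = ⟨ξ⟩² - 1` away from the origin, written as a
multiple of a power of `2π|ξ|`. -/
def invSq (ξ : Space n) : ℂ :=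
  (((2 * Real.pi) ^ 2 : ℝ) : ℂ) * (((2 * Real.pi * ‖ξ‖) ^ (-2 : ℝ) : ℝ) : ℂ)

lemma invSq_homog : Homog (-2) (invSq (n := n)) := (Homog.norm_rpow (-2)).const_mul _

lemma invSq_neg (ξ : Space n) : invSq (-ξ) = invSq ξ := by simp [invSq]

lemma invSq_mul {ξ : Space n} (h : ξ ≠ 0) : invSq ξ * (bw 2 ξ - 1) = 1 := by
  have h1 : 0 < ‖ξ‖ := norm_pos_iff.2 h
  have h2 : (2 * Real.pi) ^ 2 * (2 * Real.pi * ‖ξ‖) ^ (-2 : ℝ) * ((1 + ‖ξ‖ ^ 2) ^ ((2 : ℝ) / 2) - 1)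
      = 1 := by
    rw [div_self two_ne_zero, Real.rpow_one, Real.rpow_neg (by positivity), Real.rpow_two]
    field_simp
    ring
  rw [invSq, bw, ← Complex.ofReal_one, ← Complex.ofReal_sub, ← Complex.ofReal_mul,
    ← Complex.ofReal_mul, h2]

end RieszCommutator

namespace DyadicPartition

open RieszCommutator

variable {n : ℕ} {P : DyadicPartition n}

lemma symT_apply_zero {k : ℕ} (hk : k ≠ 0) : P.symT k 0 = 0 := by
  by_contra h
  have := (P.symT_support h).2 hk
  simp at this
  linarith [show (0 : ℝ) < 2 ^ k by positivity]

lemma symbol_mul_symT_eq_zero' {j k : ℕ} (h : j + 3 ≤ k) (ξ : Space n) :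
    P.symbol k ξ * P.symT j ξ = 0 := by
  by_contra hne
  have h1 := (P.symT_support (right_ne_zero_of_mul hne)).1
  have h2 := left_ne_zero_of_mul hne
  obtain ⟨k, rfl⟩ := Nat.exists_eq_succ_of_ne_zero (show k ≠ 0 by omega)
  rw [Nat.succ_eq_add_one, symbol_succ] at h2
  have h3 := (P.shell_support h2).1
  have h4 : (2 : ℝ) ^ (j + 2) ≤ 2 ^ k := pow_le_pow_right₀ one_le_two (by omega)
  rw [pow_add] at h4
  have h5 : (0 : ℝ) < 2 ^ j := by positivity
  have h6 : (0 : ℝ) < 2 ^ k := by positivity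
  rw [norm_smul, norm_inv, Real.norm_of_nonneg h6.le] at h3
  have h7 : 3 / 4 * 2 ^ k ≤ 2 * Real.pi * ‖ξ‖ := by
    have := mul_le_mul_of_nonneg_right h3 h6.le
    calc _ ≤ _ := this
      _ = _ := by field_simp
  linarith

lemma symT_invSq_symb (M : ℝ) {j : ℕ} (hj : j ≠ 0) : Symb M (fun ξ => P.symT j ξ * invSq ξ) :=
  (P.symT_symb (le_max_right M 0) invSq_homog hj).mono (le_max_left M 0)

/-- A block of a Schwartz function, with two derivatives moved to the function. -/
lemma op_symT_invSq {j : ℕ} (hj : j ≠ 0) (ψ : 𝓢(Space n, ℂ)) :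
    op (fun ξ => P.symT j ξ * invSq ξ) (bessel 2 ψ - ψ : 𝓢(Space n, ℂ)) = op (P.symT j) ψ := by
  have hn : (n : ℝ) < n + 1 := by linarith
  rw [op_schwartz hn (P.symT_invSq_symb _ hj), op_schwartz hn (P.symT_symb_one _ j)]
  congr 1
  ext ξ
  have e : 𝓕 ((bessel 2 ψ - ψ : 𝓢(Space n, ℂ)) : Space n → ℂ) ξ
      = (bw 2 ξ - 1) * 𝓕 (ψ : Space n → ℂ) ξ := by
    have h1 : 𝓕 (bessel 2 ψ - ψ) = 𝓕 (bessel 2 ψ) - 𝓕 ψ := by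
      rw [sub_eq_add_neg, FourierTransform.fourier_add, FourierTransform.fourier_neg,
        ← sub_eq_add_neg]
    have h2 := congrArg (fun f : 𝓢(Space n, ℂ) => f ξ) h1
    simp only [SchwartzMap.fourier_coe, sub_apply] at h2
    rw [h2, fourier_bessel]
    ring
  rw [e]
  rcases eq_or_ne ξ 0 with rfl | h
  · rw [symT_apply_zero hj]; simp
  · rw [mul_assoc, ← mul_assoc (invSq ξ), invSq_mul h, one_mul]

lemma integral_op_mul_schwartz {M : ℝ} (hn : n < M) {σ F : Space n → ℂ} (hσ : Symb M σ)
    (h : ∀ ξ, σ (-ξ) = σ ξ) (hF : WInt M F) (ψ : 𝓢(Space n, ℂ)) :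
    ∫ x, op σ F x * ψ x = ∫ x, F x * op σ ψ x := by
  have := integral_mul_op hn hσ (schwartz_decays M ψ) hF
  simp only [h] at this
  simp only [mul_comm (F _), ← this]
  simp only [mul_comm]

/-- A double series of `L^p` functions `c j q`, cut off at the frequencies `2^j`, converges to a
tempered distribution whose Besov norm is that of the sequence `∑ q, ‖c j q‖_p`. For negative `s`
the series converges in `L^p` only after division by `|ξ|²`. -/
lemma exists_synthesis {s : ℝ} (hs : -2 < s) : ∃ C : ℝ≥0∞, C ≠ ⊤ ∧
    ∀ {p r : ℝ≥0∞} (_ : 1 ≤ p) (_ : 1 ≤ r) {c : ℕ → ℕ → Space n → ℂ}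
      (_ : ∀ j q, MemLp (c j q) p volume)
      (_ : eLpNorm (fun j : ℕ => pw (j * s) * ∑' q, eLpNorm (c j q) p volume) r Measure.count ≠ ⊤),
    ∃ F : 𝓢'(Space n, ℂ),
      (∀ ψ : 𝓢(Space n, ℂ),
        HasSum (fun jq : ℕ × ℕ => ∫ x, c jq.1 jq.2 x * op (P.symT jq.1) ψ x) (F ψ)) ∧
      besovNorm P s p r F ≤
        C * eLpNorm (fun j : ℕ => pw (j * s) * ∑' q, eLpNorm (c j q) p volume) r
          Measure.count := by
  obtain ⟨C1, hC1, b1⟩ := P.symbol_bds (invSq_homog (n := n))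
  obtain ⟨C2, hC2, b2⟩ := P.one_bds
  have hg1 := (geo_lt_top one_pos).ne
  refine ⟨pw (-s) * (C2 * C2 * pw (2 + 2 * |s|)) * geo 1, by
    finiteness [pw_ne_top (-s), pw_ne_top (2 + 2 * |s|)], ?_⟩
  intro p r hp hr c hc hK
  set K := eLpNorm (fun j : ℕ => pw (j * s) * ∑' q, eLpNorm (c j q) p volume) r Measure.count
  set D : ℕ → ℝ≥0∞ := fun j => ∑' q, eLpNorm (c j q) p volume with hD
  have hDK : ∀ j : ℕ, pw (j * s) * D j ≤ K := fun j =>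
    le_eLpNorm_count hr (fun j : ℕ => pw (j * s) * D j) j
  have : Fact (1 ≤ p) := ⟨hp⟩
  obtain ⟨p', hp', hpp⟩ := exists_holderConjugate hp
  have hn : (n : ℝ) < n + 1 := by linarith
  have hcw : ∀ j q, WInt (n + 1) (c j q) := fun j q => WInt.of_memLp hn hp (hc j q)
  have hpsi : ∀ ψ : 𝓢(Space n, ℂ), MemLp ψ p' volume := fun ψ =>
    (schwartz_decays (n + 1) ψ).memLp hn hp'
  -- the lowest frequencies, and the others after division by `|ξ|²`
  set e0 : ℕ × ℕ → Space n → ℂ := fun jq =>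
    if jq.1 = 0 then op (P.symT jq.1) (c jq.1 jq.2) else 0 with he0
  set e1 : ℕ × ℕ → Space n → ℂ := fun jq =>
    if jq.1 = 0 then 0 else op (fun ξ => P.symT jq.1 ξ * invSq ξ) (c jq.1 jq.2) with he1
  have m0 : ∀ jq, MemLp (e0 jq) p volume := fun jq => by
    simp only [he0]
    split_ifs
    · exact memLp_op hn hp (P.symT_symb_one _ _) (hc _ _)
    · exact MemLp.zero
  have m1 : ∀ jq, MemLp (e1 jq) p volume := fun jq => by
    simp only [he1]
    split_ifs with h
    · exact MemLp.zero
    · exact memLp_op hn hp (P.symT_invSq_symb _ h) (hc _ _)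
  have n0 : ∀ jq : ℕ × ℕ, eLpNorm (e0 jq) p volume
      ≤ (C1 + C2) * (pw (jq.1 * -2) * eLpNorm (c jq.1 jq.2) p volume) := fun jq => by
    simp only [he0]
    split_ifs with h
    · rw [h]
      simp only [Nat.cast_zero, zero_mul, pw_zero, one_mul]
      refine (eLpNorm_op_le hp (P.symT_symb_one ((n : ℝ) + 1) _) (hc _ _).1).trans ?_
      gcongr
      exact (b2 0).2.1.trans le_add_self
    · rw [eLpNorm_zero]
      exact zero_le
  have n1 : ∀ jq : ℕ × ℕ, eLpNorm (e1 jq) p volume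
      ≤ (C1 + C2) * (pw (jq.1 * -2) * eLpNorm (c jq.1 jq.2) p volume) := fun jq => by
    simp only [he1]
    split_ifs with h
    · rw [eLpNorm_zero]
      exact zero_le
    · refine (eLpNorm_op_le hp (P.symT_invSq_symb ((n : ℝ) + 1) h) (hc _ _).1).trans ?_
      rw [← mul_assoc]
      gcongr
      exact (b1 _ h).2.one.trans (by gcongr; exact le_self_add)
  -- the weights `2^{-2j}` are summable against `2^{-js}` as `s > -2`
  have hfin : ∑' jq : ℕ × ℕ, (C1 + C2) * (pw (jq.1 * -2) * eLpNorm (c jq.1 jq.2) p volume)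
      ≠ ⊤ := by
    rw [ENNReal.tsum_mul_left, ENNReal.tsum_prod']
    refine ENNReal.mul_ne_top (by finiteness) (ne_top_of_le_ne_top
      (ENNReal.mul_ne_top (geo_lt_top (show 0 < 2 + s by linarith)).ne hK) ?_)
    calc ∑' j : ℕ, ∑' q : ℕ, pw (j * -2) * eLpNorm (c j q) p volume
        = ∑' j : ℕ, pw (-(2 + s) * |(0 : ℝ) - j|) * (pw (j * s) * D j) := by
          refine tsum_congr fun j => ?_
          rw [ENNReal.tsum_mul_left, ← mul_assoc, ← pw_add, zero_sub, abs_neg, Nat.abs_cast]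
          congr 2; ring
      _ ≤ ∑' j : ℕ, pw (-(2 + s) * |(0 : ℝ) - j|) * K :=
          ENNReal.tsum_le_tsum fun j => by gcongr; exact hDK j
      _ ≤ _ := by
          rw [ENNReal.tsum_mul_right]
          gcongr
          exact tsum_geo_le _ 0 ⟨0, by simp⟩
  obtain ⟨G0, hG0, -, hs0⟩ := exists_hasSum_integral_mul hp m0
    (ne_top_of_le_ne_top hfin (ENNReal.tsum_le_tsum n0))
  obtain ⟨G1, hG1, -, hs1⟩ := exists_hasSum_integral_mul hp m1
    (ne_top_of_le_ne_top hfin (ENNReal.tsum_le_tsum n1))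
  set F : 𝓢'(Space n, ℂ) :=
    lpDistC hG0 + (besselPotential (Space n) ℂ 2 (lpDistC hG1) - lpDistC hG1) with hF
  have hFsum : ∀ ψ : 𝓢(Space n, ℂ),
      HasSum (fun jq : ℕ × ℕ => ∫ x, c jq.1 jq.2 x * op (P.symT jq.1) ψ x) (F ψ) := fun ψ => by
    have e : F ψ = (∫ x, G0 x * ψ x) + ∫ x, G1 x * (bessel 2 ψ - ψ : 𝓢(Space n, ℂ)) x := by
      rw [← lpDistC_apply hG0, ← lpDistC_apply hG1, map_sub, ← besselPotential_apply]
      rfl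
    rw [e]
    refine ((hs0 (hpsi ψ)).add (hs1 (hpsi _))).congr_fun ?_
    rintro ⟨j, q⟩
    simp only [he0, he1]
    split_ifs with h
    · simp only [Pi.zero_apply, zero_mul, integral_zero, add_zero]
      exact (integral_op_mul_schwartz hn (P.symT_symb_one _ _) (P.symT_neg _) (hcw _ _) ψ).symm
    · simp only [Pi.zero_apply, zero_mul, integral_zero, zero_add]
      rw [integral_op_mul_schwartz hn (P.symT_invSq_symb _ h)
        (fun ξ => by rw [symT_neg, invSq_neg]) (hcw _ _), op_symT_invSq h]
  refine ⟨F, hFsum, ?_⟩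
  -- the blocks of `F`
  set dk : ℕ → ℕ × ℕ → Space n → ℂ := fun k jq =>
    op (fun ξ => P.symbol k ξ * P.symT jq.1 ξ) (c jq.1 jq.2) with hdk
  have hSk : ∀ k j, Symb ((n : ℝ) + 1) (fun ξ => P.symbol k ξ * P.symT j ξ) := fun k j =>
    (P.symbol_symb_one _ k).mul hn (P.symT_symb_one _ j)
  have mk : ∀ k jq, MemLp (dk k jq) p volume := fun k jq => memLp_op hn hp (hSk _ _) (hc _ _)
  have nk : ∀ (k : ℕ) (jq : ℕ × ℕ), pw (k * s) * eLpNorm (dk k jq) p volume ≤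
      C2 * C2 * pw (2 + 2 * |s|) * (pw (-1 * |(k : ℝ) - jq.1|) *
        (pw (jq.1 * s) * eLpNorm (c jq.1 jq.2) p volume)) := fun k jq => by
    obtain ⟨j, q⟩ := jq
    simp only [hdk]
    by_cases hkj : k < j + 3 ∧ j < k + 3
    · have h1 : |(k : ℝ) - j| ≤ 2 := by
        rw [abs_le]
        have h1 : (k : ℝ) ≤ j + 2 := by exact_mod_cast (by omega : k ≤ j + 2)
        have h2 : (j : ℝ) ≤ k + 2 := by exact_mod_cast (by omega : j ≤ k + 2)
        constructor <;> linarith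
      have h2 : ((k : ℝ) - j) * s ≤ 2 * |s| := by
        calc ((k : ℝ) - j) * s ≤ |((k : ℝ) - j) * s| := le_abs_self _
          _ = |(k : ℝ) - j| * |s| := abs_mul _ _
          _ ≤ _ := by gcongr
      have h3 : eLpNorm (op (fun ξ => P.symbol k ξ * P.symT j ξ) (c j q)) p volume
          ≤ C2 * (C2 * eLpNorm (c j q) p volume) := by
        rw [← op_op hn (P.symbol_symb_one _ k) (P.symT_symb_one _ j) (hcw j q)]
        refine (eLpNorm_op_le hp (P.symbol_symb_one ((n : ℝ) + 1) k)
          (memLp_op hn hp (P.symT_symb_one _ j) (hc j q)).1).trans ?_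
        gcongr
        · exact (b2 k).1
        · exact (eLpNorm_op_le hp (P.symT_symb_one ((n : ℝ) + 1) j) (hc j q).1).trans (by
            gcongr; exact (b2 j).2.1)
      calc _ ≤ pw (k * s) * (C2 * (C2 * eLpNorm (c j q) p volume)) := by gcongr
        _ ≤ pw ((2 + 2 * |s|) + (-1 * |(k : ℝ) - j| + j * s)) *
            (C2 * (C2 * eLpNorm (c j q) p volume)) := by
            gcongr
            exact pw_mono (by linarith)
        _ = _ := by rw [pw_add (2 + 2 * |s|), pw_add (-1 * |(k : ℝ) - j|)]; ring
    · have h0 : (fun ξ => P.symbol k ξ * P.symT j ξ) = fun _ => 0 := by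
        ext ξ
        rcases Nat.lt_or_ge k (j + 3) with h | h
        · exact P.symbol_mul_symT_eq_zero (by omega) ξ
        · exact P.symbol_mul_symT_eq_zero' h ξ
      rw [h0, op_zero, show (fun _ : Space n => (0 : ℂ)) = 0 from rfl, eLpNorm_zero, mul_zero]
      exact zero_le
  have sk : ∀ k : ℕ, pw (k * s) * ∑' jq, eLpNorm (dk k jq) p volume ≤
      C2 * C2 * pw (2 + 2 * |s|) * ∑' j : ℕ, pw (-1 * |(k : ℝ) - j|) * (pw (j * s) * D j) :=
    fun k => by
    rw [← ENNReal.tsum_mul_left]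
    refine (ENNReal.tsum_le_tsum (nk k)).trans (le_of_eq ?_)
    rw [ENNReal.tsum_mul_left, ENNReal.tsum_prod']
    congr 1
    refine tsum_congr fun j => ?_
    rw [hD, ← ENNReal.tsum_mul_left, ← ENNReal.tsum_mul_left]
  have hgeo := eLpNorm_geo_le (ε := 1) hr (fun j : ℕ => pw (j * s) * D j)
  have hfink : ∀ k : ℕ, ∑' jq, eLpNorm (dk k jq) p volume ≠ ⊤ := fun k => by
    have h1 : pw (k * s) * ∑' jq, eLpNorm (dk k jq) p volume ≠ ⊤ := by
      refine ne_top_of_le_ne_top ?_ (sk k)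
      have h2 := (le_eLpNorm_count hr (fun k : ℕ => ∑' j : ℕ, pw (-1 * |(k : ℝ) - j|) *
        (pw (j * s) * D j)) k).trans hgeo
      have h3 := ne_top_of_le_ne_top (ENNReal.mul_ne_top hg1 hK) h2
      finiteness [pw_ne_top (2 + 2 * |s|)]
    exact (ENNReal.lt_top_of_mul_ne_top_right h1 (pw_pos _).ne').ne
  have hblock : ∀ k, distLpNorm p (P.block k F) ≤ ∑' jq, eLpNorm (dk k jq) p volume := fun k => by
    obtain ⟨G, hG, hGn, hGs⟩ := exists_hasSum_integral_mul hp (mk k) (hfink k)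
    refine (distLpNorm_le hG fun ψ => ?_).trans hGn
    set φ : 𝓢(Space n, ℂ) := 𝓕 (SchwartzMap.smulLeftCLM ℂ (P.symbol k) (𝓕⁻ ψ)) with hφ
    have e1 : P.block k F ψ = F φ := rfl
    have e2 : (φ : Space n → ℂ) = op (P.symbol k) ψ := by
      rw [hφ, fourier_smulLeft_fourierInv (P.symbol_smooth k) (P.symbol_compact k), symbol_neg']
    rw [e1]
    simp only [mul_comm (ψ _)]
    refine (hFsum φ).unique ((hGs (hpsi ψ)).congr_fun ?_)
    rintro ⟨j, q⟩
    simp only [hdk]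
    rw [integral_op_mul_schwartz hn (hSk k j) (fun ξ => by rw [symbol_neg, symT_neg]) (hcw j q),
      e2, op_op hn (P.symT_symb_one _ j) (P.symbol_symb_one _ k)
      (WInt.of_memLp hn hp' (hpsi ψ))]
    simp only [mul_comm]
  unfold besovNorm
  have hfinal : ∀ k : ℕ, ENNReal.ofReal ((2 : ℝ) ^ (((k : ℝ) - 1) * s)) *
      distLpNorm p (P.block k F) ≤ (pw (-s) * (C2 * C2 * pw (2 + 2 * |s|))) *
        ∑' j : ℕ, pw (-1 * |(k : ℝ) - j|) * (pw (j * s) * D j) := fun k => by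
    rw [show ENNReal.ofReal ((2 : ℝ) ^ (((k : ℝ) - 1) * s)) = pw (-s + k * s) by
      rw [pw]; congr 2; ring, pw_add, mul_assoc, mul_assoc]
    exact mul_le_mul' le_rfl ((mul_le_mul' le_rfl (hblock k)).trans (sk k))
  refine (eLpNorm_count_mono r hfinal).trans ((eLpNorm_count_const_mul r (by
    finiteness [pw_ne_top (-s), pw_ne_top (2 + 2 * |s|)]) _).trans ?_)
  rw [mul_assoc _ (geo 1)]
  gcongr

end DyadicPartition

namespace RieszCommutator

variable {n : ℕ}

/-! ### Integration by parts in the advection term -/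

/-- Cutoffs `η(x / (k + 1))`: their gradients are `O((1 + |x|)^{-1})`, uniformly, because they
live in shells of size `k`. -/
lemma exists_cutoff (n : ℕ) : ∃ (η : ℕ → Space n → ℂ) (C : ℝ), 0 ≤ C ∧
    (∀ k, ContDiff ℝ 1 (η k)) ∧ (∀ k, HasCompactSupport (η k)) ∧ (∀ k x, ‖η k x‖ ≤ 1) ∧
    (∀ x, Tendsto (fun k => η k x) atTop (𝓝 1)) ∧
    (∀ k x v, ‖fderiv ℝ (η k) x v‖ ≤ C * ‖v‖ * wt 1 x) ∧
    ∀ x v, Tendsto (fun k => fderiv ℝ (η k) x v) atTop (𝓝 0) := by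
  let bump : ContDiffBump (0 : Space n) := ⟨1, 2, by norm_num, by norm_num⟩
  set b : Space n → ℂ := fun x => (bump x : ℂ) with hb
  have hbs : ContDiff ℝ 1 b := Complex.ofRealCLM.contDiff.comp bump.contDiff
  have hbc : HasCompactSupport b := bump.hasCompactSupport.comp_left (g := Complex.ofReal) rfl
  obtain ⟨C, hC⟩ := (hbs.continuous_fderiv one_ne_zero).bounded_above_of_compact_support
    (hbc.fderiv ℝ)
  have hC0 : 0 ≤ C := (norm_nonneg _).trans (hC 0)
  have hk0 : ∀ k : ℕ, (0 : ℝ) < (k : ℝ) + 1 := fun k => by positivity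
  have hfd : ∀ (k : ℕ) x v, fderiv ℝ (fun x => b (((k : ℝ) + 1)⁻¹ • x)) x v
      = (((k : ℝ) + 1)⁻¹ : ℝ) • fderiv ℝ b (((k : ℝ) + 1)⁻¹ • x) v := fun k x v => by
    have h1 := (hbs.differentiable one_ne_zero (((k : ℝ) + 1)⁻¹ • x)).hasFDerivAt.comp x
      ((hasFDerivAt_id x).const_smul (((k : ℝ) + 1)⁻¹))
    have h2 : fderiv ℝ (fun x => b (((k : ℝ) + 1)⁻¹ • x)) x = _ := h1.fderiv
    rw [h2]
    simp
  have hfdn : ∀ (k : ℕ) x v, ‖fderiv ℝ (fun x => b (((k : ℝ) + 1)⁻¹ • x)) x v‖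
      ≤ ((k : ℝ) + 1)⁻¹ * (C * ‖v‖) := fun k x v => by
    rw [hfd, norm_smul, Real.norm_of_nonneg (inv_pos.2 (hk0 k)).le]
    have := inv_pos.2 (hk0 k)
    gcongr
    exact (ContinuousLinearMap.le_opNorm _ _).trans (by gcongr; exact hC _)
  have hlim : Tendsto (fun k : ℕ => ((k : ℝ) + 1)⁻¹) atTop (𝓝 0) := by
    simpa [one_div] using tendsto_one_div_add_atTop_nhds_zero_nat (𝕜 := ℝ)
  refine ⟨fun k x => b (((k : ℝ) + 1)⁻¹ • x), 3 * C, by positivity, fun k => ?_, fun k => ?_,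
    fun k x => ?_, fun x => ?_, fun k x v => ?_, fun x v => ?_⟩
  · exact hbs.comp (contDiff_const_smul _)
  · exact hbc.comp_smul (inv_pos.2 (hk0 k)).ne'
  · simp only [hb, Complex.norm_real, Real.norm_of_nonneg bump.nonneg]
    exact bump.le_one
  · have h1 : Tendsto (fun k : ℕ => ((k : ℝ) + 1)⁻¹ • x) atTop (𝓝 ((0 : ℝ) • x)) :=
      hlim.smul_const x
    have h2 := (hbs.continuous.tendsto _).comp h1
    have h3 : b ((0 : ℝ) • x) = 1 := by
      simp only [hb, zero_smul]
      rw [bump.one_of_mem_closedBall (Metric.mem_closedBall_self zero_le_one), Complex.ofReal_one]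
    rw [h3] at h2
    exact h2
  · by_cases hx : ‖x‖ ≤ 2 * (k + 1)
    · refine (hfdn k x v).trans ?_
      rw [wt, Real.rpow_neg_one]
      have h1 : ((k : ℝ) + 1)⁻¹ ≤ 3 * (1 + ‖x‖)⁻¹ := by
        rw [← div_eq_mul_inv, inv_eq_one_div, div_le_div_iff₀ (hk0 k) (by positivity)]
        linarith [(Nat.cast_nonneg k : (0 : ℝ) ≤ k)]
      calc _ ≤ 3 * (1 + ‖x‖)⁻¹ * (C * ‖v‖) := by gcongr
        _ = _ := by ring
    · have h0 : fderiv ℝ b (((k : ℝ) + 1)⁻¹ • x) = 0 := by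
        refine image_eq_zero_of_notMem_tsupport fun hmem => hx ?_
        have h1 := (tsupport_fderiv_subset ℝ) hmem
        have h2 : ((k : ℝ) + 1)⁻¹ • x ∈ Metric.closedBall (0 : Space n) 2 := by
          have h3 : tsupport b ⊆ tsupport bump := closure_mono fun y hy => by
            simp only [hb, Function.mem_support, ne_eq, Complex.ofReal_eq_zero] at hy
            exact hy
          have := h3 h1
          rwa [bump.tsupport_eq] at this
        rw [mem_closedBall_zero_iff, norm_smul, Real.norm_of_nonneg (inv_pos.2 (hk0 k)).le,
          inv_mul_le_iff₀ (hk0 k)] at h2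
        linarith
      rw [hfd, h0]
      simp only [zero_apply, smul_zero, norm_zero]
      have := (wt_pos 1 x).le
      positivity
  · refine squeeze_zero_norm (hfdn · x v) ?_
    simpa using hlim.mul_const (C * ‖v‖)

/-- `∫ (U · ∇Θ) W = - ∫ Θ U · ∇W` for solenoidal `U`. -/
lemma integral_advect_mul {U : Fin n → Space n → ℂ} (hU : ∀ i, ContDiff ℝ 1 (U i))
    (hdiv : ∀ x, ∑ i, fderiv ℝ (U i) x (EuclideanSpace.single i 1) = 0)
    {Θ : Space n → ℂ} (hΘ : ContDiff ℝ 1 Θ) {W : Space n → ℂ} {V : Fin n → Space n → ℂ}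
    (hV : ∀ i, Continuous (V i)) (hW : Differentiable ℝ W)
    (hWV : ∀ x i, fderiv ℝ W x (EuclideanSpace.single i 1) = V i x)
    (h1 : Integrable (fun x => (∑ i, U i x * fderiv ℝ Θ x (EuclideanSpace.single i 1)) * W x))
    (h2 : ∀ i, Integrable (fun x => U i x * Θ x * V i x))
    (h3 : ∀ i, Integrable (fun x => U i x * Θ x * ((wt 1 x : ℂ) * W x))) :
    ∫ x, (∑ i, U i x * fderiv ℝ Θ x (EuclideanSpace.single i 1)) * W x
      = -∑ i, ∫ x, U i x * Θ x * V i x := by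
  obtain ⟨η, C, hC, hηs, hηc, hη1, hηl, hηd, hηd0⟩ := exists_cutoff n
  set e : Fin n → Space n := fun i => EuclideanSpace.single i 1 with he
  have hes : ∀ i, ‖e i‖ = 1 := fun i => by simp [he]
  -- integration by parts with the cutoff
  have key : ∀ k, (∫ x, η k x * ((∑ i, U i x * fderiv ℝ Θ x (e i)) * W x))
      + ∑ i, ∫ x, fderiv ℝ (η k) x (e i) * (U i x * Θ x * W x)
      = -∑ i, ∫ x, η k x * (U i x * Θ x * V i x) := fun k => by
    have hfs : ∀ i, ContDiff ℝ 1 (fun x => η k x * (U i x * Θ x)) := fun i =>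
      (hηs k).mul ((hU i).mul hΘ)
    have hfc : ∀ i, HasCompactSupport (fun x => η k x * (U i x * Θ x)) := fun i =>
      (hηc k).mul_right
    have hder : ∀ i x, fderiv ℝ (fun x => η k x * (U i x * Θ x)) x (e i)
        = η k x * (U i x * fderiv ℝ Θ x (e i)) + fderiv ℝ (η k) x (e i) * (U i x * Θ x)
          + η k x * Θ x * fderiv ℝ (U i) x (e i) := fun i x => by
      have d1 := ((hηs k).differentiable one_ne_zero x).hasFDerivAt
      have d2 := ((hU i).differentiable one_ne_zero x).hasFDerivAt
      have d3 := (hΘ.differentiable one_ne_zero x).hasFDerivAt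
      have d4 : fderiv ℝ (fun x => η k x * (U i x * Θ x)) x = _ := (d1.mul (d2.mul d3)).fderiv
      rw [d4]
      simp only [add_apply, smul_apply, smul_eq_mul, Pi.mul_apply]
      ring
    have ibp : ∀ i, ∫ x, η k x * (U i x * Θ x) * V i x
        = -∫ x, fderiv ℝ (fun x => η k x * (U i x * Θ x)) x (e i) * W x := fun i => by
      rw [← integral_mul_fderiv_eq_neg_fderiv_mul_of_integrable]
      · simp only [he, hWV]
      · refine Continuous.integrable_of_hasCompactSupport ?_ ?_
        · exact (((hfs i).continuous_fderiv one_ne_zero).clm_apply continuous_const).mul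
            hW.continuous
        · exact (((hfc i).fderiv ℝ).comp_left (g := fun L : Space n →L[ℝ] ℂ => L (e i))
            rfl).mul_right
      · simp only [he, hWV]
        exact ((hfs i).continuous.mul (hV i)).integrable_of_hasCompactSupport (hfc i).mul_right
      · exact ((hfs i).continuous.mul hW.continuous).integrable_of_hasCompactSupport
          (hfc i).mul_right
      · exact fun x _ => (hfs i).differentiable one_ne_zero x
      · exact fun x _ => hW x
    have i1 : ∀ i, Integrable (fun x => fderiv ℝ (η k) x (e i) * (U i x * Θ x * W x)) := fun i => by
      refine Continuous.integrable_of_hasCompactSupport ?_ ?_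
      · exact (((hηs k).continuous_fderiv one_ne_zero).clm_apply continuous_const).mul
          (((hU i).continuous.mul hΘ.continuous).mul hW.continuous)
      · exact (((hηc k).fderiv ℝ).comp_left (g := fun L : Space n →L[ℝ] ℂ => L (e i))
          rfl).mul_right
    have i2 : Integrable (fun x => η k x * ((∑ i, U i x * fderiv ℝ Θ x (e i)) * W x)) := by
      refine Continuous.integrable_of_hasCompactSupport ?_ (hηc k).mul_right
      exact (hηs k).continuous.mul ((continuous_finsetSum _ fun i _ => (hU i).continuous.mul
        ((hΘ.continuous_fderiv one_ne_zero).clm_apply continuous_const)).mul hW.continuous)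
    have i3 : ∀ i, Integrable (fun x => fderiv ℝ (fun x => η k x * (U i x * Θ x)) x (e i) * W x) :=
      fun i => by
      refine Continuous.integrable_of_hasCompactSupport ?_ ?_
      · exact (((hfs i).continuous_fderiv one_ne_zero).clm_apply continuous_const).mul
          hW.continuous
      · exact (((hfc i).fderiv ℝ).comp_left (g := fun L : Space n →L[ℝ] ℂ => L (e i))
          rfl).mul_right
    have ibp' : ∀ i, ∫ x, η k x * (U i x * Θ x * V i x)
        = -∫ x, fderiv ℝ (fun x => η k x * (U i x * Θ x)) x (e i) * W x := fun i => by
      rw [← ibp i]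
      simp only [mul_assoc]
    simp only [ibp', Finset.sum_neg_distrib, neg_neg]
    rw [← integral_finsetSum _ fun i _ => i3 i, ← integral_finsetSum _ fun i _ => i1 i,
      ← integral_add i2 (integrable_finsetSum _ fun i _ => i1 i)]
    refine integral_congr_ae (.of_forall fun x => ?_)
    have hd := hdiv x
    simp only [hder, add_mul, Finset.sum_add_distrib, mul_assoc, ← Finset.mul_sum, Finset.sum_mul]
    have h0 : ∑ i, fderiv ℝ (U i) x (e i) * W x = 0 := by rw [← Finset.sum_mul, hd, zero_mul]
    rw [h0]
    simp
  -- removal of the cutoff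
  have l1 : Tendsto (fun k => ∫ x, η k x * ((∑ i, U i x * fderiv ℝ Θ x (e i)) * W x)) atTop
      (𝓝 (∫ x, (∑ i, U i x * fderiv ℝ Θ x (e i)) * W x)) := by
    refine tendsto_integral_of_dominated_convergence _ (fun k =>
      (hηs k).continuous.aestronglyMeasurable.mul h1.1) h1.norm (fun k => .of_forall fun x => ?_)
      (.of_forall fun x => ?_)
    · rw [norm_mul]
      exact mul_le_of_le_one_left (norm_nonneg _) (hη1 k x)
    · simpa using (hηl x).mul_const ((∑ i, U i x * fderiv ℝ Θ x (e i)) * W x)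
  have l2 : ∀ i, Tendsto (fun k => ∫ x, η k x * (U i x * Θ x * V i x)) atTop
      (𝓝 (∫ x, U i x * Θ x * V i x)) := fun i => by
    refine tendsto_integral_of_dominated_convergence _ (fun k =>
      (hηs k).continuous.aestronglyMeasurable.mul (h2 i).1) (h2 i).norm
      (fun k => .of_forall fun x => ?_) (.of_forall fun x => ?_)
    · rw [norm_mul]
      exact mul_le_of_le_one_left (norm_nonneg _) (hη1 k x)
    · simpa using (hηl x).mul_const (U i x * Θ x * V i x)
  have l3 : ∀ i, Tendsto (fun k => ∫ x, fderiv ℝ (η k) x (e i) * (U i x * Θ x * W x)) atTop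
      (𝓝 0) := fun i => by
    rw [show (0 : ℂ) = ∫ x : Space n, 0 by simp]
    refine tendsto_integral_of_dominated_convergence _ (fun k =>
      ((((hηs k).continuous_fderiv one_ne_zero).clm_apply continuous_const).mul
          (((hU i).continuous.mul hΘ.continuous).mul hW.continuous)).aestronglyMeasurable)
      ((h3 i).norm.const_mul C) (fun k => .of_forall fun x => ?_) (.of_forall fun x => ?_)
    · have := hηd k x (e i)
      rw [hes, mul_one] at this
      rw [norm_mul]
      calc _ ≤ C * wt 1 x * ‖U i x * Θ x * W x‖ := by gcongr
        _ = C * ‖U i x * Θ x * ((wt 1 x : ℂ) * W x)‖ := by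
          simp only [norm_mul, Complex.norm_real, Real.norm_of_nonneg (wt_pos 1 x).le]
          ring
    · simpa using (hηd0 x (e i)).mul_const (U i x * Θ x * W x)
  have l4 := (l1.add (tendsto_finsetSum Finset.univ fun i _ => l3 i))
  have l5 := (tendsto_finsetSum Finset.univ fun i _ => l2 i).neg
  simp only [key, Finset.sum_const_zero, add_zero] at l4
  exact tendsto_nhds_unique l4 l5

end RieszCommutator

namespace RieszCommutator

variable {n : ℕ} {P : DyadicPartition n}

/-! ### The advection commutator as a limit of its blocks -/

lemma mult_dsym (P : DyadicPartition n) (i : Fin n) : Mult P 1 (dsym i) := by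
  refine ⟨dsym_homog i, ?_⟩
  exact ((Function.HasTemperateGrowth.const 1).sub
    (P.low_compact.hasTemperateGrowth P.low_smooth)).mul (dsym_temperate i)

/-- The sign comes from the reflection in the transpose: `∂_i` is skew. -/
lemma tr_mul_dsym (h ψ : Space n → ℂ) (i : Fin n) (x : Space n) :
    𝓕⁻ (fun ξ => h (-ξ) * 𝓕 ψ ξ * dsym i ξ) x = -tr (fun ξ => h ξ * dsym i ξ) ψ x := by
  have h1 := congrFun (fourierInv_const_mul (fun ξ => h (-ξ) * dsym i (-ξ) * 𝓕 ψ ξ) (-1)) x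
  rw [neg_one_mul] at h1
  rw [tr, ← h1]
  refine congrFun (congrArg _ (funext fun ξ => ?_)) x
  rw [dsym_neg]
  ring

lemma Mult.hasFDerivAt_tr {d : ℝ} (hd : 0 < d) {h : Space n → ℂ} (hh : Mult P d h)
    (ψ : 𝓢(Space n, ℂ)) (x : Space n) : ∃ D : Space n →L[ℝ] ℂ, HasFDerivAt (tr h ψ) D x ∧
      ∀ i, D (EuclideanSpace.single i 1) = -tr (fun ξ => h ξ * dsym i ξ) ψ x := by
  obtain ⟨D, hD, hD'⟩ := hasFDerivAt_fourierInv (hh.symb_tr hd ψ).integ (fun i => by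
    have := ((hh.mul_dsym i).symb_tr (by linarith) ψ).integ.neg
    refine this.congr (.of_forall fun ξ => ?_)
    simp only [Pi.neg_apply, dsym_neg]
    ring) x
  exact ⟨D, hD, fun i => (hD' i).trans (tr_mul_dsym h ψ i x)⟩

lemma fderiv_schwartz (ψ : 𝓢(Space n, ℂ)) (x : Space n) (i : Fin n) :
    fderiv ℝ ψ x (EuclideanSpace.single i 1) = -tr (dsym i) ψ x := by
  have hS : ∀ i, Integrable (fun ξ => 𝓕 (ψ : Space n → ℂ) ξ * dsym i ξ) := fun i => by
    have := (SchwartzMap.smulLeftCLM ℂ (dsym i) (𝓕 ψ)).integrable (μ := volume)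
    refine this.congr (.of_forall fun ξ => ?_)
    rw [SchwartzMap.smulLeftCLM_apply_apply (dsym_temperate i), smul_eq_mul, mul_comm,
      SchwartzMap.fourier_coe]
  have hi : Integrable (𝓕 (ψ : Space n → ℂ)) := by
    rw [← SchwartzMap.fourier_coe]
    exact (𝓕 ψ).integrable
  obtain ⟨D, hD, hD'⟩ := hasFDerivAt_fourierInv hi hS x
  have e : 𝓕⁻ (𝓕 (ψ : Space n → ℂ)) = ψ := by
    rw [← SchwartzMap.fourier_coe, ← SchwartzMap.fourierInv_coe,
      FourierTransform.fourierInv_fourier_eq]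
  rw [e] at hD
  rw [hD.fderiv, hD' i]
  have := tr_mul_dsym (fun _ => 1) ψ i x
  simp only [one_mul] at this
  exact this

lemma tr_sum {d : ℝ} (hd : 0 < d) {h : Space n → ℂ} (hh : Mult P d h) {ι : Type*} (s : Finset ι)
    (ψ : ι → 𝓢(Space n, ℂ)) : tr h (∑ i ∈ s, ψ i : 𝓢(Space n, ℂ)) = fun x => ∑ i ∈ s, tr h (ψ i)
        x := by
  classical
  induction s using Finset.induction_on with
  | empty =>
    have := tr_const_mul h 0 0
    simp only [zero_mul] at this
    simp only [Finset.sum_empty]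
    exact this
  | insert a s ha ih =>
    rw [Finset.sum_insert ha]
    refine (tr_add hd hh (ψ a) (∑ i ∈ s, ψ i)).trans ?_
    ext x
    rw [Finset.sum_insert ha, ih]

/-- The test function `U · ∇ψ`. -/
def advectSchwartz (U : Fin n → Space n → ℂ) (hU : ∀ i, ContDiff ℝ ∞ (U i)) (ψ : 𝓢(Space n, ℂ))
    (hψ : HasCompactSupport ψ) : 𝓢(Space n, ℂ) :=
  ∑ i, HasCompactSupport.toSchwartzMap
    (f := fun x => U i x * fderiv ℝ ψ x (EuclideanSpace.single i 1))
    ((hψ.fderiv ℝ).comp_left (g := fun L : Space n →L[ℝ] ℂ => L (EuclideanSpace.single i 1))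
      rfl).mul_left
    ((hU i).mul ((ψ.smooth ⊤).fderiv_right (m := ∞) le_rfl |>.clm_apply contDiff_const))

lemma advectSchwartz_apply (U : Fin n → Space n → ℂ) (hU : ∀ i, ContDiff ℝ ∞ (U i))
    (ψ : 𝓢(Space n, ℂ)) (hψ : HasCompactSupport ψ) (x : Space n) :
    advectSchwartz U hU ψ hψ x = ∑ i, U i x * fderiv ℝ ψ x (EuclideanSpace.single i 1) := by
  rw [advectSchwartz, sum_apply]
  rfl

end RieszCommutator

namespace RieszCommutator

variable {n : ℕ}

/-- A smooth divergence-free vector field with gradient in `L^p`, read as a complex valued one. -/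
lemma Velocity.of_field {p : ℝ≥0∞} (hp : 1 ≤ p) {u : Space n → Space n} (hu : ContDiff ℝ 1 u)
    (hdiv : DivergenceFree u) (hdu : MemLp (fderiv ℝ u) p volume) :
    Velocity p (eLpNorm (fderiv ℝ u) p volume) (fun i x => (u x i : ℂ)) where
  smooth i := contDiff_component hu i
  deriv i := ⟨((contDiff_component hu i).continuous_fderiv one_ne_zero).aestronglyMeasurable,
    (eLpNorm_fderiv_component_le hu i).trans_lt hdu.2⟩
  lip i := lipLp_component hp hu i
  div x := by
    simp only [fderiv_component hu]
    rw [← Complex.ofReal_sum, hdiv x, Complex.ofReal_zero]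

/-- The commutator tested against `ψ`, with all derivatives moved to the test function. -/
lemma commAdvect_eq [NeZero n] (P : DyadicPartition n) {α : ℝ} (hα1 : α < 1) {p : ℝ≥0∞}
    (hp : 2 ≤ p) (hpt : p ≠ ⊤)
    {u : Space n → Space n} {θ : Space n → ℝ} (hu : ContDiff ℝ ∞ u) (hdiv : DivergenceFree u)
    (hθ : ContDiff ℝ ∞ θ) (hdu : MemLp (fderiv ℝ u) p volume) (hdom : RieszDomain α (advect u θ))
    (hθp : MemLp θ p volume) (ψ : 𝓢(Space n, ℂ)) (hψ : HasCompactSupport ψ) :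
    commAdvect α u θ ψ =
      (∑ i, ∫ x, (u x i : ℂ) * (θ x : ℂ) * tr (fun ξ => rieszSymbol α ξ * dsym i ξ) ψ x) +
        ∫ x, (θ x : ℂ) * tr (rieszSymbol α)
          (advectSchwartz (fun i x => (u x i : ℂ)) (contDiff_component hu) ψ hψ) x := by
  have hd : 0 < 1 - α := by linarith
  have hp1 : 1 ≤ p := one_le_two.trans hp
  have hn : (n : ℝ) < n + (1 - α) := by linarith
  have hm := mult_riesz P α
  have hu1 : ContDiff ℝ 1 u := hu.of_le (mod_cast le_top)
  have hV := Velocity.of_field hp1 hu1 hdiv hdu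
  have hΘ : MemLp (fun x => (θ x : ℂ)) p volume := hθp.ofReal
  have hΘs : ContDiff ℝ ∞ (fun x => (θ x : ℂ)) := Complex.ofRealCLM.contDiff.comp hθ
  have hW := hm.decays_tr hd ψ
  have hVi := fun i => (hm.mul_dsym i).decays_tr (by linarith) ψ
  have hw : ∀ i, WInt ((n : ℝ) + (1 - α + 1)) (fun x => (u x i : ℂ) * (θ x : ℂ)) := fun i =>
    (wint_mul hp hpt hdu.2.ne (hV.cont i) (hV.lip i) hΘ).mono (by linarith)
  have hder : ∀ x, ((advect u θ x : ℝ) : ℂ) = ∑ i, (u x i : ℂ) *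
      fderiv ℝ (fun x => (θ x : ℂ)) x (EuclideanSpace.single i 1) := fun x => by
    have h1 : fderiv ℝ (fun x => (θ x : ℂ)) x = Complex.ofRealCLM ∘L fderiv ℝ θ x :=
      (Complex.ofRealCLM.hasFDerivAt.comp x
        ((hθ.differentiable (by simp)) x).hasFDerivAt).fderiv
    simp [advect, h1]
  -- the transport term
  have e1 : riesz α (advect u θ) ψ
      = ∑ i, ∫ x, (u x i : ℂ) * (θ x : ℂ) * tr (fun ξ => rieszSymbol α ξ * dsym i ξ) ψ x := by
    rw [riesz_eq]
    simp only [hder]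
    rw [integral_advect_mul (V := fun i x => -tr (fun ξ => rieszSymbol α ξ * dsym i ξ) ψ x)
      (fun i => contDiff_component hu1 i) hV.div (hΘs.of_le (mod_cast le_top))
      (fun i => (hVi i).cont.neg)]
    · simp only [mul_neg, integral_neg, Finset.sum_neg_distrib, neg_neg]
    · intro x
      obtain ⟨D, hD, -⟩ := hm.hasFDerivAt_tr hd ψ x
      exact hD.differentiableAt
    · intro x i
      obtain ⟨D, hD, hD'⟩ := hm.hasFDerivAt_tr hd ψ x
      rw [hD.fderiv, hD' i]
    · have h1 : WInt ((n : ℝ) + (1 - α)) (fun x => ((advect u θ x : ℝ) : ℂ)) := by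
        have hc : Continuous (fun x => ((advect u θ x : ℝ) : ℂ)) := by
          simp only [hder]
          exact continuous_finsetSum _ fun i _ => (hV.cont i).mul
            ((hΘs.continuous_fderiv (by simp)).clm_apply continuous_const)
        refine ⟨hc.aestronglyMeasurable, hdom.norm.congr (.of_forall fun x => ?_)⟩
        beta_reduce
        rw [norm_mul, Complex.norm_real, Real.norm_of_nonneg (by positivity), wt]
        congr 2
        ring
      refine (hW.integrable_mul h1).congr (.of_forall fun x => ?_)
      simp only [hder]
      ring
    · intro i
      refine ((hVi i).integrable_mul (hw i)).neg.congr (.of_forall fun x => ?_)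
      simp only [Pi.neg_apply]
      ring
    · intro i
      have h1 : Decays ((n : ℝ) + (1 - α + 1))
          (fun x => (wt 1 x : ℂ) * tr (rieszSymbol α) ψ x) := by
        obtain ⟨C, hC⟩ := hW.bound
        refine ⟨(Complex.continuous_ofReal.comp (wt_continuous 1)).mul hW.cont, C, fun x => ?_⟩
        rw [norm_mul, Complex.norm_real, Real.norm_of_nonneg (wt_pos 1 x).le, ← add_assoc, wt_add]
        calc _ ≤ wt 1 x * (C * wt (n + (1 - α)) x) := by
              gcongr
              · exact (wt_pos 1 x).le
              · exact hC x
          _ = _ := by ring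
      refine (h1.integrable_mul (hw i)).congr (.of_forall fun x => ?_)
      ring
  -- the term with the derivative outside
  let χ : Fin n → 𝓢(Space n, ℂ) := fun i => HasCompactSupport.toSchwartzMap
    (f := fun x => fderiv ℝ (fun x => (u x i : ℂ) * ψ x) x (EuclideanSpace.single i 1))
    (((hψ.mul_left (f := fun x => (u x i : ℂ))).fderiv ℝ).comp_left
      (g := fun L : Space n →L[ℝ] ℂ => L (EuclideanSpace.single i 1)) rfl)
    ((((contDiff_component hu i).mul (ψ.smooth ⊤)).fderiv_right (m := ∞) le_rfl).clm_apply
      contDiff_const)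
  have hχ : ∀ i, (χ i : Space n → ℂ) = fun x =>
    fderiv ℝ (fun x => (u x i : ℂ) * ψ x) x (EuclideanSpace.single i 1) := fun i => rfl
  have hsum : advectSchwartz (fun i x => (u x i : ℂ)) (contDiff_component hu) ψ hψ
      = ∑ i, χ i := by
    ext x
    rw [advectSchwartz_apply, sum_apply]
    have h1 : ∀ i, χ i x = (u x i : ℂ) * fderiv ℝ ψ x (EuclideanSpace.single i 1) +
        fderiv ℝ (fun x => (u x i : ℂ)) x (EuclideanSpace.single i 1) * ψ x := fun i => by
      have d1 := ((hV.smooth i).differentiable one_ne_zero x).hasFDerivAt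
      have d2 := (ψ.differentiable x).hasFDerivAt
      have d3 : fderiv ℝ (fun x => (u x i : ℂ) * ψ x) x = _ := (d1.mul d2).fderiv
      rw [hχ]
      simp only [d3, add_apply, smul_apply, smul_eq_mul]
      ring
    simp only [h1, Finset.sum_add_distrib, ← Finset.sum_mul]
    rw [hV.div x, zero_mul, add_zero]
  obtain ⟨p', hp', hpp⟩ := exists_holderConjugate hp1
  have e2 : ∫ x, (θ x : ℂ) * tr (rieszSymbol α)
      (advectSchwartz (fun i x => (u x i : ℂ)) (contDiff_component hu) ψ hψ) x
      = ∑ i, riesz α θ (χ i) := by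
    rw [hsum, tr_sum hd hm]
    simp only [riesz_eq, Finset.mul_sum]
    rw [integral_finsetSum]
    exact fun i _ => integrable_mul_of_memLp hΘ ((hm.decays_tr hd (χ i)).memLp hn hp')
  rw [e2, ← e1, commAdvect, Pi.sub_apply, Finset.sum_apply]
  simp only [mulDist, partialDist, Finset.sum_neg_distrib, sub_neg_eq_add, hχ]

end RieszCommutator

namespace DyadicPartition

open RieszCommutator

variable {n : ℕ} {P : DyadicPartition n} [NeZero n]

/-- The low frequency cutoff of `u f`, tested against a decaying function. -/
lemma tendsto_integral_op_cut_mul {p A : ℝ≥0∞} (hp : 2 ≤ p) (hpt : p ≠ ⊤) (hA : A ≠ ⊤)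
    {u : Space n → ℂ} (hu : Continuous u) (h : LipLp p A u) {f : Space n → ℂ}
    (hf : MemLp f p volume) (hf' : MemLp f ⊤ volume) {w : Space n → ℂ} (hw : Decays (n + 1) w) :
    Tendsto (fun J => ∫ x, op (P.cut J) (fun y => u y * f y) x * w x) atTop
      (𝓝 (∫ x, u x * f x * w x)) := by
  have hp1 : 1 ≤ p := one_le_two.trans hp
  have hn : (n : ℝ) < n + 1 := by linarith
  have hM : (0 : ℝ) ≤ n + 1 := by positivity
  obtain ⟨p', hp', hpp⟩ := exists_holderConjugate hp1
  have huf := wint_mul hp hpt hA hu h hf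
  have hfw := WInt.of_memLp hn hp1 hf
  have hwp := hw.memLp hn hp'
  have huw : MemLp (fun x => u x * w x) p' volume := memLp_mul_decays hp hpt hA hu h hw
  have hS := fun J => P.cut_symb hM J
  have hcm : ∀ J, AEStronglyMeasurable (com (P.cut J) u f) volume := fun J =>
    (huf.op hn (hS J)).meas.sub (hu.aestronglyMeasurable.mul (hfw.op hn (hS J)).meas)
  have hcn : ∀ J : ℕ, eLpNorm (com (P.cut J) u f) p volume
      ≤ pw (-J) * (N2 P.low * A * eLpNorm f ⊤ volume) := fun J => by
    refine (eLpNorm_com_le (p := p) (q := ⊤) hM hp1 (hS J) hfw huf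
      hu.aestronglyMeasurable h).trans (le_of_eq ?_)
    rw [N2_cut]
    ring
  have hN2 : N2 P.low ≠ ⊤ := (N2_lt_top (M := n + 2) (by linarith) (P.low_symb _)).ne
  have hfin : N2 P.low * A * eLpNorm f ⊤ volume ≠ ⊤ := by finiteness [hf'.2.ne]
  have hcL : ∀ J, MemLp (com (P.cut J) u f) p volume := fun J =>
    ⟨hcm J, (hcn J).trans_lt (by finiteness [pw_ne_top (-J)])⟩
  have l1 : Tendsto (fun J => ∫ x, com (P.cut J) u f x * w x) atTop (𝓝 (∫ x, 0 * w x)) := by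
    refine tendsto_integral_mul (p := p) (q := p') hcL (G := fun _ => 0) MemLp.zero hwp ?_
    simp only [sub_zero]
    refine tendsto_of_tendsto_of_tendsto_of_le_of_le tendsto_const_nhds ?_
      (fun _ => zero_le) hcn
    simpa using ENNReal.Tendsto.mul_const tendsto_pw_neg (Or.inr hfin)
  have l2 : Tendsto (fun J => ∫ x, op (P.cut J) f x * (u x * w x)) atTop
      (𝓝 (∫ x, f x * (u x * w x))) :=
    tendsto_integral_mul (p := p) (q := p') (fun J => memLp_op hn hp1 (hS J) hf) hf huw
      (P.tendsto_op_cut hp1 hpt hf)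
  have l3 := l1.add l2
  simp only [zero_mul, integral_zero, zero_add] at l3
  have e0 : ∫ x, f x * (u x * w x) = ∫ x, u x * f x * w x :=
    integral_congr_ae (.of_forall fun x => by ring)
  rw [e0] at l3
  refine l3.congr fun J => ?_
  rw [← integral_add (integrable_mul_of_memLp (hcL J) hwp)
    (integrable_mul_of_memLp (memLp_op hn hp1 (hS J) hf) huw)]
  refine integral_congr_ae (.of_forall fun x => ?_)
  simp only [com]
  ring

lemma ablk_aesm {d : ℝ} (hd : 0 < d) {h : Space n → ℂ} (hh : Mult P d h)
    {p A : ℝ≥0∞} (hp : 2 ≤ p) (hpt : p ≠ ⊤) (hA : A ≠ ⊤) {u : Fin n → Space n → ℂ}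
    (hu : Velocity p A u) {f g : Space n → ℂ} (hf : MemLp f p volume) (hg : MemLp g p volume)
    (j : ℕ) : AEStronglyMeasurable (P.ablk h j u f g) volume := by
  have hn : (n : ℝ) < n + 1 := by linarith
  have hS := fun i => P.symbol_symb' (M := n + 1) (by positivity) (hh.mul_dsym i).toHomog
    ((P.symb_low (by linarith) (hh.mul_dsym i).toHomog).mono (by linarith)) j
  have h1 := fun i => ((wint_mul hp hpt hA (hu.cont i) (hu.lip i) hf).op hn (hS i)).meas.sub
    ((wint_mul hp hpt hA (hu.cont i) (hu.lip i) hg).op hn (P.symbol_dsym_symb _ j i)).meas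
  exact Finset.aestronglyMeasurable_fun_sum _ fun i _ => h1 i

/-- Truncation of `θ` to low frequencies in the tested commutator. -/
lemma tendsto_truncated_advection {d : ℝ} (hd : 0 < d) {h : Space n → ℂ} (hh : Mult P d h)
    {p A : ℝ≥0∞} (hp : 2 ≤ p) (hpt : p ≠ ⊤) (hA : A ≠ ⊤) {u : Fin n → Space n → ℂ}
    (hu : Velocity p A u) (hus : ∀ i, ContDiff ℝ ∞ (u i)) {θ : Space n → ℂ}
    (hθ : MemLp θ p volume) (ψ : 𝓢(Space n, ℂ)) (hψ : HasCompactSupport ψ) :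
    Tendsto (fun Q => ∑ i, ((∫ x, u i x * op (P.cut Q) θ x * tr (fun ξ => h ξ * dsym i ξ) ψ x) -
      ∫ x, u i x * op (fun ξ => P.cut Q ξ * h ξ) θ x * tr (dsym i) ψ x)) atTop
      (𝓝 ((∑ i, ∫ x, u i x * θ x * tr (fun ξ => h ξ * dsym i ξ) ψ x) +
        ∫ x, θ x * tr h (advectSchwartz u hus ψ hψ) x)) := by
  have hp1 : 1 ≤ p := one_le_two.trans hp
  have hn : (n : ℝ) < n + d := by linarith
  have hM : (0 : ℝ) ≤ n + d := by positivity
  obtain ⟨p', hp', hpp⟩ := exists_holderConjugate hp1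
  set φ := advectSchwartz u hus ψ hψ with hφ
  have hl := P.symb_low hd hh.toHomog
  have hS := fun Q => P.cut_symb hM Q
  have hS' := fun Q => P.cut_symb' hM hh.toHomog hl Q
  have hθw := WInt.of_memLp hn hp1 hθ
  have hf := fun Q => memLp_op hn hp1 (hS Q) hθ
  have hg := fun Q => memLp_op hn hp1 (hS' Q) hθ
  have hW := fun i => ((hh.mul_dsym i).decays_tr (by linarith) ψ).mono
    (N := (n : ℝ) + 1) (by linarith)
  have hW' := fun i => (mult_dsym P i).decays_tr one_pos ψ
  have huW := fun i => memLp_mul_decays (p := p) (p' := p') hp hpt hA (hu.cont i) (hu.lip i) (hW i)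
  have huW' := fun i =>
    memLp_mul_decays (p := p) (p' := p') hp hpt hA (hu.cont i) (hu.lip i) (hW' i)
  have hφd := hh.decays_tr hd φ
  have hcut := P.tendsto_op_cut hp1 hpt hθ
  have l1 : ∀ i, Tendsto
      (fun Q => ∫ x, op (P.cut Q) θ x * (u i x * tr (fun ξ => h ξ * dsym i ξ) ψ x)) atTop
      (𝓝 (∫ x, θ x * (u i x * tr (fun ξ => h ξ * dsym i ξ) ψ x))) := fun i =>
    tendsto_integral_mul (p := p) (q := p') hf hθ (huW i) hcut
  have l2 : Tendsto (fun Q => ∫ x, op (P.cut Q) θ x * tr h φ x) atTop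
      (𝓝 (∫ x, θ x * tr h φ x)) :=
    tendsto_integral_mul (p := p) (q := p') hf hθ (hφd.memLp hn hp') hcut
  have l3 := (tendsto_finsetSum Finset.univ fun i _ => l1 i).add l2
  have e0 : ∀ (F : Space n → ℂ) i, ∫ x, F x * (u i x * tr (fun ξ => h ξ * dsym i ξ) ψ x)
      = ∫ x, u i x * F x * tr (fun ξ => h ξ * dsym i ξ) ψ x := fun F i =>
    integral_congr_ae (.of_forall fun x => by ring)
  simp only [e0] at l3
  refine l3.congr fun Q => ?_
  rw [Finset.sum_sub_distrib, sub_eq_add_neg]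
  congr 1
  have e1 := hh.integral_op_mul hd φ (hS Q) (hS' Q) hθw
  rw [cut_neg'] at e1
  have e2 := integral_mul_op hn (hS Q) hφd hθw
  rw [cut_neg'] at e2
  -- the second terms, with the cutoff and `h(D)` moved to the test function
  have e3 : ∫ x, op (P.cut Q) θ x * tr h φ x = ∫ x, op (fun ξ => P.cut Q ξ * h ξ) θ x * φ x := by
    rw [e1]
    simp only [mul_comm (op (P.cut Q) θ _), e2, mul_comm (θ _)]
  rw [e3, ← integral_finsetSum, ← integral_neg]
  · refine integral_congr_ae (.of_forall fun x => ?_)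
    simp only [hφ, advectSchwartz_apply, fderiv_schwartz, Finset.mul_sum, ← Finset.sum_neg_distrib]
    exact Finset.sum_congr rfl fun i _ => by ring
  · intro i _
    refine (integrable_mul_of_memLp (hg Q) (huW' i)).congr (.of_forall fun x => ?_)
    ring

/-- The blocks of the commutator sum up to the commutator with truncated `θ`. -/
lemma tendsto_sum_ablk {d : ℝ} (hd : 0 < d) (hd1 : d < 1) {h : Space n → ℂ} (hh : Mult P d h)
    {p A : ℝ≥0∞} (hp : 2 ≤ p) (hpt : p ≠ ⊤) (hA : A ≠ ⊤) {u : Fin n → Space n → ℂ}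
    (hu : Velocity p A u) {θ : Space n → ℂ}
    (hθ : MemLp θ p volume) (ψ : 𝓢(Space n, ℂ)) (Q : ℕ) :
    Tendsto (fun J => ∑ q ∈ Finset.range (Q + 1), ∑ j ∈ Finset.range (J + 1),
      ∫ x, P.ablk h j u (op (P.symbol q) θ) (op (fun ξ => P.symbol q ξ * h ξ) θ) x *
        op (P.symT j) ψ x) atTop
      (𝓝 (∑ i, ((∫ x, u i x * op (P.cut Q) θ x * tr (fun ξ => h ξ * dsym i ξ) ψ x) -
        ∫ x, u i x * op (fun ξ => P.cut Q ξ * h ξ) θ x * tr (dsym i) ψ x))) := by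
  have hp1 : 1 ≤ p := one_le_two.trans hp
  have hn : (n : ℝ) < n + d := by linarith
  have hn1 : (n : ℝ) < n + 1 := by linarith
  have hM : (0 : ℝ) ≤ n + d := by positivity
  have hM1 : (0 : ℝ) ≤ n + 1 := by positivity
  obtain ⟨p', hp', hpp⟩ := exists_holderConjugate hp1
  have hl := P.symb_low hd hh.toHomog
  have hθw := WInt.of_memLp hn hp1 hθ
  have hSd := fun q => P.symbol_symb' hM hh.toHomog hl q
  have hf := fun q => memLp_op hn hp1 (P.symbol_symb_one _ q) hθ
  have hg := fun q => memLp_op hn hp1 (hSd q) hθ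
  have hft := fun q => memLp_op_top hn hp1 (P.symbol_symb_one _ q) hθ
  have hgt := fun q => memLp_op_top hn hp1 (hSd q) hθ
  have hW := fun i => ((hh.mul_dsym i).decays_tr (by linarith) ψ).mono
    (N := (n : ℝ) + 1) (by linarith)
  have hW' := fun i => (mult_dsym P i).decays_tr one_pos ψ
  have huF : ∀ {F}, MemLp F p volume → ∀ i, WInt (n + 1) (fun y => u i y * F y) := fun hF i =>
    wint_mul hp hpt hA (hu.cont i) (hu.lip i) hF
  have hSi := fun i j => P.symbol_symb' hM1 (hh.mul_dsym i).toHomog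
    ((P.symb_low (by linarith) (hh.mul_dsym i).toHomog).mono (by linarith)) j
  -- the sum over the output frequencies
  have e1 : ∀ J q, ∑ j ∈ Finset.range (J + 1),
      ∫ x, P.ablk h j u (op (P.symbol q) θ) (op (fun ξ => P.symbol q ξ * h ξ) θ) x *
        op (P.symT j) ψ x
      = ∑ i, ((∫ x, op (P.cut J) (fun y => u i y * op (P.symbol q) θ y) x *
          tr (fun ξ => h ξ * dsym i ξ) ψ x) -
        ∫ x, op (P.cut J) (fun y => u i y * op (fun ξ => P.symbol q ξ * h ξ) θ y) x *
          tr (dsym i) ψ x) := fun J q => by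
    have hψd : ∀ j, Decays ((n : ℝ) + 1) (op (P.symT j) ψ) := fun j =>
      (schwartz_decays _ ψ).op hn1 (P.symT_symb_one _ j)
    have i1 : ∀ i j, Integrable (fun x => op (fun ξ => P.symbol j ξ * (h ξ * dsym i ξ))
        (fun y => u i y * op (P.symbol q) θ y) x * op (P.symT j) ψ x) := fun i j =>
      ((hψd j).integrable_mul ((huF (hf q) i).op hn1 (hSi i j))).congr
        (.of_forall fun x => mul_comm _ _)
    have i2 : ∀ i j, Integrable (fun x => op (fun ξ => P.symbol j ξ * dsym i ξ)
        (fun y => u i y * op (fun ξ => P.symbol q ξ * h ξ) θ y) x * op (P.symT j) ψ x) :=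
      fun i j => ((hψd j).integrable_mul ((huF (hg q) i).op hn1
        (P.symbol_dsym_symb _ j i))).congr (.of_forall fun x => mul_comm _ _)
    have h1 : ∀ j, ∫ x, P.ablk h j u (op (P.symbol q) θ) (op (fun ξ => P.symbol q ξ * h ξ) θ) x *
        op (P.symT j) ψ x = ∑ i, ((∫ x, op (fun ξ => P.symbol j ξ * (h ξ * dsym i ξ))
          (fun y => u i y * op (P.symbol q) θ y) x * op (P.symT j) ψ x) -
          ∫ x, op (fun ξ => P.symbol j ξ * dsym i ξ)
          (fun y => u i y * op (fun ξ => P.symbol q ξ * h ξ) θ y) x * op (P.symT j) ψ x) :=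
      fun j => by
      simp only [ablk, Finset.sum_mul, sub_mul]
      exact (integral_finsetSum _ fun i _ => (i1 i j).sub (i2 i j)).trans
        (Finset.sum_congr rfl fun i _ => integral_sub (i1 i j) (i2 i j))
    simp only [h1]
    rw [Finset.sum_comm]
    refine Finset.sum_congr rfl fun i _ => ?_
    rw [Finset.sum_sub_distrib,
      P.sum_integral_block (by linarith) (hh.mul_dsym i) ((huF (hf q) i).mono (by linarith)),
      P.sum_integral_block one_pos (mult_dsym P i) (huF (hg q) i)]
  -- the limit of each term
  have l1 : ∀ q, Tendsto (fun J => ∑ j ∈ Finset.range (J + 1),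
      ∫ x, P.ablk h j u (op (P.symbol q) θ) (op (fun ξ => P.symbol q ξ * h ξ) θ) x *
        op (P.symT j) ψ x) atTop
      (𝓝 (∑ i, ((∫ x, u i x * op (P.symbol q) θ x * tr (fun ξ => h ξ * dsym i ξ) ψ x) -
        ∫ x, u i x * op (fun ξ => P.symbol q ξ * h ξ) θ x * tr (dsym i) ψ x))) := fun q => by
    simp only [e1]
    exact tendsto_finsetSum _ fun i _ =>
      (tendsto_integral_op_cut_mul hp hpt hA (hu.cont i) (hu.lip i) (hf q) (hft q) (hW i)).sub
      (tendsto_integral_op_cut_mul hp hpt hA (hu.cont i) (hu.lip i) (hg q) (hgt q) (hW' i))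
  have l2 := tendsto_finsetSum (Finset.range (Q + 1)) fun q _ => l1 q
  convert l2 using 2
  -- the sum over the input frequencies
  rw [Finset.sum_comm]
  refine Finset.sum_congr rfl fun i _ => ?_
  have j1 : ∀ q, Integrable (fun x => u i x * op (P.symbol q) θ x *
      tr (fun ξ => h ξ * dsym i ξ) ψ x) := fun q =>
    ((hW i).integrable_mul (huF (hf q) i)).congr (.of_forall fun x => mul_comm _ _)
  have j2 : ∀ q, Integrable (fun x => u i x * op (fun ξ => P.symbol q ξ * h ξ) θ x *
      tr (dsym i) ψ x) := fun q =>
    ((hW' i).integrable_mul (huF (hg q) i)).congr (.of_forall fun x => mul_comm _ _)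
  rw [P.sum_op_symbol hM hθw, P.op_cut_mul hM hh.toHomog hl hθw, Finset.sum_sub_distrib,
    ← integral_finsetSum _ fun q _ => j1 q, ← integral_finsetSum _ fun q _ => j2 q]
  simp only [Finset.mul_sum, Finset.sum_mul]

/-- The estimate of `[R_α, u · ∇] θ` in `B^s_{p,r}`, `-1 < s < α`. The term `‖θ‖_p` is not needed
for the bound: the lowest block of `θ` is part of the Besov norm. -/
theorem exists_commAdvect_bound (P : DyadicPartition n) {α s : ℝ} (hα : 0 < α) (hα1 : α < 1)
    (hs : -1 < s) (hsα : s < α) :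
    ∃ C : ℝ≥0, ∀ (p r : ℝ≥0∞) [Fact (1 ≤ p)], 2 ≤ p → p ≠ ⊤ → 1 ≤ r →
      ∀ (u : Space n → Space n) (θ : Space n → ℝ),
      ContDiff ℝ ∞ u → DivergenceFree u → ContDiff ℝ ∞ θ →
      MemLp (fderiv ℝ u) p volume → RieszDomain α (advect u θ) →
      ∀ hθ : MemLp θ p volume, besovNorm P (s + 1 - α) ⊤ r (lpDist hθ) < ⊤ →
      ∃ F : 𝓢'(Space n, ℂ), Extends F (commAdvect α u θ) ∧
        besovNorm P s p r F ≤ C * (eLpNorm (fderiv ℝ u) p volume *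
          (besovNorm P (s + 1 - α) ⊤ r (lpDist hθ) + eLpNorm θ p volume)) := by
  have hd : 0 < 1 - α := by linarith
  have hd1 : 1 - α < 1 := by linarith
  have hm := mult_riesz P α
  obtain ⟨C1, hC1, h1⟩ := exists_ablk_series_estimate hd hd1 hs (by linarith) hm
  obtain ⟨C2, hC2, h2⟩ := P.exists_synthesis (s := s) (by linarith)
  have hC : C2 * (C1 * pw (s + 1 - α)) ≠ ⊤ := by finiteness [pw_ne_top (s + 1 - α)]
  refine ⟨(C2 * (C1 * pw (s + 1 - α))).toNNReal, ?_⟩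
  intro p r _ hp hpt hr u θ hu hdiv hθs hdu hdom hθ hb
  rw [ENNReal.coe_toNNReal hC]
  have hp1 : 1 ≤ p := one_le_two.trans hp
  have hV := Velocity.of_field hp1 (hu.of_le (mod_cast le_top)) hdiv hdu
  have hA := hdu.2.ne
  have hΘ : MemLp (fun x => (θ x : ℂ)) p volume := hθ.ofReal
  have hn : (n : ℝ) < n + (1 - α) := by linarith
  have hM : (0 : ℝ) ≤ n + (1 - α) := by positivity
  have hbb := P.blocks_le_besovNorm hθ (s + 1 - α) le_top r (q := ⊤)
  set c : ℕ → ℕ → Space n → ℂ := fun j q =>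
    P.ablk (rieszSymbol α) j (fun i x => (u x i : ℂ)) (op (P.symbol q) (fun x => (θ x : ℂ)))
      (op (fun ξ => P.symbol q ξ * rieszSymbol α ξ) (fun x => (θ x : ℂ))) with hc
  have hK : eLpNorm (fun j : ℕ => pw (j * s) * ∑' q, eLpNorm (c j q) p volume) r Measure.count
      ≤ C1 * pw (s + 1 - α) * (eLpNorm (fderiv ℝ u) p volume *
        besovNorm P (s + 1 - α) ⊤ r (lpDist hθ)) := by
    refine (h1 hp hpt hr hA hV hΘ).trans ?_
    rw [show s + (1 - α) = s + 1 - α by ring]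
    calc _ ≤ C1 * eLpNorm (fderiv ℝ u) p volume * (pw (s + 1 - α) *
          besovNorm P (s + 1 - α) ⊤ r (lpDist hθ)) := mul_le_mul' le_rfl hbb
      _ = _ := by ring
  have hKt := ne_top_of_le_ne_top (by finiteness [pw_ne_top (s + 1 - α), hb.ne]) hK
  have hcm : ∀ j q, MemLp (c j q) p volume := fun j q => by
    have hj := ENNReal.lt_top_of_mul_ne_top_right (ne_top_of_le_ne_top hKt (le_eLpNorm_count hr
      (fun j : ℕ => pw (j * s) * ∑' q, eLpNorm (c j q) p volume) j)) (pw_pos _).ne'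
    exact ⟨ablk_aesm hd hm hp hpt hA hV (memLp_op hn hp1 (P.symbol_symb_one _ q) hΘ)
      (memLp_op hn hp1 (P.symbol_symb' hM hm.toHomog (P.symb_low hd hm.toHomog) q) hΘ) j,
      (ENNReal.le_tsum q).trans_lt hj⟩
  obtain ⟨F, hF, hFn⟩ := h2 hp1 hr hcm hKt
  -- the sum over all blocks, taken first over the output frequencies `j` and then over `q`, is
  -- the limit of the truncated commutators
  refine ⟨F, fun ψ hψ => ?_, ?_⟩
  · rw [commAdvect_eq P hα1 hp hpt hu hdiv hθs hdu hdom hθ ψ hψ]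
    have t1 := fun Q => tendsto_sum_ablk hd hd1 hm hp hpt hA hV hΘ ψ Q
    have t2 := tendsto_truncated_advection hd hm hp hpt hA hV (contDiff_component hu) hΘ ψ hψ
    have hF1 : HasSum (fun qj : ℕ × ℕ => ∫ x, c qj.2 qj.1 x * op (P.symT qj.2) ψ x) (F ψ) :=
      (Equiv.prodComm ℕ ℕ).hasSum_iff.2 (hF ψ)
    have hs1 : ∀ q : ℕ, Summable (fun j => ∫ x, c j q x * op (P.symT j) ψ x) := fun q =>
      hF1.summable.prod_factor q
    have hF2 := hF1.prod_fiberwise fun q => (hs1 q).hasSum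
    have t3 := hF2.tendsto_sum_nat.comp (tendsto_add_atTop_nat 1)
    refine tendsto_nhds_unique t3 (t2.congr fun Q => ?_)
    refine tendsto_nhds_unique (t1 Q) ?_
    exact tendsto_finsetSum _ fun q _ =>
      (hs1 q).hasSum.tendsto_sum_nat.comp (tendsto_add_atTop_nat 1)
  · calc _ ≤ C2 * (C1 * pw (s + 1 - α) * (eLpNorm (fderiv ℝ u) p volume *
          besovNorm P (s + 1 - α) ⊤ r (lpDist hθ))) := hFn.trans (mul_le_mul' le_rfl hK)
      _ = C2 * (C1 * pw (s + 1 - α)) * (eLpNorm (fderiv ℝ u) p volume *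
          besovNorm P (s + 1 - α) ⊤ r (lpDist hθ)) := by ring
      _ ≤ _ := by
          gcongr
          exact le_self_add

end DyadicPartition

end

theorem mainTheorem2 :
    -- (1), general form
    (∀ (n : ℕ) [NeZero n] (P : DyadicPartition n) (α s : ℝ), 0 < α → α < 1 → 0 < s → s < α →
      ∃ C : ℝ≥0, ∀ (u : Space n → Space n) (θ : Space n → ℝ),
        ContDiff ℝ ∞ u → DivergenceFree u → ContDiff ℝ ∞ θ →
        MemLp u 2 volume → MemLp (fderiv ℝ u) 2 volume →
        ∀ hθ : MemLp θ 2 volume, besovNorm P (s - α) ⊤ 2 (lpDist hθ) < ⊤ →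
        ∃ F : Fin n → 𝓢'(Space n, ℂ), (∀ i, Extends (F i) (commMul α u θ i)) ∧
          ∑ i, sobolevNorm s (F i) ≤
            C * (eLpNorm (fderiv ℝ u) 2 volume * besovNorm P (s - α) ⊤ 2 (lpDist hθ)
              + eLpNorm u 2 volume * eLpNorm θ 2 volume)) ∧
    -- (1), for the Biot-Savart velocity of `ω = Γ + R_α θ` in the plane
    (∀ (P : DyadicPartition 2) (α s : ℝ), 0 < α → α < 1 → 0 < s → s < α →
      ∃ C : ℝ≥0, ∀ (u : Space 2 → Space 2) (θ Γ : Space 2 → ℝ),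
        ContDiff ℝ ∞ u → DivergenceFree u → ContDiff ℝ ∞ θ →
        MemLp u 2 volume → MemLp θ ⊤ volume →
        ∀ (hu : ∀ i, MemLp (fun x => u x i) 2 volume)
          (hθ : MemLp θ 2 volume) (hΓ : MemLp Γ 2 volume),
        IsBiotSavart hu (fun ξ => fourierL2 hΓ ξ + rieszSymbol α ξ * fourierL2 hθ ξ) →
        sobolevNorm (s + 1 - 2 * α) (lpDist hθ) < ⊤ →
        ∃ F : Fin 2 → 𝓢'(Space 2, ℂ), (∀ i, Extends (F i) (commMul α u θ i)) ∧
          ∑ i, sobolevNorm s (F i) ≤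
            C * (eLpNorm Γ 2 volume * besovNorm P (s - α) ⊤ 2 (lpDist hθ)
              + eLpNorm θ ⊤ volume * sobolevNorm (s + 1 - 2 * α) (lpDist hθ)
              + eLpNorm u 2 volume * eLpNorm θ 2 volume)) ∧
    -- (2); the constant does not depend on `p` and `r`
    (∀ (n : ℕ) [NeZero n] (P : DyadicPartition n) (α s : ℝ), 0 < α → α < 1 → -1 < s → s < α →
      ∃ C : ℝ≥0, ∀ (p r : ℝ≥0∞) [Fact (1 ≤ p)], 2 ≤ p → p ≠ ⊤ → 1 ≤ r →
        ∀ (u : Space n → Space n) (θ : Space n → ℝ),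
        ContDiff ℝ ∞ u → DivergenceFree u → ContDiff ℝ ∞ θ →
        MemLp (fderiv ℝ u) p volume → RieszDomain α (advect u θ) →
        ∀ hθ : MemLp θ p volume, besovNorm P (s + 1 - α) ⊤ r (lpDist hθ) < ⊤ →
        ∃ F : 𝓢'(Space n, ℂ), Extends F (commAdvect α u θ) ∧
          besovNorm P s p r F ≤
            C * (eLpNorm (fderiv ℝ u) p volume *
              (besovNorm P (s + 1 - α) ⊤ r (lpDist hθ) + eLpNorm θ p volume))) := by
  refine ⟨fun n _ P α s _ hα1 hs hsα => ?_, fun P α s _ hα1 hs hsα => ?_,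
    fun n _ P α s hα hα1 hs hsα => P.exists_commAdvect_bound hα hα1 hs hsα⟩
  · obtain ⟨C, h⟩ := P.exists_commMul_bound hα1 hs hsα
    exact ⟨C, fun u θ hu _ _ h1 h2 hθ hb => h u θ hu h1 h2 hθ hb⟩
  · obtain ⟨C, h⟩ := P.exists_commMul_bound_biotSavart hα1 hs hsα
    exact ⟨C, fun u θ Γ hu _ _ h1 h2 => h u θ Γ hu h1 h2⟩
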